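/- Let $n\ge 1$, let $q$ and $\bar q^{1/n}$ be independent indeterminates, $\mathbb F=\mathbb Q(q,\bar q^{1/n})$, and let $V$ be an $n$-dimensional $\mathbb F$-vector space with basis $v_1,\dots,v_n$ and matrix units $E_{ij}\in\mathrm{End}(V)$. Set $$R(x)=\sum_{i,j=1}^n\Big(\frac{q-xq^{-1}}{1-x}\Big)^{\delta_{ij}}E_{ii}\otimes E_{jj}+(q-q^{-1})\sum_{i\ne j}\frac{x^{\delta_{i<j}}}{1-x}E_{ij}\otimes E_{ji},\qquad \widetilde R(x)=R_{21}\Big(\frac1{x\bar q^2}\Big),\qquad f(x)=\frac{(1-xq^2)(1-xq^{-2})}{(1-x)^2}.$$ Here and below, subscripts $X_{a_1\dots a_k}$ indicate that the tensor $X$ acts in the tensor factors $a_1,\dots,a_k$ of $V^{\otimes N}$ and as the identity in the others, and $\prod_{i=1}^k$ (resp. $\prod_{i=k}^1$) is a product of non-commuting factors with $i$ increasing (resp. decreasing) from left to right. On $\mathcal T=\bigoplus_{k\ge0}\mathrm{End}(V^{\otimes k})(z_1,\dots,z_k)$ the shuffle product is the bilinear product given, for $A=A_{1\dots k}(z_1,\dots,z_k)$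 and $B=B_{1\dots l}(z_1,\dots,z_l)$, by $$A*B=\sum\Big[\prod_{i=k}^1\prod_{j=1}^l\underbrace{R_{a_ib_j}\big(\tfrac{z_{a_i}}{z_{b_j}}\big)}_{\text{only if }a_i<b_j}\Big]A_{a_1\dots a_k}(z_{a_1},\dots,z_{a_k})\Big[\prod_{i=1}^k\prod_{j=l}^1\widetilde R_{a_ib_j}\big(\tfrac{z_{a_i}}{z_{b_j}}\big)\Big]B_{b_1\dots b_l}(z_{b_1},\dots,z_{b_l})\Big[\prod_{i=k}^1\prod_{j=1}^l\underbrace{R_{a_ib_j}\big(\tfrac{z_{a_i}}{z_{b_j}}\big)}_{\text{only if }a_i>b_j}\Big],$$ the sum being over all $a_1<\dots<a_k$, $b_1<\dots<b_l$ with $\{1,\dots,k+l\}=\{a_1,\dots,a_k\}\sqcup\{b_1,\dots,b_l\}$. Let $\mathcal A^+\subset\mathcal T$ be the set of those elements each of whose components $X\in\mathrm{End}(V^{\otimes k})(z_1,\dots,z_k)$, $k\ge0$, satisfies the following three conditions. (1) $X=x/\prod_{1\le i\ne j\le k}(z_i-z_j\bar q^2)$ for some $x\in\mathrm{End}(V^{\otimes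 k})[z_1^{\pm1},\dots,z_k^{\pm1}]$. (2) $X$ is symmetric: $X=R_\sigma\cdot X_{\sigma(1)\dots\sigma(k)}(z_{\sigma(1)},\dots,z_{\sigma(k)})\cdot R_\sigma^{-1}$ for all $\sigma\in S(k)$ and every braid lift $R_\sigma$ of $\sigma$. Here the braid lifts are the products obtained as follows: $1$ is a lift of the identity, and if $M$ is a lift of $\sigma$ and $1\le i<k$, then, with $a=\sigma(i)$, $b=\sigma(i+1)$, both $M R_{ab}(z_a/z_b)$ and $M R_{ba}(z_b/z_a)^{-1}$ are lifts of $\sigma\circ(i,i+1)$. (3) (Wheel conditions.) For every composition $k=\lambda_1+\dots+\lambda_u$ into positive integers, with $c_s=1+\lambda_1+\dots+\lambda_{s-1}$, there is some $X^{(\lambda_1,\dots,\lambda_u)}\in\mathrm{End}(V^{\otimes u})(y_1,\dots,y_u)$ such that $$\operatorname*{Res}_{\{z_{c_s}=y_s,\ z_{c_s+1}=y_s\bar q^2,\ \dots,\ z_{c_s+\lambda_s-1}=y_s\bar q^{2(\lambda_s-1)}\}_{1\le s\le u}}X=(q^{-1}-q)^{k-u}\prod_{\{(s,d),(t,e)\}}f\Big(\frac{y_s\bar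 q^{2d}}{y_t\bar q^{2e}}\Big)$$ $$\cdot\Big[\prod_{s=u}^{1}\prod_{t=s}^{u}\prod_{e=1}^{\lambda_t-1}R_{c_s,c_t+e}\Big(\frac{y_s}{y_t\bar q^{2e}}\Big)\Big]X^{(\lambda_1,\dots,\lambda_u)}_{c_1\dots c_u}(y_1,\dots,y_u)\Big[\prod_{s=1}^{u}\prod_{t=u}^{s+1}\prod_{e=\lambda_t-1}^{1}R_{c_t+e,c_s}\Big(\frac{y_t\bar q^{2e}}{y_s\bar q^{2\lambda_s}}\Big)\Big]\prod_{s=1}^u(c_s\mapsto c_s+1\mapsto\dots\mapsto c_s+\lambda_s-1\mapsto c_s).$$ The scalar product is over unordered pairs of distinct $(s,d)\neq(t,e)$ with $1\le s,t\le u$, $1\le d<\lambda_s$, $1\le e<\lambda_t$; a permutation $\sigma$ acts on $V^{\otimes k}$ by moving the $i$-th factor to position $\sigma(i)$; and $\operatorname{Res}$ is the iterated residue, taken for $s=1,\dots,u$ successively at $z_{c_s+1}=z_{c_s}\bar q^2$, then at $z_{c_s+2}=z_{c_s}\bar q^4$, ..., with the convention that $(\alpha-x)^{-1}$ has residue $1$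 at $x=\alpha$, followed by renaming $z_{c_s}$ to $y_s$. Then $\mathcal A^+$ is an $\mathbb F$-vector subspace of $\mathcal T$ that is closed under the shuffle product: $X*Y\in\mathcal A^+$ for all $X,Y\in\mathcal A^+$. It contains the unit $1\in\mathrm{End}(V^{\otimes0})$, which satisfies $1*X=X=X*1$ for all $X\in\mathcal A^+$, and $(X*Y)*Z=X*(Y*Z)$ for all $X,Y,Z\in\mathcal A^+$. Hence $\mathcal A^+$ is an associative unital algebra. -/

import Mathlib

open scoped Kronecker DirectSum

noncomputable section

namespace RShuffle

/-- The ground field `ℚ(q, q̄^{1/n})`: rational functions in two independent indeterminates. -/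
abbrev GroundField : Type := FractionRing (MvPolynomial (Fin 2) ℚ)

/-- The parameter `q`, the first indeterminate of the ground field. -/
def qParam : GroundField :=
  algebraMap (MvPolynomial (Fin 2) ℚ) GroundField (MvPolynomial.X 0)

/-- The parameter `q̄`; the second indeterminate of the ground field is its `n`-th root. -/
def qbarParam (n : ℕ) : GroundField :=
  (algebraMap (MvPolynomial (Fin 2) ℚ) GroundField (MvPolynomial.X 1)) ^ n

/-! The constructions below make sense over any field `K` with two parameters `q` and `q̄`
(written `qb`). -/

variable {K : Type*} [Field K]

/-- Rational functions in `z_1, ..., z_k` over the ground field. -/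
abbrev RatF (K : Type*) [Field K] (k : ℕ) : Type _ := FractionRing (MvPolynomial (Fin k) K)

/-- The variable `z_i`. -/
def z {k : ℕ} (i : Fin k) : RatF K k :=
  algebraMap (MvPolynomial (Fin k) K) (RatF K k) (MvPolynomial.X i)

/-- A scalar as a constant rational function. -/
def const (k : ℕ) (c : K) : RatF K k := algebraMap K (RatF K k) c

/-- `End(V^{⊗k})(z_1, ..., z_k)` for `V` with basis `v_1, ..., v_n`. The basis of `V^{⊗k}` is
indexed by `I : Fin k → Fin n`, and `E_{i_1 j_1} ⊗ ... ⊗ E_{i_k j_k}` is the matrix unit at row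
`(i_1, ..., i_k)` and column `(j_1, ..., j_k)`. -/
abbrev Tens (K : Type*) [Field K] (n k : ℕ) : Type _ :=
  Matrix (Fin k → Fin n) (Fin k → Fin n) (RatF K k)

/-! ### Tensors in chosen factors and variables -/

/-- The substitution `z_i ↦ z_{a_i}` of rational functions, for distinct `a_1, ..., a_k`. -/
def varMap {k N : ℕ} (a : Fin k ↪ Fin N) : RatF K k →ₐ[K] RatF K N :=
  IsFractionRing.liftAlgHom (A := MvPolynomial (Fin k) K)
    (g := (IsScalarTower.toAlgHom K (MvPolynomial (Fin N) K) (RatF K N)).comp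
      (MvPolynomial.rename a))
    ((IsFractionRing.injective (MvPolynomial (Fin N) K) (RatF K N)).comp
      (MvPolynomial.rename_injective a a.injective))

/-- `X_{a_1 ... a_k}(z_{a_1}, ..., z_{a_k})`: the tensor `X` acting in the factors
`a_1, ..., a_k` of `V^{⊗N}` (and as the identity in the others), with variables relabelled. -/
def place {n k N : ℕ} (a : Fin k ↪ Fin N) (X : Tens K n k) : Tens K n N :=
  Matrix.of fun I J =>
    if ∀ m, m ∉ Set.range a → I m = J m then varMap a (X (I ∘ a) (J ∘ a)) else 0

/-- `M_{ab}`: the operator on `V^{⊗N}` that acts by `M ∈ End(V ⊗ V)` with its first factor in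
position `a` and its second one in position `b` (for `a ≠ b`). -/
def twoSite {n N : ℕ} (a b : Fin N) (M : Matrix (Fin n × Fin n) (Fin n × Fin n) (RatF K N)) :
    Tens K n N :=
  Matrix.of fun I J =>
    if ∀ m, m ≠ a → m ≠ b → I m = J m then M (I a, I b) (J a, J b) else 0

/-! ### The R-matrix -/

/-- `E_{ij} ∈ End(V)`. -/
def E {n N : ℕ} (i j : Fin n) : Matrix (Fin n) (Fin n) (RatF K N) := Matrix.single i j 1

/-- The R-matrix `R(x) ∈ End(V ⊗ V)`. -/
def Rmat {n N : ℕ} (q : K) (x : RatF K N) : Matrix (Fin n × Fin n) (Fin n × Fin n) (RatF K N) :=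
  (∑ i : Fin n, ∑ j : Fin n,
    (if i = j then (const N q - x * (const N q)⁻¹) / (1 - x) else 1) • (E i i ⊗ₖ E j j)) +
  (const N q - (const N q)⁻¹) • ∑ i : Fin n, ∑ j : Fin n,
    (if i = j then 0 else (if i < j then x else 1) / (1 - x)) • (E i j ⊗ₖ E j i)

/-- `R_{ab}(x)`. -/
def R {n N : ℕ} (q : K) (a b : Fin N) (x : RatF K N) : Tens K n N := twoSite a b (Rmat q x)

/-- `R̃_{ab}(x)`, where `R̃(x) = R_{21}(1 / (x q̄²))`. -/
def Rtilde {n N : ℕ} (q qb : K) (a b : Fin N) (x : RatF K N) : Tens K n N :=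
  R q b a (1 / (x * const N qb ^ 2))

/-- The scalar `f(x)` with `R_{12}(x) R_{21}(1/x) = f(x)`. -/
def f {N : ℕ} (q : K) (x : RatF K N) : RatF K N :=
  (1 - x * const N q ^ 2) * (1 - x * (const N q ^ 2)⁻¹) / (1 - x) ^ 2

/-! ### The shuffle product -/

/-- The pairs `(a, b)` of increasing sequences `a_1 < ... < a_k` and `b_1 < ... < b_l` with
`{1, ..., k + l} = {a_1, ..., a_k} ⊔ {b_1, ..., b_l}`. -/
def shuffles (k l : ℕ) : Finset ((Fin k ↪ Fin (k + l)) × (Fin l ↪ Fin (k + l))) :=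
  Finset.univ.filter fun p => StrictMono p.1 ∧ StrictMono p.2 ∧ ∀ i j, p.1 i ≠ p.2 j

/-- `∏_{i=k}^{1} ∏_{j=1}^{l} R_{a_i b_j}(z_{a_i} / z_{b_j})`, only over the pairs with
`a_i < b_j`. -/
def leftFactor {n k l N : ℕ} (q : K) (a : Fin k ↪ Fin N) (b : Fin l ↪ Fin N) : Tens K n N :=
  ((List.finRange k).reverse.map fun i =>
    ((List.finRange l).map fun j =>
      if a i < b j then R q (a i) (b j) (z (a i) / z (b j)) else 1).prod).prod

/-- `∏_{i=1}^{k} ∏_{j=l}^{1} R̃_{a_i b_j}(z_{a_i} / z_{b_j})`. -/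
def middleFactor {n k l N : ℕ} (q qb : K) (a : Fin k ↪ Fin N) (b : Fin l ↪ Fin N) : Tens K n N :=
  ((List.finRange k).map fun i =>
    ((List.finRange l).reverse.map fun j =>
      Rtilde q qb (a i) (b j) (z (a i) / z (b j))).prod).prod

/-- `∏_{i=k}^{1} ∏_{j=1}^{l} R_{a_i b_j}(z_{a_i} / z_{b_j})`, only over the pairs with
`a_i > b_j`. -/
def rightFactor {n k l N : ℕ} (q : K) (a : Fin k ↪ Fin N) (b : Fin l ↪ Fin N) : Tens K n N :=
  ((List.finRange k).reverse.map fun i =>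
    ((List.finRange l).map fun j =>
      if b j < a i then R q (a i) (b j) (z (a i) / z (b j)) else 1).prod).prod

/-- The shuffle product of a tensor in `k` variables and a tensor in `l` variables. -/
def shuffleProd {n k l : ℕ} (q qb : K) (A : Tens K n k) (B : Tens K n l) : Tens K n (k + l) :=
  ∑ p ∈ shuffles k l,
    leftFactor q p.1 p.2 * place p.1 A * middleFactor q qb p.1 p.2 * place p.2 B * rightFactor q p.1 p.2

theorem place_add {n k N : ℕ} (a : Fin k ↪ Fin N) (X Y : Tens K n k) :
    place a (X + Y) = place a X + place a Y := by
  ext I J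
  change (if _ then varMap a (X (I ∘ a) (J ∘ a) + Y (I ∘ a) (J ∘ a)) else 0) =
    (if _ then varMap a (X (I ∘ a) (J ∘ a)) else 0) +
      (if _ then varMap a (Y (I ∘ a) (J ∘ a)) else 0)
  split_ifs
  · exact map_add _ _ _
  · exact (add_zero 0).symm

theorem place_smul {n k N : ℕ} (a : Fin k ↪ Fin N) (c : K) (X : Tens K n k) :
    place a (c • X) = c • place a X := by
  ext I J
  change (if _ then varMap a (c • X (I ∘ a) (J ∘ a)) else 0) =
    c • (if _ then varMap a (X (I ∘ a) (J ∘ a)) else 0)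
  split_ifs
  · exact map_smul (varMap a).toLinearMap _ _
  · exact (smul_zero c).symm

/-- The ambient space `⨁_k End(V^{⊗k})(z_1, ..., z_k)`. -/
abbrev Ambient (K : Type*) [Field K] (n : ℕ) : Type _ := ⨁ k : ℕ, Tens K n k

/-- The shuffle product as a bilinear map on homogeneous pieces. -/
def shuffleBilin (q qb : K) (n k l : ℕ) : Tens K n k →ₗ[K] Tens K n l →ₗ[K] Tens K n (k + l) :=
  LinearMap.mk₂ K (shuffleProd q qb)
    (by
      intro A A' B
      simp only [shuffleProd, place_add, mul_add, add_mul, Finset.sum_add_distrib])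
    (by
      intro c A B
      simp only [shuffleProd, place_smul, mul_smul_comm, smul_mul_assoc, Finset.smul_sum])
    (by
      intro A B B'
      simp only [shuffleProd, place_add, mul_add, add_mul, Finset.sum_add_distrib])
    (by
      intro c A B
      simp only [shuffleProd, place_smul, mul_smul_comm, smul_mul_assoc, Finset.smul_sum])

/-- The shuffle product on the ambient space, extended bilinearly from homogeneous tensors. -/
def shuffle (q qb : K) (n : ℕ) : Ambient K n →ₗ[K] Ambient K n →ₗ[K] Ambient K n :=
  DirectSum.toModule K ℕ (Ambient K n →ₗ[K] Ambient K n) fun k =>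
    LinearMap.flip (DirectSum.toModule K ℕ (Tens K n k →ₗ[K] Ambient K n) fun l =>
      LinearMap.flip
        ((shuffleBilin q qb n k l).compr₂ (DirectSum.lof K ℕ (fun m => Tens K n m) (k + l))))

/-- The shuffle product of homogeneous tensors is given by the defining formula. -/
theorem shuffle_lof (q qb : K) (n k l : ℕ) (A : Tens K n k) (B : Tens K n l) :
    shuffle q qb n (DirectSum.lof K ℕ (fun m => Tens K n m) k A)
      (DirectSum.lof K ℕ (fun m => Tens K n m) l B) =
    DirectSum.lof K ℕ (fun m => Tens K n m) (k + l) (shuffleProd q qb A B) := by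
  simp only [shuffle, DirectSum.toModule_lof, LinearMap.flip_apply, LinearMap.compr₂_apply]
  rfl

/-- The unit `1 ∈ End(V^{⊗0})`. -/
def unit (K : Type*) [Field K] (n : ℕ) : Ambient K n := DirectSum.lof K ℕ (fun m => Tens K n m) 0 1

/-! ### Allowed poles and symmetry -/

/-- Laurent polynomials in `z_1, ..., z_k`, inside the rational functions. -/
def laurent (K : Type*) [Field K] (k : ℕ) : Subalgebra K (RatF K k) :=
  Algebra.adjoin K (Set.range (fun i : Fin k => (z i : RatF K k)) ∪ Set.range (fun i : Fin k => (z i : RatF K k)⁻¹))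

/-- `X` is a Laurent polynomial divided by `∏_{i ≠ j} (z_i - z_j q̄²)`. -/
def HasAllowedPoles {n k : ℕ} (qb : K) (X : Tens K n k) : Prop :=
  ∃ x : Tens K n k, (∀ I J, x I J ∈ laurent K k) ∧
    X = (∏ p ∈ (Finset.univ : Finset (Fin k × Fin k)).filter (fun p => p.1 ≠ p.2),
      (z p.1 - z p.2 * const k qb ^ 2))⁻¹ • x

/-- `IsBraidLift σ M`: the operator `M` is `R_σ(z_1, ..., z_k)` for some braid lifting `σ`.
A braid is read from left to right; its strands are labelled by their left endpoints, and the
strand labelled `σ(i)` ends at the `i`-th endpoint on the right. A further crossing of the strands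
in positions `i` and `i + 1` multiplies `M` on the right by `R_{σ(i) σ(i+1)}(z_{σ(i)} / z_{σ(i+1)})`
(positive crossing) or by `R_{σ(i+1) σ(i)}(z_{σ(i+1)} / z_{σ(i)})⁻¹` (negative crossing). -/
inductive IsBraidLift {n k : ℕ} (q : K) : Equiv.Perm (Fin k) → Tens K n k → Prop
  | one : IsBraidLift q 1 1
  | pos (σ : Equiv.Perm (Fin k)) (M : Tens K n k) (i j : Fin k) (hij : (j : ℕ) = i + 1)
      (h : IsBraidLift q σ M) :
      IsBraidLift q (σ * Equiv.swap i j) (M * R q (σ i) (σ j) (z (σ i) / z (σ j)))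
  | neg (σ : Equiv.Perm (Fin k)) (M : Tens K n k) (i j : Fin k) (hij : (j : ℕ) = i + 1)
      (h : IsBraidLift q σ M) :
      IsBraidLift q (σ * Equiv.swap i j) (M * (R q (σ j) (σ i) (z (σ j) / z (σ i)))⁻¹)

/-- `X = R_σ · (σ X σ⁻¹) · R_σ⁻¹` for all `σ` and all braid lifts `R_σ` of `σ`, where
`σ X σ⁻¹ = X_{σ(1) ... σ(k)}(z_{σ(1)}, ..., z_{σ(k)})`. -/
def IsSymm {n k : ℕ} (q : K) (X : Tens K n k) : Prop :=
  ∀ (σ : Equiv.Perm (Fin k)) (M : Tens K n k), IsBraidLift q σ M →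
    X = M * place σ.toEmbedding X * M⁻¹

/-! ### Iterated residues -/

/-- The substitution `z_j ↦ c z_i` in polynomials. -/
def subst {k : ℕ} (i j : Fin k) (c : K) :
    MvPolynomial (Fin k) K →ₐ[K] MvPolynomial (Fin k) K :=
  MvPolynomial.aeval
    (Function.update MvPolynomial.X j (MvPolynomial.C c * MvPolynomial.X i))

/-- The residue at `z_j = c z_i` of a rational function with at most a simple pole there, with the
convention that `1 / (α - z_j)` has residue `1` at `z_j = α`: multiply by `c z_i - z_j`, write the
result in lowest terms, and set `z_j = c z_i`. -/
def residue {k : ℕ} (i j : Fin k) (c : K) (g : RatF K k) : RatF K k :=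
  let h : RatF K k := g * algebraMap (MvPolynomial (Fin k) K) (RatF K k)
    (MvPolynomial.C c * MvPolynomial.X i - MvPolynomial.X j)
  algebraMap (MvPolynomial (Fin k) K) (RatF K k)
      (subst i j c (IsFractionRing.num (MvPolynomial (Fin k) K) h)) /
    algebraMap (MvPolynomial (Fin k) K) (RatF K k)
      (subst i j c (IsFractionRing.den (MvPolynomial (Fin k) K) h : MvPolynomial (Fin k) K))

/-- The first index `c_s` of the `s`-th block of a composition `λ` of `k`; the block consists of
the indices `c_s + e = λ.embedding s e` with `0 ≤ e < λ_s`. -/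
def start {k : ℕ} (lam : Composition k) : Fin lam.length ↪ Fin k where
  toFun s := lam.embedding s ⟨0, lam.one_le_blocksFun s⟩
  inj' s t h := by
    by_contra hst
    have := Set.disjoint_left.mp (lam.disjoint_range hst)
      (Set.mem_range_self (f := lam.embedding s) ⟨0, lam.one_le_blocksFun s⟩)
    exact this ⟨⟨0, lam.one_le_blocksFun t⟩, h.symm⟩

/-- The indices `e` with `1 ≤ e < λ_s`, in increasing order. -/
def laterIdx {k : ℕ} (lam : Composition k) (s : Fin lam.length) : List (Fin (lam.blocksFun s)) :=
  (List.finRange (lam.blocksFun s)).filter fun e => 1 ≤ (e : ℕ)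

/-- The iterated residue of `g` at `z_{c_s + e} = y_s q̄^{2e}`, taken successively for
`s = 1, ..., u` and, for each `s`, for `e = 1, ..., λ_s - 1`. The variable `z_{c_s}`, which is not
eliminated, plays the role of `y_s`. -/
def iteratedResidue (qb : K) {k : ℕ} (lam : Composition k) (g : RatF K k) : RatF K k :=
  (List.finRange lam.length).foldl (fun g s =>
    (laterIdx lam s).foldl (fun g e =>
      residue (start lam s) (lam.embedding s e) (qb ^ (2 * (e : ℕ))) g) g) g

/-! ### The wheel conditions -/

/-- The product of `f(y_s q̄^{2d} / (y_t q̄^{2e}))` over the unordered pairs `(s,d) ≠ (t,e)` with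
`1 ≤ d < λ_s` and `1 ≤ e < λ_t`, where `y_s = z_{c_s}`. Pairs `(s,d)` are encoded as indices
`p = c_s + d`; as `f(x) = f(1/x)`, an unordered pair of indices may be listed with `p < p'`. -/
def wheelScalar (q qb : K) {k : ℕ} (lam : Composition k) : RatF K k :=
  ∏ p ∈ (Finset.univ : Finset (Fin k × Fin k)).filter (fun p => p.1 < p.2 ∧
      1 ≤ (lam.invEmbedding p.1 : ℕ) ∧ 1 ≤ (lam.invEmbedding p.2 : ℕ)),
    f q ((z (start lam (lam.index p.1)) * const k qb ^ (2 * (lam.invEmbedding p.1 : ℕ))) /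
      (z (start lam (lam.index p.2)) * const k qb ^ (2 * (lam.invEmbedding p.2 : ℕ))))

/-- `∏_{u ≥ s ≥ 1} ∏_{s ≤ t ≤ u} ∏_{1 ≤ e < λ_t} R_{c_s, c_t + e}(y_s / (y_t q̄^{2e}))`, where
`y_s = z_{c_s}`. -/
def wheelLeft {n k : ℕ} (q qb : K) (lam : Composition k) : Tens K n k :=
  ((List.finRange lam.length).reverse.map fun s =>
    (((List.finRange lam.length).filter fun t => s ≤ t).map fun t =>
      ((laterIdx lam t).map fun e =>
        R q (start lam s) (lam.embedding t e)
          (z (start lam s) / (z (start lam t) * const k qb ^ (2 * (e : ℕ))))).prod).prod).prod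

/-- `∏_{1 ≤ s ≤ u} ∏_{u ≥ t > s} ∏_{λ_t > e ≥ 1} R_{c_t + e, c_s}(y_t q̄^{2e} / (y_s q̄^{2λ_s}))`,
where `y_s = z_{c_s}`. -/
def wheelRight {n k : ℕ} (q qb : K) (lam : Composition k) : Tens K n k :=
  ((List.finRange lam.length).map fun s =>
    (((List.finRange lam.length).reverse.filter fun t => s < t).map fun t =>
      ((laterIdx lam t).reverse.map fun e =>
        R q (lam.embedding t e) (start lam s)
          (z (start lam t) * const k qb ^ (2 * (e : ℕ)) /
            (z (start lam s) * const k qb ^ (2 * lam.blocksFun s)))).prod).prod).prod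

/-- The product over all blocks of the cycles `c_s ↦ c_s + 1 ↦ ... ↦ c_{s+1} - 1 ↦ c_s`. -/
def blockCycles {k : ℕ} (lam : Composition k) : Equiv.Perm (Fin k) :=
  lam.blocksFinEquiv.permCongr (Equiv.Perm.sigmaCongrRight fun s => finRotate (lam.blocksFun s))

/-- The operator on `V^{⊗k}` that moves the `i`-th tensor factor to position `σ(i)`. -/
def permOp {n k : ℕ} (σ : Equiv.Perm (Fin k)) : Tens K n k :=
  Matrix.of fun I J => if I ∘ σ = J then 1 else 0

/-- The matrix wheel conditions: for each composition `λ` of `k`, the iterated residue of `X` is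
the displayed product for some `Y = X^{(λ_1, ..., λ_u)} ∈ End(V^{⊗u})(y_1, ..., y_u)`. -/
def WheelConditions {n k : ℕ} (q qb : K) (X : Tens K n k) : Prop :=
  ∀ lam : Composition k, ∃ Y : Tens K n lam.length,
    X.map (iteratedResidue qb lam) =
      (((const k q)⁻¹ - const k q) ^ (k - lam.length) * wheelScalar q qb lam) •
        (wheelLeft q qb lam * place (start lam) Y * wheelRight q qb lam * permOp (blockCycles lam))

/-- Membership in `𝒜⁺`: every homogeneous component has the allowed poles, is symmetric, and
satisfies the wheel conditions. -/
def InShuffleAlgebra {n : ℕ} (q qb : K) (X : Ambient K n) : Prop :=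
  ∀ k : ℕ, HasAllowedPoles qb (X k) ∧ IsSymm q (X k) ∧ WheelConditions q qb (X k)

end RShuffle

end

/-! The shuffle product is an operation on braids. The R-matrix, divided by its entry on equal
indices, satisfies the Yang–Baxter equation and unitarity with no scalar left over. For parameters
avoiding its poles, an operator `braid q u l l'` therefore rearranges strands from the order `l` to
the order `l'`, and these operators compose whatever the route (`braid_trans`). Up to a scalar, a
summand of A * B is the following diagram (`shuffle_term_eq`): bring the strands of A to the right
end, apply A, which multiplies their spectral parameters by q̄², exchange the two families, apply B,
and return to the increasing order.

Symmetry. All braid lifts of σ are multiples of one normalized braid, so condition (2) is invariance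
under the braided action `adj` of the symmetric group (`isSymm_iff`). For symmetric factors the
product is 1/(k! l!) times the sum of all `adj q σ` of a single summand (`shuffleProd_eq_sum`).
Hence it is symmetric, and associativity reduces to an identity of two diagrams with three families
of strands (`shuffleTerm_assoc`).

Poles. Besides the allowed denominators z_i - z_j q̄², the summands have only simple poles along z_i
= z_j. If T is the value of (z_i - z_j) W there, the braid lifting the transposition (i j) becomes
the transposition itself, so symmetry of W gives T = -T and the pole is absent
(`IsSymm.regular_of_simple_pole`).

Wheel conditions. The iterated residue is the value of `wheelDen` times X at the point z_{c_s + e} =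
y_s q̄^{2e} (`iteratedResidue_eq`). The prescribed right-hand side is, up to nonzero scalars, a
braid, an operator Z in the first strands of the blocks, a second braid and a permutation
(`WheelForm`, `wheelConditions_iff`). The permutation only has to send each label to its successor
in the block; the rest of it can be absorbed into Z. This makes the conditions linear.

Consider a summand of X * Y. If in some block a label of Y is directly followed by a label of X, a
factor of `wheelDen` vanishes without meeting a pole and the summand contributes 0. Otherwise every
block consists of labels of X followed by labels of Y. The wheel conditions of X and Y then apply to
the shorter blocks so formed, and the two wheel forms are merged in `WheelForm.product`. Two facts
make this work. Strands that are not first in their block keep their parameter when an operator is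
applied, so their braids slide through it. At a boundary between X and Y the two strands to be
exchanged have equal parameters, so the exchange is a mere permutation (`braid_map_perm`). -/

noncomputable section

namespace RShuffle

/-! ### Operators on tensor powers over an arbitrary field -/

section Operators

set_option linter.unusedSectionVars false

variable {F : Type*} [Field F] {n : ℕ}
variable {ι κ μ : Type*}

/-- `End(V^{⊗ι})` with coefficients in `F`. -/
abbrev Op (F : Type*) [Field F] (n : ℕ) (ι : Type*) : Type _ :=
  Matrix (ι → Fin n) (ι → Fin n) F

open Classical in
/-- The operator `X` acting in the tensor factors `a i`, and as the identity in the others. -/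
def act (a : ι ↪ κ) (X : Op F n ι) : Op F n κ :=
  Matrix.of fun I J => if ∀ m, m ∉ Set.range a → I m = J m then X (I ∘ a) (J ∘ a) else 0

variable [Fintype ι] [DecidableEq ι] [Fintype κ] [DecidableEq κ] [Fintype μ] [DecidableEq μ]

/-- Permutation of the tensor factors. -/
def permF (σ : Equiv.Perm κ) : Op F n κ := Matrix.of fun I J => if I ∘ σ = J then 1 else 0

theorem op_ext {M N : Op F n κ} (h : ∀ v, M.mulVec v = N.mulVec v) : M = N :=
  Matrix.ext_of_mulVec_single fun _ => h _

theorem permF_mulVec (σ : Equiv.Perm κ) (v : (κ → Fin n) → F) (I : κ → Fin n) :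
    (permF σ).mulVec v I = v (I ∘ σ) := by
  simp [permF, Matrix.mulVec, dotProduct]

/-- Only the columns `J` agreeing with `I` off the image of `a` contribute, and such a `J` is `I`
with its restriction `j` glued in. Identities for `act` are then checked on vectors. -/
theorem act_mulVec (a : ι ↪ κ) (X : Op F n ι) (v : (κ → Fin n) → F) (I : κ → Fin n) :
    (act a X).mulVec v I = ∑ j, X (I ∘ a) j * v (Function.extend a j I) := by
  classical
  simp only [act, Matrix.mulVec, dotProduct, Matrix.of_apply, ite_mul, zero_mul]
  rw [← Finset.sum_filter]
  refine Finset.sum_nbij' (fun J => J ∘ a) (fun j => Function.extend a j I) ?_ ?_ ?_ ?_ ?_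
  · simp
  · intro j _
    simp only [Finset.mem_filter, Finset.mem_univ, true_and]
    intro m hm
    rw [Function.extend_apply' _ _ _ (by simpa using hm)]
  · intro J hJ
    simp only [Finset.mem_filter, Finset.mem_univ, true_and] at hJ
    funext m
    by_cases hm : m ∈ Set.range a
    · obtain ⟨i, rfl⟩ := hm
      simp [a.injective.extend_apply]
    · rw [Function.extend_apply' _ _ _ (by simpa using hm), hJ m hm]
  · intro j _
    exact Function.extend_comp a.injective j I
  · intro J hJ
    simp only [Finset.mem_filter, Finset.mem_univ, true_and] at hJ
    congr 2
    funext m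
    by_cases hm : m ∈ Set.range a
    · obtain ⟨i, rfl⟩ := hm
      simp [a.injective.extend_apply]
    · rw [Function.extend_apply' _ _ _ (by simpa using hm), hJ m hm]

theorem permF_mul (σ τ : Equiv.Perm κ) :
    (permF σ * permF τ : Op F n κ) = permF (σ * τ) := by
  refine op_ext fun v => funext fun I => ?_
  simp only [← Matrix.mulVec_mulVec, permF_mulVec]
  rfl

theorem permF_one : (permF 1 : Op F n κ) = 1 := by
  refine op_ext fun v => funext fun I => ?_
  simp only [permF_mulVec, Matrix.one_mulVec]
  rfl

theorem permF_mul_inv (σ : Equiv.Perm κ) : (permF σ * permF σ⁻¹ : Op F n κ) = 1 := by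
  rw [permF_mul, mul_inv_cancel, permF_one]

theorem permF_inv_mul (σ : Equiv.Perm κ) : (permF σ⁻¹ * permF σ : Op F n κ) = 1 := by
  rw [permF_mul, inv_mul_cancel, permF_one]

/-- Serves to collect permutation operators at the right end of a product. -/
theorem permF_mul_act (σ : Equiv.Perm κ) (a : ι ↪ κ) (X : Op F n ι) :
    permF σ * act a X = act (a.trans σ.toEmbedding) X * permF σ := by
  refine op_ext fun v => funext fun I => ?_
  simp only [← Matrix.mulVec_mulVec, permF_mulVec, act_mulVec]
  refine Finset.sum_congr rfl fun j _ => ?_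
  congr 2
  funext m
  by_cases hm : m ∈ Set.range a
  · obtain ⟨i, rfl⟩ := hm
    have : Function.extend (a.trans σ.toEmbedding) j I (σ (a i)) = j i :=
      (a.trans σ.toEmbedding).injective.extend_apply j I i
    simp only [a.injective.extend_apply, Function.comp_apply, this]
  · rw [Function.extend_apply' _ _ _ (by simpa using hm), Function.comp_apply, Function.comp_apply,
      Function.extend_apply']
    rintro ⟨i, hi⟩
    exact hm ⟨i, σ.injective hi⟩

theorem act_mul (a : ι ↪ κ) (X Y : Op F n ι) : act a (X * Y) = act a X * act a Y := by
  refine op_ext fun v => funext fun I => ?_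
  simp only [← Matrix.mulVec_mulVec, act_mulVec, Matrix.mul_apply, Finset.sum_mul, Finset.mul_sum]
  rw [Finset.sum_comm]
  refine Finset.sum_congr rfl fun j _ => Finset.sum_congr rfl fun l _ => ?_
  rw [mul_assoc, Function.extend_comp a.injective]
  congr 3
  funext m
  by_cases hm : m ∈ Set.range a
  · obtain ⟨i, rfl⟩ := hm
    simp only [a.injective.extend_apply]
  · simp only [Function.extend_apply' _ _ m (show ¬ ∃ i, a i = m by simpa using hm)]

theorem act_one (a : ι ↪ κ) : act a (1 : Op F n ι) = 1 := by
  refine op_ext fun v => funext fun I => ?_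
  simp only [act_mulVec, Matrix.one_apply, ite_mul, one_mul, zero_mul, Finset.sum_ite_eq,
    Finset.mem_univ, if_true, Matrix.one_mulVec]
  congr 1
  funext m
  by_cases hm : m ∈ Set.range a
  · obtain ⟨i, rfl⟩ := hm
    simp only [a.injective.extend_apply, Function.comp_apply]
  · simp only [Function.extend_apply' _ _ m (show ¬ ∃ i, a i = m by simpa using hm)]

theorem act_add (a : ι ↪ κ) (X Y : Op F n ι) : act a (X + Y) = act a X + act a Y := by
  ext I J
  simp only [act, Matrix.of_apply, Matrix.add_apply]
  split_ifs <;> simp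

theorem act_smul (a : ι ↪ κ) (c : F) (X : Op F n ι) : act a (c • X) = c • act a X := by
  ext I J
  simp only [act, Matrix.of_apply, Matrix.smul_apply]
  split_ifs <;> simp

/-- `act a` as a homomorphism of algebras. -/
def actHom (a : ι ↪ κ) : Op F n ι →ₐ[F] Op F n κ :=
  AlgHom.ofLinearMap ⟨⟨act a, act_add a⟩, act_smul a⟩ (act_one a) (act_mul a)

theorem act_zero (a : ι ↪ κ) : act a (0 : Op F n ι) = 0 := map_zero (actHom a)

theorem act_list_prod (a : ι ↪ κ) (l : List (Op F n ι)) :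
    act a l.prod = (l.map (act a)).prod := map_list_prod (actHom a) l

/-- Gluing values in at disjoint sets of positions can be done in either order. -/
theorem act_commute (a : ι ↪ κ) (b : μ ↪ κ) (h : ∀ i j, a i ≠ b j) (X : Op F n ι) (Y : Op F n μ) :
    Commute (act a X) (act b Y) := by
  refine op_ext fun v => funext fun I => ?_
  simp only [← Matrix.mulVec_mulVec, act_mulVec, Finset.mul_sum]
  rw [Finset.sum_comm]
  refine Finset.sum_congr rfl fun l _ => Finset.sum_congr rfl fun j _ => ?_
  have h1 : Function.extend a j I ∘ b = I ∘ b := by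
    funext m
    exact Function.extend_apply' _ _ _ (by rintro ⟨i, hi⟩; exact h i m hi)
  have h2 : Function.extend b l I ∘ a = I ∘ a := by
    funext m
    exact Function.extend_apply' _ _ _ (by rintro ⟨i, hi⟩; exact h m i hi.symm)
  have h3 : Function.extend b l (Function.extend a j I) =
      Function.extend a j (Function.extend b l I) := by
    funext m
    by_cases ha : ∃ i, a i = m
    · have hb : ¬ ∃ i, b i = m := by
        rintro ⟨i', hi'⟩
        obtain ⟨i, hi⟩ := ha
        exact h i i' (hi.trans hi'.symm)
      rw [Function.extend_apply' _ _ _ hb]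
      obtain ⟨i, rfl⟩ := ha
      simp only [a.injective.extend_apply]
    · rw [Function.extend_apply' (f := a) _ _ _ ha]
      by_cases hb : ∃ i, b i = m
      · obtain ⟨i, rfl⟩ := hb
        simp only [b.injective.extend_apply]
      · simp only [Function.extend_apply' _ _ _ hb, Function.extend_apply' _ _ _ ha]
  rw [h1, h2, h3]
  ring

theorem act_act (a : ι ↪ κ) (b : κ ↪ μ) (X : Op F n ι) :
    act b (act a X) = act (a.trans b) X := by
  refine op_ext fun v => funext fun I => ?_
  rw [act_mulVec, act_mulVec]
  have := act_mulVec a X (fun j => v (Function.extend b j I)) (I ∘ b)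
  rw [Matrix.mulVec, dotProduct] at this
  rw [this]
  refine Finset.sum_congr rfl fun j _ => ?_
  congr 2
  funext m
  by_cases hb : ∃ i, b i = m
  · obtain ⟨i, rfl⟩ := hb
    rw [b.injective.extend_apply]
    by_cases ha : ∃ l, a l = i
    · obtain ⟨l, rfl⟩ := ha
      rw [a.injective.extend_apply]
      exact ((a.trans b).injective.extend_apply j I l).symm
    · rw [Function.extend_apply' _ _ _ ha, Function.extend_apply']
      · rfl
      · rintro ⟨l, hl⟩
        exact ha ⟨l, b.injective hl⟩
  · rw [Function.extend_apply' _ _ _ hb, Function.extend_apply']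
    rintro ⟨l, hl⟩
    exact hb ⟨a l, hl⟩

theorem act_refl (X : Op F n ι) : act (Function.Embedding.refl ι) X = X := by
  ext I J
  simp only [act, Matrix.of_apply]
  rw [if_pos]
  · rfl
  · intro m hm
    exact absurd ⟨m, rfl⟩ hm

/-! ### The normalized R-matrix -/

/-- The polynomial numerator of `R_{ab}(u / v)`. -/
def Rn (q : F) (a b : κ) (u v : F) : Op F n κ :=
  Matrix.diagonal (fun I => if I a = I b then q * v - q⁻¹ * u else v - u) +
    Matrix.diagonal (fun I => if I a = I b then 0 else
      (q - q⁻¹) * (if I a < I b then u else v)) * permF (Equiv.swap a b)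

theorem Rn_mulVec (q : F) (a b : κ) (u v : F) (w : (κ → Fin n) → F) (I : κ → Fin n) :
    (Rn q a b u v).mulVec w I = (if I a = I b then q * v - q⁻¹ * u else v - u) * w I +
      (if I a = I b then 0 else (q - q⁻¹) * (if I a < I b then u else v)) *
        w (I ∘ Equiv.swap a b) := by
  simp only [Rn, Matrix.add_mulVec, Pi.add_apply, Matrix.mulVec_diagonal, ← Matrix.mulVec_mulVec,
    permF_mulVec]

/-- The operators only read and permute the three values `I a`, `I b`, `I c`, so the claim is a
finite list of rational identities, one for each relative order of three indices. -/
theorem Rn_ybe {q : F} (hq : q ≠ 0) {a b c : κ} (hab : a ≠ b) (hac : a ≠ c) (hbc : b ≠ c)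
    (x y w : F) :
    (Rn q a b x y * Rn q a c x w * Rn q b c y w : Op F n κ) =
      Rn q b c y w * Rn q a c x w * Rn q a b x y := by
  refine op_ext fun v => funext fun I => ?_
  -- `up i j k` is `I` with these three values replaced; composing with a transposition of `a`, `b`,
  -- `c` permutes the arguments of `up`.
  set up : Fin n → Fin n → Fin n → κ → Fin n := fun i j k =>
    Function.update (Function.update (Function.update I a i) b j) c k with hup
  have ua : ∀ i j k, up i j k a = i := fun i j k => by
    simp [hup, hab, hac]
  have ub : ∀ i j k, up i j k b = j := fun i j k => by
    simp [hup, hbc]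
  have uc : ∀ i j k, up i j k c = k := fun i j k => by
    simp [hup]
  have uo : ∀ i j k m, m ≠ a → m ≠ b → m ≠ c → up i j k m = I m := fun i j k m h1 h2 h3 => by
    simp [hup, h1, h2, h3]
  have hI : I = up (I a) (I b) (I c) := by
    funext m
    by_cases h1 : m = a
    · subst h1; rw [ua]
    by_cases h2 : m = b
    · subst h2; rw [ub]
    by_cases h3 : m = c
    · subst h3; rw [uc]
    rw [uo _ _ _ _ h1 h2 h3]
  have key : ∀ (e : Equiv.Perm κ) (i j k i' j' k' : Fin n), up i j k (e a) = i' →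
      up i j k (e b) = j' → up i j k (e c) = k' →
      (∀ m, m ≠ a → m ≠ b → m ≠ c → e m = m) → up i j k ∘ e = up i' j' k' := by
    intro e i j k i' j' k' e1 e2 e3 e4
    funext m
    by_cases h1 : m = a
    · subst h1; rw [ua, ← e1]; rfl
    by_cases h2 : m = b
    · subst h2; rw [ub, ← e2]; rfl
    by_cases h3 : m = c
    · subst h3; rw [uc, ← e3]; rfl
    rw [Function.comp_apply, e4 m h1 h2 h3, uo _ _ _ _ h1 h2 h3, uo _ _ _ _ h1 h2 h3]
  have sab : ∀ i j k, up i j k ∘ Equiv.swap a b = up j i k := fun i j k => by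
    refine key _ _ _ _ _ _ _ ?_ ?_ ?_ fun m h1 h2 _ => Equiv.swap_apply_of_ne_of_ne h1 h2
    · rw [Equiv.swap_apply_left, ub]
    · rw [Equiv.swap_apply_right, ua]
    · rw [Equiv.swap_apply_of_ne_of_ne hac.symm hbc.symm, uc]
  have sac : ∀ i j k, up i j k ∘ Equiv.swap a c = up k j i := fun i j k => by
    refine key _ _ _ _ _ _ _ ?_ ?_ ?_ fun m h1 _ h2 => Equiv.swap_apply_of_ne_of_ne h1 h2
    · rw [Equiv.swap_apply_left, uc]
    · rw [Equiv.swap_apply_of_ne_of_ne hab.symm hbc, ub]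
    · rw [Equiv.swap_apply_right, ua]
  have sbc : ∀ i j k, up i j k ∘ Equiv.swap b c = up i k j := fun i j k => by
    refine key _ _ _ _ _ _ _ ?_ ?_ ?_ fun m _ h1 h2 => Equiv.swap_apply_of_ne_of_ne h1 h2
    · rw [Equiv.swap_apply_of_ne_of_ne hab hac, ua]
    · rw [Equiv.swap_apply_left, uc]
    · rw [Equiv.swap_apply_right, ub]
  rw [hI]
  generalize I a = i
  generalize I b = j
  generalize I c = k
  simp only [← Matrix.mulVec_mulVec, Rn_mulVec, sab, sac, sbc, ua, ub, uc]
  have tri : ∀ i j : Fin n, ((i < j) = True ∧ (j < i) = False ∧ (i = j) = False ∧ (j = i) = False) ∨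
      i = j ∨ ((i < j) = False ∧ (j < i) = True ∧ (i = j) = False ∧ (j = i) = False) := by
    intro i j
    simp only [eq_iff_iff, iff_true, iff_false]
    omega
  clear hI key uo
  clear_value up
  -- Combinations of comparisons that violate transitivity are discarded by `omega`; the others are
  -- closed by field arithmetic.
  rcases tri i j with ⟨h1, h2, h3, h4⟩ | h1 | ⟨h1, h2, h3, h4⟩ <;>
  rcases tri i k with ⟨g1, g2, g3, g4⟩ | g1 | ⟨g1, g2, g3, g4⟩ <;>
  rcases tri j k with ⟨f1, f2, f3, f4⟩ | f1 | ⟨f1, f2, f3, f4⟩ <;>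
  first
    | (exfalso; simp only [eq_iff_iff, iff_true, iff_false] at *; omega)
    | (try subst h1
       try subst g1
       try subst f1
       simp only [*, if_true, if_false, lt_irrefl, zero_mul, add_zero]
       field_simp
       try ring)

theorem swap_comp_val (a b : κ) (I : κ → Fin n) (h : I a = I b) : I ∘ Equiv.swap a b = I := by
  funext m
  by_cases h1 : m = a
  · subst h1; simp [h]
  by_cases h2 : m = b
  · subst h2; simp [h]
  simp [Equiv.swap_apply_of_ne_of_ne h1 h2]

theorem Rn_unitarity {q : F} (hq : q ≠ 0) {a b : κ} (_hab : a ≠ b) (u v : F) :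
    (Rn q a b u v * Rn q b a v u : Op F n κ) =
      ((q * v - q⁻¹ * u) * (q * u - q⁻¹ * v)) • 1 := by
  refine op_ext fun w => funext fun I => ?_
  have hI : (I ∘ Equiv.swap a b) ∘ Equiv.swap b a = I := by
    funext m; simp [Equiv.swap_comm b a]
  simp only [← Matrix.mulVec_mulVec, Rn_mulVec, Matrix.smul_mulVec, Matrix.one_mulVec,
    Pi.smul_apply, smul_eq_mul, hI]
  simp only [Function.comp_apply, Equiv.swap_apply_left, Equiv.swap_apply_right,
    Equiv.swap_comm b a]
  rcases lt_trichotomy (I a) (I b) with h | h | h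
  · simp only [h.ne, h.ne', h, h.not_gt, if_true, if_false]
    field_simp
    ring
  · simp only [h, if_true]
    ring
  · simp only [h.ne, h.ne', h, h.not_gt, if_true, if_false]
    field_simp
    ring

/-- At equal parameters the entries `v - u` vanish and the exchange coefficients coincide. This
degeneration is what turns braids into permutation operators later. -/
theorem Rn_self {q : F} (a b : κ) (u : F) :
    (Rn q a b u u : Op F n κ) = (q * u - q⁻¹ * u) • permF (Equiv.swap a b) := by
  refine op_ext fun w => funext fun I => ?_
  simp only [Rn_mulVec, Matrix.smul_mulVec, Pi.smul_apply, smul_eq_mul, permF_mulVec]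
  by_cases h : I a = I b
  · simp [h, swap_comp_val a b I h]
  · simp only [h, if_false, ite_self]
    ring

/-- Because of this the normalized R-matrix depends only on the ratio of its parameters, and
multiplying all of them by q̄² changes nothing. -/
theorem Rn_homog (q c : F) (a b : κ) (u v : F) :
    (Rn q a b (c * u) (c * v) : Op F n κ) = c • Rn q a b u v := by
  refine op_ext fun w => funext fun I => ?_
  simp only [Rn_mulVec, Matrix.smul_mulVec, Pi.smul_apply, smul_eq_mul]
  split_ifs <;> ring

theorem act_Rn (q : F) (f : ι ↪ κ) {a b : ι} (_hab : a ≠ b) (u v : F) :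
    act f (Rn q a b u v : Op F n ι) = Rn q (f a) (f b) u v := by
  refine op_ext fun w => funext fun I => ?_
  rw [act_mulVec, Rn_mulVec]
  have := Rn_mulVec q a b u v (fun j => w (Function.extend f j I)) (I ∘ f)
  rw [Matrix.mulVec, dotProduct] at this
  rw [this]
  have h1 : Function.extend f (I ∘ f) I = I := by
    funext m
    by_cases hm : ∃ i, f i = m
    · obtain ⟨i, rfl⟩ := hm
      rw [f.injective.extend_apply, Function.comp_apply]
    · rw [Function.extend_apply' _ _ _ hm]
  have h2 : Function.extend f ((I ∘ f) ∘ Equiv.swap a b) I = I ∘ Equiv.swap (f a) (f b) := by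
    funext m
    by_cases hm : ∃ i, f i = m
    · obtain ⟨i, rfl⟩ := hm
      rw [f.injective.extend_apply, Function.comp_apply, Function.comp_apply, Function.comp_apply,
        f.injective.map_swap]
    · rw [Function.extend_apply' _ _ _ hm, Function.comp_apply,
        Equiv.swap_apply_of_ne_of_ne]
      · rintro rfl; exact hm ⟨_, rfl⟩
      · rintro rfl; exact hm ⟨_, rfl⟩
  rw [h1, h2]
  rfl

/-- The operators acting in the tensor factors from `S`. -/
def loc (F : Type*) [Field F] (n : ℕ) (S : Finset κ) : Subalgebra F (Op F n κ) :=
  (actHom (F := F) (n := n) (Function.Embedding.subtype (· ∈ S))).range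

theorem mem_loc {S : Finset κ} {M : Op F n κ} :
    M ∈ loc F n S ↔ ∃ X : Op F n S, act (Function.Embedding.subtype (· ∈ S)) X = M := Iff.rfl

theorem act_mem_loc (a : ι ↪ κ) {S : Finset κ} (h : ∀ i, a i ∈ S) (X : Op F n ι) :
    act a X ∈ loc F n S := by
  refine mem_loc.2 ⟨act ⟨fun i => ⟨a i, h i⟩, fun i j hij => a.injective (by simpa using hij)⟩ X, ?_⟩
  rw [act_act]
  rfl

/-- A section of `a` over `S` carries the tensor on `S` back to `ι`; factors of `ι` outside the
section get the identity. -/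
theorem exists_act_of_mem_loc (a : ι ↪ κ) {S : Finset κ} (h : ∀ m ∈ S, ∃ i, a i = m) {M : Op F n κ}
    (hM : M ∈ loc F n S) : ∃ X : Op F n ι, act a X = M := by
  obtain ⟨X, rfl⟩ := mem_loc.1 hM
  choose g hg using fun m : S => h m m.2
  refine ⟨act ⟨g, fun x y hxy => ?_⟩ X, ?_⟩
  · rw [Subtype.ext_iff, ← hg x, ← hg y, hxy]
  · rw [act_act]
    congr 1
    ext m
    exact hg m

theorem act_loc (a : ι ↪ κ) {S : Finset ι} {T : Finset κ} (h : ∀ i ∈ S, a i ∈ T) {M : Op F n ι}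
    (hM : M ∈ loc F n S) : act a M ∈ loc F n T := by
  obtain ⟨X, rfl⟩ := mem_loc.1 hM
  rw [act_act]
  exact act_mem_loc _ (fun i => h i.1 i.2) X

theorem permF_conj_loc (σ : Equiv.Perm κ) {S T : Finset κ} (h : ∀ i ∈ S, σ i ∈ T) {M : Op F n κ}
    (hM : M ∈ loc F n S) : ∃ M' ∈ loc F n T, permF σ * M = M' * permF σ := by
  obtain ⟨X, rfl⟩ := mem_loc.1 hM
  exact ⟨_, act_mem_loc ((Function.Embedding.subtype _).trans σ.toEmbedding)
    (fun i => h i.1 i.2) X, permF_mul_act _ _ _⟩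

theorem loc_commute {S T : Finset κ} (h : Disjoint S T) {M N : Op F n κ}
    (hM : M ∈ loc F n S) (hN : N ∈ loc F n T) : Commute M N := by
  obtain ⟨X, rfl⟩ := mem_loc.1 hM
  obtain ⟨Y, rfl⟩ := mem_loc.1 hN
  refine act_commute _ _ (fun i j hij => ?_) X Y
  exact Finset.disjoint_left.1 h i.2 (by rw [show (i : κ) = j from hij]; exact j.2)

theorem loc_mono {S T : Finset κ} (h : S ⊆ T) : loc F n S ≤ loc F n T := by
  intro M hM
  obtain ⟨X, rfl⟩ := mem_loc.1 hM
  exact act_mem_loc _ (fun i => h i.2) X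

theorem Rn_mem_loc (q : F) {a b : κ} (hab : a ≠ b) {S : Finset κ} (ha : a ∈ S) (hb : b ∈ S)
    (u v : F) : (Rn q a b u v : Op F n κ) ∈ loc F n S :=
  mem_loc.2 ⟨Rn q ⟨a, ha⟩ ⟨b, hb⟩ u v, act_Rn q _ (by simpa using hab) u v⟩

/-- The normalized R-matrix `R̂_{ab}(u / v)`, which has no pole at `u = v`. -/
def Rh (q : F) (a b : κ) (u v : F) : Op F n κ := (q * v - q⁻¹ * u)⁻¹ • Rn q a b u v

theorem Rh_mem_loc (q : F) {a b : κ} (hab : a ≠ b) {S : Finset κ} (ha : a ∈ S) (hb : b ∈ S)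
    (u v : F) : (Rh q a b u v : Op F n κ) ∈ loc F n S :=
  Subalgebra.smul_mem _ (Rn_mem_loc q hab ha hb u v) _

theorem act_Rh (q : F) (f : ι ↪ κ) {a b : ι} (hab : a ≠ b) (u v : F) :
    act f (Rh q a b u v : Op F n ι) = Rh q (f a) (f b) u v := by
  rw [Rh, act_smul, act_Rn q f hab, Rh]

theorem Rh_ybe {q : F} (hq : q ≠ 0) {a b c : κ} (hab : a ≠ b) (hac : a ≠ c) (hbc : b ≠ c)
    (x y w : F) :
    (Rh q a b x y * Rh q a c x w * Rh q b c y w : Op F n κ) =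
      Rh q b c y w * Rh q a c x w * Rh q a b x y := by
  simp only [Rh, smul_mul_assoc, mul_smul_comm, smul_smul, Rn_ybe hq hab hac hbc]
  congr 1
  ring

/-- The absence of a scalar here is the reason for the normalization: crossing twice is exactly
trivial, so braids do not depend on the route. -/
theorem Rh_unitarity {q : F} (hq : q ≠ 0) {a b : κ} (hab : a ≠ b) {u v : F}
    (h : q * v - q⁻¹ * u ≠ 0) (h' : q * u - q⁻¹ * v ≠ 0) :
    (Rh q a b u v * Rh q b a v u : Op F n κ) = 1 := by
  rw [Rh, Rh, smul_mul_assoc, mul_smul_comm, Rn_unitarity hq hab, smul_smul, smul_smul]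
  rw [← mul_inv, inv_mul_cancel₀ (mul_ne_zero h h'), one_smul]

theorem Rh_self {q : F} (a b : κ) {u : F} (h : q * u - q⁻¹ * u ≠ 0) :
    (Rh q a b u u : Op F n κ) = permF (Equiv.swap a b) := by
  rw [Rh, Rn_self, smul_smul, inv_mul_cancel₀ h, one_smul]

theorem Rh_homog (q : F) {c : F} (hc : c ≠ 0) (a b : κ) (u v : F) :
    (Rh q a b (c * u) (c * v) : Op F n κ) = Rh q a b u v := by
  rw [Rh, Rn_homog, smul_smul, Rh]
  congr 1
  rw [show q * (c * v) - q⁻¹ * (c * u) = c * (q * v - q⁻¹ * u) by ring, mul_inv, mul_assoc,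
    mul_comm, mul_assoc, mul_inv_cancel₀ hc, mul_one]

theorem Rh_commute (q : F) {a b c d : κ} (hab : a ≠ b) (hcd : c ≠ d) (hac : a ≠ c) (had : a ≠ d)
    (hbc : b ≠ c) (hbd : b ≠ d) (u v x y : F) :
    Commute (Rh q a b u v : Op F n κ) (Rh q c d x y) :=
  loc_commute (S := {a, b}) (T := {c, d}) (by simp [*, eq_comm])
    (Rh_mem_loc q hab (by simp) (by simp) u v) (Rh_mem_loc q hcd (by simp) (by simp) x y)

end Operators
end RShuffle

namespace RShuffle

/-! ### Braids between orderings of a set of strands -/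

section Braids

set_option linter.unusedSectionVars false

variable {F : Type*} [Field F] {n : ℕ}
variable {ι κ : Type*} [Fintype ι] [DecidableEq ι] [Fintype κ] [DecidableEq κ]

/-- The product of the normalized R-matrices moving the strand `x` to the left past `p`. -/
def passLeft (q : F) (u : κ → F) (p : List κ) (x : κ) : Op F n κ :=
  (p.reverse.map fun b => Rh q b x (u b) (u x)).prod

/-- The normalized braid from the order `l` of the strands to the order given by the second list;
`u` holds the spectral parameters of the strands. -/
def braid (q : F) (u : κ → F) : List κ → List κ → Op F n κ
  | _, [] => 1
  | l, x :: t => passLeft q u (l.takeWhile (fun y => decide (y ≠ x))) x * braid q u (l.erase x) t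

/-- The spectral parameters of the strands in `l` avoid the poles of the normalized R-matrix. -/
def Regular (q : F) (u : κ → F) (l : List κ) : Prop :=
  ∀ a ∈ l, ∀ b ∈ l, a ≠ b → q * u b - q⁻¹ * u a ≠ 0

theorem Regular.perm {q : F} {u : κ → F} {l l' : List κ} (h : Regular q u l) (hl : l.Perm l') :
    Regular q u l' :=
  fun a ha b hb => h a (hl.mem_iff.2 ha) b (hl.mem_iff.2 hb)

theorem Regular.mono {q : F} {u : κ → F} {l l' : List κ} (h : Regular q u l)
    (hl : ∀ x ∈ l', x ∈ l) : Regular q u l' :=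
  fun a ha b hb => h a (hl a ha) b (hl b hb)

theorem takeWhile_split {p s : List κ} {x : κ} (hx : x ∉ p) :
    (p ++ x :: s).takeWhile (fun y => decide (y ≠ x)) = p := by
  rw [List.takeWhile_append_of_pos]
  · simp
  · intro a ha
    simp only [decide_eq_true_eq]
    rintro rfl
    exact hx ha

theorem braid_split (q : F) (u : κ → F) {p s t : List κ} {x : κ} (hx : x ∉ p) :
    (braid q u (p ++ x :: s) (x :: t) : Op F n κ) = passLeft q u p x * braid q u (p ++ s) t := by
  rw [braid, takeWhile_split hx, List.erase_append_right _ hx, List.erase_cons_head]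

theorem braid_cons_cons (q : F) (u : κ → F) (x : κ) (s t : List κ) :
    (braid q u (x :: s) (x :: t) : Op F n κ) = braid q u s t := by
  have := braid_split (n := n) q u (p := []) (s := s) (t := t) (x := x) (by simp)
  simpa [passLeft] using this

theorem braid_self (q : F) (u : κ → F) (l : List κ) : (braid q u l l : Op F n κ) = 1 := by
  induction l with
  | nil => rfl
  | cons x t ih => rw [braid_cons_cons, ih]

theorem passLeft_mem_loc (q : F) (u : κ → F) {p : List κ} {x : κ} (hx : x ∉ p) {S : Finset κ}
    (hp : ∀ y ∈ p, y ∈ S) (hxS : x ∈ S) : (passLeft q u p x : Op F n κ) ∈ loc F n S := by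
  refine Subalgebra.list_prod_mem _ fun M hM => ?_
  obtain ⟨b, hb, rfl⟩ := List.mem_map.1 hM
  rw [List.mem_reverse] at hb
  exact Rh_mem_loc q (by rintro rfl; exact hx hb) (hp b hb) hxS _ _

theorem braid_mem_loc (q : F) (u : κ → F) {S : Finset κ} (l t : List κ) (hl : ∀ y ∈ l, y ∈ S)
    (ht : ∀ y ∈ t, y ∈ S) : (braid q u l t : Op F n κ) ∈ loc F n S := by
  induction t generalizing l with
  | nil => exact Subalgebra.one_mem _
  | cons x t ih =>
    refine Subalgebra.mul_mem _ (passLeft_mem_loc q u ?_ ?_ (ht x (by simp))) (ih _ ?_ ?_)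
    · intro h
      simpa using List.mem_takeWhile_imp h
    · intro y hy
      exact hl y ((List.takeWhile_sublist _).subset hy)
    · intro y hy
      exact hl y (List.mem_of_mem_erase hy)
    · intro y hy
      exact ht y (by simp [hy])

theorem act_passLeft (q : F) (f : ι ↪ κ) (u : κ → F) {p : List ι} {x : ι} (hx : x ∉ p) :
    act f (passLeft q (u ∘ f) p x : Op F n ι) = passLeft q u (p.map f) (f x) := by
  rw [passLeft, act_list_prod, passLeft, ← List.map_reverse, List.map_map, List.map_map]
  congr 1
  refine List.map_congr_left fun b hb => ?_
  rw [List.mem_reverse] at hb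
  exact act_Rh q f (by rintro rfl; exact hx hb) _ _

theorem act_braid (q : F) (f : ι ↪ κ) (u : κ → F) (l t : List ι) :
    act f (braid q (u ∘ f) l t : Op F n ι) = braid q u (l.map f) (t.map f) := by
  induction t generalizing l with
  | nil => exact act_one f
  | cons x t ih =>
    rw [braid, act_mul, List.map_cons, braid, ih, act_passLeft]
    · rw [List.takeWhile_map, List.map_erase f.injective]
      congr 4
      funext y
      simp
    · intro h
      simpa using List.mem_takeWhile_imp h

/-- Passing a permutation through a braid relabels the strands, and each strand takes its parameter
along. -/
theorem permF_mul_braid (q : F) (σ : Equiv.Perm κ) (u : κ → F) (l t : List κ) :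
    (permF σ * braid q (u ∘ σ) l t : Op F n κ) = braid q u (l.map σ) (t.map σ) * permF σ := by
  have h1 := act_braid (n := n) q σ.toEmbedding u l t
  have h2 := permF_mul_act (n := n) σ (Function.Embedding.refl κ) (braid q (u ∘ σ) l t)
  rw [act_refl] at h2
  rw [h2, ← show _ = (braid q u (l.map σ) (t.map σ) : Op F n κ) from h1]
  rfl

theorem passLeft_congr (q : F) {u u' : κ → F} {p : List κ} {x : κ} (h : ∀ y ∈ p, u y = u' y)
    (hx : u x = u' x) : (passLeft q u p x : Op F n κ) = passLeft q u' p x := by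
  rw [passLeft, passLeft]
  congr 1
  refine List.map_congr_left fun b hb => ?_
  rw [h b (List.mem_reverse.1 hb), hx]

theorem braid_congr (q : F) {u u' : κ → F} (l t : List κ) (h : ∀ y ∈ l, u y = u' y)
    (ht : ∀ y ∈ t, u y = u' y) : (braid q u l t : Op F n κ) = braid q u' l t := by
  induction t generalizing l with
  | nil => rfl
  | cons x t ih =>
    rw [braid, braid, ih _ (fun y hy => h y (List.mem_of_mem_erase hy))
      (fun y hy => ht y (by simp [hy])),
      passLeft_congr q (fun y hy => h y ((List.takeWhile_sublist _).subset hy)) (ht x (by simp))]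

theorem braid_homog (q : F) {c : F} (hc : c ≠ 0) (u : κ → F) (l t : List κ) :
    (braid q (fun y => c * u y) l t : Op F n κ) = braid q u l t := by
  induction t generalizing l with
  | nil => rfl
  | cons x t ih =>
    rw [braid, braid, ih, passLeft, passLeft]
    simp only [Rh_homog q hc]

theorem exists_split {l : List κ} {x : κ} (hx : x ∈ l) : ∃ p s, x ∉ p ∧ l = p ++ x :: s := by
  obtain ⟨p, s, h1, h2⟩ := List.eq_append_cons_of_mem hx
  exact ⟨p, s, by assumption, by assumption⟩

/-- A braid on some neighbouring strands. -/
theorem braid_local (q : F) (u : κ → F) (p s : List κ) {m m' : List κ} (hm : m.Perm m') :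
    (braid q u (p ++ m ++ s) (p ++ m' ++ s) : Op F n κ) = braid q u m m' := by
  induction p with
  | cons x p ih => simpa only [List.cons_append, braid_cons_cons] using ih
  | nil =>
    simp only [List.nil_append]
    induction m' generalizing m with
    | nil => rw [List.perm_nil.1 hm]; exact braid_self q u s
    | cons x t ih =>
      have hx : x ∈ m := hm.mem_iff.2 (by simp)
      obtain ⟨m1, m2, h1, rfl⟩ := exists_split hx
      have hp : (m1 ++ m2).Perm t := by
        have := List.perm_middle.symm.trans hm
        exact (List.perm_cons x).1 this
      rw [List.append_assoc, List.cons_append, List.cons_append, braid_split q u h1,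
        braid_split q u h1, ← List.append_assoc, ih hp]

/-- Induction on `p` from its right end: each strand `c` contributes one Yang–Baxter relation for
`c`, `a`, `b`, after the factors with disjoint strands have been commuted away. -/
theorem passLeft_slide {q : F} (hq : q ≠ 0) (u : κ → F) {a b : κ} (hab : a ≠ b) {p : List κ}
    (hp : p.Nodup) (ha : a ∉ p) (hb : b ∉ p) :
    (passLeft q u p a * passLeft q u p b * Rh q a b (u a) (u b) : Op F n κ) =
      Rh q a b (u a) (u b) * (passLeft q u p b * passLeft q u p a) := by
  induction p using List.reverseRecOn with
  | nil => simp [passLeft]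
  | append_singleton p c ih =>
    rw [List.nodup_append] at hp
    have hc : c ∉ p := fun h => hp.2.2 c h c (by simp) rfl
    have hca : c ≠ a := fun h => ha (by simp [h])
    have hcb : c ≠ b := fun h => hb (by simp [h])
    have hap : a ∉ p := fun h => ha (by simp [h])
    have hbp : b ∉ p := fun h => hb (by simp [h])
    have e : ∀ x, (passLeft q u (p ++ [c]) x : Op F n κ) =
        Rh q c x (u c) (u x) * passLeft q u p x := by
      intro x
      simp [passLeft]
    have comm : ∀ x y, x ≠ y → x ≠ c → y ≠ c → x ∉ p → y ∉ p →
        Commute (passLeft q u p x : Op F n κ) (Rh q c y (u c) (u y)) := by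
      intro x y hxy hxc hyc hx hy
      refine loc_commute (S := insert x p.toFinset) (T := {c, y}) ?_
        (passLeft_mem_loc q u hx (by simp +contextual) (by simp))
        (Rh_mem_loc q (Ne.symm hyc) (by simp) (by simp) _ _)
      simp only [Finset.disjoint_left, Finset.mem_insert, List.mem_toFinset, Finset.mem_singleton]
      rintro z (rfl | hz) (rfl | rfl) <;> contradiction
    have c1 := comm a b hab hca.symm hcb.symm hap hbp
    have c2 := comm b a hab.symm hcb.symm hca.symm hbp hap
    have y := Rh_ybe (n := n) hq hca hcb hab (u c) (u a) (u b)
    have ih := ih hp.1 hap hbp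
    rw [e, e]
    calc _ = Rh q c a (u c) (u a) * (passLeft q u p a * Rh q c b (u c) (u b)) *
          passLeft q u p b * Rh q a b (u a) (u b) := by simp only [mul_assoc]
      _ = Rh q c a (u c) (u a) * Rh q c b (u c) (u b) *
          (passLeft q u p a * passLeft q u p b * Rh q a b (u a) (u b)) := by
        rw [c1.eq]; simp only [mul_assoc]
      _ = Rh q c a (u c) (u a) * Rh q c b (u c) (u b) * Rh q a b (u a) (u b) *
          (passLeft q u p b * passLeft q u p a) := by rw [ih]; simp only [mul_assoc]
      _ = Rh q a b (u a) (u b) * Rh q c b (u c) (u b) *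
          (Rh q c a (u c) (u a) * passLeft q u p b) * passLeft q u p a := by
        rw [y]; simp only [mul_assoc]
      _ = _ := by rw [← c2.eq]; simp only [mul_assoc]

/-- With `a` before `b` in the source, the target `b, a` needs one more crossing. `passLeft_slide`
moves that crossing to the right of the passages over `l1`, and it commutes with the braid of the
remaining strands. -/
theorem braid_exchange_head {q : F} (hq : q ≠ 0) (u : κ → F) {l1 l2 l3 t : List κ} {a b : κ}
    (hl : (l1 ++ a :: (l2 ++ b :: l3)).Nodup) (ht : (l1 ++ (l2 ++ l3)).Perm t) :
    (braid q u (l1 ++ a :: (l2 ++ b :: l3)) (b :: a :: t) : Op F n κ) =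
      braid q u (l1 ++ a :: (l2 ++ b :: l3)) (a :: b :: t) * Rh q a b (u a) (u b) := by
  have hp : (l1 ++ a :: (l2 ++ b :: l3)).Perm (a :: b :: (l1 ++ (l2 ++ l3))) := by
    refine List.perm_middle.trans (List.Perm.cons a ?_)
    rw [← List.append_assoc, ← List.append_assoc]
    exact List.perm_middle
  have hnd := hp.nodup_iff.1 hl
  simp only [List.nodup_cons, List.mem_cons, List.mem_append, not_or] at hnd
  obtain ⟨⟨hab, ha1, ha2, ha3⟩, ⟨hb1, hb2, hb3⟩, hnd⟩ := hnd
  rw [braid_split q u ha1]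
  conv_rhs => rw [← List.append_assoc]
  rw [braid_split q u (by simp [hb1, hb2])]
  have e : l1 ++ a :: (l2 ++ b :: l3) = (l1 ++ a :: l2) ++ b :: l3 := by simp
  rw [e, braid_split q u (by simp [hb1, hb2, Ne.symm hab])]
  have e : l1 ++ a :: l2 ++ l3 = l1 ++ a :: (l2 ++ l3) := by simp
  rw [e, braid_split q u ha1, List.append_assoc]
  have c1 : Commute (braid q u (l1 ++ (l2 ++ l3)) t : Op F n κ) (Rh q a b (u a) (u b)) := by
    refine loc_commute (S := t.toFinset) (T := {a, b}) ?_
      (braid_mem_loc q u _ _ (fun y hy => by simpa using ht.mem_iff.1 hy) (by simp))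
      (Rh_mem_loc q hab (by simp) (by simp) _ _)
    simp only [Finset.disjoint_left, Finset.mem_insert, List.mem_toFinset, Finset.mem_singleton]
    rintro z hz (rfl | rfl)
    · simpa [ha1, ha2, ha3] using ht.mem_iff.2 hz
    · simpa [hb1, hb2, hb3] using ht.mem_iff.2 hz
  have c2 : Commute (passLeft q u l1 a : Op F n κ) (passLeft q u l2 b) := by
    refine loc_commute (S := insert a l1.toFinset) (T := insert b l2.toFinset) ?_
      (passLeft_mem_loc q u ha1 (by simp +contextual) (by simp))
      (passLeft_mem_loc q u hb2 (by simp +contextual) (by simp))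
    simp only [Finset.disjoint_left, Finset.mem_insert, List.mem_toFinset]
    rw [List.nodup_append] at hnd
    rintro z (rfl | hz) (rfl | hz')
    · exact hab rfl
    · exact ha2 hz'
    · exact hb1 hz
    · exact hnd.2.2 z hz z (by simp [hz']) rfl
  have s := passLeft_slide (n := n) hq u hab (List.nodup_append.1 hnd).1 ha1 hb1
  have e1 : (passLeft q u (l1 ++ a :: l2) b : Op F n κ) =
      passLeft q u l2 b * Rh q a b (u a) (u b) * passLeft q u l1 b := by
    simp [passLeft, mul_assoc]
  have e2 : (passLeft q u (l1 ++ l2) b : Op F n κ) = passLeft q u l2 b * passLeft q u l1 b := by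
    simp [passLeft]
  rw [e1, e2]
  symm
  calc _ = passLeft q u l1 a * passLeft q u l2 b * passLeft q u l1 b *
        (braid q u (l1 ++ (l2 ++ l3)) t * Rh q a b (u a) (u b)) := by simp only [mul_assoc]
    _ = passLeft q u l2 b * (passLeft q u l1 a * passLeft q u l1 b * Rh q a b (u a) (u b)) *
        braid q u (l1 ++ (l2 ++ l3)) t := by rw [c1.eq, c2.eq]; simp only [mul_assoc]
    _ = _ := by rw [s]; simp only [mul_assoc]

/-- Stripping the common initial part `t1` leaves an exchange at the head. If `b` precedes `a` in
the source, the new crossing cancels an existing one by unitarity; this is where `Regular` is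
needed. -/
theorem braid_exchange {q : F} (hq : q ≠ 0) {u : κ → F} {l t1 t2 : List κ} {a b : κ}
    (hl : l.Nodup) (ht : l.Perm (t1 ++ a :: b :: t2)) (hu : Regular q u l) :
    (braid q u l (t1 ++ b :: a :: t2) : Op F n κ) =
      braid q u l (t1 ++ a :: b :: t2) * Rh q a b (u a) (u b) := by
  induction t1 generalizing l with
  | cons x t1 ih =>
    obtain ⟨p, s, hx, rfl⟩ := exists_split (ht.mem_iff.2 (by simp) : x ∈ l)
    have hm : (p ++ x :: s).Perm (x :: (p ++ s)) := List.perm_middle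
    rw [List.cons_append, List.cons_append, braid_split q u hx, braid_split q u hx,
      ih (List.nodup_cons.1 (hm.nodup_iff.1 hl)).2 ((List.perm_cons x).1 (hm.symm.trans ht))
        (hu.mono (by simp +contextual [or_imp])), mul_assoc]
  | nil =>
    simp only [List.nil_append] at ht ⊢
    have hnd := ht.nodup_iff.1 hl
    simp only [List.nodup_cons, List.mem_cons, not_or] at hnd
    have ha : a ∈ l := ht.mem_iff.2 (by simp)
    have hb : b ∈ l := ht.mem_iff.2 (by simp)
    obtain ⟨p, s, hp, rfl⟩ := exists_split ha
    have hm : (p ++ a :: s).Perm (a :: (p ++ s)) := List.perm_middle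
    have ht' := (List.perm_cons a).1 (hm.symm.trans ht)
    by_cases hbs : b ∈ s
    · obtain ⟨l2, l3, h2, rfl⟩ := exists_split hbs
      refine braid_exchange_head hq u hl ?_
      refine (List.perm_cons b).1 (List.Perm.trans ?_ ht')
      rw [← List.append_assoc, ← List.append_assoc]
      exact List.perm_middle.symm
    · have hbp : b ∈ p := by
        simp only [List.mem_append, List.mem_cons] at hb
        rcases hb with hb | hb | hb
        · exact hb
        · exact absurd hb.symm hnd.1.1
        · exact absurd hb hbs
      obtain ⟨l1, l2, h2, rfl⟩ := exists_split hbp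
      have e : (l1 ++ b :: l2) ++ a :: s = l1 ++ b :: (l2 ++ a :: s) := by simp
      rw [e] at hl ht ⊢
      have h := braid_exchange_head (n := n) hq u hl (t := t2) (by
        refine (List.perm_cons b).1 (List.Perm.trans ?_ ht')
        simpa using List.perm_middle.symm)
      rw [h, mul_assoc, Rh_unitarity hq (Ne.symm hnd.1.1), mul_one]
      · exact hu b (by simp) a (by simp) (Ne.symm hnd.1.1)
      · exact hu a (by simp) b (by simp) hnd.1.1

/-- `passLeft` is a succession of exchanges of neighbours in the target order. -/
theorem braid_slide {q : F} (hq : q ≠ 0) {u : κ → F} {l p s : List κ} {x : κ}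
    (hl : l.Nodup) (ht : l.Perm (p ++ x :: s)) (hu : Regular q u l) :
    (braid q u l (p ++ x :: s) * passLeft q u p x : Op F n κ) = braid q u l (x :: (p ++ s)) := by
  induction p using List.reverseRecOn generalizing s with
  | nil => simp [passLeft]
  | append_singleton p c ih =>
    have e : (passLeft q u (p ++ [c]) x : Op F n κ) =
        Rh q c x (u c) (u x) * passLeft q u p x := by simp [passLeft]
    simp only [List.append_assoc, List.singleton_append] at ht ⊢
    rw [e, ← mul_assoc, ← braid_exchange hq hl ht hu, ih]
    exact ht.trans (List.Perm.append_left p (List.Perm.swap _ _ _))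

/-- Composition of braids. -/
theorem braid_trans {q : F} (hq : q ≠ 0) {u : κ → F} {l l' l'' : List κ} (hl : l.Nodup)
    (h : l.Perm l') (h' : l'.Perm l'') (hu : Regular q u l) :
    (braid q u l l' * braid q u l' l'' : Op F n κ) = braid q u l l'' := by
  induction l'' generalizing l l' with
  | nil =>
    rw [List.perm_nil.1 h'] at h ⊢
    rw [List.perm_nil.1 h]
    simp [braid]
  | cons x t ih =>
    obtain ⟨p, s, hx, rfl⟩ := exists_split (h'.mem_iff.2 (by simp) : x ∈ l')
    obtain ⟨p2, s2, hx2, rfl⟩ := exists_split (h.mem_iff.2 (by simp) : x ∈ l)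
    have hm : (p ++ x :: s).Perm (x :: (p ++ s)) := List.perm_middle
    have hm2 : (p2 ++ x :: s2).Perm (x :: (p2 ++ s2)) := List.perm_middle
    -- Once `x` has been brought to the front of the intermediate order, it can be removed from all
    -- three lists and the induction hypothesis applies.
    rw [braid_split q u hx, ← mul_assoc, braid_slide hq hl h hu, braid_split q u hx2,
      braid_split q u hx2, mul_assoc, ih (List.nodup_cons.1 (hm2.nodup_iff.1 hl)).2
        ((List.perm_cons x).1 (hm2.symm.trans (h.trans hm)))
        ((List.perm_cons x).1 (hm.symm.trans h')) (hu.mono (by simp +contextual [or_imp]))]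

theorem braid_inv {q : F} (hq : q ≠ 0) {u : κ → F} {l l' : List κ} (hl : l.Nodup)
    (h : l.Perm l') (hu : Regular q u l) :
    (braid q u l l' * braid q u l' l : Op F n κ) = 1 := by
  rw [braid_trans hq hl h h.symm hu, braid_self]

/-- Strands with equal parameters may be exchanged at the cost of a permutation operator. -/
theorem braid_map_perm {q : F} (hq : q ≠ 0) {u : κ → F} {l : List κ} (hl : l.Nodup)
    (hall : ∀ x, x ∈ l) (hu : Regular q u l) (π : Equiv.Perm κ) (hπ : ∀ x, u (π x) = u x) :
    (braid q u l (l.map π) : Op F n κ) = permF π⁻¹ := by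
  have hperm : ∀ σ : Equiv.Perm κ, ∀ l' : List κ, l'.Nodup → (∀ x, x ∈ l') →
      l'.Perm (l'.map σ) := by
    intro σ l' h1 h2
    refine (List.perm_ext_iff_of_nodup h1 (h1.map σ.injective)).2 fun x => ?_
    simp only [h2, List.mem_map, true_and, true_iff]
    exact ⟨σ⁻¹ x, by simp⟩
  have swap_case : ∀ x y, x ≠ y → u x = u y →
      (braid q u l (l.map (Equiv.swap x y)) : Op F n κ) = permF (Equiv.swap x y) := by
    intro x y hxy hu'
    have huσ : u ∘ Equiv.swap x y = u := by
      funext z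
      simp only [Function.comp_apply, Equiv.swap_apply_def]
      split_ifs with h1 h2
      · rw [h1, hu']
      · rw [h2, hu']
      · rfl
    set r := (l.erase x).erase y with hr
    have hl0 : l.Perm (x :: y :: r) := by
      refine (List.perm_cons_erase (hall x)).trans (List.Perm.cons x (List.perm_cons_erase ?_))
      rw [List.mem_erase_of_ne hxy.symm]
      exact hall y
    have hnd := hl0.nodup_iff.1 hl
    have hmap : (x :: y :: r).map (Equiv.swap x y) = y :: x :: r := by
      simp only [List.nodup_cons, List.mem_cons, not_or] at hnd
      simp only [List.map_cons, Equiv.swap_apply_left, Equiv.swap_apply_right]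
      congr 2
      conv_rhs => rw [← List.map_id r]
      refine List.map_congr_left fun z hz => ?_
      exact Equiv.swap_apply_of_ne_of_ne (fun h => hnd.1.2 (h ▸ hz)) (fun h => hnd.2.1 (h ▸ hz))
    -- For neighbouring strands with equal parameters the only crossing is `Rh_self`.
    have h0 : (braid q u (x :: y :: r) (y :: x :: r) : Op F n κ) = permF (Equiv.swap x y) := by
      have := braid_exchange (n := n) hq (t1 := []) hnd (List.Perm.refl _) (hu.perm hl0)
      simp only [List.nil_append] at this
      rw [this, braid_self, one_mul, hu', Rh_self]
      have := hu x (hall x) y (hall y) hxy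
      rwa [hu'] at this
    have h1 := permF_mul_braid (n := n) q (Equiv.swap x y) u (x :: y :: r) l
    rw [huσ, hmap] at h1
    have p1 := hperm (Equiv.swap x y) l hl hall
    -- The route goes through `x :: y :: r` and `y :: x :: r`. Its last leg is the conjugate by the
    -- transposition of the inverse of its first leg, so only the transposition survives.
    rw [← braid_trans hq hl hl0 (hl0.symm.trans p1) hu,
      ← braid_trans hq hnd (List.Perm.swap _ _ _)
        ((List.Perm.swap _ _ _).trans (hl0.symm.trans p1)) (hu.perm hl0), h0]
    have h2 : (braid q u (y :: x :: r) (l.map (Equiv.swap x y)) : Op F n κ) =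
        permF (Equiv.swap x y) * braid q u (x :: y :: r) l * permF (Equiv.swap x y) := by
      rw [h1, mul_assoc, permF_mul, Equiv.swap_mul_self, permF_one, mul_one]
    rw [h2]
    simp only [← mul_assoc]
    rw [mul_assoc (braid q u l (x :: y :: r)) (permF _) (permF _), permF_mul, Equiv.swap_mul_self,
      permF_one, mul_one, braid_inv hq hl hl0 hu, one_mul]
  induction hN : π.support.card using Nat.strong_induction_on generalizing π with
  | _ N ih =>
    by_cases h1 : π = 1
    · subst h1
      simp [braid_self, permF_one]
    obtain ⟨x, hx⟩ : ∃ x, π x ≠ x := by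
      by_contra h
      push Not at h
      exact h1 (Equiv.ext h)
    set τ := Equiv.swap x (π x) with hτ
    have hττ : τ * τ = 1 := Equiv.swap_mul_self _ _
    have hbτ : (braid q u l (l.map τ) : Op F n κ) = permF τ := swap_case x _ (Ne.symm hx) (hπ x).symm
    have hτu : ∀ z, u (τ z) = u z := by
      intro z
      simp only [hτ, Equiv.swap_apply_def]
      split_ifs with h2 h3
      · rw [h2, hπ]
      · rw [h3, hπ]
      · rfl
    have hlt : (τ * π).support.card < N := hN ▸ Equiv.Perm.card_support_swap_mul hx
    have ih' := ih _ hlt (τ * π) (fun z => by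
      rw [Equiv.Perm.mul_apply, hτu, hπ]) rfl
    have e : π = τ * (τ * π) := by
      rw [← mul_assoc, hττ, one_mul]
    clear_value τ
    generalize τ * π = π' at *
    rw [e]
    have hm : l.map (τ * π') = (l.map π').map τ := by
      rw [List.map_map]; rfl
    have huτ : u ∘ τ = u := funext hτu
    have h3 := permF_mul_braid (n := n) q τ u l (l.map π')
    rw [huτ] at h3
    have h4 : (braid q u (l.map τ) (l.map (τ * π')) : Op F n κ) =
        permF τ * permF π'⁻¹ * permF τ⁻¹ := by
      rw [hm, ← ih', h3, mul_assoc, permF_mul_inv, mul_one]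
    rw [← braid_trans hq hl (hperm τ l hl hall)
      ((hperm τ l hl hall).symm.trans (hperm _ l hl hall)) hu, h4, hbτ, mul_inv_rev, ← permF_mul, mul_assoc, ← mul_assoc (permF τ), permF_mul τ τ,
      hττ, permF_one, one_mul]

/-! ### Braids interleaving two families of strands -/

/-- `l` is an interleaving of `X` and `A`, in which `a ∈ A` precedes `b ∈ X` iff `P a b`. -/
inductive Interleaving (P : κ → κ → Prop) : List κ → List κ → List κ → Prop
  | nil : Interleaving P [] [] []
  | left {X A l : List κ} (x : κ) (hx : ∀ a ∈ A, ¬ P a x) (h : Interleaving P X A l) :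
      Interleaving P (x :: X) A (x :: l)
  | right {X A l : List κ} (a : κ) (ha : ∀ b ∈ X, P a b) (h : Interleaving P X A l) :
      Interleaving P X (a :: A) (a :: l)

theorem Interleaving.of_filter (P : κ → κ → Prop) (hP : ∀ x y, P x y → ¬ P y x)
    (p : κ → Bool) {l : List κ} (hl : l.Pairwise P) :
    Interleaving P (l.filter fun x => !p x) (l.filter p) l := by
  induction l with
  | nil => exact .nil
  | cons x t ih =>
    obtain ⟨h1, h2⟩ := List.pairwise_cons.1 hl
    cases h : p x
    · rw [List.filter_cons_of_pos (by simp [h]), List.filter_cons_of_neg (by simp [h])]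
      exact .left x (fun a ha => hP _ _ (h1 a (List.mem_of_mem_filter ha))) (ih h2)
    · rw [List.filter_cons_of_neg (by simp [h]), List.filter_cons_of_pos (by simp [h])]
      exact .right x (fun a ha => h1 a (List.mem_of_mem_filter ha)) (ih h2)

theorem Interleaving.perm {P : κ → κ → Prop} {X A l : List κ} (h : Interleaving P X A l) :
    l.Perm (X ++ A) := by
  induction h with
  | nil => exact .refl _
  | left x hx h ih => exact ih.cons x
  | right a ha h ih => exact (ih.cons a).trans List.perm_middle.symm

theorem Interleaving.nil_right {P : κ → κ → Prop} (X : List κ) : Interleaving P X [] X := by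
  induction X with
  | nil => exact .nil
  | cons a A ih => exact .left a (by simp) ih

theorem Interleaving.append {P : κ → κ → Prop} (X A : List κ) (h : ∀ a ∈ A, ∀ b ∈ X, P a b) :
    Interleaving P X A (A ++ X) := by
  induction A with
  | nil => exact .nil_right X
  | cons a A ih => exact .right a (h a (by simp)) (ih fun a ha => h a (by simp [ha]))

/-- `A1` consists of the strands that `x` has to pass on its way to the front. -/
theorem Interleaving.split {P : κ → κ → Prop} {Y A l : List κ} (h : Interleaving P Y A l) :
    ∀ {x X}, Y = x :: X → ∃ A1 A2 l', A = A1 ++ A2 ∧ l = A1 ++ x :: l' ∧ (∀ a ∈ A1, P a x) ∧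
      (∀ a ∈ A2, ¬ P a x) ∧ Interleaving P X A (A1 ++ l') := by
  induction h with
  | nil => simp
  | @left X' A l y hx h ih =>
    intro x X e
    obtain ⟨rfl, rfl⟩ := List.cons.inj e
    exact ⟨[], A, l, rfl, rfl, by simp, hx, h⟩
  | @right X' A l a ha h ih =>
    rintro x X rfl
    obtain ⟨A1, A2, l', rfl, rfl, h1, h2, h3⟩ := ih rfl
    refine ⟨a :: A1, A2, l', rfl, rfl, ?_, h2, .right a (fun b hb => ha b (by simp [hb])) h3⟩
    intro b hb
    rcases List.mem_cons.1 hb with rfl | hb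
    · exact ha x (by simp)
    · exact h1 b hb

theorem prod_map_comm_mul {M α : Type*} [Monoid M] (l : List α) (f g : α → M)
    (h : l.Pairwise fun a b => Commute (f b) (g a)) :
    (l.map f).prod * (l.map g).prod = (l.map fun a => f a * g a).prod := by
  induction l with
  | nil => simp
  | cons a l ih =>
    obtain ⟨h1, h2⟩ := List.pairwise_cons.1 h
    have c : Commute (l.map f).prod (g a) := by
      refine Commute.list_prod_left _ _ fun x hx => ?_
      obtain ⟨b, hb, rfl⟩ := List.mem_map.1 hx
      exact h1 b hb
    simp only [List.map_cons, List.prod_cons, ← ih h2]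
    rw [mul_assoc, ← mul_assoc (l.map f).prod, c.eq]
    simp only [mul_assoc]

/-- Exchanging the rows and columns of a product over a grid. -/
theorem prod_grid_comm {M α β : Type*} [Monoid M] {l : List α} {r : List β} (hl : l.Nodup)
    (hr : r.Nodup) (f : α → β → M)
    (h : ∀ a ∈ l, ∀ a' ∈ l, ∀ b ∈ r, ∀ b' ∈ r, a ≠ a' → b ≠ b' → Commute (f a b) (f a' b')) :
    (l.map fun a => (r.map fun b => f a b).prod).prod =
      (r.map fun b => (l.map fun a => f a b).prod).prod := by
  induction r with
  | nil => simp
  | cons b r ih =>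
    obtain ⟨h1, h2⟩ := List.nodup_cons.1 hr
    simp only [List.map_cons, List.prod_cons]
    rw [← ih h2, prod_map_comm_mul]
    · refine List.Pairwise.imp_of_mem ?_ hl
      intro a a' ha ha' hne
      refine Commute.list_prod_right _ _ fun x hx => ?_
      obtain ⟨b', hb', rfl⟩ := List.mem_map.1 hx
      exact h _ ha' _ ha _ (by simp) _ (by simp [hb']) (Ne.symm hne) (by rintro rfl; exact h1 hb')
    · intro a ha a' ha' b hb b' hb'
      exact h a ha a' ha' b (by simp [hb]) b' (by simp [hb'])

theorem prod_map_ite_true {M α : Type*} [Monoid M] (l : List α) (p : α → Prop) [DecidablePred p]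
    (f : α → M) (h : ∀ a ∈ l, p a) :
    (l.map fun a => if p a then f a else 1).prod = (l.map f).prod := by
  congr 1
  exact List.map_congr_left fun a ha => if_pos (h a ha)

theorem prod_map_ite_false {M α : Type*} [Monoid M] (l : List α) (p : α → Prop) [DecidablePred p]
    (f : α → M) (h : ∀ a ∈ l, ¬ p a) :
    (l.map fun a => if p a then f a else 1).prod = 1 := by
  refine List.prod_eq_one fun x hx => ?_
  obtain ⟨a, ha, rfl⟩ := List.mem_map.1 hx
  exact if_neg (h a ha)

/-- Each `a` passes exactly those `b` that follow it in the target. Formulas of this kind match the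
explicit ordered products of R-matrices with braids. -/
theorem braid_append_interleaving (q : F) (u : κ → F) {P : κ → κ → Prop} [DecidableRel P]
    {X A l : List κ} (h : Interleaving P X A l) (hl : l.Nodup) :
    (braid q u (X ++ A) l : Op F n κ) = (A.map fun a => (X.reverse.map fun b =>
      if P a b then Rh q b a (u b) (u a) else 1).prod).prod := by
  induction h with
  | nil => rfl
  | left x hx h ih =>
    rw [List.cons_append, braid_cons_cons, ih (List.nodup_cons.1 hl).2]
    congr 1
    refine List.map_congr_left fun a ha => ?_
    simp [hx a ha]
  | @right X A l a ha h ih =>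
    have haX : a ∉ X := by
      have := h.perm.mem_iff (a := a)
      simp only [List.mem_append] at this
      exact fun haX => (List.nodup_cons.1 hl).1 (this.2 (Or.inl haX))
    rw [braid_split q u haX, ih (List.nodup_cons.1 hl).2, List.map_cons, List.prod_cons,
      prod_map_ite_true]
    · rfl
    · intro b hb
      exact ha b (List.mem_reverse.1 hb)

theorem braid_interleaving_append_col (q : F) (u : κ → F) {P : κ → κ → Prop} [DecidableRel P]
    {X A l : List κ} (h : Interleaving P X A l) (hl : l.Nodup) :
    (braid q u l (X ++ A) : Op F n κ) = (X.map fun b => (A.reverse.map fun a =>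
      if P a b then Rh q a b (u a) (u b) else 1).prod).prod := by
  induction X generalizing l with
  | nil =>
    have : l = A := by
      generalize hX : ([] : List κ) = X at h
      induction h with
      | nil => rfl
      | left => simp at hX
      | right a ha h ih => rw [ih (List.nodup_cons.1 hl).2 hX]
    subst this
    simp [braid_self]
  | cons x X ih =>
    obtain ⟨A1, A2, l', rfl, rfl, h1, h2, h3⟩ := h.split rfl
    have hm : (A1 ++ x :: l').Perm (x :: (A1 ++ l')) := List.perm_middle
    have hnd := List.nodup_cons.1 (hm.nodup_iff.1 hl)
    rw [List.cons_append, braid_split q u (by simp only [List.mem_append, not_or] at hnd; exact hnd.1.1), ih h3 hnd.2, List.map_cons, List.prod_cons, List.reverse_append, List.map_append, List.prod_append,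
      prod_map_ite_false, one_mul, prod_map_ite_true]
    · rfl
    · intro b hb
      exact h1 b (List.mem_reverse.1 hb)
    · intro b hb
      exact h2 b (List.mem_reverse.1 hb)

/-- The definition of `braid` yields the crossings grouped by `b`. Crossings without a common strand
commute, so the grid may be transposed into the order used by `leftFactor` and `wheelLeft`. -/
theorem braid_interleaving_append (q : F) (u : κ → F) {P : κ → κ → Prop} [DecidableRel P]
    {X A l : List κ} (h : Interleaving P X A l) (hl : l.Nodup) :
    (braid q u l (X ++ A) : Op F n κ) = (A.reverse.map fun a => (X.map fun b =>
      if P a b then Rh q a b (u a) (u b) else 1).prod).prod := by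
  have hnd := List.nodup_append.1 (h.perm.nodup_iff.1 hl)
  rw [braid_interleaving_append_col q u h hl]
  refine prod_grid_comm hnd.1 (List.nodup_reverse.2 hnd.2.1) _ ?_
  intro b hb b' hb' a ha a' ha' hbb haa
  rw [List.mem_reverse] at ha ha'
  split_ifs
  · exact Rh_commute q (Ne.symm (hnd.2.2 b hb a ha)) (Ne.symm (hnd.2.2 b' hb' a' ha')) haa
      (Ne.symm (hnd.2.2 b' hb' a ha)) (hnd.2.2 b hb a' ha') hbb _ _ _ _
  · exact Commute.one_right _
  · exact Commute.one_left _
  · exact Commute.one_left _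

/-- The transposed grouping, which is the one occurring in `rightFactor`. -/
theorem braid_append_interleaving_row (q : F) (u : κ → F) {P : κ → κ → Prop} [DecidableRel P]
    {X A l : List κ} (h : Interleaving P X A l) (hl : l.Nodup) :
    (braid q u (X ++ A) l : Op F n κ) = (X.reverse.map fun b => (A.map fun a =>
      if P a b then Rh q b a (u b) (u a) else 1).prod).prod := by
  have hnd := List.nodup_append.1 (h.perm.nodup_iff.1 hl)
  rw [braid_append_interleaving q u h hl]
  refine prod_grid_comm hnd.2.1 (List.nodup_reverse.2 hnd.1) _ ?_
  intro a ha a' ha' b hb b' hb' haa hbb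
  rw [List.mem_reverse] at hb hb'
  split_ifs
  · exact Rh_commute q (hnd.2.2 b hb a ha) (hnd.2.2 b' hb' a' ha') hbb (hnd.2.2 b hb a' ha')
      (Ne.symm (hnd.2.2 b' hb' a ha)) haa _ _ _ _
  · exact Commute.one_right _
  · exact Commute.one_left _
  · exact Commute.one_left _

end Braids
end RShuffle

namespace RShuffle

/-! ### Evaluating rational functions at a point -/

section Evaluation

set_option linter.unusedSectionVars false

variable {K : Type*} [Field K] {F : Type*} [Field F] [Algebra K F] {F' : Type*} [Field F']
  [Algebra K F'] {n k N : ℕ}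

/-- The rational function `g` is regular at the point `u`, with value `h`. -/
def Sp (u : Fin k → F) (g : RatF K k) (h : F) : Prop :=
  ∃ p d : MvPolynomial (Fin k) K, MvPolynomial.aeval u d ≠ 0 ∧
    g * algebraMap (MvPolynomial (Fin k) K) (RatF K k) d = algebraMap _ (RatF K k) p ∧
    h * MvPolynomial.aeval u d = MvPolynomial.aeval u p

theorem Sp.of_poly (u : Fin k → F) (p : MvPolynomial (Fin k) K) :
    Sp u (algebraMap _ (RatF K k) p) (MvPolynomial.aeval u p) :=
  ⟨p, 1, by simp, by simp, by simp⟩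

theorem algebraMap_C (c : K) :
    algebraMap (MvPolynomial (Fin k) K) (RatF K k) (MvPolynomial.C c) = const k c :=
  (IsScalarTower.algebraMap_apply K (MvPolynomial (Fin k) K) (RatF K k) c).symm

theorem Sp.z (u : Fin k → F) (i : Fin k) : Sp u (z i : RatF K k) (u i) := by
  simpa using! Sp.of_poly u (MvPolynomial.X i : MvPolynomial (Fin k) K)

theorem Sp.const (u : Fin k → F) (c : K) : Sp u (const k c) (algebraMap K F c) := by
  have := Sp.of_poly u (MvPolynomial.C c : MvPolynomial (Fin k) K)
  rwa [algebraMap_C, MvPolynomial.aeval_C] at this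

theorem Sp.zero (u : Fin k → F) : Sp u (0 : RatF K k) 0 := by
  simpa using Sp.of_poly u (0 : MvPolynomial (Fin k) K)

theorem Sp.one (u : Fin k → F) : Sp u (1 : RatF K k) 1 := by
  simpa using Sp.of_poly u (1 : MvPolynomial (Fin k) K)

theorem Sp.add {u : Fin k → F} {g g' : RatF K k} {h h' : F} (H : Sp u g h) (H' : Sp u g' h') :
    Sp u (g + g') (h + h') := by
  obtain ⟨p, d, h1, h2, h3⟩ := H
  obtain ⟨p', d', h1', h2', h3'⟩ := H'
  refine ⟨p * d' + p' * d, d * d', by simp [h1, h1'], ?_, ?_⟩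
  · simp only [map_mul, map_add, ← h2, ← h2']; ring
  · simp only [map_mul, map_add, ← h3, ← h3']; ring

theorem Sp.mul {u : Fin k → F} {g g' : RatF K k} {h h' : F} (H : Sp u g h) (H' : Sp u g' h') :
    Sp u (g * g') (h * h') := by
  obtain ⟨p, d, h1, h2, h3⟩ := H
  obtain ⟨p', d', h1', h2', h3'⟩ := H'
  refine ⟨p * p', d * d', by simp [h1, h1'], ?_, ?_⟩
  · simp only [map_mul, ← h2, ← h2']; ring
  · simp only [map_mul, ← h3, ← h3']; ring

theorem Sp.neg {u : Fin k → F} {g : RatF K k} {h : F} (H : Sp u g h) : Sp u (-g) (-h) := by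
  obtain ⟨p, d, h1, h2, h3⟩ := H
  exact ⟨-p, d, h1, by rw [map_neg, ← h2]; ring, by rw [map_neg, ← h3]; ring⟩

theorem Sp.sub {u : Fin k → F} {g g' : RatF K k} {h h' : F} (H : Sp u g h) (H' : Sp u g' h') :
    Sp u (g - g') (h - h') := by
  simpa only [sub_eq_add_neg] using H.add H'.neg

/-- The old numerator serves as the new denominator; it does not vanish at `u` because the value of
`g` is nonzero. -/
theorem Sp.inv {u : Fin k → F} {g : RatF K k} {h : F} (H : Sp u g h) (hh : h ≠ 0) :
    Sp u g⁻¹ h⁻¹ := by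
  obtain ⟨p, d, h1, h2, h3⟩ := H
  have hp : MvPolynomial.aeval u p ≠ 0 := by rw [← h3]; exact mul_ne_zero hh h1
  have hp0 : algebraMap (MvPolynomial (Fin k) K) (RatF K k) p ≠ 0 := by
    rw [Ne, map_eq_zero_iff _ (IsFractionRing.injective _ _)]
    rintro rfl
    simp at hp
  have hg : g ≠ 0 := by
    rintro rfl
    rw [zero_mul] at h2
    exact hp0 h2.symm
  refine ⟨d, p, hp, ?_, ?_⟩
  · rw [← h2, inv_mul_cancel_left₀ hg]
  · rw [← h3, inv_mul_cancel_left₀ hh]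

theorem Sp.unique {u : Fin k → F} {g : RatF K k} {h h' : F} (H : Sp u g h) (H' : Sp u g h') :
    h = h' := by
  obtain ⟨p, d, h1, h2, h3⟩ := H
  obtain ⟨p', d', h1', h2', h3'⟩ := H'
  have e : p * d' = p' * d := by
    apply IsFractionRing.injective (MvPolynomial (Fin k) K) (RatF K k)
    rw [map_mul, map_mul, ← h2, ← h2']; ring
  have e' := congrArg (MvPolynomial.aeval u) e
  rw [map_mul, map_mul, ← h3, ← h3'] at e'
  refine mul_right_cancel₀ (mul_ne_zero h1 h1') ?_
  linear_combination e'

theorem Sp.sum {u : Fin k → F} {α : Type*} (s : Finset α) {g : α → RatF K k} {h : α → F}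
    (H : ∀ i ∈ s, Sp u (g i) (h i)) : Sp u (∑ i ∈ s, g i) (∑ i ∈ s, h i) := by
  classical
  induction s using Finset.induction_on with
  | empty => simpa using Sp.zero u
  | insert a s ha ih =>
    rw [Finset.sum_insert ha, Finset.sum_insert ha]
    exact (H a (by simp)).add (ih fun i hi => H i (by simp [hi]))

theorem Sp.prod {u : Fin k → F} {α : Type*} (s : Finset α) {g : α → RatF K k} {h : α → F}
    (H : ∀ i ∈ s, Sp u (g i) (h i)) : Sp u (∏ i ∈ s, g i) (∏ i ∈ s, h i) := by
  classical
  induction s using Finset.induction_on with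
  | empty => simpa using Sp.one u
  | insert a s ha ih =>
    rw [Finset.prod_insert ha, Finset.prod_insert ha]
    exact (H a (by simp)).mul (ih fun i hi => H i (by simp [hi]))

theorem Sp.exists_prod {u : Fin k → F} {α : Type*} (s : Finset α) {g : α → RatF K k}
    (H : ∀ i ∈ s, ∃ h, Sp u (g i) h) : ∃ h, Sp u (∏ i ∈ s, g i) h := by
  choose! h hh using H
  exact ⟨_, Sp.prod s hh⟩

theorem Sp.map {u : Fin k → F} {g : RatF K k} {h : F} (H : Sp u g h) (ψ : F →ₐ[K] F') :
    Sp (fun i => ψ (u i)) g (ψ h) := by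
  have e : ∀ p : MvPolynomial (Fin k) K,
      MvPolynomial.aeval (fun i => ψ (u i)) p = ψ (MvPolynomial.aeval u p) := by
    intro p
    rw [← MvPolynomial.comp_aeval_apply]
  obtain ⟨p, d, h1, h2, h3⟩ := H
  refine ⟨p, d, ?_, h2, ?_⟩
  · rw [e]
    exact (map_ne_zero ψ).2 h1
  · rw [e, e, ← h3, map_mul]

theorem varMap_algebraMap (a : Fin k ↪ Fin N) (p : MvPolynomial (Fin k) K) :
    varMap a (algebraMap _ (RatF K k) p) = algebraMap _ (RatF K N) (MvPolynomial.rename a p) := by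
  exact IsFractionRing.lift_algebraMap (g := ((IsScalarTower.toAlgHom K (MvPolynomial (Fin N) K)
    (RatF K N)).comp (MvPolynomial.rename a) : MvPolynomial (Fin k) K →+* RatF K N))
    ((IsFractionRing.injective (MvPolynomial (Fin N) K) (RatF K N)).comp
      (MvPolynomial.rename_injective a a.injective)) p

theorem varMap_z (a : Fin k ↪ Fin N) (i : Fin k) : varMap a (z i : RatF K k) = z (a i) := by
  rw [z, varMap_algebraMap, MvPolynomial.rename_X, z]

theorem varMap_const (a : Fin k ↪ Fin N) (c : K) : varMap a (const k c) = const N c :=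
  (varMap a).commutes c

theorem Sp.varMap {u : Fin N → F} (a : Fin k ↪ Fin N) {g : RatF K k} {h : F}
    (H : Sp (u ∘ a) g h) : Sp u (varMap a g) h := by
  obtain ⟨p, d, h1, h2, h3⟩ := H
  refine ⟨MvPolynomial.rename a p, MvPolynomial.rename a d, ?_, ?_, ?_⟩
  · rwa [MvPolynomial.aeval_rename]
  · rw [← varMap_algebraMap, ← varMap_algebraMap, ← h2, map_mul]
  · rwa [MvPolynomial.aeval_rename, MvPolynomial.aeval_rename]

theorem ratF_algHom_ext {B : Type*} [Field B] [Algebra K B] {φ ψ : RatF K k →ₐ[K] B}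
    (h : ∀ i, φ (z i) = ψ (z i)) : φ = ψ := by
  have e : ∀ p : MvPolynomial (Fin k) K, φ (algebraMap _ _ p) = ψ (algebraMap _ _ p) := by
    intro p
    induction p using MvPolynomial.induction_on with
    | C c => rw [algebraMap_C]; exact (φ.commutes c).trans (ψ.commutes c).symm
    | add p r hp hr => rw [map_add, map_add, map_add, hp, hr]
    | mul_X p i hp => rw [map_mul, map_mul, map_mul, hp]; exact congrArg _ (h i)
  refine AlgHom.ext fun g => ?_
  obtain ⟨p, d, hd, rfl⟩ := IsFractionRing.div_surjective (A := MvPolynomial (Fin k) K) g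
  rw [map_div₀, map_div₀, e, e]

theorem varMap_refl (g : RatF K k) : RShuffle.varMap (Function.Embedding.refl _) g = g := by
  have : RShuffle.varMap (Function.Embedding.refl (Fin k)) = AlgHom.id K (RatF K k) := by
    exact ratF_algHom_ext fun i => varMap_z _ i
  rw [this]; rfl

theorem varMap_varMap {m : ℕ} (a : Fin k ↪ Fin N) (b : Fin N ↪ Fin m) (g : RatF K k) :
    RShuffle.varMap b (RShuffle.varMap a g) = RShuffle.varMap (a.trans b) g := by
  have : (RShuffle.varMap b).comp (RShuffle.varMap a) =
      (RShuffle.varMap (a.trans b) : RatF K k →ₐ[K] RatF K m) := by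
    refine ratF_algHom_ext fun i => ?_
    rw [AlgHom.comp_apply, varMap_z, varMap_z, varMap_z]
    rfl
  rw [← this]; rfl

/-- At the tautological point no nonzero polynomial vanishes, so every function is regular there.
Iterated residues start from this point. -/
theorem Sp.self (g : RatF K k) : Sp (RShuffle.z : Fin k → RatF K k) g g := by
  have e : ∀ p : MvPolynomial (Fin k) K,
      MvPolynomial.aeval (RShuffle.z : Fin k → RatF K k) p = algebraMap _ _ p := by
    intro p
    have : MvPolynomial.aeval (RShuffle.z : Fin k → RatF K k) =
        IsScalarTower.toAlgHom K (MvPolynomial (Fin k) K) (RatF K k) := by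
      ext i; simp [RShuffle.z]
    rw [this]; rfl
  obtain ⟨p, d, hd, rfl⟩ := IsFractionRing.div_surjective (A := MvPolynomial (Fin k) K) g
  have hd' : algebraMap _ (RatF K k) d ≠ 0 := by
    rw [Ne, map_eq_zero_iff _ (IsFractionRing.injective _ _)]
    exact nonZeroDivisors.ne_zero hd
  refine ⟨p, d, by rwa [e], ?_, ?_⟩
  · field_simp
  · rw [e, e]; field_simp

/-- Entrywise evaluation of operators. -/
def SpM (u : Fin k → F) {ι : Type*} (M : Op (RatF K k) n ι) (T : Op F n ι) : Prop :=
  ∀ I J, Sp u (M I J) (T I J)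

variable {ι : Type*} [Fintype ι] [DecidableEq ι]

theorem SpM.one (u : Fin k → F) : SpM u (1 : Op (RatF K k) n ι) 1 := by
  intro I J
  rw [Matrix.one_apply, Matrix.one_apply]
  split_ifs
  exacts [Sp.one u, Sp.zero u]

theorem SpM.mul {u : Fin k → F} {M M' : Op (RatF K k) n ι} {T T' : Op F n ι} (H : SpM u M T)
    (H' : SpM u M' T') : SpM u (M * M') (T * T') := by
  intro I J
  rw [Matrix.mul_apply, Matrix.mul_apply]
  exact Sp.sum _ fun _ _ => (H _ _).mul (H' _ _)

theorem SpM.add {u : Fin k → F} {M M' : Op (RatF K k) n ι} {T T' : Op F n ι} (H : SpM u M T)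
    (H' : SpM u M' T') : SpM u (M + M') (T + T') := fun I J => (H I J).add (H' I J)

theorem SpM.smul {u : Fin k → F} {M : Op (RatF K k) n ι} {T : Op F n ι} {g : RatF K k} {h : F}
    (Hg : Sp u g h) (H : SpM u M T) : SpM u (g • M) (h • T) := fun I J => Hg.mul (H I J)

theorem SpM.zero (u : Fin k → F) : SpM u (0 : Op (RatF K k) n ι) 0 := fun _ _ => Sp.zero u

theorem SpM.sum {u : Fin k → F} {α : Type*} (s : Finset α) {M : α → Op (RatF K k) n ι}
    {T : α → Op F n ι} (H : ∀ i ∈ s, SpM u (M i) (T i)) : SpM u (∑ i ∈ s, M i) (∑ i ∈ s, T i) := by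
  intro I J
  rw [Matrix.sum_apply, Matrix.sum_apply]
  exact Sp.sum s fun i hi => H i hi I J

theorem SpM.unique {u : Fin k → F} {M : Op (RatF K k) n ι} {T T' : Op F n ι} (H : SpM u M T)
    (H' : SpM u M T') : T = T' := by
  ext I J
  exact (H I J).unique (H' I J)

theorem SpM.permF (u : Fin k → F) (σ : Equiv.Perm ι) :
    SpM u (permF σ : Op (RatF K k) n ι) (permF σ) := by
  intro I J
  simp only [RShuffle.permF, Matrix.of_apply]
  split_ifs
  exacts [Sp.one u, Sp.zero u]

theorem SpM.Rn {u : Fin k → F} (q : K) (a b : ι) {x y : RatF K k} {x' y' : F} (hx : Sp u x x')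
    (hy : Sp u y y') : SpM u (Rn (algebraMap K (RatF K k) q) a b x y : Op (RatF K k) n ι)
      (Rn (algebraMap K F q) a b x' y') := by
  have hq : Sp u (algebraMap K (RatF K k) q) (algebraMap K F q) := Sp.const u q
  have hq' : Sp u (algebraMap K (RatF K k) q)⁻¹ (algebraMap K F q)⁻¹ := by
    by_cases h : q = 0
    · simpa [h] using Sp.zero u
    · exact hq.inv (by simpa using h)
  refine SpM.add ?_ (SpM.mul ?_ (SpM.permF u _))
  · intro I J
    rw [Matrix.diagonal_apply, Matrix.diagonal_apply]
    split_ifs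
    exacts [(hq.mul hy).sub (hq'.mul hx), hy.sub hx, Sp.zero u]
  · intro I J
    rw [Matrix.diagonal_apply, Matrix.diagonal_apply]
    split_ifs
    exacts [Sp.zero u, (hq.sub hq').mul hx, (hq.sub hq').mul hy, Sp.zero u]

theorem SpM.Rh {u : Fin k → F} (q : K) (a b : ι) {x y : RatF K k} {x' y' : F} (hx : Sp u x x')
    (hy : Sp u y y') (h : algebraMap K F q * y' - (algebraMap K F q)⁻¹ * x' ≠ 0) :
    SpM u (Rh (algebraMap K (RatF K k) q) a b x y : Op (RatF K k) n ι)
      (Rh (algebraMap K F q) a b x' y') := by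
  have hq : Sp u (algebraMap K (RatF K k) q) (algebraMap K F q) := Sp.const u q
  have hq' : Sp u (algebraMap K (RatF K k) q)⁻¹ (algebraMap K F q)⁻¹ := by
    by_cases h : q = 0
    · simpa [h] using Sp.zero u
    · exact hq.inv (by simpa using h)
  exact SpM.smul (((hq.mul hy).sub (hq'.mul hx)).inv h) (SpM.Rn q a b hx hy)

theorem SpM.passLeft {u : Fin k → F} (q : K) {w : ι → RatF K k} {w' : ι → F}
    (hw : ∀ i, Sp u (w i) (w' i)) {p : List ι} {x : ι}
    (h : ∀ y ∈ p, algebraMap K F q * w' x - (algebraMap K F q)⁻¹ * w' y ≠ 0) :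
    SpM u (passLeft (algebraMap K (RatF K k) q) w p x : Op (RatF K k) n ι)
      (passLeft (algebraMap K F q) w' p x) := by
  induction p using List.reverseRecOn with
  | nil => simpa [RShuffle.passLeft] using SpM.one u
  | append_singleton p c ih =>
    have := (SpM.Rh (n := n) q c x (hw c) (hw x) (h c (by simp))).mul
      (ih fun y hy => h y (by simp [hy]))
    simpa [RShuffle.passLeft] using this

/-- Normalized crossings are singular only where `Regular` fails. In particular coinciding
parameters are harmless, in contrast to the original R-matrix. -/
theorem SpM.braid {u : Fin k → F} (q : K) {w : ι → RatF K k} {w' : ι → F}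
    (hw : ∀ i, Sp u (w i) (w' i)) {l t : List ι} (ht : ∀ y ∈ t, y ∈ l)
    (h : Regular (algebraMap K F q) w' l) (hnd : t.Nodup) :
    SpM u (braid (algebraMap K (RatF K k) q) w l t : Op (RatF K k) n ι)
      (braid (algebraMap K F q) w' l t) := by
  induction t generalizing l with
  | nil => exact SpM.one u
  | cons x t ih =>
    refine (SpM.passLeft q hw fun y hy => ?_).mul (ih ?_ ?_ (List.nodup_cons.1 hnd).2)
    · refine h y ((List.takeWhile_sublist _).subset hy) x (ht x (by simp)) ?_
      simpa using List.mem_takeWhile_imp hy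
    · intro y hy
      refine (List.mem_erase_of_ne ?_).2 (ht y (by simp [hy]))
      rintro rfl
      exact (List.nodup_cons.1 hnd).1 hy
    · exact h.mono fun y hy => List.mem_of_mem_erase hy

/-! ### Comparison with the operators on rational functions -/

/-- Separates the change of variables from the action in chosen factors, so that the results on
`act` over an arbitrary field apply. -/
theorem place_eq (a : Fin k ↪ Fin N) (X : Tens K n k) :
    place a X = act a (X.map (varMap a)) := by
  ext I J
  simp only [place, act, Matrix.of_apply, Matrix.map_apply]
  congr

theorem map_mul_varMap (a : Fin k ↪ Fin N) (X Y : Op (RatF K k) n ι) :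
    (X * Y).map (varMap a) = X.map (varMap a) * Y.map (varMap a) :=
  Matrix.map_mul (f := (varMap a).toRingHom)

theorem place_mul (a : Fin k ↪ Fin N) (X Y : Tens K n k) :
    place a (X * Y) = place a X * place a Y := by
  rw [place_eq, map_mul_varMap, act_mul, place_eq, place_eq]

theorem place_one (a : Fin k ↪ Fin N) : place a (1 : Tens K n k) = 1 := by
  rw [place_eq, Matrix.map_one _ (map_zero _) (map_one _), act_one]

theorem place_smul' (a : Fin k ↪ Fin N) (c : RatF K k) (X : Tens K n k) :
    place a (c • X) = varMap a c • place a X := by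
  rw [place_eq, place_eq, ← act_smul]
  congr 1
  ext I J
  simp

theorem place_zero (a : Fin k ↪ Fin N) : place a (0 : Tens K n k) = 0 := by
  rw [place_eq, Matrix.map_zero _ (map_zero _), act_zero]

theorem place_refl (X : Tens K n k) : place (Function.Embedding.refl _) X = X := by
  rw [place_eq, act_refl]
  ext I J
  exact varMap_refl _

theorem map_act {E E' : Type*} [Field E] [Field E'] (φ : E →+* E') {κ : Type*} (a : ι ↪ κ)
    (X : Op E n ι) : (act a X).map φ = act a (X.map φ) := by
  ext I J
  simp only [act, Matrix.map_apply, Matrix.of_apply]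
  split_ifs
  exacts [rfl, map_zero φ]

theorem place_place {m : ℕ} (a : Fin k ↪ Fin N) (b : Fin N ↪ Fin m) (X : Tens K n k) :
    place b (place a X) = place (a.trans b) X := by
  have h := map_act (n := n) (varMap b : RatF K N →ₐ[K] RatF K m).toRingHom a (X.map (varMap a))
  rw [place_eq, place_eq, place_eq, ← act_act]
  congr 1
  refine h.trans ?_
  congr 1
  ext I J
  exact varMap_varMap a b _

theorem SpM.place {u : Fin N → F} (a : Fin k ↪ Fin N) {X : Tens K n k} {T : Op F n (Fin k)}
    (H : SpM (u ∘ a) X T) : SpM u (place a X) (act a T) := by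
  intro I J
  rw [place_eq]
  simp only [act, Matrix.of_apply]
  split_ifs
  · exact (H _ _).varMap a
  · exact Sp.zero u

theorem map_permF {E E' : Type*} [Field E] [Field E'] (φ : E →+* E') (σ : Equiv.Perm ι) :
    (permF σ : Op E n ι).map φ = permF σ := by
  ext I J
  simp only [permF, Matrix.map_apply, Matrix.of_apply]
  split_ifs
  exacts [map_one φ, map_zero φ]

theorem map_Rn {E E' : Type*} [Field E] [Field E'] (φ : E →+* E') (q : E) (a b : ι) (x y : E) :
    (Rn q a b x y : Op E n ι).map φ = Rn (φ q) a b (φ x) (φ y) := by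
  rw [Rn, Matrix.map_add _ (map_add φ), Matrix.map_mul (f := φ), map_permF, Rn,
    Matrix.diagonal_map (map_zero φ), Matrix.diagonal_map (map_zero φ)]
  congr 2
  · funext I
    simp only [apply_ite φ, map_sub, map_mul, map_inv₀]
  · funext I
    simp only [apply_ite φ, map_sub, map_mul, map_inv₀, map_zero]

theorem map_Rh {E E' : Type*} [Field E] [Field E'] (φ : E →+* E') (q : E) (a b : ι) (x y : E) :
    (Rh q a b x y : Op E n ι).map φ = Rh (φ q) a b (φ x) (φ y) := by
  rw [Rh, Rh, ← map_Rn, ← map_inv₀ φ q, ← map_mul, ← map_mul, ← map_sub, ← map_inv₀]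
  ext I J
  simp

theorem map_list_prod_op {E E' : Type*} [Field E] [Field E'] (φ : E →+* E') (l : List (Op E n ι)) :
    l.prod.map φ = (l.map fun M => M.map φ).prod :=
  map_list_prod φ.mapMatrix l

theorem map_braid {E E' : Type*} [Field E] [Field E'] (φ : E →+* E') (q : E) (u : ι → E)
    (l t : List ι) :
    (braid q u l t : Op E n ι).map φ = braid (φ q) (fun i => φ (u i)) l t := by
  induction t generalizing l with
  | nil => exact Matrix.map_one _ (map_zero φ) (map_one φ)
  | cons x t ih =>
    rw [braid, braid, Matrix.map_mul (f := φ), ih, passLeft, passLeft, map_list_prod_op,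
      List.map_map]
    congr 3
    funext b
    exact map_Rh φ q b x _ _

theorem place_braid {q : K} (a : Fin k ↪ Fin N) (w : Fin N → RatF K N) (v : Fin k → RatF K k)
    (h : ∀ i, varMap a (v i) = w (a i)) (l t : List (Fin k)) :
    place a (braid (const k q) v l t : Tens K n k) =
      braid (const N q) w (l.map a) (t.map a) := by
  rw [place_eq, ← act_braid]
  congr 1
  refine (map_braid (E := RatF K k) (E' := RatF K N) (varMap a).toRingHom _ _ _ _).trans ?_
  congr 1
  · exact varMap_const a q
  · exact funext h

theorem Rmat_apply (q : K) (x : RatF K N) (i j i' j' : Fin n) :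
    Rmat q x (i, j) (i', j') =
      (if i = i' ∧ j = j' then
        (if i = j then (const N q - x * (const N q)⁻¹) / (1 - x) else 1) else 0) +
      (const N q - (const N q)⁻¹) * (if i = j' ∧ j = i' then
        (if i = j then 0 else (if i < j then x else 1) / (1 - x)) else 0) := by
  simp only [Rmat, E, Matrix.add_apply, Matrix.smul_apply, Matrix.sum_apply,
    Matrix.kroneckerMap_apply, Matrix.single_apply, smul_eq_mul]
  congr 2
  · rw [Finset.sum_eq_single i, Finset.sum_eq_single j]
    · by_cases h1 : i = i' <;> by_cases h2 : j = j' <;> simp [h1, h2]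
    · intro b _ hb
      simp [hb]
    · simp
    · intro b _ hb
      simp [hb]
    · simp
  · rw [Finset.sum_eq_single i, Finset.sum_eq_single j]
    · by_cases h1 : i = j' <;> by_cases h2 : j = i' <;> simp [h1, h2]
    · intro b _ hb
      simp [hb]
    · simp
    · intro b _ hb
      simp [hb]
    · simp

/-- A comparison of entries. Both sides vanish unless `I` and `J` agree off `a` and `b`; after that
only the values at `a` and `b` matter. -/
theorem R_eq_smul_Rn (q : K) {a b : Fin N} (hab : a ≠ b) {x y : RatF K N} (hy : y ≠ 0)
    (hxy : y - x ≠ 0) : (R q a b (x / y) : Tens K n N) = (y - x)⁻¹ • Rn (const N q) a b x y := by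
  have h1 : 1 - x / y = (y - x) / y := by field_simp
  have h1' : 1 - x / y ≠ 0 := by rw [h1]; exact div_ne_zero hxy hy
  ext I J
  simp only [R, twoSite, Rn, Matrix.of_apply, Matrix.smul_apply, Matrix.add_apply,
    Matrix.diagonal_mul, Matrix.diagonal_apply, permF, Rmat_apply, smul_eq_mul, h1]
  have e1 : I = J ↔ (∀ m, m ≠ a → m ≠ b → I m = J m) ∧ I a = J a ∧ I b = J b := by
    constructor
    · rintro rfl; simp
    · rintro ⟨h, ha, hb⟩
      funext m
      by_cases h1 : m = a
      · rw [h1, ha]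
      by_cases h2 : m = b
      · rw [h2, hb]
      exact h m h1 h2
  have e2 : I ∘ Equiv.swap a b = J ↔
      (∀ m, m ≠ a → m ≠ b → I m = J m) ∧ I a = J b ∧ I b = J a := by
    constructor
    · rintro rfl
      refine ⟨fun m h1 h2 => ?_, by simp, by simp⟩
      rw [Function.comp_apply, Equiv.swap_apply_of_ne_of_ne h1 h2]
    · rintro ⟨h, ha, hb⟩
      funext m
      by_cases h1 : m = a
      · subst h1; simp [hb]
      by_cases h2 : m = b
      · subst h2; simp [ha]
      rw [Function.comp_apply, Equiv.swap_apply_of_ne_of_ne h1 h2]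
      exact h m h1 h2
  rw [if_congr e1 rfl rfl, if_congr e2 rfl rfl]
  by_cases hc : ∀ m, m ≠ a → m ≠ b → I m = J m
  swap
  · simp [hc]
  simp only [eq_true hc, true_and]
  have hd : (const N q - x / y * (const N q)⁻¹) / ((y - x) / y) =
      (y - x)⁻¹ * (const N q * y - (const N q)⁻¹ * x) := by
    have : const N q - x / y * (const N q)⁻¹ = (const N q * y - (const N q)⁻¹ * x) / y := by
      generalize (const N q)⁻¹ = r
      field_simp
    rw [this]
    generalize const N q * y - (const N q)⁻¹ * x = r
    field_simp
  rw [hd, mul_add]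
  generalize const N q * y - (const N q)⁻¹ * x = r
  generalize const N q - (const N q)⁻¹ = s
  split_ifs <;> simp only [mul_zero, mul_one] <;> field_simp

end Evaluation
end RShuffle

namespace RShuffle

/-! ### The shuffle product through normalized braids -/

section Shuffle

set_option linter.unusedSectionVars false

variable {K : Type*} [Field K] {n k l m N : ℕ}

/-- Genericity of the parameters `q` and `q̄`. -/
structure GenericParams (q qb : K) : Prop where
  q_ne : q ≠ 0
  qb_ne : qb ≠ 0
  qb_pow : ∀ m : ℕ, m ≠ 0 → qb ^ m ≠ 1
  qb_pow_ne : ∀ m : ℕ, qb ^ m ≠ q ^ 2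
  mul_qb_pow_ne : ∀ m : ℕ, q ^ 2 * qb ^ m ≠ 1

theorem const_ne_zero {c : K} (hc : c ≠ 0) : const N c ≠ 0 :=
  (map_ne_zero (algebraMap K (RatF K N))).2 hc

/-- Evaluation at the `i`-th unit vector leaves `c`. -/
theorem linear_ne_zero {i j : Fin N} (hij : i ≠ j) {c : K} (hc : c ≠ 0) (d : K) :
    const N c * z i - const N d * z j ≠ 0 := by
  rw [← algebraMap_C, ← algebraMap_C, z, z, ← map_mul, ← map_mul, ← map_sub, Ne,
    map_eq_zero_iff _ (IsFractionRing.injective _ _)]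
  intro h
  have := congrArg (MvPolynomial.eval (Pi.single i 1)) h
  simp [Pi.single_eq_of_ne hij.symm, hc] at this

theorem z_ne_zero (i : Fin N) : (z i : RatF K N) ≠ 0 := by
  rw [z, Ne, map_eq_zero_iff _ (IsFractionRing.injective _ _)]
  exact MvPolynomial.X_ne_zero i

theorem z_sub_ne_zero {i j : Fin N} (hij : i ≠ j) : (z i - z j : RatF K N) ≠ 0 := by
  have := linear_ne_zero (K := K) hij one_ne_zero 1
  simpa [const] using this

/-- Different strands carry different variables, so no genericity beyond `q ≠ 0` and nonzero scales
is required. -/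
theorem regular_scaled {q : K} (hq : q ≠ 0) {c : Fin N → K} (hc : ∀ i, c i ≠ 0)
    (l : List (Fin N)) : Regular (const N q) (fun i => const N (c i) * z i) l := by
  intro a _ b _ hab
  have := linear_ne_zero hab.symm (mul_ne_zero hq (hc b)) (q⁻¹ * c a)
  simpa [const, mul_assoc] using this

theorem regular_z {q : K} (hq : q ≠ 0) (l : List (Fin N)) :
    Regular (const N q) (z : Fin N → RatF K N) l := by
  have := regular_scaled hq (c := fun _ : Fin N => 1) (fun _ => one_ne_zero) l
  simpa [const] using this

/-- The labels `a_1, ..., a_k` in order. -/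
def ord (a : Fin k ↪ Fin N) : List (Fin N) := (List.finRange k).map a

theorem mem_ord {a : Fin k ↪ Fin N} {x : Fin N} : x ∈ ord a ↔ ∃ i, a i = x := by simp [ord]

theorem ord_nodup (a : Fin k ↪ Fin N) : (ord a).Nodup :=
  (List.nodup_finRange k).map a.injective

theorem map_ord (a : Fin k ↪ Fin N) (b : Fin N ↪ Fin m) : (ord a).map b = ord (a.trans b) := by
  rw [ord, List.map_map]; rfl

theorem map_ord_perm (a : Fin k ↪ Fin N) (σ : Equiv.Perm (Fin N)) :
    (ord a).map σ = ord (a.trans σ.toEmbedding) := map_ord a σ.toEmbedding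

theorem ord_refl : ord (Function.Embedding.refl (Fin N)) = List.finRange N :=
  List.map_id _

theorem ord_perm (τ : Equiv.Perm (Fin k)) (a : Fin k ↪ Fin N) :
    (ord (τ.toEmbedding.trans a)).Perm (ord a) := by
  rw [← map_ord]
  exact (Equiv.Perm.map_finRange_perm τ).map a

/-- `{1, ..., N}` is the disjoint union of the values of `a` and of `b`. -/
structure Complementary (a : Fin k ↪ Fin N) (b : Fin l ↪ Fin N) : Prop where
  disj : ∀ i j, a i ≠ b j
  cover : ∀ x, x ∈ ord a ∨ x ∈ ord b

theorem Complementary.symm {a : Fin k ↪ Fin N} {b : Fin l ↪ Fin N} (h : Complementary a b) :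
    Complementary b a :=
  ⟨fun i j => (h.disj j i).symm, fun x => (h.cover x).symm⟩

theorem Complementary.not_mem {a : Fin k ↪ Fin N} {b : Fin l ↪ Fin N} (h : Complementary a b)
    {x : Fin N} (hx : x ∈ ord b) : x ∉ ord a := by
  rintro hx'
  obtain ⟨i, rfl⟩ := mem_ord.1 hx'
  obtain ⟨j, hj⟩ := mem_ord.1 hx
  exact h.disj i j hj.symm

theorem Complementary.not_mem_iff {a : Fin k ↪ Fin N} {b : Fin l ↪ Fin N} (h : Complementary a b)
    {x : Fin N} : x ∉ ord a ↔ x ∈ ord b :=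
  ⟨fun hx => (h.cover x).resolve_left hx, h.not_mem⟩

theorem Complementary.nodup {a : Fin k ↪ Fin N} {b : Fin l ↪ Fin N} (h : Complementary a b) :
    (ord a ++ ord b).Nodup := by
  refine List.nodup_append.2 ⟨ord_nodup a, ord_nodup b, ?_⟩
  rintro x hx y hy rfl
  exact h.not_mem hy hx

theorem Complementary.perm {a : Fin k ↪ Fin N} {b : Fin l ↪ Fin N} (h : Complementary a b) :
    (List.finRange N).Perm (ord a ++ ord b) := by
  refine (List.perm_ext_iff_of_nodup (List.nodup_finRange N) h.nodup).2 fun x => ?_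
  simpa using h.cover x

theorem Complementary.trans {a : Fin k ↪ Fin N} {b : Fin l ↪ Fin N} (h : Complementary a b)
    (σ : Equiv.Perm (Fin N)) :
    Complementary (a.trans σ.toEmbedding) (b.trans σ.toEmbedding) := by
  refine ⟨fun i j hij => h.disj i j (σ.injective hij), fun x => ?_⟩
  rw [← map_ord_perm, ← map_ord_perm]
  refine (h.cover (σ⁻¹ x)).imp (fun hx => ?_) fun hx => ?_
  · exact List.mem_map.2 ⟨_, hx, by simp⟩
  · exact List.mem_map.2 ⟨_, hx, by simp⟩

/-- Two strictly increasing lists with the same elements are equal. -/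
theorem ord_eq_filter {a : Fin k ↪ Fin N} (ha : StrictMono a) (p : Fin N → Bool)
    (hp : ∀ x, p x = true ↔ x ∈ ord a) : (List.finRange N).filter p = ord a := by
  refine List.Perm.eq_of_pairwise (le := (· < ·)) (fun x y _ _ h h' => absurd h h'.asymm)
    ((List.pairwise_lt_finRange N).filter p) ?_ ?_
  · exact (List.pairwise_lt_finRange k).map a fun x y h => ha h
  · refine (List.perm_ext_iff_of_nodup ((List.nodup_finRange N).filter p) (ord_nodup a)).2
      fun x => ?_
    rw [List.mem_filter, ← hp]
    simp

theorem Complementary.interleaving {a : Fin k ↪ Fin N} {b : Fin l ↪ Fin N}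
    (h : Complementary a b) (ha : StrictMono a) (hb : StrictMono b) :
    Interleaving (· < ·) (ord b) (ord a) (List.finRange N) := by
  have := Interleaving.of_filter (· < ·) (fun x y h => h.asymm) (fun x => decide (x ∈ ord a))
    (List.pairwise_lt_finRange N)
  rwa [ord_eq_filter ha (fun x => decide (x ∈ ord a)) (by simp),
    ord_eq_filter hb (fun x => !decide (x ∈ ord a)) (by simp [h.not_mem_iff])] at this

/-- The scalar relating `R_{ab}(x / y)` to its normalized version. -/
def gfac (q : K) (x y : RatF K N) : RatF K N := (const N q * y - (const N q)⁻¹ * x) / (y - x)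

theorem R_eq_smul_Rh (q : K) {a b : Fin N} (hab : a ≠ b) {x y : RatF K N} (hy : y ≠ 0)
    (hxy : y - x ≠ 0) (hd : const N q * y - (const N q)⁻¹ * x ≠ 0) :
    (R q a b (x / y) : Tens K n N) = gfac q x y • Rh (const N q) a b x y := by
  rw [R_eq_smul_Rn q hab hy hxy, Rh, smul_smul, gfac, div_eq_mul_inv, mul_right_comm,
    mul_inv_cancel₀ hd, one_mul]

theorem list_prod_map_smul {α A : Type*} [CommRing A] {M : Type*} [Ring M] [Algebra A M]
    (l : List α) (c : α → A) (f : α → M) :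
    (l.map fun i => c i • f i).prod = (l.map c).prod • (l.map f).prod := by
  induction l with
  | nil => simp
  | cons a l ih =>
    simp only [List.map_cons, List.prod_cons, ih, smul_mul_assoc, mul_smul_comm, smul_smul]
    rw [mul_comm (c a)]

theorem list_grid_smul {α β A : Type*} [CommRing A] {M : Type*} [Ring M] [Algebra A M]
    (l : List α) (r : List β) (P : α → β → Prop) [∀ a b, Decidable (P a b)] (f g : α → β → M)
    (c : α → β → A) (h : ∀ a ∈ l, ∀ b ∈ r, f a b = c a b • g a b) :
    (l.map fun a => (r.map fun b => if P a b then f a b else 1).prod).prod =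
      (l.map fun a => (r.map fun b => if P a b then c a b else 1).prod).prod •
        (l.map fun a => (r.map fun b => if P a b then g a b else 1).prod).prod := by
  rw [← list_prod_map_smul]
  congr 1
  refine List.map_congr_left fun a ha => ?_
  rw [← list_prod_map_smul]
  congr 1
  refine List.map_congr_left fun b hb => ?_
  split_ifs
  · exact h a ha b hb
  · rw [one_smul]

theorem list_grid_prod {A : Type*} [CommRing A] (c : Fin k → Fin l → A) :
    ((List.finRange k).map fun i => ((List.finRange l).map fun j => c i j).prod).prod =
      ∏ i, ∏ j, c i j := by
  simp only [Fin.prod_univ_def]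

theorem list_grid_prod_reverse {A : Type*} [CommRing A] (c : Fin k → Fin l → A) :
    ((List.finRange k).reverse.map fun i => ((List.finRange l).map fun j => c i j).prod).prod =
      ∏ i, ∏ j, c i j := by
  rw [List.map_reverse, List.prod_reverse, list_grid_prod]

theorem list_grid_prod_reverse' {A : Type*} [CommRing A] (c : Fin k → Fin l → A) :
    ((List.finRange k).map fun i => ((List.finRange l).reverse.map fun j => c i j).prod).prod =
      ∏ i, ∏ j, c i j := by
  rw [← list_grid_prod]
  simp only [List.map_reverse, List.prod_reverse]

variable {q qb : K}

/-- The pairs with `a i < b j` are the crossings needed to move all strands of `a` to the right of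
those of `b`. -/
theorem leftFactor_eq (hq : q ≠ 0) {a : Fin k ↪ Fin N} {b : Fin l ↪ Fin N}
    (h : Complementary a b) (ha : StrictMono a) (hb : StrictMono b) :
    (leftFactor q a b : Tens K n N) =
      (∏ i, ∏ j, if a i < b j then gfac q (z (a i)) (z (b j)) else 1) •
        braid (const N q) z (List.finRange N) (ord b ++ ord a) := by
  rw [braid_interleaving_append _ _ (h.interleaving ha hb) (List.nodup_finRange N), leftFactor,
    list_grid_smul _ _ (fun i j => a i < b j) _
      (fun i j => Rh (const N q) (a i) (b j) (z (a i)) (z (b j)))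
      (fun i j => gfac q (z (a i)) (z (b j))), list_grid_prod_reverse]
  · simp only [ord, ← List.map_reverse, List.map_map]
    rfl
  · intro i _ j _
    exact R_eq_smul_Rh q (h.disj i j) (z_ne_zero _) (z_sub_ne_zero (h.disj i j).symm)
      (regular_z hq [a i, b j] _ (by simp) _ (by simp) (h.disj i j))

/-- The pairs with `b j < a i` are the crossings needed to restore the increasing order when the
strands of `a` stand to the left. -/
theorem rightFactor_eq (hq : q ≠ 0) {a : Fin k ↪ Fin N} {b : Fin l ↪ Fin N}
    (h : Complementary a b) (ha : StrictMono a) (hb : StrictMono b) :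
    (rightFactor q a b : Tens K n N) =
      (∏ i, ∏ j, if b j < a i then gfac q (z (a i)) (z (b j)) else 1) •
        braid (const N q) z (ord a ++ ord b) (List.finRange N) := by
  rw [braid_append_interleaving_row _ _ (h.symm.interleaving hb ha) (List.nodup_finRange N),
    rightFactor, list_grid_smul _ _ (fun i j => b j < a i) _
      (fun i j => Rh (const N q) (a i) (b j) (z (a i)) (z (b j)))
      (fun i j => gfac q (z (a i)) (z (b j))), list_grid_prod_reverse]
  · simp only [ord, ← List.map_reverse, List.map_map]
    rfl
  · intro i _ j _
    exact R_eq_smul_Rh q (h.disj i j) (z_ne_zero _) (z_sub_ne_zero (h.disj i j).symm)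
      (regular_z hq [a i, b j] _ (by simp) _ (by simp) (h.disj i j))

/-- The spectral parameters after passing through an operator on the strands of `a`. -/
def shifted (qb : K) (a : Fin k ↪ Fin N) (p : Fin N) : RatF K N :=
  if p ∈ ord a then const N qb ^ 2 * z p else z p

theorem shifted_apply_left (qb : K) (a : Fin k ↪ Fin N) (i : Fin k) :
    shifted qb a (a i) = const N qb ^ 2 * z (a i) := if_pos (mem_ord.2 ⟨i, rfl⟩)

theorem shifted_of_mem {a : Fin k ↪ Fin N} {p : Fin N} (h : p ∈ ord a) :
    shifted qb a p = const N qb ^ 2 * z p := if_pos h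

theorem shifted_of_not_mem {a : Fin k ↪ Fin N} {p : Fin N} (h : p ∉ ord a) :
    shifted qb a p = z p := if_neg h

theorem regular_shifted (hq : q ≠ 0) (hqb : qb ≠ 0) (a : Fin k ↪ Fin N) (l : List (Fin N)) :
    Regular (const N q) (shifted qb a) l := by
  have := regular_scaled hq (c := fun p => if p ∈ ord a then qb ^ 2 else 1)
    (fun p => by split_ifs <;> simp [hqb]) l
  convert this using 1
  funext p
  simp only [shifted]
  split_ifs <;> simp [const]

/-- By definition R̃_{ab}(z_a / z_b) = R_{ba}(z_b / (q̄² z_a)): a crossing of `b` with `a` when the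
parameter of `a` has become q̄² z_a. Thus an operator multiplies the parameters of its strands by
q̄². -/
theorem middleFactor_eq (hq : q ≠ 0) (hqb : qb ≠ 0) {a : Fin k ↪ Fin N} {b : Fin l ↪ Fin N}
    (h : Complementary a b) :
    (middleFactor q qb a b : Tens K n N) =
      (∏ i, ∏ j, gfac q (z (b j)) (const N qb ^ 2 * z (a i))) •
        braid (const N q) (shifted qb a) (ord b ++ ord a) (ord a ++ ord b) := by
  rw [braid_append_interleaving (P := fun _ _ => True) _ _
    (Interleaving.append _ _ fun _ _ _ _ => trivial) h.nodup]
  have e := list_grid_smul (M := Tens K n N) (List.finRange k) (List.finRange l).reverse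
      (fun i j => True) (fun i j => Rtilde q qb (a i) (b j) (z (a i) / z (b j)))
      (fun i j => Rh (const N q) (b j) (a i) (shifted qb a (b j)) (shifted qb a (a i)))
      (fun i j => gfac q (z (b j)) (const N qb ^ 2 * z (a i))) (by
        intro i _ j _
        rw [shifted_apply_left, shifted_of_not_mem (h.not_mem (mem_ord.2 ⟨j, rfl⟩)), Rtilde,
          ← R_eq_smul_Rh q (h.disj i j).symm]
        · congr 1
          have := z_ne_zero (K := K) (a i)
          have := z_ne_zero (K := K) (b j)
          have := const_ne_zero (N := N) hqb
          field_simp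
        · exact mul_ne_zero (pow_ne_zero _ (const_ne_zero hqb)) (z_ne_zero _)
        · have := linear_ne_zero (h.disj i j) (pow_ne_zero 2 hqb) 1
          simpa [const] using this
        · have := regular_shifted hq hqb a [a i, b j] (b j) (by simp) (a i) (by simp)
            (h.disj i j).symm
          rwa [shifted_apply_left, shifted_of_not_mem (h.not_mem (mem_ord.2 ⟨j, rfl⟩))] at this)
  simp only [if_true] at e
  rw [middleFactor, e, list_grid_prod_reverse']
  simp only [ord, ← List.map_reverse, List.map_map, if_true]
  rfl

/-- The scalar prefactor of a term of the shuffle product. -/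
def shuffleScalar (q qb : K) (a : Fin k ↪ Fin N) (b : Fin l ↪ Fin N) : RatF K N :=
  ∏ i, ∏ j, gfac q (z (a i)) (z (b j)) * gfac q (z (b j)) (const N qb ^ 2 * z (a i))

/-- A term of the shuffle product, written through normalized braids. -/
def shuffleTerm (q qb : K) (a : Fin k ↪ Fin N) (b : Fin l ↪ Fin N) (X : Tens K n k)
    (Y : Tens K n l) : Tens K n N :=
  shuffleScalar q qb a b • (braid (const N q) z (List.finRange N) (ord b ++ ord a) * place a X *
    braid (const N q) (shifted qb a) (ord b ++ ord a) (ord a ++ ord b) * place b Y *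
    braid (const N q) z (ord a ++ ord b) (List.finRange N))

/-- Each pair `(i, j)` occurs in exactly one of the outer factors, so the scalars combine into a
product over all pairs that does not depend on the relative order of the labels. -/
theorem shuffle_term_eq (hq : q ≠ 0) (hqb : qb ≠ 0) {a : Fin k ↪ Fin N} {b : Fin l ↪ Fin N}
    (h : Complementary a b) (ha : StrictMono a) (hb : StrictMono b) (X : Tens K n k)
    (Y : Tens K n l) :
    leftFactor q a b * place a X * middleFactor q qb a b * place b Y * rightFactor q a b =
      shuffleTerm q qb a b X Y := by
  rw [leftFactor_eq hq h ha hb, rightFactor_eq hq h ha hb, middleFactor_eq hq hqb h, shuffleTerm]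
  simp only [smul_mul_assoc, mul_smul_comm, smul_smul]
  congr 1
  rw [shuffleScalar, ← Finset.prod_mul_distrib, ← Finset.prod_mul_distrib]
  refine Finset.prod_congr rfl fun i _ => ?_
  rw [← Finset.prod_mul_distrib, ← Finset.prod_mul_distrib]
  refine Finset.prod_congr rfl fun j _ => ?_
  rcases lt_or_gt_of_ne (h.disj i j) with hlt | hlt
  · rw [if_pos hlt, if_neg hlt.asymm]; ring
  · rw [if_pos hlt, if_neg hlt.asymm]; ring

/-- Disjoint images of sizes `k` and `l` fill a set of size `k + l`. -/
theorem complementary_of_mem_shuffles {p : (Fin k ↪ Fin (k + l)) × (Fin l ↪ Fin (k + l))}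
    (hp : p ∈ shuffles k l) : Complementary p.1 p.2 := by
  simp only [shuffles, Finset.mem_filter, Finset.mem_univ, true_and] at hp
  refine ⟨hp.2.2, fun x => ?_⟩
  have hnd : (ord p.1 ++ ord p.2).Nodup := by
    refine List.nodup_append.2 ⟨ord_nodup _, ord_nodup _, ?_⟩
    rintro x hx y hy rfl
    obtain ⟨i, rfl⟩ := mem_ord.1 hx
    obtain ⟨j, hj⟩ := mem_ord.1 hy
    exact hp.2.2 i j hj.symm
  have hc : (ord p.1 ++ ord p.2).toFinset = Finset.univ := by
    apply Finset.eq_univ_of_card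
    rw [List.toFinset_card_of_nodup hnd]
    simp [ord]
  have := Finset.mem_univ x
  rw [← hc] at this
  simpa using this

theorem shuffleProd_eq (hq : q ≠ 0) (hqb : qb ≠ 0) (X : Tens K n k) (Y : Tens K n l) :
    shuffleProd q qb X Y = ∑ p ∈ shuffles k l, shuffleTerm q qb p.1 p.2 X Y := by
  refine Finset.sum_congr rfl fun p hp => ?_
  have h := complementary_of_mem_shuffles hp
  simp only [shuffles, Finset.mem_filter, Finset.mem_univ, true_and] at hp
  exact shuffle_term_eq hq hqb h hp.1 hp.2.1 X Y

end Shuffle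
end RShuffle

namespace RShuffle

/-! ### The braided action of the symmetric group -/

section Action

set_option linter.unusedSectionVars false

variable {K : Type*} [Field K] {n k l m N : ℕ} {q qb : K}

/-- The braided action of a permutation: conjugation of `σ X σ⁻¹` by a braid lifting `σ`. -/
def adj (q : K) (σ : Equiv.Perm (Fin N)) (X : Tens K n N) : Tens K n N :=
  braid (const N q) z (List.finRange N) (ord σ.toEmbedding) * place σ.toEmbedding X *
    braid (const N q) z (ord σ.toEmbedding) (List.finRange N)

theorem finRange_perm_ord (σ : Equiv.Perm (Fin N)) :
    (List.finRange N).Perm (ord σ.toEmbedding) := (Equiv.Perm.map_finRange_perm σ).symm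

theorem place_braid_z (a : Fin k ↪ Fin N) (l t : List (Fin k)) :
    place a (braid (const k q) z l t : Tens K n k) =
      braid (const N q) z (l.map a) (t.map a) :=
  place_braid a z z (varMap_z a) l t

/-- The braids on either side of `X` compose by `braid_trans`, so `adj` is a genuine action of the
symmetric group. -/
theorem adj_mul (hq : q ≠ 0) (σ τ : Equiv.Perm (Fin N)) (X : Tens K n N) :
    adj q (σ * τ) X = adj q σ (adj q τ X) := by
  have e : (ord τ.toEmbedding).map σ = ord (σ * τ).toEmbedding := map_ord_perm _ _
  have e1 : (List.finRange N).map σ = ord σ.toEmbedding := rfl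
  have p1 := finRange_perm_ord σ
  have p2 := finRange_perm_ord (σ * τ)
  have nd := List.nodup_finRange N
  simp only [adj, place_mul, place_braid_z, place_place, Equiv.coe_toEmbedding, e, e1]
  have h1 := braid_trans (n := n) (const_ne_zero hq) nd p1 (p1.symm.trans p2)
    (regular_z hq _)
  have h2 := braid_trans (n := n) (const_ne_zero hq) (p2.nodup_iff.1 nd) (p2.symm.trans p1) p1.symm
    (regular_z hq _)
  rw [← h1, ← h2]
  simp only [mul_assoc]
  rfl

theorem adj_one (X : Tens K n N) : adj q 1 X = X := by
  have : ord (1 : Equiv.Perm (Fin N)).toEmbedding = List.finRange N := ord_refl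
  have h : place (1 : Equiv.Perm (Fin N)).toEmbedding X = X := place_refl X
  rw [adj, this, braid_self, one_mul, mul_one, h]

theorem adj_add (σ : Equiv.Perm (Fin N)) (X Y : Tens K n N) :
    adj q σ (X + Y) = adj q σ X + adj q σ Y := by
  simp only [adj, place_add, mul_add, add_mul]

theorem adj_smul (σ : Equiv.Perm (Fin N)) (c : K) (X : Tens K n N) :
    adj q σ (c • X) = c • adj q σ X := by
  simp only [adj, place_smul, mul_smul_comm, smul_mul_assoc]

theorem adj_ratF_smul (σ : Equiv.Perm (Fin N)) (c : RatF K N) (X : Tens K n N) :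
    adj q σ (c • X) = varMap σ.toEmbedding c • adj q σ X := by
  simp only [adj, place_smul', mul_smul_comm, smul_mul_assoc]

/-- `adj` as a linear map. -/
def adjLin (q : K) (σ : Equiv.Perm (Fin N)) : Tens K n N →ₗ[K] Tens K n N :=
  ⟨⟨adj q σ, adj_add σ⟩, adj_smul σ⟩

theorem adj_sum {α : Type*} (σ : Equiv.Perm (Fin N)) (s : Finset α) (X : α → Tens K n N) :
    adj q σ (∑ i ∈ s, X i) = ∑ i ∈ s, adj q σ (X i) := map_sum (adjLin q σ) X s

theorem gfac_ne_zero {x y : RatF K N} (h : const N q * y - (const N q)⁻¹ * x ≠ 0)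
    (h' : y - x ≠ 0) : gfac q x y ≠ 0 := div_ne_zero h h'

theorem finRange_split {i j : Fin N} (hij : (j : ℕ) = i + 1) :
    ∃ t1 t2, List.finRange N = t1 ++ i :: j :: t2 := by
  obtain ⟨p, s, hp, e⟩ := exists_split (List.mem_finRange i)
  have hs := List.pairwise_lt_finRange N
  rw [e, List.pairwise_append, List.pairwise_cons] at hs
  obtain ⟨-, ⟨h1, h2⟩, h3⟩ := hs
  have hj : j ∈ p ++ i :: s := e ▸ List.mem_finRange j
  have hj : j ∈ s := by
    rcases List.mem_append.1 hj with h | h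
    · have := h3 j h i (by simp)
      omega
    · rcases List.mem_cons.1 h with h | h
      · omega
      · exact h
  cases s with
  | nil => simp at hj
  | cons x s =>
    rcases List.mem_cons.1 hj with rfl | hj
    · exact ⟨p, s, e⟩
    · have a1 := h1 x (by simp)
      have a2 := (List.pairwise_cons.1 h2).1 j hj
      omega

theorem ord_mul_swap {i j : Fin N} (hij : (j : ℕ) = i + 1) (σ : Equiv.Perm (Fin N)) :
    ∃ t1 t2, ord σ.toEmbedding = t1 ++ σ i :: σ j :: t2 ∧
      ord (σ * Equiv.swap i j).toEmbedding = t1 ++ σ j :: σ i :: t2 := by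
  obtain ⟨t1, t2, e⟩ := finRange_split hij
  have hnd := List.nodup_finRange N
  rw [e, List.nodup_append] at hnd
  simp only [List.nodup_cons, List.mem_cons, not_or] at hnd
  have key : ∀ t : List (Fin N), i ∉ t → j ∉ t →
      t.map (σ * Equiv.swap i j) = t.map σ := by
    intro t h1 h2
    refine List.map_congr_left fun x hx => ?_
    rw [Equiv.Perm.mul_apply, Equiv.swap_apply_of_ne_of_ne]
    · rintro rfl; exact h1 hx
    · rintro rfl; exact h2 hx
  refine ⟨t1.map σ, t2.map σ, ?_, ?_⟩
  · simp [ord, e]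
  · have k1 := key t1 (fun h => hnd.2.2 i h i (by simp) rfl) (fun h => hnd.2.2 j h j (by simp) rfl)
    have k2 := key t2 hnd.2.1.1.2 hnd.2.1.2.1
    simp only [ord, e, List.map_append, List.map_cons, Equiv.coe_toEmbedding, k1, k2]
    simp

/-- Each crossing exchanges two neighbours in the target order. By unitarity positive and negative
crossings are multiples of the same normalized one, so lifts of `σ` differ only by scalars, which
conjugation does not see. -/
theorem IsBraidLift.eq_smul (hq : q ≠ 0) {σ : Equiv.Perm (Fin N)} {M : Tens K n N}
    (h : IsBraidLift q σ M) :
    ∃ c : RatF K N, c ≠ 0 ∧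
      M = c • braid (const N q) z (List.finRange N) (ord σ.toEmbedding) := by
  have nd := List.nodup_finRange N
  induction h with
  | one =>
    refine ⟨1, one_ne_zero, ?_⟩
    rw [show ord (1 : Equiv.Perm (Fin N)).toEmbedding = List.finRange N from ord_refl, braid_self,
      one_smul]
  | pos σ M i j hij h ih =>
    obtain ⟨c, hc, rfl⟩ := ih
    obtain ⟨t1, t2, e1, e2⟩ := ord_mul_swap hij σ
    have hne : σ i ≠ σ j := fun h => by
      have := σ.injective h
      omega
    have hd := regular_z hq [σ i, σ j] (σ i) (by simp) (σ j) (by simp) hne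
    have hs : (z (σ j) - z (σ i) : RatF K N) ≠ 0 := z_sub_ne_zero hne.symm
    refine ⟨c * gfac q (z (σ i)) (z (σ j)), mul_ne_zero hc (gfac_ne_zero hd hs), ?_⟩
    rw [e2, braid_exchange (const_ne_zero hq) nd (e1 ▸ finRange_perm_ord σ) (regular_z hq _), ← e1,
      R_eq_smul_Rh q hne (z_ne_zero _) hs hd, smul_mul_assoc, mul_smul_comm, smul_smul]
  | neg σ M i j hij h ih =>
    obtain ⟨c, hc, rfl⟩ := ih
    obtain ⟨t1, t2, e1, e2⟩ := ord_mul_swap hij σ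
    have hne : σ i ≠ σ j := fun h => by
      have := σ.injective h
      omega
    have hd := regular_z hq [σ i, σ j] (σ i) (by simp) (σ j) (by simp) hne
    have hd' := regular_z hq [σ i, σ j] (σ j) (by simp) (σ i) (by simp) hne.symm
    have hs : (z (σ i) - z (σ j) : RatF K N) ≠ 0 := z_sub_ne_zero hne
    have hg := gfac_ne_zero hd' hs
    refine ⟨c * (gfac q (z (σ j)) (z (σ i)))⁻¹, mul_ne_zero hc (inv_ne_zero hg), ?_⟩
    have hinv : (R q (σ j) (σ i) (z (σ j) / z (σ i)) : Tens K n N)⁻¹ =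
        (gfac q (z (σ j)) (z (σ i)))⁻¹ • Rh (const N q) (σ i) (σ j) (z (σ i)) (z (σ j)) := by
      refine Matrix.inv_eq_right_inv ?_
      rw [R_eq_smul_Rh q hne.symm (z_ne_zero _) hs hd', smul_mul_assoc, mul_smul_comm, smul_smul,
        Rh_unitarity (const_ne_zero hq) hne.symm hd' hd, mul_inv_cancel₀ hg, one_smul]
    rw [e2, braid_exchange (const_ne_zero hq) nd (e1 ▸ finRange_perm_ord σ) (regular_z hq _), ← e1,
      hinv, smul_mul_assoc, mul_smul_comm, smul_smul]

theorem IsBraidLift.conj (hq : q ≠ 0) {σ : Equiv.Perm (Fin N)} {M : Tens K n N}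
    (h : IsBraidLift q σ M) (X : Tens K n N) :
    M * place σ.toEmbedding X * M⁻¹ = adj q σ X := by
  obtain ⟨c, hc, rfl⟩ := h.eq_smul hq
  have hinv : (c • braid (const N q) z (List.finRange N) (ord σ.toEmbedding) : Tens K n N)⁻¹ =
      c⁻¹ • braid (const N q) z (ord σ.toEmbedding) (List.finRange N) := by
    refine Matrix.inv_eq_right_inv ?_
    rw [smul_mul_assoc, mul_smul_comm, smul_smul, mul_inv_cancel₀ hc, one_smul,
      braid_inv (const_ne_zero hq) (List.nodup_finRange N) (finRange_perm_ord σ) (regular_z hq _)]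
  rw [hinv, smul_mul_assoc, smul_mul_assoc, mul_smul_comm, smul_smul, mul_inv_cancel₀ hc, one_smul,
    adj]

theorem exists_isBraidLift (q : K) (σ : Equiv.Perm (Fin N)) :
    ∃ M : Tens K n N, IsBraidLift q σ M := by
  cases N with
  | zero => exact ⟨1, Subsingleton.elim 1 σ ▸ IsBraidLift.one⟩
  | succ N =>
    have h : σ ∈ Submonoid.closure (Set.range fun i : Fin N => Equiv.swap i.castSucc i.succ) := by
      rw [Equiv.Perm.mclosure_swap_castSucc_succ]; trivial
    induction h using Submonoid.closure_induction_right with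
    | one => exact ⟨1, IsBraidLift.one⟩
    | mul_right x hx y hy ih =>
      obtain ⟨M, hM⟩ := ih
      obtain ⟨i, rfl⟩ := hy
      exact ⟨_, IsBraidLift.pos x M _ _ (by simp) hM⟩

theorem isSymm_iff (hq : q ≠ 0) (X : Tens K n N) : IsSymm q X ↔ ∀ σ, adj q σ X = X := by
  constructor
  · intro h σ
    obtain ⟨M, hM⟩ := exists_isBraidLift (n := n) q σ
    rw [← hM.conj hq X]
    exact (h σ M hM).symm
  · intro h σ M hM
    rw [hM.conj hq X, h]

/-! ### Terms of the shuffle product and the braided action -/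

theorem varMap_gfac (σ : Fin k ↪ Fin N) (x y : RatF K k) :
    varMap σ (gfac q x y) = gfac q (varMap σ x) (varMap σ y) := by
  simp only [gfac, map_div₀, map_sub, map_mul, map_inv₀, varMap_const]

theorem varMap_shuffleScalar {M : ℕ} (σ : Fin N ↪ Fin M) (a : Fin k ↪ Fin N) (b : Fin l ↪ Fin N) :
    varMap σ (shuffleScalar q qb a b) = shuffleScalar q qb (a.trans σ) (b.trans σ) := by
  simp only [shuffleScalar, map_prod, map_mul, varMap_gfac, varMap_z, map_pow, varMap_const]
  rfl

theorem varMap_shifted {M : ℕ} (σ : Fin N ↪ Fin M) (a : Fin k ↪ Fin N) (p : Fin N) :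
    varMap σ (shifted qb a p) = shifted qb (a.trans σ) (σ p) := by
  have : p ∈ ord a ↔ σ p ∈ ord (a.trans σ) := by
    rw [← map_ord, List.mem_map_of_injective σ.injective]
  simp only [shifted, this]
  split_ifs <;> simp [varMap_z, varMap_const]

/-- The conjugating braids merge with the two outer braids of the term. -/
theorem adj_shuffleTerm (hq : q ≠ 0) {a : Fin k ↪ Fin N} {b : Fin l ↪ Fin N}
    (h : Complementary a b) (σ : Equiv.Perm (Fin N)) (X : Tens K n k) (Y : Tens K n l) :
    adj q σ (shuffleTerm q qb a b X Y) =
      shuffleTerm q qb (a.trans σ.toEmbedding) (b.trans σ.toEmbedding) X Y := by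
  rw [shuffleTerm, adj_ratF_smul, varMap_shuffleScalar, shuffleTerm]
  congr 1
  have h' := h.trans σ
  have e1 : (List.finRange N).map σ = ord σ.toEmbedding := rfl
  have nd := List.nodup_finRange N
  have p0 := finRange_perm_ord σ
  have p1 := h'.perm
  have p2 := p1.trans List.perm_append_comm
  simp only [adj, place_mul, place_braid_z, place_place, Equiv.coe_toEmbedding, e1,
    place_braid σ.toEmbedding (shifted qb (a.trans σ.toEmbedding)) (shifted qb a)
      (varMap_shifted σ.toEmbedding a), List.map_append, map_ord_perm]
  rw [← braid_trans (const_ne_zero hq) nd p0 (p0.symm.trans p2) (regular_z hq _),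
    ← braid_trans (const_ne_zero hq) (p1.nodup_iff.1 nd) (p1.symm.trans p0) p0.symm
      (regular_z hq _)]
  simp only [mul_assoc]

theorem shuffleScalar_perm (τ₁ : Equiv.Perm (Fin k)) (τ₂ : Equiv.Perm (Fin l)) (a : Fin k ↪ Fin N)
    (b : Fin l ↪ Fin N) :
    shuffleScalar q qb (τ₁.toEmbedding.trans a) (τ₂.toEmbedding.trans b) =
      shuffleScalar q qb a b := by
  refine Fintype.prod_equiv τ₁ _ _ fun i => ?_
  exact Fintype.prod_equiv τ₂ _ _ fun j => rfl

theorem place_mem_loc (a : Fin k ↪ Fin N) (X : Tens K n k) :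
    place a X ∈ loc (RatF K N) n (ord a).toFinset := by
  rw [place_eq]
  exact act_mem_loc a (fun i => by simp [mem_ord]) _

theorem place_adj (a : Fin k ↪ Fin N) (τ : Equiv.Perm (Fin k)) (X : Tens K n k) :
    place a (adj q τ X) = braid (const N q) z (ord a) (ord (τ.toEmbedding.trans a)) *
      place (τ.toEmbedding.trans a) X *
      braid (const N q) z (ord (τ.toEmbedding.trans a)) (ord a) := by
  simp only [adj, place_mul, place_braid_z, place_place, map_ord]
  rfl

/-- All strands involved are shifted by the same factor, and braids depend only on ratios. -/
theorem braid_shifted_left (hqb : qb ≠ 0) (a : Fin k ↪ Fin N) (s t : List (Fin N))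
    (hs : ∀ x ∈ s, x ∈ ord a) (ht : ∀ x ∈ t, x ∈ ord a) :
    (braid (const N q) z s t : Tens K n N) = braid (const N q) (shifted qb a) s t := by
  rw [← braid_homog (const N q) (pow_ne_zero 2 (const_ne_zero hqb)) z s t]
  exact braid_congr _ _ _ (fun y hy => (shifted_of_mem (hs y hy)).symm)
    fun y hy => (shifted_of_mem (ht y hy)).symm

theorem braid_shifted_right (a : Fin k ↪ Fin N) (s t : List (Fin N))
    (hs : ∀ x ∈ s, x ∉ ord a) (ht : ∀ x ∈ t, x ∉ ord a) :
    (braid (const N q) z s t : Tens K n N) = braid (const N q) (shifted qb a) s t :=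
  braid_congr _ _ _ (fun y hy => (shifted_of_not_mem (hs y hy)).symm)
    fun y hy => (shifted_of_not_mem (ht y hy)).symm

/-- The braids around `X` and `Y` are absorbed into the adjacent braids of the term. A braid within
one family looks the same with shifted and unshifted parameters, and it commutes with the operator
on the other family. -/
theorem shuffleTerm_adj (hq : q ≠ 0) (hqb : qb ≠ 0) {a : Fin k ↪ Fin N} {b : Fin l ↪ Fin N}
    (h : Complementary a b) (τ₁ : Equiv.Perm (Fin k)) (τ₂ : Equiv.Perm (Fin l)) (X : Tens K n k)
    (Y : Tens K n l) :
    shuffleTerm q qb a b (adj q τ₁ X) (adj q τ₂ Y) =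
      shuffleTerm q qb (τ₁.toEmbedding.trans a) (τ₂.toEmbedding.trans b) X Y := by
  rw [shuffleTerm, shuffleTerm, shuffleScalar_perm, place_adj, place_adj]
  congr 1
  have hA := ord_perm τ₁ a
  have hB := ord_perm τ₂ b
  have hs : shifted qb (τ₁.toEmbedding.trans a) = shifted qb a := by
    funext p
    simp only [shifted, hA.mem_iff]
  rw [hs]
  have hX := place_mem_loc (τ₁.toEmbedding.trans a) X
  have hY := place_mem_loc (τ₂.toEmbedding.trans b) Y
  generalize place (τ₁.toEmbedding.trans a) X = X' at *
  generalize place (τ₂.toEmbedding.trans b) Y = Y' at *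
  have nA := ord_nodup (τ₁.toEmbedding.trans a)
  generalize ord (τ₁.toEmbedding.trans a) = A' at *
  generalize ord (τ₂.toEmbedding.trans b) = B' at *
  have hq' := const_ne_zero (N := N) hq
  have pN := h.perm
  have nAB := h.nodup
  have hZ := fun l => regular_z (N := N) hq l
  have hW := fun l => regular_shifted (N := N) hq hqb a l
  have mA : ∀ x ∈ A', x ∈ ord a := fun x hx => hA.mem_iff.1 hx
  have mB : ∀ x ∈ B', x ∉ ord a := fun x hx => h.not_mem (hB.mem_iff.1 hx)
  have mB0 : ∀ x ∈ ord b, x ∉ ord a := fun x hx => h.not_mem hx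
  have hAB : Disjoint (ord a).toFinset (ord b).toFinset := by
    simp only [Finset.disjoint_left, List.mem_toFinset]
    exact fun x hx hx' => mB0 x hx' hx
  have hX : X' ∈ loc (RatF K N) n (ord a).toFinset :=
    loc_mono (fun x hx => by simpa using mA x (by simpa using hx)) hX
  have hY : Y' ∈ loc (RatF K N) n (ord b).toFinset :=
    loc_mono (fun x hx => by simpa using hB.mem_iff.1 (by simpa using hx)) hY
  have fL := braid_shifted_left (n := n) (q := q) hqb a
  have fR := braid_shifted_right (n := n) (q := q) (qb := qb) a
  generalize ord a = A at *
  generalize ord b = B at *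
  have swap : (A ++ B).Perm (B ++ A) := List.perm_append_comm
  have nBA := swap.nodup_iff.1 nAB
  have pBA : (B ++ A).Perm (B ++ A') := List.Perm.append_left B hA.symm
  have pA'B' : (A ++ B).Perm (A' ++ B') := hA.symm.append hB.symm
  have pAB' : (A ++ B).Perm (A ++ B') := List.Perm.append_left A hB.symm
  have pB'A' : (B ++ A).Perm (B' ++ A') := hB.symm.append hA.symm
  have i1 : (braid (const N q) z A A' : Tens K n N) =
      braid (const N q) z (B ++ A) (B ++ A') := by
    simpa using (braid_local (n := n) (const N q) z B [] hA.symm).symm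
  have i2 : (braid (const N q) z A' A : Tens K n N) =
      braid (const N q) (shifted qb a) (B ++ A') (B ++ A) := by
    rw [fL _ _ mA (fun x hx => mA x (hA.mem_iff.2 hx))]
    simpa using (braid_local (n := n) (const N q) (shifted qb a) B [] hA).symm
  have i3 : (braid (const N q) z B B' : Tens K n N) =
      braid (const N q) (shifted qb a) (A ++ B) (A ++ B') := by
    rw [fR _ _ mB0 mB]
    simpa using (braid_local (n := n) (const N q) (shifted qb a) A [] hB.symm).symm
  have i4 : (braid (const N q) z (B ++ A') (B' ++ A') : Tens K n N) =
      braid (const N q) (shifted qb a) (B ++ A') (B' ++ A') := by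
    have e1 := braid_local (n := n) (const N q) z [] A' hB.symm
    have e2 := braid_local (n := n) (const N q) (shifted qb a) [] A' hB.symm
    simp only [List.nil_append] at e1 e2
    rw [e1, e2, fR _ _ mB0 mB]
  have i4' : (braid (const N q) z (B ++ A') (B' ++ A') : Tens K n N) ∈
      loc (RatF K N) n B.toFinset := by
    have e1 := braid_local (n := n) (const N q) z [] A' hB.symm
    simp only [List.nil_append] at e1
    rw [e1]
    exact braid_mem_loc _ _ _ _ (by simp) (fun x hx => by simpa using hB.mem_iff.1 hx)
  have i5 : (braid (const N q) z (A ++ B') (A' ++ B') : Tens K n N) =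
      braid (const N q) (shifted qb a) (A ++ B') (A' ++ B') := by
    have e1 := braid_local (n := n) (const N q) z [] B' hA.symm
    have e2 := braid_local (n := n) (const N q) (shifted qb a) [] B' hA.symm
    simp only [List.nil_append] at e1 e2
    rw [e1, e2, fL _ _ (fun x hx => mA x (hA.mem_iff.2 hx)) mA]
  have i5' : (braid (const N q) z (A ++ B') (A' ++ B') : Tens K n N) ∈
      loc (RatF K N) n A.toFinset := by
    have e1 := braid_local (n := n) (const N q) z [] B' hA.symm
    simp only [List.nil_append] at e1
    rw [e1]
    exact braid_mem_loc _ _ _ _ (by simp) (fun x hx => by simpa using hA.mem_iff.1 hx)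
  have i6 : (braid (const N q) z B' B : Tens K n N) =
      braid (const N q) z (A ++ B') (A ++ B) := by
    simpa using (braid_local (n := n) (const N q) z A [] hB).symm
  have c1 := loc_commute hAB.symm i4' hX
  have c2 := loc_commute hAB i5' hY
  have t1 := braid_trans (n := n) hq' (List.nodup_finRange N) (pN.trans swap) pBA (hZ _)
  have t2 := braid_trans (n := n) hq' (List.nodup_finRange N) (pN.trans (swap.trans pBA))
    (pBA.symm.trans pB'A') (hZ _)
  have t3 := braid_trans (n := n) hq' (pBA.nodup_iff.1 nBA) pBA.symm swap.symm (hW _)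
  have t4 := braid_trans (n := n) hq' (pBA.nodup_iff.1 nBA) (pBA.symm.trans swap.symm) pAB' (hW _)
  have t5 := braid_trans (n := n) hq' (pBA.nodup_iff.1 nBA) (pBA.symm.trans pB'A')
    (pB'A'.symm.trans (swap.symm.trans pA'B')) (hW _)
  have t6 := braid_trans (n := n) hq' (pBA.nodup_iff.1 nBA) (pBA.symm.trans (swap.symm.trans pAB'))
    (pAB'.symm.trans pA'B') (hW _)
  have t7 := braid_trans (n := n) hq' (pAB'.nodup_iff.1 nAB) (pAB'.symm.trans pA'B')
    (pA'B'.symm.trans pN.symm) (hZ _)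
  have t8 := braid_trans (n := n) hq' (pAB'.nodup_iff.1 nAB) pAB'.symm pN.symm (hZ _)
  calc _ = (braid (const N q) z (List.finRange N) (B ++ A) * braid (const N q) z A A') * X' *
        (braid (const N q) z A' A * braid (const N q) (shifted qb a) (B ++ A) (A ++ B) *
          braid (const N q) z B B') * Y' *
        (braid (const N q) z B' B * braid (const N q) z (A ++ B) (List.finRange N)) := by
        simp only [mul_assoc]
    _ = braid (const N q) z (List.finRange N) (B ++ A') * X' *
        braid (const N q) (shifted qb a) (B ++ A') (A ++ B') * Y' *
        braid (const N q) z (A ++ B') (List.finRange N) := by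
        rw [i1, t1, i2, t3, i3, t4, i6, t8]
    -- The outer orders still list one family in its old order. The braid permuting that family does
    -- not touch the adjacent operator, so it passes through into the middle braid.
    _ = braid (const N q) z (List.finRange N) (B ++ A') * X' *
        (braid (const N q) z (B ++ A') (B' ++ A') *
          braid (const N q) (shifted qb a) (B' ++ A') (A' ++ B')) * Y' *
        braid (const N q) z (A' ++ B') (List.finRange N) := by
        rw [← t7, i4, t5, ← t6, ← i5]
        simp only [mul_assoc]
        rw [← mul_assoc Y', ← c2.eq, mul_assoc]
    _ = _ := by
        rw [← t2]
        simp only [mul_assoc]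
        rw [← mul_assoc X', ← c1.eq, mul_assoc]

end Action
end RShuffle

namespace RShuffle

/-! ### Associativity of the terms and symmetrization -/

section Symmetrization

set_option linter.unusedSectionVars false

variable {K : Type*} [Field K] {n k l m N : ℕ} {q qb : K}

theorem ord_add (e : Fin (k + l) ↪ Fin N) :
    ord e = ord ((Fin.castAddEmb l).trans e) ++ ord ((Fin.natAddEmb k).trans e) := by
  simp only [ord, ← List.ofFn_eq_map]
  exact List.ofFn_add

theorem complementary_add : Complementary (Fin.castAddEmb l : Fin k ↪ Fin (k + l))
    (Fin.natAddEmb k) := by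
  refine ⟨fun i j h => ?_, fun x => ?_⟩
  · have h2 := congrArg Fin.val h
    simp at h2
    omega
  · simp only [mem_ord]
    refine Fin.addCases (fun i => Or.inl ⟨i, rfl⟩) (fun i => Or.inr ⟨i, rfl⟩) x

/-- Both sides are diagrams on three families A, B, C in which X, Y, Z act in this order, shifting
the parameters of A, then of B, then of C. A braid of strands not met by an operator slides through
it, with the same parameters before and after; this identifies the two diagrams. -/
theorem shuffleTerm_assoc (hq : q ≠ 0) (hqb : qb ≠ 0) {e : Fin (k + l) ↪ Fin N}
    {c : Fin m ↪ Fin N} {a : Fin k ↪ Fin N} {b : Fin l ↪ Fin N} {e' : Fin (l + m) ↪ Fin N}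
    (h1 : (Fin.castAddEmb l).trans e = a) (h2 : (Fin.natAddEmb k).trans e = b)
    (h3 : (Fin.castAddEmb m).trans e' = b) (h4 : (Fin.natAddEmb l).trans e' = c)
    (hec : Complementary e c) (hae : Complementary a e') (X : Tens K n k) (Y : Tens K n l)
    (Z : Tens K n m) :
    shuffleTerm q qb e c (shuffleTerm q qb (Fin.castAddEmb l) (Fin.natAddEmb k) X Y) Z =
      shuffleTerm q qb a e' X (shuffleTerm q qb (Fin.castAddEmb m) (Fin.natAddEmb l) Y Z) := by
  -- Both products of scalars contain one factor for each of the pairs of families AB, AC, BC.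
  have hG : shuffleScalar q qb e c * shuffleScalar q qb a b =
      shuffleScalar q qb a e' * shuffleScalar q qb b c := by
    have e1 : shuffleScalar q qb e c = shuffleScalar q qb a c * shuffleScalar q qb b c := by
      rw [shuffleScalar, Fin.prod_univ_add, ← h1, ← h2]; rfl
    have e2 : shuffleScalar q qb a e' = shuffleScalar q qb a b * shuffleScalar q qb a c := by
      rw [shuffleScalar, shuffleScalar, shuffleScalar, ← Finset.prod_mul_distrib, ← h3, ← h4]
      refine Finset.prod_congr rfl fun i _ => ?_
      rw [Fin.prod_univ_add]; rfl
    rw [e1, e2]; ring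
  have oe : ord e = ord a ++ ord b := by rw [ord_add, h1, h2]
  have oe' : ord e' = ord b ++ ord c := by rw [ord_add, h3, h4]
  have ob : ∀ k l : ℕ, ord (Fin.castAddEmb l : Fin k ↪ Fin (k + l)) ++ ord (Fin.natAddEmb k) =
      List.finRange (k + l) := by
    intro k l
    have := ord_add (Function.Embedding.refl (Fin (k + l)))
    rw [ord_refl] at this
    exact this.symm
  have s1 : ∀ p, p ∉ ord c → shifted qb e p = shifted qb e p := fun p _ => rfl
  have X1 : place e (shuffleTerm q qb (Fin.castAddEmb l) (Fin.natAddEmb k) X Y) =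
      shuffleScalar q qb a b • (braid (const N q) z (ord a ++ ord b) (ord b ++ ord a) * place a X *
        braid (const N q) (shifted qb a) (ord b ++ ord a) (ord a ++ ord b) * place b Y) := by
    rw [shuffleTerm, place_smul', varMap_shuffleScalar, h1, h2, ob, braid_self, mul_one]
    simp only [place_mul, place_braid_z, place_place, h1, h2, List.map_append, map_ord,
      place_braid e (shifted qb a) (shifted qb (Fin.castAddEmb l))
        (fun i => by rw [varMap_shifted, h1])]
    rw [← ord, oe]
  have X2 : place e' (shuffleTerm q qb (Fin.castAddEmb m) (Fin.natAddEmb l) Y Z) =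
      shuffleScalar q qb b c • (braid (const N q) z (ord b ++ ord c) (ord c ++ ord b) * place b Y *
        braid (const N q) (shifted qb b) (ord c ++ ord b) (ord b ++ ord c) * place c Z) := by
    rw [shuffleTerm, place_smul', varMap_shuffleScalar, h3, h4, ob, braid_self, mul_one]
    simp only [place_mul, place_braid_z, place_place, h3, h4, List.map_append, map_ord,
      place_braid e' (shifted qb b) (shifted qb (Fin.castAddEmb m))
        (fun i => by rw [varMap_shifted, h3])]
    rw [← ord, oe']
  rw [shuffleTerm, X1, shuffleTerm, X2, oe, oe']
  simp only [smul_mul_assoc, mul_smul_comm, smul_smul]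
  rw [hG]
  congr 1
  have hab : Disjoint (ord a).toFinset (ord b ++ ord c).toFinset := by
    rw [← oe']
    simp only [Finset.disjoint_left, List.mem_toFinset]
    exact fun x hx hx' => hae.not_mem hx' hx
  have hce : Disjoint (ord a ++ ord b).toFinset (ord c).toFinset := by
    rw [← oe]
    simp only [Finset.disjoint_left, List.mem_toFinset]
    exact fun x hx hx' => hec.not_mem hx' hx
  have hX := place_mem_loc a X
  have hY := place_mem_loc b Y
  have hq' := const_ne_zero (N := N) hq
  have pN := hec.perm
  have nd := hec.nodup
  rw [oe] at pN nd
  have hZ := fun l => regular_z (N := N) hq l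
  have hW1 := fun l => regular_shifted (N := N) hq hqb a l
  have hW2 := fun l => regular_shifted (N := N) hq hqb e l
  -- Applying X does not change the parameters of B and C.
  have w1z : ∀ s t, (∀ x ∈ s, x ∈ ord b ++ ord c) → (∀ x ∈ t, x ∈ ord b ++ ord c) →
      (braid (const N q) z s t : Tens K n N) = braid (const N q) (shifted qb a) s t :=
    fun s t hs ht => braid_shifted_right a s t (fun x hx => hae.not_mem (oe' ▸ hs x hx))
      (fun x hx => hae.not_mem (oe' ▸ ht x hx))
  have hbe : ∀ x, x ∈ ord b → x ∈ ord e := fun x hx => by rw [oe]; simp [hx]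
  have haE : ∀ x, x ∈ ord a → x ∈ ord e := fun x hx => by rw [oe]; simp [hx]
  -- Applying Y does not change the parameters of A and C.
  have w12 : ∀ s t, (∀ x ∈ s, x ∈ ord a ++ ord c) → (∀ x ∈ t, x ∈ ord a ++ ord c) →
      (braid (const N q) (shifted qb a) s t : Tens K n N) =
        braid (const N q) (shifted qb e) s t := by
    have key : ∀ x ∈ ord a ++ ord c, shifted qb a x = shifted qb e x := by
      intro x hx
      rcases List.mem_append.1 hx with hx | hx
      · rw [shifted_of_mem hx, shifted_of_mem (haE x hx)]
      · rw [shifted_of_not_mem (hec.not_mem hx),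
          shifted_of_not_mem (hae.not_mem (oe' ▸ by simp [hx]))]
    exact fun s t hs ht => braid_congr _ _ _ (fun y hy => key y (hs y hy))
      fun y hy => key y (ht y hy)
  have wb2 : ∀ s t, (∀ x ∈ s, x ∈ ord b ++ ord c) → (∀ x ∈ t, x ∈ ord b ++ ord c) →
      (braid (const N q) (shifted qb b) s t : Tens K n N) =
        braid (const N q) (shifted qb e) s t := by
    have key : ∀ x ∈ ord b ++ ord c, shifted qb b x = shifted qb e x := by
      intro x hx
      rcases List.mem_append.1 hx with hx | hx
      · rw [shifted_of_mem hx, shifted_of_mem (hbe x hx)]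
      · rw [shifted_of_not_mem (hec.not_mem hx), shifted_of_not_mem]
        intro hb
        exact hec.not_mem hx (hbe x hb)
    exact fun s t hs ht => braid_congr _ _ _ (fun y hy => key y (hs y hy))
      fun y hy => key y (ht y hy)
  generalize shifted qb a = W1 at *
  generalize shifted qb b = Wb at *
  generalize shifted qb e = W2 at *
  generalize place a X = X' at *
  generalize place b Y = Y' at *
  generalize place c Z = Z' at *
  generalize ord a = A at *
  generalize ord b = B at *
  generalize ord c = C at *
  have pAB : (A ++ B).Perm (B ++ A) := List.perm_append_comm
  have pBC : (B ++ C).Perm (C ++ B) := List.perm_append_comm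
  have pAC : (A ++ C).Perm (C ++ A) := List.perm_append_comm
  have oABC : (List.finRange N).Perm (A ++ B ++ C) := pN
  have oCAB : (List.finRange N).Perm (C ++ (A ++ B)) := pN.trans List.perm_append_comm
  have oCBA : (List.finRange N).Perm (C ++ (B ++ A)) := oCAB.trans (List.Perm.append_left C pAB)
  have oBCA : (List.finRange N).Perm ((B ++ C) ++ A) := by
    refine oCBA.trans ?_
    rw [← List.append_assoc]
    exact List.Perm.append_right A pBC.symm
  have oACB : (List.finRange N).Perm (A ++ C ++ B) := by
    refine oABC.trans ?_
    rw [List.append_assoc, List.append_assoc]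
    exact List.Perm.append_left A pBC
  have nN := List.nodup_finRange N
  have tr : ∀ {w : Fin N → RatF K N} (_ : ∀ l, Regular (const N q) w l) {l l' l'' : List (Fin N)}
      (_ : (List.finRange N).Perm l) (_ : (List.finRange N).Perm l')
      (_ : (List.finRange N).Perm l''),
      (braid (const N q) w l l' * braid (const N q) w l' l'' : Tens K n N) =
        braid (const N q) w l l'' := by
    intro w hw l l' l'' h h' h''
    exact braid_trans hq' (h.nodup_iff.1 nN) (h.symm.trans h') (h'.symm.trans h'') (hw _)
  have lf : ∀ (w : Fin N → RatF K N) (p : List (Fin N)) {m m' : List (Fin N)} (_ : m.Perm m'),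
      (braid (const N q) w m m' : Tens K n N) = braid (const N q) w (p ++ m) (p ++ m') := by
    intro w p m m' hm
    simpa using (braid_local (n := n) (const N q) w p [] hm).symm
  have rf : ∀ (w : Fin N → RatF K N) (p : List (Fin N)) {m m' : List (Fin N)} (_ : m.Perm m'),
      (braid (const N q) w m m' : Tens K n N) = braid (const N q) w (m ++ p) (m' ++ p) := by
    intro w p m m' hm
    simpa using (braid_local (n := n) (const N q) w [] p hm).symm
  have r1 := lf z C pAB
  have r2 := lf W1 C pAB.symm
  have r3 : (braid (const N q) z (B ++ C ++ A) (C ++ (B ++ A)) : Tens K n N) =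
      braid (const N q) W1 (B ++ C ++ A) (C ++ (B ++ A)) := by
    rw [← List.append_assoc C, ← rf z A pBC, ← rf W1 A pBC, w1z]
    · simp
    · simp [or_comm]
  have r3' : (braid (const N q) z (B ++ C ++ A) (C ++ (B ++ A)) : Tens K n N) ∈
      loc (RatF K N) n (B ++ C).toFinset := by
    rw [← List.append_assoc C, ← rf z A pBC]
    exact braid_mem_loc _ _ _ _ (by simp) (by simp [or_comm])
  have r4 : (braid (const N q) W1 (A ++ C ++ B) (C ++ (A ++ B)) : Tens K n N) =
      braid (const N q) W2 (A ++ C ++ B) (C ++ (A ++ B)) := by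
    rw [← List.append_assoc C, ← rf W1 B pAC, ← rf W2 B pAC, w12]
    · simp
    · simp [or_comm]
  have r4' : (braid (const N q) W1 (A ++ C ++ B) (C ++ (A ++ B)) : Tens K n N) ∈
      loc (RatF K N) n (A ++ C).toFinset := by
    rw [← List.append_assoc C, ← rf W1 B pAC]
    exact braid_mem_loc _ _ _ _ (by simp) (by simp [or_comm])
  have r5 : (braid (const N q) W2 (A ++ C ++ B) (A ++ B ++ C) : Tens K n N) =
      braid (const N q) Wb (C ++ B) (B ++ C) := by
    rw [List.append_assoc, List.append_assoc, ← lf W2 A pBC.symm, wb2]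
    · simp [or_comm]
    · simp
  have r6 : (braid (const N q) z (B ++ C) (C ++ B) : Tens K n N) =
      braid (const N q) W1 (A ++ B ++ C) (A ++ C ++ B) := by
    rw [List.append_assoc, List.append_assoc, ← lf W1 A pBC, w1z]
    · simp
    · simp [or_comm]
  have c1 := loc_commute hab.symm r3' hX
  have hdis : Disjoint (A ++ C).toFinset B.toFinset := by
    have hnd := List.nodup_append.1 (oACB.nodup_iff.1 nN)
    simp only [Finset.disjoint_left, List.mem_toFinset]
    exact fun x hx hx' => hnd.2.2 x hx x hx' rfl
  have c2 := loc_commute hdis r4' hY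
  calc _ = (braid (const N q) z (List.finRange N) (C ++ (A ++ B)) *
          braid (const N q) z (A ++ B) (B ++ A)) * X' *
        braid (const N q) W1 (B ++ A) (A ++ B) * Y' *
        braid (const N q) W2 (C ++ (A ++ B)) (A ++ B ++ C) * Z' *
        braid (const N q) z (A ++ B ++ C) (List.finRange N) := by simp only [mul_assoc]
    -- The braid exchanging B and C passes to the right of `X'`.
    _ = braid (const N q) z (List.finRange N) (B ++ C ++ A) * (X' *
        (braid (const N q) z (B ++ C ++ A) (C ++ (B ++ A)) *
        braid (const N q) W1 (C ++ (B ++ A)) (C ++ (A ++ B)))) * Y' *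
        braid (const N q) W2 (C ++ (A ++ B)) (A ++ B ++ C) * Z' *
        braid (const N q) z (A ++ B ++ C) (List.finRange N) := by
      rw [r1, tr hZ (List.Perm.refl _) oCAB oCBA, ← tr hZ (List.Perm.refl _) oBCA oCBA, r2,
        ← mul_assoc X', ← c1.eq]
      simp only [mul_assoc]
    -- The braid exchanging A and C passes to the right of `Y'`.
    _ = braid (const N q) z (List.finRange N) (B ++ C ++ A) * X' *
        braid (const N q) W1 (B ++ C ++ A) (A ++ C ++ B) * (Y' *
        (braid (const N q) W1 (A ++ C ++ B) (C ++ (A ++ B)) *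
        braid (const N q) W2 (C ++ (A ++ B)) (A ++ B ++ C))) * Z' *
        braid (const N q) z (A ++ B ++ C) (List.finRange N) := by
      rw [r3, tr hW1 oBCA oCBA oCAB, ← tr hW1 oBCA oACB oCAB, ← mul_assoc Y', ← c2.eq]
      simp only [mul_assoc]
    _ = braid (const N q) z (List.finRange N) (B ++ C ++ A) * X' *
        (braid (const N q) W1 (B ++ C ++ A) (A ++ B ++ C) *
          braid (const N q) z (B ++ C) (C ++ B)) * Y' *
        braid (const N q) Wb (C ++ B) (B ++ C) * Z' *
        braid (const N q) z (A ++ B ++ C) (List.finRange N) := by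
      rw [r4, tr hW2 oACB oCAB oABC, r5, r6, tr hW1 oBCA oABC oACB]
      simp only [mul_assoc]
    _ = _ := by simp only [mul_assoc, List.append_assoc]

/-- The permutation sending the first `k` labels to `a` and the other ones to `b`. -/
def permOf (a : Fin k ↪ Fin (k + l)) (b : Fin l ↪ Fin (k + l)) (h : Complementary a b) :
    Equiv.Perm (Fin (k + l)) :=
  Equiv.ofBijective (Fin.addCases (motive := fun _ => Fin (k + l)) a b) (by
    rw [← Finite.surjective_iff_bijective]
    intro x
    rcases h.cover x with hx | hx
    · obtain ⟨i, hi⟩ := mem_ord.1 hx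
      exact ⟨Fin.castAdd l i, by simp [hi]⟩
    · obtain ⟨i, hi⟩ := mem_ord.1 hx
      exact ⟨Fin.natAdd k i, by simp [hi]⟩)

theorem permOf_left (a : Fin k ↪ Fin (k + l)) (b : Fin l ↪ Fin (k + l)) (h : Complementary a b) :
    (Fin.castAddEmb l).trans (permOf a b h).toEmbedding = a := by
  ext i
  simp [permOf]

theorem permOf_right (a : Fin k ↪ Fin (k + l)) (b : Fin l ↪ Fin (k + l))
    (h : Complementary a b) : (Fin.natAddEmb k).trans (permOf a b h).toEmbedding = b := by
  ext i
  simp [permOf]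

theorem Complementary.perm_trans {a : Fin k ↪ Fin N} {b : Fin l ↪ Fin N} (h : Complementary a b)
    (τ₁ : Equiv.Perm (Fin k)) (τ₂ : Equiv.Perm (Fin l)) :
    Complementary (τ₁.toEmbedding.trans a) (τ₂.toEmbedding.trans b) :=
  ⟨fun _ _ => h.disj _ _, fun x => (h.cover x).imp (ord_perm τ₁ a).mem_iff.2
    (ord_perm τ₂ b).mem_iff.2⟩

theorem mem_shuffles {p : (Fin k ↪ Fin (k + l)) × (Fin l ↪ Fin (k + l))} :
    p ∈ shuffles k l ↔ StrictMono p.1 ∧ StrictMono p.2 ∧ ∀ i j, p.1 i ≠ p.2 j := by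
  simp [shuffles]

/-- A strictly increasing map is determined by its range, which a permutation of the source does not
change. -/
theorem eq_of_strictMono_trans {a a' : Fin k ↪ Fin N} (ha : StrictMono a) (ha' : StrictMono a')
    {τ τ' : Equiv.Perm (Fin k)} (h : τ.toEmbedding.trans a = τ'.toEmbedding.trans a') :
    a = a' ∧ τ = τ' := by
  have e : (a : Fin k → Fin N) = a' := by
    rw [← StrictMono.range_inj ha ha']
    have h1 : Set.range (τ.toEmbedding.trans a) = Set.range a := by
      rw [Function.Embedding.coe_trans, Set.range_comp, Equiv.coe_toEmbedding, τ.range_eq_univ,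
        Set.image_univ]
    have h2 : Set.range (τ'.toEmbedding.trans a') = Set.range a' := by
      rw [Function.Embedding.coe_trans, Set.range_comp, Equiv.coe_toEmbedding, τ'.range_eq_univ,
        Set.image_univ]
    rw [← h1, h, h2]
  have e' : a = a' := DFunLike.coe_injective e
  subst e'
  refine ⟨rfl, Equiv.ext fun i => a.injective ?_⟩
  exact DFunLike.congr_fun h i

theorem exists_sort (a : Fin k ↪ Fin N) :
    ∃ τ : Equiv.Perm (Fin k), ∃ a' : Fin k ↪ Fin N, StrictMono a' ∧ τ.toEmbedding.trans a' = a := by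
  refine ⟨(Tuple.sort a)⁻¹, (Tuple.sort a).toEmbedding.trans a, ?_, ?_⟩
  · exact (Tuple.monotone_sort a).strictMono_of_injective
      (a.injective.comp (Tuple.sort a).injective)
  · ext i
    simp

/-- Every decomposition of the labels is uniquely a shuffle followed by two permutations. -/
theorem sum_perm_eq_sum_shuffles {M : Type*} [AddCommMonoid M]
    (t : (Fin k ↪ Fin (k + l)) → (Fin l ↪ Fin (k + l)) → M) :
    ∑ σ : Equiv.Perm (Fin (k + l)), t ((Fin.castAddEmb l).trans σ.toEmbedding)
        ((Fin.natAddEmb k).trans σ.toEmbedding) =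
      ∑ p ∈ shuffles k l, ∑ τ : Equiv.Perm (Fin k) × Equiv.Perm (Fin l),
        t (τ.1.toEmbedding.trans p.1) (τ.2.toEmbedding.trans p.2) := by
  rw [← Finset.sum_product']
  symm
  have hc : ∀ x ∈ shuffles k l ×ˢ (Finset.univ : Finset (Equiv.Perm (Fin k) × Equiv.Perm (Fin l))),
      Complementary (x.2.1.toEmbedding.trans x.1.1) (x.2.2.toEmbedding.trans x.1.2) := fun x hx =>
    (complementary_of_mem_shuffles (Finset.mem_product.1 hx).1).perm_trans _ _
  refine Finset.sum_bij (fun x hx => permOf _ _ (hc x hx)) (fun _ _ => Finset.mem_univ _) ?_ ?_ ?_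
  · rintro ⟨⟨a, b⟩, ⟨τ₁, τ₂⟩⟩ hx ⟨⟨a', b'⟩, ⟨τ₁', τ₂'⟩⟩ hx' h
    have h1 := permOf_left _ _ (hc _ hx)
    have h2 := permOf_right _ _ (hc _ hx)
    rw [h] at h1 h2
    rw [permOf_left] at h1
    rw [permOf_right] at h2
    have m := mem_shuffles.1 (Finset.mem_product.1 hx).1
    have m' := mem_shuffles.1 (Finset.mem_product.1 hx').1
    obtain ⟨e1, e2⟩ := eq_of_strictMono_trans m'.1 m.1 h1
    obtain ⟨e3, e4⟩ := eq_of_strictMono_trans m'.2.1 m.2.1 h2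
    simp only at e1 e2 e3 e4
    rw [e1, e2, e3, e4]
  · intro σ _
    obtain ⟨τ₁, a, ha, h1⟩ := exists_sort ((Fin.castAddEmb l).trans σ.toEmbedding)
    obtain ⟨τ₂, b, hb, h2⟩ := exists_sort ((Fin.natAddEmb k).trans σ.toEmbedding)
    have hm : ((a, b), (τ₁, τ₂)) ∈ shuffles k l ×ˢ
        (Finset.univ : Finset (Equiv.Perm (Fin k) × Equiv.Perm (Fin l))) := by
      refine Finset.mem_product.2 ⟨mem_shuffles.2 ⟨ha, hb, fun i j hij => ?_⟩, Finset.mem_univ _⟩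
      have e1 := DFunLike.congr_fun h1 (τ₁⁻¹ i)
      have e2 := DFunLike.congr_fun h2 (τ₂⁻¹ j)
      simp at e1 e2
      exact (complementary_add.trans σ).disj _ _ (e1.symm.trans (hij.trans e2))
    refine ⟨_, hm, ?_⟩
    have h1' := permOf_left _ _ (hc _ hm)
    have h2' := permOf_right _ _ (hc _ hm)
    ext x
    refine congrArg Fin.val ?_
    refine Fin.addCases (fun i => ?_) (fun i => ?_) x
    · exact (DFunLike.congr_fun h1' i).trans (DFunLike.congr_fun h1 i)
    · exact (DFunLike.congr_fun h2' i).trans (DFunLike.congr_fun h2 i)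
  · intro x hx
    rw [permOf_left, permOf_right]

theorem adj_sum_perm (hq : q ≠ 0) (ρ : Equiv.Perm (Fin N)) (T : Tens K n N) :
    adj q ρ (∑ σ : Equiv.Perm (Fin N), adj q σ T) = ∑ σ : Equiv.Perm (Fin N), adj q σ T := by
  rw [adj_sum]
  simp only [← adj_mul hq]
  exact Fintype.sum_equiv (Equiv.mulLeft ρ) _ _ fun σ => rfl

theorem sum_perm_adj (hq : q ≠ 0) (ρ : Equiv.Perm (Fin N)) (T : Tens K n N) :
    ∑ σ : Equiv.Perm (Fin N), adj q σ (adj q ρ T) = ∑ σ : Equiv.Perm (Fin N), adj q σ T := by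
  simp only [← adj_mul hq]
  exact Fintype.sum_equiv (Equiv.mulRight ρ) _ _ fun σ => rfl

variable [CharZero K]

/-- The shuffle product of symmetric tensors is a symmetrization. -/
theorem shuffleProd_eq_sum (hq : q ≠ 0) (hqb : qb ≠ 0) {X : Tens K n k} {Y : Tens K n l}
    (hX : IsSymm q X) (hY : IsSymm q Y) :
    shuffleProd q qb X Y = ((k.factorial * l.factorial : ℕ) : K)⁻¹ •
      ∑ σ : Equiv.Perm (Fin (k + l)),
        adj q σ (shuffleTerm q qb (Fin.castAddEmb l) (Fin.natAddEmb k) X Y) := by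
  rw [isSymm_iff hq] at hX hY
  have h1 : ∀ σ : Equiv.Perm (Fin (k + l)),
      adj q σ (shuffleTerm q qb (Fin.castAddEmb l) (Fin.natAddEmb k) X Y) = _ := fun σ =>
    adj_shuffleTerm (qb := qb) hq complementary_add σ X Y
  simp only [h1]
  rw [sum_perm_eq_sum_shuffles fun a b => shuffleTerm q qb a b X Y]
  -- By symmetry of `X` and `Y` the k! l! terms over one shuffle coincide.
  have h2 : ∀ p ∈ shuffles k l, ∑ τ : Equiv.Perm (Fin k) × Equiv.Perm (Fin l),
      shuffleTerm q qb (τ.1.toEmbedding.trans p.1) (τ.2.toEmbedding.trans p.2) X Y =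
      ((k.factorial * l.factorial : ℕ) : K) • shuffleTerm q qb p.1 p.2 X Y := by
    intro p hp
    have h3 : ∀ τ : Equiv.Perm (Fin k) × Equiv.Perm (Fin l),
        shuffleTerm q qb (τ.1.toEmbedding.trans p.1) (τ.2.toEmbedding.trans p.2) X Y =
          shuffleTerm q qb p.1 p.2 X Y := by
      intro τ
      rw [← shuffleTerm_adj hq hqb (complementary_of_mem_shuffles hp), hX, hY]
    simp only [h3]
    rw [Finset.sum_const, Finset.card_univ, Fintype.card_prod, Fintype.card_perm,
      Fintype.card_perm, Fintype.card_fin, Fintype.card_fin, Nat.cast_smul_eq_nsmul]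
  rw [Finset.sum_congr rfl h2, ← Finset.smul_sum, smul_smul, inv_mul_cancel₀, one_smul,
    shuffleProd_eq hq hqb]
  exact_mod_cast (Nat.mul_pos (Nat.factorial_pos k) (Nat.factorial_pos l)).ne'

theorem isSymm_shuffleProd (hq : q ≠ 0) (hqb : qb ≠ 0) {X : Tens K n k} {Y : Tens K n l}
    (hX : IsSymm q X) (hY : IsSymm q Y) : IsSymm q (shuffleProd q qb X Y) := by
  rw [isSymm_iff hq]
  intro σ
  rw [shuffleProd_eq_sum hq hqb hX hY, adj_smul, adj_sum_perm hq]

/-- Triple products live over `k + l + m` and `k + (l + m)`; the transport to a common `N` makes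
them comparable. -/
theorem shuffleProd_cast (hq : q ≠ 0) (hqb : qb ≠ 0) {X : Tens K n k} {Y : Tens K n l}
    (hX : IsSymm q X) (hY : IsSymm q Y) (h : k + l = N) :
    place (finCongr h).toEmbedding (shuffleProd q qb X Y) =
      ((k.factorial * l.factorial : ℕ) : K)⁻¹ • ∑ σ : Equiv.Perm (Fin N),
        adj q σ (shuffleTerm q qb ((Fin.castAddEmb l).trans (finCongr h).toEmbedding)
          ((Fin.natAddEmb k).trans (finCongr h).toEmbedding) X Y) := by
  subst h
  exact (place_refl _).trans (shuffleProd_eq_sum hq hqb hX hY)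

theorem lof_cast {k N : ℕ} (h : k = N) (X : Tens K n k) :
    DirectSum.lof K ℕ (fun m => Tens K n m) k X =
      DirectSum.lof K ℕ (fun m => Tens K n m) N (place (finCongr h).toEmbedding X) := by
  subst h
  exact congrArg _ (place_refl X).symm

end Symmetrization
end RShuffle

namespace RShuffle

/-! ### Associativity and units -/

section Associativity

variable {K : Type*} [Field K] {n k l m N : ℕ} {q qb : K}

/-- The terms of the shuffle product, as a bilinear map. -/
def shuffleTermBilin (q qb : K) (n : ℕ) (a : Fin k ↪ Fin N) (b : Fin l ↪ Fin N) :
    Tens K n k →ₗ[K] Tens K n l →ₗ[K] Tens K n N :=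
  LinearMap.mk₂ K (shuffleTerm q qb a b)
    (fun X X' Y => by simp only [shuffleTerm, place_add, mul_add, add_mul, smul_add])
    (fun c X Y => by
      simp only [shuffleTerm, place_smul, mul_smul_comm, smul_mul_assoc]
      exact smul_comm _ _ _)
    (fun X Y Y' => by simp only [shuffleTerm, place_add, mul_add, add_mul, smul_add])
    (fun c X Y => by
      simp only [shuffleTerm, place_smul, mul_smul_comm, smul_mul_assoc]
      exact smul_comm _ _ _)

theorem Complementary.exists_perm {a a' : Fin k ↪ Fin N} {b b' : Fin l ↪ Fin N} (h : k + l = N)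
    (hab : Complementary a b) (hab' : Complementary a' b') :
    ∃ π : Equiv.Perm (Fin N), a.trans π.toEmbedding = a' ∧ b.trans π.toEmbedding = b' := by
  subst h
  refine ⟨(permOf a b hab).symm.trans (permOf a' b' hab'), ?_, ?_⟩
  · ext i
    have h1 := DFunLike.congr_fun (permOf_left a b hab) i
    have h2 := DFunLike.congr_fun (permOf_left a' b' hab') i
    simp only [Function.Embedding.trans_apply, Equiv.coe_toEmbedding] at h1 h2
    simp [← h1, ← h2]
  · ext i
    have h1 := DFunLike.congr_fun (permOf_right a b hab) i
    have h2 := DFunLike.congr_fun (permOf_right a' b' hab') i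
    simp only [Function.Embedding.trans_apply, Equiv.coe_toEmbedding] at h1 h2
    simp [← h1, ← h2]

/-- The inner actions only relabel the two families. That relabelling is induced by a permutation of
all labels, which the full symmetrization absorbs. -/
theorem sum_adj_shuffleTerm_adj (hq : q ≠ 0) (hqb : qb ≠ 0) (h : k + l = N) {a : Fin k ↪ Fin N}
    {b : Fin l ↪ Fin N} (hab : Complementary a b) (τ₁ : Equiv.Perm (Fin k))
    (τ₂ : Equiv.Perm (Fin l)) (X : Tens K n k) (Y : Tens K n l) :
    ∑ σ : Equiv.Perm (Fin N), adj q σ (shuffleTerm q qb a b (adj q τ₁ X) (adj q τ₂ Y)) =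
      ∑ σ : Equiv.Perm (Fin N), adj q σ (shuffleTerm q qb a b X Y) := by
  obtain ⟨π, h1, h2⟩ := hab.exists_perm h (hab.perm_trans τ₁ τ₂)
  rw [shuffleTerm_adj hq hqb hab, ← h1, ← h2, ← adj_shuffleTerm hq hab, sum_perm_adj hq]

theorem Complementary.cast {N' : ℕ} (h : N = N') {a : Fin k ↪ Fin N} {b : Fin l ↪ Fin N}
    (hab : Complementary a b) :
    Complementary (a.trans (finCongr h).toEmbedding) (b.trans (finCongr h).toEmbedding) := by
  subst h
  exact hab

theorem isSymm_one (hq : q ≠ 0) : IsSymm q (1 : Tens K n k) := by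
  rw [isSymm_iff hq]
  intro σ
  rw [adj, place_one, mul_one, braid_inv (const_ne_zero hq) (List.nodup_finRange k)
    (finRange_perm_ord σ) (regular_z hq _)]

variable [CharZero K]

/-- Under the outer symmetrization the (k + l)! terms of the inner one contribute equally. -/
theorem sum_adj_shuffleTerm_shuffleProd_left (hq : q ≠ 0) (hqb : qb ≠ 0) (h : k + l + m = N)
    {X : Tens K n k} {Y : Tens K n l} (Z : Tens K n m) (hX : IsSymm q X) (hY : IsSymm q Y)
    {e : Fin (k + l) ↪ Fin N} {c : Fin m ↪ Fin N} (hec : Complementary e c) :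
    ∑ σ : Equiv.Perm (Fin N), adj q σ (shuffleTerm q qb e c (shuffleProd q qb X Y) Z) =
      (((k + l).factorial : K) * ((k.factorial * l.factorial : ℕ) : K)⁻¹) •
      ∑ σ : Equiv.Perm (Fin N), adj q σ (shuffleTerm q qb e c
        (shuffleTerm q qb (Fin.castAddEmb l) (Fin.natAddEmb k) X Y) Z) := by
  have h1 : shuffleTerm q qb e c (shuffleProd q qb X Y) Z =
      ((k.factorial * l.factorial : ℕ) : K)⁻¹ • ∑ ρ : Equiv.Perm (Fin (k + l)),
        shuffleTerm q qb e c (adj q ρ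
          (shuffleTerm q qb (Fin.castAddEmb l) (Fin.natAddEmb k) X Y)) (adj q 1 Z) := by
    rw [shuffleProd_eq_sum hq hqb hX hY, adj_one]
    change (shuffleTermBilin q qb n e c) _ Z = _
    rw [map_smul, LinearMap.smul_apply, map_sum, LinearMap.sum_apply]
    rfl
  simp only [h1, adj_smul, adj_sum]
  rw [← Finset.smul_sum, Finset.sum_comm]
  simp only [sum_adj_shuffleTerm_adj hq hqb h hec]
  rw [Finset.sum_const, Finset.card_univ, Fintype.card_perm, Fintype.card_fin,
    ← Nat.cast_smul_eq_nsmul K, smul_smul, mul_comm]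

theorem sum_adj_shuffleTerm_shuffleProd_right (hq : q ≠ 0) (hqb : qb ≠ 0) (h : m + (k + l) = N)
    {X : Tens K n k} {Y : Tens K n l} (Z : Tens K n m) (hX : IsSymm q X) (hY : IsSymm q Y)
    {e : Fin (k + l) ↪ Fin N} {c : Fin m ↪ Fin N} (hec : Complementary c e) :
    ∑ σ : Equiv.Perm (Fin N), adj q σ (shuffleTerm q qb c e Z (shuffleProd q qb X Y)) =
      (((k + l).factorial : K) * ((k.factorial * l.factorial : ℕ) : K)⁻¹) •
      ∑ σ : Equiv.Perm (Fin N), adj q σ (shuffleTerm q qb c e Z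
        (shuffleTerm q qb (Fin.castAddEmb l) (Fin.natAddEmb k) X Y)) := by
  have h1 : shuffleTerm q qb c e Z (shuffleProd q qb X Y) =
      ((k.factorial * l.factorial : ℕ) : K)⁻¹ • ∑ ρ : Equiv.Perm (Fin (k + l)),
        shuffleTerm q qb c e (adj q 1 Z) (adj q ρ
          (shuffleTerm q qb (Fin.castAddEmb l) (Fin.natAddEmb k) X Y)) := by
    rw [shuffleProd_eq_sum hq hqb hX hY, adj_one]
    change (shuffleTermBilin q qb n c e) Z _ = _
    rw [map_smul, map_sum]
    rfl
  simp only [h1, adj_smul, adj_sum]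
  rw [← Finset.smul_sum, Finset.sum_comm]
  simp only [sum_adj_shuffleTerm_adj hq hqb h hec]
  rw [Finset.sum_const, Finset.card_univ, Fintype.card_perm, Fintype.card_fin,
    ← Nat.cast_smul_eq_nsmul K, smul_smul, mul_comm]

/-- Both sides are 1/(k! l! m!) times the symmetrization of the same threefold term. -/
theorem shuffleProd_assoc (hq : q ≠ 0) (hqb : qb ≠ 0) {X : Tens K n k} {Y : Tens K n l}
    {Z : Tens K n m} (hX : IsSymm q X) (hY : IsSymm q Y) (hZ : IsSymm q Z) :
    DirectSum.lof K ℕ (fun m => Tens K n m) _ (shuffleProd q qb (shuffleProd q qb X Y) Z) =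
      DirectSum.lof K ℕ (fun m => Tens K n m) _ (shuffleProd q qb X (shuffleProd q qb Y Z)) := by
  have h : k + (l + m) = k + l + m := (add_assoc k l m).symm
  have h1 := shuffleProd_cast (qb := qb) hq hqb (isSymm_shuffleProd hq hqb hX hY) hZ
    (rfl : k + l + m = k + l + m)
  have h2 := shuffleProd_cast hq hqb hX (isSymm_shuffleProd (qb := qb) hq hqb hY hZ) h
  have c1 : Complementary ((Fin.castAddEmb m).trans (finCongr rfl).toEmbedding)
      ((Fin.natAddEmb (k + l)).trans (finCongr (rfl : k + l + m = k + l + m)).toEmbedding) :=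
    complementary_add.cast rfl
  have c2 : Complementary ((Fin.castAddEmb (l + m)).trans (finCongr h).toEmbedding)
      ((Fin.natAddEmb k).trans (finCongr h).toEmbedding) := complementary_add.cast h
  rw [sum_adj_shuffleTerm_shuffleProd_left hq hqb rfl Z hX hY c1] at h1
  rw [sum_adj_shuffleTerm_shuffleProd_right hq hqb h X hY hZ c2] at h2
  rw [shuffleTerm_assoc hq hqb (a := (Fin.castAddEmb (l + m)).trans (finCongr h).toEmbedding)
    (b := (Fin.castAddEmb m).trans ((Fin.natAddEmb k).trans (finCongr h).toEmbedding))
    (e' := (Fin.natAddEmb k).trans (finCongr h).toEmbedding) ?_ ?_ rfl ?_ c1 c2] at h1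
  · rw [lof_cast rfl, lof_cast h, h1, h2, smul_smul, smul_smul]
    congr 2
    have f : ∀ i : ℕ, (i.factorial : K) ≠ 0 := fun i => by exact_mod_cast i.factorial_ne_zero
    have := f k
    have := f l
    have := f m
    have := f (k + l)
    have := f (l + m)
    push_cast
    field_simp
  · ext i; simp
  · ext i; simp
  · ext i; simp [add_assoc]

theorem sum_adj_of_isSymm (hq : q ≠ 0) {X : Tens K n k} (hX : IsSymm q X) :
    ((k.factorial : ℕ) : K)⁻¹ • ∑ σ : Equiv.Perm (Fin k), adj q σ X = X := by
  rw [isSymm_iff hq] at hX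
  simp only [hX]
  rw [Finset.sum_const, Finset.card_univ, Fintype.card_perm, Fintype.card_fin,
    ← Nat.cast_smul_eq_nsmul K, smul_smul, inv_mul_cancel₀, one_smul]
  exact_mod_cast k.factorial_ne_zero

theorem one_shuffleProd (hq : q ≠ 0) (hqb : qb ≠ 0) {X : Tens K n k} (hX : IsSymm q X) :
    DirectSum.lof K ℕ (fun m => Tens K n m) _ (shuffleProd q qb (1 : Tens K n 0) X) =
      DirectSum.lof K ℕ (fun m => Tens K n m) k X := by
  rw [lof_cast (zero_add k), shuffleProd_cast hq hqb (isSymm_one hq) hX (zero_add k)]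
  have hb : (Fin.natAddEmb 0).trans (finCongr (zero_add k)).toEmbedding =
      Function.Embedding.refl (Fin k) := by ext i; simp
  have ha : ∀ a : Fin 0 ↪ Fin k, ord a = [] := fun a => rfl
  rw [hb, shuffleTerm, ha, ord_refl, place_one, place_refl]
  simp only [List.nil_append, List.append_nil, braid_self, one_mul, mul_one, shuffleScalar,
    Finset.univ_eq_empty, Finset.prod_empty, one_smul, Nat.factorial_zero]
  rw [sum_adj_of_isSymm hq hX]

theorem shuffleProd_one (hq : q ≠ 0) (hqb : qb ≠ 0) {X : Tens K n k} (hX : IsSymm q X) :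
    DirectSum.lof K ℕ (fun m => Tens K n m) _ (shuffleProd q qb X (1 : Tens K n 0)) =
      DirectSum.lof K ℕ (fun m => Tens K n m) k X := by
  rw [lof_cast (add_zero k), shuffleProd_cast hq hqb hX (isSymm_one hq) (add_zero k)]
  have hb : (Fin.castAddEmb 0).trans (finCongr (add_zero k)).toEmbedding =
      Function.Embedding.refl (Fin k) := by ext i; rfl
  have ha : ∀ a : Fin 0 ↪ Fin k, ord a = [] := fun a => rfl
  rw [hb, shuffleTerm, ha, ord_refl, place_one, place_refl]
  simp only [List.nil_append, List.append_nil, braid_self, one_mul, mul_one, shuffleScalar,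
    Finset.univ_eq_empty, Finset.prod_empty, Finset.prod_const_one, one_smul, Nat.factorial_zero]
  rw [sum_adj_of_isSymm hq hX]

end Associativity
end RShuffle

namespace RShuffle

/-! ### Poles -/

section Poles

variable {K : Type*} [Field K] {F : Type*} [Field F] [Algebra K F] {n k l m N : ℕ} {q qb : K}

theorem algebraMap_ne_zero {p : MvPolynomial (Fin k) K} (hp : p ≠ 0) :
    algebraMap (MvPolynomial (Fin k) K) (RatF K k) p ≠ 0 := by
  rwa [Ne, map_eq_zero_iff _ (IsFractionRing.injective _ _)]

/-- The point `z` with the coordinate `j` replaced by `c z_i`. -/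
def collide (i j : Fin k) (c : K) : Fin k → RatF K k :=
  Function.update z j (const k c * z i)

theorem aeval_collide (i j : Fin k) (c : K) (p : MvPolynomial (Fin k) K) :
    MvPolynomial.aeval (collide i j c) p = algebraMap _ (RatF K k) (subst i j c p) := by
  have : MvPolynomial.aeval (collide i j c) =
      (IsScalarTower.toAlgHom K (MvPolynomial (Fin k) K) (RatF K k)).comp (subst i j c) := by
    ext x
    by_cases hx : x = j
    · subst hx
      simp [collide, subst, algebraMap_C, z]
    · simp [collide, subst, hx, z]
  rw [this]
  rfl

theorem Sp.pow {u : Fin k → F} {g : RatF K k} {h : F} (H : Sp u g h) (r : ℕ) :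
    Sp u (g ^ r) (h ^ r) := by
  simpa using Sp.prod (Finset.range r) (g := fun _ => g) (h := fun _ => h) fun _ _ => H

/-- Modulo the linear form the substitution is the identity on the variables, hence on all
polynomials. -/
theorem sub_dvd_sub_subst (i j : Fin k) (c : K) (p : MvPolynomial (Fin k) K) :
    (MvPolynomial.C c * MvPolynomial.X i - MvPolynomial.X j) ∣ p - subst i j c p := by
  rw [← Ideal.mem_span_singleton, ← Ideal.Quotient.mk_eq_mk_iff_sub_mem]
  set I : Ideal (MvPolynomial (Fin k) K) :=
    Ideal.span {MvPolynomial.C c * MvPolynomial.X i - MvPolynomial.X j}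
  have : Ideal.Quotient.mkₐ K I = (Ideal.Quotient.mkₐ K I).comp (subst i j c) := by
    ext x
    by_cases hx : x = j
    · subst hx
      simp only [AlgHom.comp_apply, subst, MvPolynomial.aeval_X, Function.update_self,
        Ideal.Quotient.mkₐ_eq_mk]
      rw [eq_comm, Ideal.Quotient.mk_eq_mk_iff_sub_mem]
      exact Ideal.subset_span rfl
    · simp [subst, hx]
  exact DFunLike.congr_fun this p

theorem aeval_collide_eq_zero {i j : Fin k} {c : K} {p : MvPolynomial (Fin k) K}
    (h : MvPolynomial.aeval (collide i j c) p = 0) :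
    (MvPolynomial.C c * MvPolynomial.X i - MvPolynomial.X j) ∣ p := by
  rw [aeval_collide, map_eq_zero_iff _ (IsFractionRing.injective _ _)] at h
  simpa [h] using sub_dvd_sub_subst i j c p

/-- The numerator of the product vanishes at the generic point of the hyperplane, so it is divisible
by the linear form, which cancels. Used to remove a simple pole whose leading coefficient is zero.
-/
theorem Sp.exists_of_mul_eq_zero {i j : Fin k} {c : K} (hij : i ≠ j) {g : RatF K k}
    (h : Sp (collide i j c) ((RShuffle.const k c * RShuffle.z i - RShuffle.z j) * g) 0) :
    ∃ v, Sp (collide i j c) g v := by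
  obtain ⟨p, d, hd, h1, h2⟩ := h
  rw [zero_mul] at h2
  obtain ⟨p', rfl⟩ := aeval_collide_eq_zero h2.symm
  refine ⟨MvPolynomial.aeval (collide i j c) p' / MvPolynomial.aeval (collide i j c) d,
    p', d, hd, ?_, div_mul_cancel₀ _ hd⟩
  have hne : (RShuffle.const k c * RShuffle.z i - RShuffle.z j : RatF K k) ≠ 0 := by
    have := linear_ne_zero (K := K) hij.symm (c := -1) (by simp) (-c)
    intro h0
    apply this
    simp only [RShuffle.const, map_neg, map_one] at h0 ⊢
    linear_combination h0
  apply mul_left_cancel₀ hne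
  rw [map_mul, map_sub, map_mul, algebraMap_C] at h1
  rw [← mul_assoc]
  exact h1

/-! ### Laurent polynomials and division by diagonal factors. -/

theorem z_mem_laurent (i : Fin k) : (z i : RatF K k) ∈ laurent K k :=
  Algebra.subset_adjoin (Or.inl ⟨i, rfl⟩)

theorem z_inv_mem_laurent (i : Fin k) : (z i : RatF K k)⁻¹ ∈ laurent K k :=
  Algebra.subset_adjoin (Or.inr ⟨i, rfl⟩)

theorem const_mem_laurent (c : K) : const k c ∈ laurent K k := (laurent K k).algebraMap_mem c

theorem algebraMap_mem_laurent (p : MvPolynomial (Fin k) K) :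
    algebraMap _ (RatF K k) p ∈ laurent K k := by
  induction p using MvPolynomial.induction_on with
  | C c => rw [algebraMap_C]; exact const_mem_laurent c
  | add p r hp hr => rw [map_add]; exact add_mem hp hr
  | mul_X p i hp => rw [map_mul]; exact mul_mem hp (z_mem_laurent i)

theorem mem_laurent_iff {g : RatF K k} : g ∈ laurent K k ↔
    ∃ (r : ℕ) (p : MvPolynomial (Fin k) K), g * (∏ i, z i) ^ r = algebraMap _ (RatF K k) p := by
  have hz : ∀ r : ℕ, (∏ i, z i : RatF K k) ^ r =
      algebraMap _ (RatF K k) ((∏ i : Fin k, (MvPolynomial.X i : MvPolynomial (Fin k) K)) ^ r) := by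
    intro r
    rw [map_pow, map_prod]
    rfl
  constructor
  · intro h
    induction h using Algebra.adjoin_induction with
    | mem x hx =>
      rcases hx with ⟨i, rfl⟩ | ⟨i, rfl⟩
      · exact ⟨0, MvPolynomial.X i, by simp [z]⟩
      · refine ⟨1, ∏ j ∈ Finset.univ.erase i, MvPolynomial.X j, ?_⟩
        rw [pow_one, ← Finset.mul_prod_erase Finset.univ _ (Finset.mem_univ i),
          inv_mul_cancel_left₀ (z_ne_zero i), map_prod]
        rfl
    | algebraMap c => exact ⟨0, MvPolynomial.C c, by rw [pow_zero, mul_one, algebraMap_C]; rfl⟩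
    | add x y _ _ hx hy =>
      obtain ⟨r, p, hp⟩ := hx
      obtain ⟨r', p', hp'⟩ := hy
      refine ⟨r + r', p * (∏ i, MvPolynomial.X i) ^ r' + p' * (∏ i, MvPolynomial.X i) ^ r, ?_⟩
      rw [map_add, map_mul, map_mul, ← hz, ← hz, ← hp, ← hp']
      ring
    | mul x y _ _ hx hy =>
      obtain ⟨r, p, hp⟩ := hx
      obtain ⟨r', p', hp'⟩ := hy
      refine ⟨r + r', p * p', ?_⟩
      rw [map_mul, ← hp, ← hp']
      ring
  · rintro ⟨r, p, h⟩
    have hne : (∏ i, z i : RatF K k) ≠ 0 := Finset.prod_ne_zero_iff.2 fun i _ => z_ne_zero i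
    have : g = algebraMap _ (RatF K k) p * (∏ i, (z i)⁻¹) ^ r := by
      rw [← h, mul_assoc, ← mul_pow, Finset.prod_inv_distrib, mul_inv_cancel₀ hne, one_pow,
        mul_one]
    rw [this]
    exact mul_mem (algebraMap_mem_laurent p)
      (pow_mem (prod_mem fun i _ => z_inv_mem_laurent i) r)

theorem Sp.exists_of_mem_laurent {u : Fin k → F} (hu : ∀ i, u i ≠ 0) {g : RatF K k}
    (hg : g ∈ laurent K k) : ∃ h, Sp u g h := by
  induction hg using Algebra.adjoin_induction with
  | mem x hx =>
    rcases hx with ⟨i, rfl⟩ | ⟨i, rfl⟩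
    exacts [⟨_, Sp.z u i⟩, ⟨_, (Sp.z u i).inv (hu i)⟩]
  | algebraMap c => exact ⟨_, Sp.const u c⟩
  | add x y _ _ hx hy =>
    obtain ⟨_, hx⟩ := hx
    obtain ⟨_, hy⟩ := hy
    exact ⟨_, hx.add hy⟩
  | mul x y _ _ hx hy =>
    obtain ⟨_, hx⟩ := hx
    obtain ⟨_, hy⟩ := hy
    exact ⟨_, hx.mul hy⟩

/-- After clearing monomials, the polynomial representing the product vanishes on z_i = z_j because
`g` is regular there, so it is divisible by z_i - z_j. -/
theorem mem_laurent_of_mul_mem {i j : Fin k} (hij : i ≠ j) {g : RatF K k}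
    (h : (z i - z j) * g ∈ laurent K k) (hg : ∃ v, Sp (collide i j (1 : K)) g v) :
    g ∈ laurent K k := by
  obtain ⟨r, p, hp⟩ := mem_laurent_iff.1 h
  obtain ⟨v, hv⟩ := hg
  have h1 : Sp (collide i j (1 : K)) ((z i - z j) * g * (∏ i, z i) ^ r) 0 := by
    have e1 : Sp (collide i j (1 : K)) (z i - z j : RatF K k) 0 := by
      have := (Sp.z (K := K) (collide i j (1 : K)) i).sub (Sp.z (collide i j (1 : K)) j)
      simpa [collide, hij, const] using this
    have e2 : ∃ w, Sp (collide i j (1 : K)) ((∏ i, z i : RatF K k) ^ r) w := by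
      obtain ⟨w, hw⟩ := Sp.exists_prod (u := collide i j (1 : K)) Finset.univ (g := (z : Fin k → RatF K k))
        fun p _ => ⟨_, Sp.z (collide i j (1 : K)) p⟩
      exact ⟨_, hw.pow r⟩
    obtain ⟨w, hw⟩ := e2
    simpa using (e1.mul hv).mul hw
  rw [hp] at h1
  obtain ⟨p', rfl⟩ := aeval_collide_eq_zero (h1.unique (Sp.of_poly _ p)).symm
  refine mem_laurent_iff.2 ⟨r, p', mul_left_cancel₀ (z_sub_ne_zero hij) ?_⟩
  rw [← mul_assoc, hp, map_mul]
  simp [z]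

/-- A rational function with poles along the diagonals only is a Laurent polynomial if it is
regular there. -/
theorem mem_laurent_of_prod_mul_mem (s : Finset (Fin k × Fin k)) (hs : ∀ p ∈ s, p.1 ≠ p.2)
    {g : RatF K k} (h : (∏ p ∈ s, (z p.1 - z p.2)) * g ∈ laurent K k)
    (hg : ∀ p ∈ s, ∃ v, Sp (collide p.1 p.2 (1 : K)) g v) : g ∈ laurent K k := by
  classical
  induction s using Finset.induction_on with
  | empty => rwa [Finset.prod_empty, one_mul] at h
  | insert p s hp ih =>
    rw [Finset.prod_insert hp, mul_assoc] at h
    refine ih (fun p' h' => hs p' (Finset.mem_insert_of_mem h')) ?_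
      fun p' h' => hg p' (Finset.mem_insert_of_mem h')
    refine mem_laurent_of_mul_mem (hs p (Finset.mem_insert_self p s)) h ?_
    obtain ⟨v, hv⟩ := hg p (Finset.mem_insert_self p s)
    obtain ⟨w, hw⟩ := Sp.exists_prod (u := collide p.1 p.2 (1 : K)) s
      (g := fun p' => (z p'.1 - z p'.2 : RatF K k)) fun p' _ =>
        ⟨_, (Sp.z (collide p.1 p.2 (1 : K)) p'.1).sub (Sp.z (collide p.1 p.2 (1 : K)) p'.2)⟩
    exact ⟨_, hw.mul hv⟩

/-- Operators with Laurent polynomial entries. -/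
def LaurentM (M : Tens K n k) : Prop := ∀ I J, M I J ∈ laurent K k

theorem LaurentM.one : LaurentM (1 : Tens K n k) := by
  intro I J
  rw [Matrix.one_apply]
  split_ifs
  exacts [one_mem _, zero_mem _]

theorem LaurentM.mul {M M' : Tens K n k} (h : LaurentM M) (h' : LaurentM M') :
    LaurentM (M * M') := by
  intro I J
  rw [Matrix.mul_apply]
  exact sum_mem fun _ _ => mul_mem (h _ _) (h' _ _)

theorem LaurentM.smul {c : RatF K k} (hc : c ∈ laurent K k) {M : Tens K n k} (h : LaurentM M) :
    LaurentM (c • M) := fun I J => mul_mem hc (h I J)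

theorem LaurentM.smul_mul_smul {c c' : RatF K k} {M M' : Tens K n k} (h : LaurentM (c • M))
    (h' : LaurentM (c' • M')) : LaurentM ((c * c') • (M * M')) := by
  have := h.mul h'
  rwa [smul_mul_smul_comm] at this

theorem LaurentM.list_prod {α : Type*} (s : List α) {c : α → RatF K k} {M : α → Tens K n k}
    (h : ∀ x ∈ s, LaurentM (c x • M x)) : LaurentM ((s.map c).prod • (s.map M).prod) := by
  induction s with
  | nil => simpa using LaurentM.one
  | cons x s ih =>
    simp only [List.map_cons, List.prod_cons]
    exact (h x (by simp)).smul_mul_smul (ih fun y hy => h y (by simp [hy]))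

theorem laurentM_Rn {a b : Fin k} {x y : RatF K k} (hx : x ∈ laurent K k) (hy : y ∈ laurent K k) :
    LaurentM (Rn (const k q) a b x y : Tens K n k) := by
  have hq := const_mem_laurent (k := k) q
  have hq' : (const k q)⁻¹ ∈ laurent K k := by
    have := const_mem_laurent (k := k) q⁻¹
    rwa [const, map_inv₀] at this
  intro I J
  refine add_mem ?_ (LaurentM.mul (n := n) ?_ ?_ I J)
  · rw [Matrix.diagonal_apply]
    split_ifs
    exacts [sub_mem (mul_mem hq hy) (mul_mem hq' hx), sub_mem hy hx, zero_mem _]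
  · intro I J
    rw [Matrix.diagonal_apply]
    split_ifs
    exacts [zero_mem _, mul_mem (sub_mem hq hq') hx, mul_mem (sub_mem hq hq') hy, zero_mem _]
  · intro I J
    simp only [permF, Matrix.of_apply]
    split_ifs
    exacts [one_mem _, zero_mem _]

theorem laurentM_R {a b : Fin k} (hab : a ≠ b) {x y : RatF K k} (hx : x ∈ laurent K k)
    (hy : y ∈ laurent K k) (hy0 : y ≠ 0) (hxy : y - x ≠ 0) :
    LaurentM ((y - x) • R q a b (x / y) : Tens K n k) := by
  rw [R_eq_smul_Rn q hab hy0 hxy, smul_smul, mul_inv_cancel₀ hxy, one_smul]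
  exact laurentM_Rn hx hy

theorem LaurentM.neg_smul {c : RatF K k} {M : Tens K n k} (h : LaurentM (c • M)) :
    LaurentM ((-c) • M) := by
  intro I J
  rw [_root_.neg_smul]
  exact neg_mem (h I J)

/-- The denominator `∏_{i ≠ j} (z_i - z_j q̄²)`. -/
def poleDen (qb : K) (k : ℕ) : RatF K k :=
  ∏ p ∈ (Finset.univ : Finset (Fin k × Fin k)).filter (fun p => p.1 ≠ p.2),
    (z p.1 - z p.2 * const k qb ^ 2)

theorem z_sub_mul_ne_zero {i j : Fin k} (hij : i ≠ j) (c : K) :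
    (z i - z j * const k c : RatF K k) ≠ 0 := by
  have := linear_ne_zero (K := K) hij (c := 1) (by simp) c
  intro h0
  apply this
  simp only [const, map_one] at h0 ⊢
  linear_combination h0

theorem poleDen_ne_zero (qb : K) (k : ℕ) : poleDen qb k ≠ 0 := by
  refine Finset.prod_ne_zero_iff.2 fun p hp => ?_
  have := z_sub_mul_ne_zero (Finset.mem_filter.1 hp).2 (qb ^ 2)
  rwa [const, map_pow] at this

theorem hasAllowedPoles_iff {X : Tens K n k} :
    HasAllowedPoles qb X ↔ LaurentM (poleDen qb k • X) := by
  constructor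
  · rintro ⟨x, hx, rfl⟩
    change LaurentM (poleDen qb k • (poleDen qb k)⁻¹ • x)
    rwa [smul_smul, mul_inv_cancel₀ (poleDen_ne_zero qb k), one_smul]
  · intro h
    refine ⟨_, h, ?_⟩
    change X = (poleDen qb k)⁻¹ • poleDen qb k • X
    rw [smul_smul, inv_mul_cancel₀ (poleDen_ne_zero qb k), one_smul]

theorem varMap_mem_laurent (a : Fin k ↪ Fin N) {g : RatF K k} (hg : g ∈ laurent K k) :
    varMap a g ∈ laurent K N := by
  induction hg using Algebra.adjoin_induction with
  | mem x hx =>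
    rcases hx with ⟨i, rfl⟩ | ⟨i, rfl⟩
    · rw [varMap_z]; exact z_mem_laurent _
    · simp only [map_inv₀, varMap_z]; exact z_inv_mem_laurent _
  | algebraMap c => rw [AlgHom.commutes]; exact (laurent K N).algebraMap_mem c
  | add x y _ _ hx hy => rw [map_add]; exact add_mem hx hy
  | mul x y _ _ hx hy => rw [map_mul]; exact mul_mem hx hy

theorem LaurentM.place (a : Fin k ↪ Fin N) {X : Tens K n k} (h : LaurentM X) :
    LaurentM (place a X) := by
  intro I J
  simp only [RShuffle.place, Matrix.of_apply]
  split_ifs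
  exacts [varMap_mem_laurent a (h _ _), zero_mem _]

theorem Complementary.prod_univ {M : Type*} [CommMonoid M] {a : Fin k ↪ Fin N} {b : Fin l ↪ Fin N}
    (h : Complementary a b) (g : Fin N → M) : ∏ x, g x = (∏ i, g (a i)) * ∏ j, g (b j) := by
  rw [Fin.prod_univ_def, (h.perm.map g).prod_eq, List.map_append, List.prod_append,
    Fin.prod_univ_def, Fin.prod_univ_def]
  simp [ord, Function.comp_def]

theorem prod_filter_ne {M : Type*} [CommMonoid M] (g : Fin k → Fin k → M) :
    ∏ p ∈ (Finset.univ : Finset (Fin k × Fin k)).filter (fun p => p.1 ≠ p.2), g p.1 p.2 =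
      ∏ i, ∏ j, if i ≠ j then g i j else 1 := by
  rw [Finset.prod_filter, Fintype.prod_prod_type]

/-- A product over the pairs of distinct labels, split according to a decomposition. -/
theorem Complementary.prod_filter_ne {M : Type*} [CommMonoid M] {a : Fin k ↪ Fin N}
    {b : Fin l ↪ Fin N} (h : Complementary a b) (g : Fin N → Fin N → M) :
    ∏ p ∈ (Finset.univ : Finset (Fin N × Fin N)).filter (fun p => p.1 ≠ p.2), g p.1 p.2 =
      (∏ p ∈ (Finset.univ : Finset (Fin k × Fin k)).filter (fun p => p.1 ≠ p.2),
        g (a p.1) (a p.2)) *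
      (∏ p ∈ (Finset.univ : Finset (Fin l × Fin l)).filter (fun p => p.1 ≠ p.2),
        g (b p.1) (b p.2)) * (∏ i, ∏ j, g (a i) (b j)) * ∏ i, ∏ j, g (b j) (a i) := by
  have e1 : ∀ i, ∏ y, (if a i ≠ y then g (a i) y else 1) =
      (∏ j, if i ≠ j then g (a i) (a j) else 1) * ∏ j, g (a i) (b j) := by
    intro i
    rw [h.prod_univ]
    congr 1
    · exact Finset.prod_congr rfl fun j _ => if_congr a.injective.ne_iff rfl rfl
    · exact Finset.prod_congr rfl fun j _ => if_pos (h.disj i j)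
  have e2 : ∀ j, ∏ y, (if b j ≠ y then g (b j) y else 1) =
      (∏ i, g (b j) (a i)) * ∏ i, if j ≠ i then g (b j) (b i) else 1 := by
    intro j
    rw [h.prod_univ]
    congr 1
    · exact Finset.prod_congr rfl fun i _ => if_pos (h.disj i j).symm
    · exact Finset.prod_congr rfl fun i _ => if_congr b.injective.ne_iff rfl rfl
  rw [RShuffle.prod_filter_ne, h.prod_univ, Finset.prod_congr rfl fun i _ => e1 i,
    Finset.prod_congr rfl fun j _ => e2 j, Finset.prod_mul_distrib, Finset.prod_mul_distrib,
    RShuffle.prod_filter_ne fun i j => g (a i) (a j),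
    RShuffle.prod_filter_ne fun i j => g (b i) (b j),
    Finset.prod_comm (f := fun j i => g (b j) (a i))]
  rw [mul_assoc, mul_assoc, mul_assoc]
  congr 1
  rw [mul_comm (∏ i, ∏ j, g (b j) (a i)), mul_left_comm]

/-- The product of the differences `z_i - z_j` for `i < j`. -/
def diagDen (K : Type*) [Field K] (k : ℕ) : RatF K k :=
  ∏ p ∈ (Finset.univ : Finset (Fin k × Fin k)).filter (fun p => p.1 < p.2), (z p.1 - z p.2)

theorem diagDen_eq : diagDen K k =
    ∏ p ∈ (Finset.univ : Finset (Fin k × Fin k)).filter (fun p => p.1 ≠ p.2),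
      if p.1 < p.2 then (z p.1 - z p.2 : RatF K k) else 1 := by
  rw [diagDen, Finset.prod_filter, Finset.prod_filter]
  refine Finset.prod_congr rfl fun p _ => ?_
  by_cases h : p.1 < p.2
  · simp [h, h.ne]
  · simp [h]

/-! ### Clearing the denominators of the shuffle product. -/

theorem laurentM_grid {s : List (Fin k)} {t : List (Fin l)} {c : Fin k → Fin l → RatF K N}
    {M : Fin k → Fin l → Tens K n N} (h : ∀ i j, LaurentM (c i j • M i j)) :
    LaurentM ((s.map fun i => (t.map fun j => c i j).prod).prod •
      (s.map fun i => (t.map fun j => M i j).prod).prod) :=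
  LaurentM.list_prod s fun i _ => LaurentM.list_prod t fun j _ => h i j

theorem laurentM_leftFactor {a : Fin k ↪ Fin N} {b : Fin l ↪ Fin N} (h : Complementary a b) :
    LaurentM ((∏ i, ∏ j, if a i < b j then (z (a i) - z (b j) : RatF K N) else 1) •
      leftFactor q a b : Tens K n N) := by
  rw [← list_grid_prod_reverse]
  refine laurentM_grid fun i j => ?_
  split_ifs
  · rw [← neg_sub]
    exact LaurentM.neg_smul (laurentM_R (h.disj i j) (z_mem_laurent _) (z_mem_laurent _)
      (z_ne_zero _) (z_sub_ne_zero (h.disj i j).symm))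
  · rw [one_smul]
    exact LaurentM.one

theorem laurentM_rightFactor {a : Fin k ↪ Fin N} {b : Fin l ↪ Fin N} (h : Complementary a b) :
    LaurentM ((∏ i, ∏ j, if b j < a i then (z (b j) - z (a i) : RatF K N) else 1) •
      rightFactor q a b : Tens K n N) := by
  rw [← list_grid_prod_reverse]
  refine laurentM_grid fun i j => ?_
  split_ifs
  · exact laurentM_R (h.disj i j) (z_mem_laurent _) (z_mem_laurent _)
      (z_ne_zero _) (z_sub_ne_zero (h.disj i j).symm)
  · rw [one_smul]
    exact LaurentM.one

/-- The poles created by R̃ are at z_b = z_a q̄², among the allowed ones. -/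
theorem laurentM_middleFactor (hqb : qb ≠ 0) {a : Fin k ↪ Fin N} {b : Fin l ↪ Fin N}
    (h : Complementary a b) :
    LaurentM ((∏ i, ∏ j, (z (b j) - z (a i) * const N qb ^ 2)) •
      middleFactor q qb a b : Tens K n N) := by
  rw [← list_grid_prod_reverse']
  refine laurentM_grid fun i j => ?_
  have e : (1 : RatF K N) / (z (a i) / z (b j) * const N qb ^ 2) =
      z (b j) / (z (a i) * const N qb ^ 2) := by
    rw [div_mul_eq_mul_div, one_div_div]
  have h1 := z_sub_mul_ne_zero (h.disj i j).symm (qb ^ 2)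
  rw [const, map_pow] at h1
  rw [Rtilde, e, ← neg_sub]
  exact LaurentM.neg_smul (laurentM_R (h.disj i j).symm (z_mem_laurent _)
    (mul_mem (z_mem_laurent _) (pow_mem (const_mem_laurent qb) 2))
    (mul_ne_zero (z_ne_zero _) (pow_ne_zero 2 (const_ne_zero hqb)))
    (by rw [← neg_sub]; exact neg_ne_zero.2 h1))

theorem varMap_poleDen (a : Fin k ↪ Fin N) : varMap a (poleDen qb k) =
    ∏ p ∈ (Finset.univ : Finset (Fin k × Fin k)).filter (fun p => p.1 ≠ p.2),
      (z (a p.1) - z (a p.2) * const N qb ^ 2) := by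
  simp only [poleDen, map_prod, map_sub, map_mul, map_pow, varMap_z, varMap_const]

/-- Pairs within one family are cleared by the pole conditions of `X` and `Y`, mixed pairs by the
three products of R-matrices. Each mixed pair has one factor z_i - z_j, in the outer factor where it
occurs. -/
theorem laurentM_term (hqb : qb ≠ 0) {a : Fin k ↪ Fin N} {b : Fin l ↪ Fin N}
    (h : Complementary a b) {X : Tens K n k} {Y : Tens K n l} (hX : HasAllowedPoles qb X)
    (hY : HasAllowedPoles qb Y) :
    LaurentM ((diagDen K N * poleDen qb N) • (leftFactor q a b * place a X * middleFactor q qb a b *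
      place b Y * rightFactor q a b)) := by
  have hX' := (hasAllowedPoles_iff.1 hX).place a
  have hY' := (hasAllowedPoles_iff.1 hY).place b
  rw [place_smul', varMap_poleDen] at hX' hY'
  have h0 := ((((laurentM_leftFactor (q := q) h).smul_mul_smul hX').smul_mul_smul
    (laurentM_middleFactor (q := q) hqb h)).smul_mul_smul hY').smul_mul_smul
    (laurentM_rightFactor (q := q) h)
  have e1 := h.prod_filter_ne fun i j => (z i - z j * const N qb ^ 2 : RatF K N)
  have e2 := h.prod_filter_ne fun i j => if i < j then (z i - z j : RatF K N) else 1
  rw [← poleDen] at e1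
  rw [← diagDen_eq] at e2
  have L1 : ∀ i j : Fin N, (z i - z j * const N qb ^ 2 : RatF K N) ∈ laurent K N := fun i j =>
    sub_mem (z_mem_laurent i) (mul_mem (z_mem_laurent j) (pow_mem (const_mem_laurent qb) 2))
  have L2 : ∀ i j : Fin N, (if i < j then (z i - z j : RatF K N) else 1) ∈ laurent K N := by
    intro i j
    split_ifs
    exacts [sub_mem (z_mem_laurent i) (z_mem_laurent j), one_mem _]
  -- The factors of `diagDen * poleDen` that nothing in the term requires; they are polynomials and
  -- may be multiplied in.
  have h1 := h0.smul (mul_mem (prod_mem fun i _ => prod_mem fun j _ => L1 (a i) (b j))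
    (mul_mem (prod_mem fun p _ => L2 (a p.1) (a p.2)) (prod_mem fun p _ => L2 (b p.1) (b p.2))) :
      (∏ i, ∏ j, (z (a i) - z (b j) * const N qb ^ 2)) *
      ((∏ p ∈ (Finset.univ : Finset (Fin k × Fin k)).filter (fun p => p.1 ≠ p.2),
        if a p.1 < a p.2 then (z (a p.1) - z (a p.2) : RatF K N) else 1) *
      ∏ p ∈ (Finset.univ : Finset (Fin l × Fin l)).filter (fun p => p.1 ≠ p.2),
        if b p.1 < b p.2 then (z (b p.1) - z (b p.2) : RatF K N) else 1) ∈ laurent K N)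
  rw [smul_smul] at h1
  convert h1 using 2
  rw [e1, e2]
  ring

theorem LaurentM.sum {α : Type*} (s : Finset α) {M : α → Tens K n k} (h : ∀ x ∈ s, LaurentM (M x)) :
    LaurentM (∑ x ∈ s, M x) := by
  intro I J
  rw [Matrix.sum_apply]
  exact sum_mem fun x hx => h x hx I J

theorem laurentM_shuffleProd (hqb : qb ≠ 0) {X : Tens K n k} {Y : Tens K n l}
    (hX : HasAllowedPoles qb X) (hY : HasAllowedPoles qb Y) :
    LaurentM ((diagDen K (k + l) * poleDen qb (k + l)) • shuffleProd q qb X Y) := by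
  rw [shuffleProd, Finset.smul_sum]
  exact LaurentM.sum _ fun p hp => laurentM_term hqb (complementary_of_mem_shuffles hp) hX hY

/-! ### Absence of poles along the diagonals. -/

theorem collide_ne_zero (i j p : Fin k) : collide i j (1 : K) p ≠ 0 := by
  by_cases h : p = j
  · subst h
    simpa [collide, const] using z_ne_zero i
  · simpa [collide, h] using z_ne_zero p

theorem collide_swap (i j p : Fin k) :
    collide i j (1 : K) (Equiv.swap i j p) = collide i j (1 : K) p := by
  by_cases hij : i = j
  · subst hij; simp
  by_cases h : p = j
  · subst h
    simp [collide, hij, const]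
  by_cases h' : p = i
  · subst h'
    simp [collide, hij, const]
  · rw [Equiv.swap_apply_of_ne_of_ne h' h]

theorem collide_sub_ne_zero (i j x y : Fin k) {c d : K} (hc : c ≠ 0) (hcd : c ≠ d) :
    const k c * collide i j (1 : K) x - const k d * collide i j (1 : K) y ≠ 0 := by
  have h1 : ∀ p, const k c * z p - const k d * z p ≠ 0 := by
    intro p
    rw [← sub_mul, const, const, ← map_sub]
    exact mul_ne_zero (const_ne_zero (sub_ne_zero.2 hcd)) (z_ne_zero p)
  have h2 : ∀ p p', const k c * z p - const k d * z p' ≠ 0 := by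
    intro p p'
    by_cases h : p = p'
    · rw [h]; exact h1 p'
    · exact linear_ne_zero h hc d
  have h3 : ∀ p, ∃ p', collide i j (1 : K) p = z p' := by
    intro p
    by_cases h : p = j
    · exact ⟨i, by simp [collide, h, const]⟩
    · exact ⟨p, by simp [collide, h]⟩
  obtain ⟨x', hx⟩ := h3 x
  obtain ⟨y', hy⟩ := h3 y
  rw [hx, hy]
  exact h2 x' y'

/-- Two strands may now share a variable, so q² ≠ 1 is needed; it is the case `m = 0` of
`qb_pow_ne`. -/
theorem regular_collide (hq : GenericParams q qb) (i j : Fin k) (l : List (Fin k)) :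
    Regular (const k q) (collide i j (1 : K)) l := by
  intro a _ b _ _
  have := collide_sub_ne_zero i j b a hq.q_ne (d := q⁻¹) (by
    intro h
    have := hq.qb_pow_ne 0
    rw [pow_zero, sq] at this
    apply this
    nth_rewrite 1 [h]
    exact (inv_mul_cancel₀ hq.q_ne).symm)
  rwa [const, const, map_inv₀] at this

/-- A symmetric tensor has no simple poles along the diagonals. -/
theorem IsSymm.regular_of_simple_pole [CharZero K] (hq : GenericParams q qb) {W : Tens K n N}
    (hW : IsSymm q W) {i j : Fin N} (hij : i ≠ j)
    (h : ∀ I J, ∃ v, Sp (collide i j (1 : K)) ((z i - z j) * W I J) v) (I J : Fin N → Fin n) :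
    ∃ v, Sp (collide i j (1 : K)) (W I J) v := by
  choose T hT using h
  have hs := (isSymm_iff hq.q_ne W).1 hW (Equiv.swap i j)
  set s := Equiv.swap i j with hs_def
  have hδ : SpM (collide i j (1 : K)) ((z i - z j : RatF K N) • W) (Matrix.of T) := fun I J => by
    rw [Matrix.smul_apply, smul_eq_mul]
    exact hT I J
  have hcol : collide i j (1 : K) ∘ s.toEmbedding = collide i j (1 : K) :=
    funext fun p => collide_swap i j p
  -- The symmetric `W` is fixed by the transposition, while the factor z_i - z_j changes sign.
  have h1 : (z i - z j : RatF K N) • W = (-1 : RatF K N) • (adj q s ((z i - z j : RatF K N) • W)) := by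
    rw [adj_ratF_smul, hs, smul_smul]
    congr 1
    rw [map_sub, varMap_z, varMap_z, hs_def]
    simp
  have hreg := regular_collide hq i j
  have nd := List.nodup_finRange N
  -- On the hyperplane z_i = z_j the braid lifting the transposition is the transposition operator.
  have hb := braid_map_perm (n := n) (const_ne_zero (N := N) hq.q_ne) nd (List.mem_finRange)
    (hreg _) s (fun p => collide_swap i j p)
  have hinv := braid_inv (n := n) (const_ne_zero hq.q_ne) nd (finRange_perm_ord s) (hreg _)
  have hss : s⁻¹ = s := Equiv.swap_inv i j
  rw [hss] at hb
  have hb' : braid (const N q) (collide i j (1 : K)) (List.finRange N) (ord s.toEmbedding) =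
      (permF s : Op (RatF K N) n (Fin N)) := hb
  have hb2 : braid (const N q) (collide i j (1 : K)) (ord s.toEmbedding) (List.finRange N) =
      (permF s : Op (RatF K N) n (Fin N)) := by
    have e : (permF s * permF s : Op (RatF K N) n (Fin N)) = 1 := by
      conv_lhs => rw [← hss]
      rw [hss]
      nth_rewrite 1 [← hss]
      exact permF_inv_mul s
    rw [hb'] at hinv
    calc _ = (permF s * permF s) * _ := by rw [e, one_mul]
      _ = _ := by rw [mul_assoc, hinv, mul_one]
  have hB := SpM.braid (n := n) q (u := collide i j (1 : K)) (w := z) (Sp.z _)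
    (l := List.finRange N) (t := ord s.toEmbedding) (fun _ _ => List.mem_finRange _)
    (hreg _) (ord_nodup _)
  have hB' := SpM.braid (n := n) q (u := collide i j (1 : K)) (w := z) (Sp.z _)
    (l := ord s.toEmbedding) (t := List.finRange N)
    (fun y _ => (finRange_perm_ord s).mem_iff.1 (List.mem_finRange y)) (hreg _) nd
  have hP : SpM (collide i j (1 : K)) (place s.toEmbedding ((z i - z j : RatF K N) • W))
      (act s.toEmbedding (Matrix.of T)) := SpM.place s.toEmbedding (by rw [hcol]; exact hδ)
  have h2 := SpM.smul (Sp.const (collide i j (1 : K)) (-1 : K)) ((hB.mul hP).mul hB')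
  have e3 : (-1 : RatF K N) = const N (-1 : K) := by simp [const]
  rw [adj, e3] at h1
  have h3 : SpM (collide i j (1 : K)) (const N (-1 : K) • (
      braid (const N q) z (List.finRange N) (ord s.toEmbedding) *
        place s.toEmbedding ((z i - z j : RatF K N) • W) *
      braid (const N q) z (ord s.toEmbedding) (List.finRange N))) (const N (-1 : K) • (
      braid (const N q) (collide i j (1 : K)) (List.finRange N) (ord s.toEmbedding) *
        act s.toEmbedding (Matrix.of T) *
      braid (const N q) (collide i j (1 : K)) (ord s.toEmbedding) (List.finRange N))) := h2
  rw [← h1, hb', hb2, ← e3] at h3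
  have h4 := hδ.unique h3
  have h5 := permF_mul_act (n := n) s (Function.Embedding.refl _) (Matrix.of T)
  rw [act_refl] at h5
  have h6 : (permF s * permF s : Op (RatF K N) n (Fin N)) = 1 := by
    nth_rewrite 1 [← hss]
    exact permF_inv_mul s
  -- The two transposition operators undo the relabelling of `T`, so the equation for the values
  -- reads T = -T.
  have h7 : (Matrix.of T : Tens K n N) = -Matrix.of T := by
    have e5 : (permF s * act s.toEmbedding (Matrix.of T) * permF s : Tens K n N) = Matrix.of T := by
      have : (act s.toEmbedding (Matrix.of T) * permF s : Tens K n N) =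
        permF s * Matrix.of T := h5.symm
      rw [mul_assoc, this, ← mul_assoc, h6, one_mul]
    rw [e5] at h4
    rw [← neg_one_smul (RatF K N) (Matrix.of T)]
    exact h4
  have h8 : T I J = 0 := by
    have := congrFun (congrFun h7 I) J
    simp only [Matrix.of_apply, Matrix.neg_apply] at this
    exact self_eq_neg.1 this
  refine Sp.exists_of_mul_eq_zero hij ?_
  have := hT I J
  rw [h8] at this
  simpa [const] using this

theorem hasAllowedPoles_shuffleProd [CharZero K] (hq : GenericParams q qb) {X : Tens K n k}
    {Y : Tens K n l} (hX : HasAllowedPoles qb X) (hY : HasAllowedPoles qb Y)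
    (hX' : IsSymm q X) (hY' : IsSymm q Y) : HasAllowedPoles qb (shuffleProd q qb X Y) := by
  rw [hasAllowedPoles_iff]
  have hL := laurentM_shuffleProd (q := q) hq.qb_ne hX hY
  have hs := isSymm_shuffleProd hq.q_ne hq.qb_ne hX' hY'
  generalize shuffleProd q qb X Y = W at *
  have hD : ∀ i j : Fin (k + l), ∃ v, v ≠ 0 ∧ Sp (collide i j (1 : K)) (poleDen qb (k + l)) v := by
    intro i j
    refine ⟨_, ?_, Sp.prod _ fun p _ => (Sp.z _ p.1).sub
      ((Sp.z _ p.2).mul ((Sp.const (collide i j (1 : K)) qb).pow 2))⟩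
    refine Finset.prod_ne_zero_iff.2 fun p _ => ?_
    have h1 := collide_sub_ne_zero i j p.1 p.2 one_ne_zero (hq.qb_pow 2 (by norm_num)).symm
    simpa [const, mul_comm] using h1
  have hreg : ∀ i j : Fin (k + l), i < j → ∀ I J, ∃ v, Sp (collide i j (1 : K)) (W I J) v := by
    intro i j hij
    refine hs.regular_of_simple_pole hq hij.ne fun I J => ?_
    obtain ⟨v, hv⟩ := Sp.exists_of_mem_laurent (collide_ne_zero (K := K) i j) (hL I J)
    obtain ⟨w, hw, hw'⟩ := hD i j
    set P := (Finset.univ : Finset (Fin (k + l) × Fin (k + l))).filter (fun p => p.1 < p.2)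
    have hm : (i, j) ∈ P := by simp [P, hij]
    have hE : Sp (collide i j (1 : K))
        (∏ p ∈ P.erase (i, j), (z p.1 - z p.2 : RatF K (k + l))) _ :=
      Sp.prod _ fun p _ => (Sp.z _ p.1).sub (Sp.z _ p.2)
    -- On z_i = z_j only one of the factors z_p - z_p' with p < p' vanishes, so the pole of `W`
    -- there is at most simple.
    have hE0 : (∏ p ∈ P.erase (i, j), (collide i j (1 : K) p.1 - collide i j (1 : K) p.2)) ≠ 0 := by
      refine Finset.prod_ne_zero_iff.2 fun p hp => ?_
      obtain ⟨hp1, hp2⟩ := Finset.mem_erase.1 hp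
      have hp3 : p.1 < p.2 := (Finset.mem_filter.1 hp2).2
      have hp4 : ¬ (p.1 = i ∧ p.2 = j) := fun h => hp1 (Prod.ext h.1 h.2)
      simp only [collide, Function.update_apply, const, map_one, one_mul]
      split_ifs with h1 h2 h2
      · exact absurd (h1.trans h2.symm) hp3.ne
      · refine z_sub_ne_zero fun h => ?_
        rw [← h, h1] at hp3
        exact (hp3.trans hij).false
      · exact z_sub_ne_zero fun h => hp4 ⟨h, h2⟩
      · exact z_sub_ne_zero hp3.ne
    have h3 := (hv.mul (hE.inv hE0)).mul (hw'.inv hw)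
    have e : ((diagDen K (k + l) * poleDen qb (k + l)) • W) I J *
        (∏ p ∈ P.erase (i, j), (z p.1 - z p.2))⁻¹ * (poleDen qb (k + l))⁻¹ =
        (z i - z j) * W I J := by
      simp only [Matrix.smul_apply, smul_eq_mul, diagDen]
      rw [← Finset.mul_prod_erase P _ hm]
      have n1 : (∏ p ∈ P.erase (i, j), (z p.1 - z p.2 : RatF K (k + l))) ≠ 0 :=
        Finset.prod_ne_zero_iff.2 fun p hp =>
          z_sub_ne_zero (Finset.mem_filter.1 (Finset.mem_erase.1 hp).2).2.ne
      have n2 := poleDen_ne_zero qb (k + l)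
      field_simp
    rw [e] at h3
    exact ⟨_, h3⟩
  intro I J
  refine mem_laurent_of_prod_mul_mem
    ((Finset.univ : Finset (Fin (k + l) × Fin (k + l))).filter (fun p => p.1 < p.2))
    (fun p hp => (Finset.mem_filter.1 hp).2.ne) ?_ fun p hp => ?_
  · have := hL I J
    rwa [mul_smul] at this
  · obtain ⟨v, hv⟩ := hreg p.1 p.2 (Finset.mem_filter.1 hp).2 I J
    obtain ⟨w, _, hw⟩ := hD p.1 p.2
    exact ⟨_, hw.mul hv⟩

end Poles
end RShuffle

namespace RShuffle

/-! ### Operators of wheel form -/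

section WheelForm

variable {F : Type*} [Field F] {n k l N : ℕ}

theorem act_permF {ι κ : Type*} [Fintype ι] [DecidableEq ι] [Fintype κ] [DecidableEq κ] {a : ι ↪ κ}
    {σ : Equiv.Perm ι} {ρ : Equiv.Perm κ} (h : ∀ i, ρ (a i) = a (σ i))
    (h' : ∀ x, x ∉ Set.range a → ρ x = x) : act a (permF σ : Op F n ι) = permF ρ := by
  ext I J
  simp only [act, permF, Matrix.of_apply]
  by_cases hc : I ∘ ρ = J
  · subst hc
    rw [if_pos rfl, if_pos, if_pos]
    · funext i
      simp [h]
    · intro m hm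
      rw [Function.comp_apply, h' m hm]
  · rw [if_neg hc]
    split_ifs with h1 h2
    · refine absurd (funext fun x => ?_) hc
      by_cases hx : x ∈ Set.range a
      · obtain ⟨i, rfl⟩ := hx
        rw [Function.comp_apply, h]
        exact congrFun h2 i
      · rw [Function.comp_apply, h' x hx, h1 x hx]
    · rfl
    · rfl

theorem permF_mem_loc {κ : Type*} [Fintype κ] [DecidableEq κ] {τ : Equiv.Perm κ} {S : Finset κ}
    (h : ∀ x, x ∉ S → τ x = x) : (permF τ : Op F n κ) ∈ loc F n S := by
  have hS : ∀ x, x ∈ S ↔ τ x ∈ S := by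
    intro x
    constructor
    · intro hx
      by_contra hx'
      exact hx' (by rwa [τ.injective (h _ hx')])
    · intro hx
      by_contra hx'
      exact hx' (by rwa [h x hx'] at hx)
  rw [← act_permF (a := Function.Embedding.subtype (· ∈ S)) (σ := τ.subtypePerm fun x => (hS x).symm)
    (fun i => rfl) fun x hx => h x fun hx' => hx ⟨⟨x, hx'⟩, rfl⟩]
  exact act_mem_loc _ (fun i => i.2) _

/-- The labels in `S`, in increasing order. -/
def startList (S : Finset (Fin N)) : List (Fin N) := (List.finRange N).filter (· ∈ S)

/-- The labels outside `S`, in increasing order. -/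
def laterList (S : Finset (Fin N)) : List (Fin N) := (List.finRange N).filter (· ∉ S)

theorem mem_startList {S : Finset (Fin N)} {x : Fin N} : x ∈ startList S ↔ x ∈ S := by
  simp [startList]

theorem mem_laterList {S : Finset (Fin N)} {x : Fin N} : x ∈ laterList S ↔ x ∉ S := by
  simp [laterList]

theorem startList_nodup (S : Finset (Fin N)) : (startList S).Nodup :=
  (List.nodup_finRange N).filter _

theorem laterList_nodup (S : Finset (Fin N)) : (laterList S).Nodup :=
  (List.nodup_finRange N).filter _

theorem later_start_perm (S : Finset (Fin N)) :
    (List.finRange N).Perm (laterList S ++ startList S) := by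
  have := (List.filter_append_perm (fun x => decide (x ∉ S)) (List.finRange N)).symm
  simpa [laterList, startList] using this

theorem startList_toFinset (S : Finset (Fin N)) : (startList S).toFinset = S := by
  ext x; simp [mem_startList]

/-- The successor of a label is its image under `σ`, unless it starts a new block. -/
def SuccPerm (S : Finset (Fin N)) (σ : Equiv.Perm (Fin N)) : Prop :=
  ∀ p p' : Fin N, (p' : ℕ) = p + 1 → p' ∉ S → σ p = p'

/-- The first label starts a block. -/
def HasZero (S : Finset (Fin N)) : Prop := ∀ p : Fin N, (p : ℕ) = 0 → p ∈ S

theorem HasZero.exists_pred {S : Finset (Fin N)} (h : HasZero S) {p' : Fin N} (hp : p' ∉ S) :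
    ∃ p : Fin N, (p' : ℕ) = p + 1 := by
  have h0 : (p' : ℕ) ≠ 0 := fun h0 => hp (h p' h0)
  exact ⟨⟨p' - 1, by omega⟩, by simp; omega⟩

/-- The operators allowed by the wheel conditions for the blocks starting at the labels in `S`, at
the parameters `u`. -/
def WheelForm (q c : F) (S : Finset (Fin N)) (u : Fin N → F) (T : Op F n (Fin N)) : Prop :=
  ∃ σ : Equiv.Perm (Fin N), SuccPerm S σ ∧ ∃ Z ∈ loc F n S,
    T = braid q u (List.finRange N) (laterList S ++ startList S) * Z *
      braid q (fun x => c * u (σ⁻¹ x)) (laterList S ++ startList S) (ord σ.toEmbedding) * permF σ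

theorem WheelForm.smul {q c : F} {S : Finset (Fin N)} {u : Fin N → F} {T : Op F n (Fin N)}
    (h : WheelForm q c S u T) (g : F) : WheelForm q c S u (g • T) := by
  obtain ⟨σ, hσ, Z, hZ, rfl⟩ := h
  refine ⟨σ, hσ, g • Z, Subalgebra.smul_mem _ hZ g, ?_⟩
  simp only [mul_smul_comm, smul_mul_assoc]

theorem braid_append_left {q : F} (u : Fin N → F) (p : List (Fin N)) {m m' : List (Fin N)}
    (h : m.Perm m') : (braid q u (p ++ m) (p ++ m') : Op F n (Fin N)) = braid q u m m' := by
  simpa using braid_local (n := n) q u p [] h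

theorem braid_append_right {q : F} (u : Fin N → F) (s : List (Fin N)) {m m' : List (Fin N)}
    (h : m.Perm m') : (braid q u (m ++ s) (m' ++ s) : Op F n (Fin N)) = braid q u m m' := by
  simpa using braid_local (n := n) q u [] s h

theorem ord_mul (σ τ : Equiv.Perm (Fin N)) :
    (ord τ.toEmbedding).map σ = ord (σ * τ).toEmbedding := map_ord_perm _ _

theorem permF_inv_mul_cancel (τ : Equiv.Perm (Fin N)) (M : Op F n (Fin N)) :
    permF τ⁻¹ * (permF τ * M) = M := by
  rw [← mul_assoc, permF_inv_mul, one_mul]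

/-- The permutation in a wheel form may be chosen freely. -/
theorem WheelForm.exists_of_succPerm {q c : F} (hq : q ≠ 0) {S : Finset (Fin N)} (hS : HasZero S)
    {u : Fin N → F} {T : Op F n (Fin N)} (h : WheelForm q c S u T) {σ' : Equiv.Perm (Fin N)}
    (hσ' : SuccPerm S σ')
    (hreg : ∀ l, Regular q (fun x => c * u (σ'⁻¹ x)) l) :
    ∃ Z ∈ loc F n S,
    T = braid q u (List.finRange N) (laterList S ++ startList S) * Z *
      braid q (fun x => c * u (σ'⁻¹ x)) (laterList S ++ startList S) (ord σ'.toEmbedding) *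
        permF σ' := by
  obtain ⟨σ, hσ, Z, hZ, rfl⟩ := h
  set τ := σ' * σ⁻¹ with hτ
  -- Both permutations send the predecessor of `x` to `x`, so they differ by a permutation of `S`.
  have hfix : ∀ x, x ∉ S → τ x = x := by
    intro x hx
    obtain ⟨p, hp⟩ := hS.exists_pred hx
    have h1 := hσ p x hp hx
    have h2 := hσ' p x hp hx
    rw [hτ, Equiv.Perm.mul_apply, ← h1, Equiv.Perm.inv_def, Equiv.symm_apply_apply, h2, h1]
  have hτσ : τ * σ = σ' := by rw [hτ, inv_mul_cancel_right]
  have hmapO : (laterList S).map τ = laterList S := by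
    conv_rhs => rw [← List.map_id (laterList S)]
    exact List.map_congr_left fun x hx => hfix x (mem_laterList.1 hx)
  have hτS : ∀ x, τ x ∈ S ↔ x ∈ S := by
    intro x
    constructor
    · intro hx
      by_contra hx'
      exact hx' (by rwa [hfix x hx'] at hx)
    · intro hx
      by_contra hx'
      exact hx' (by rwa [τ.injective (hfix _ hx')])
  have hperm : ((startList S).map τ).Perm (startList S) := by
    refine (List.perm_ext_iff_of_nodup ((startList_nodup S).map τ.injective)
      (startList_nodup S)).2 fun x => ?_
    simp only [List.mem_map, mem_startList]
    constructor
    · rintro ⟨y, hy, rfl⟩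
      exact (hτS y).2 hy
    · exact fun hx => ⟨τ⁻¹ x, (hτS _).1 (by simpa using hx), by simp⟩
  have e1 := permF_mul_braid (n := n) q τ (fun x => c * u (σ'⁻¹ x)) (laterList S ++ startList S)
    (ord σ.toEmbedding)
  have e2 : ((fun x => c * u (σ'⁻¹ x)) ∘ τ) = fun x => c * u (σ⁻¹ x) := by
    funext x
    simp [hτ]
  rw [e2, List.map_append, hmapO, ord_mul, hτσ] at e1
  have nd : (laterList S ++ (startList S).map τ).Nodup :=
    ((List.Perm.append_left _ hperm).trans (later_start_perm S).symm).nodup_iff.2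
      (List.nodup_finRange N)
  have e3 := braid_trans (n := n) hq nd (List.Perm.append_left _ hperm)
    ((later_start_perm S).symm.trans (finRange_perm_ord σ')) (hreg _)
  rw [braid_append_left _ _ hperm] at e3
  -- The permutation `τ` and the resulting reordering of the first labels act only in the factors
  -- from `S`, hence can be absorbed into `Z`.
  refine ⟨Z * (permF τ⁻¹ * braid q (fun x => c * u (σ'⁻¹ x)) ((startList S).map τ) (startList S)),
    mul_mem hZ (mul_mem (permF_mem_loc fun x hx => ?_)
      (braid_mem_loc _ _ _ _ (fun y hy => ?_) fun y hy => mem_startList.1 hy)), ?_⟩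
  · rw [Equiv.Perm.inv_def, Equiv.symm_apply_eq, hfix x hx]
  · obtain ⟨x, hx, rfl⟩ := List.mem_map.1 hy
    exact (hτS x).2 (mem_startList.1 hx)
  · rw [← permF_inv_mul_cancel τ (braid q (fun x => c * u (σ⁻¹ x)) _ _ : Op F n (Fin N)), e1, ← e3]
    have e5 : (permF τ * permF σ : Op F n (Fin N)) = permF σ' := by rw [permF_mul, hτσ]
    simp only [mul_assoc, e5]

/-- `O` lists the strands that are not first in their block and `St` the first ones; `X` acts on
`As` and `Y` on `Bs`, both within `St`. By `e₀` and `e₁` the strands of `O ++ B'` and `O ++ A'` have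
the same parameters before and after `X`, respectively `Y`, so their braids slide through. All of
`O` can then be kept at the front, and what remains involves only `St`. -/
theorem exists_loc_of_braids {q : F} (hq : q ≠ 0) {u₀ u₁ u₂ : Fin N → F}
    (h₀ : ∀ l, Regular q u₀ l) (h₁ : ∀ l, Regular q u₁ l) (h₂ : ∀ l, Regular q u₂ l)
    {l₀ l₃ O St As A' Bs B' m₁ m₂ : List (Fin N)} (hl : l₀.Nodup) (p₀ : l₀.Perm (O ++ St))
    (p₁ : m₁.Perm (O ++ B')) (p₂ : (B' ++ As).Perm St) (p₃ : m₂.Perm (O ++ A'))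
    (p₄ : (A' ++ Bs).Perm St) (p₅ : (O ++ St).Perm l₃) (e₀ : ∀ x ∈ O ++ B', u₀ x = u₁ x)
    (e₁ : ∀ x ∈ O ++ A', u₁ x = u₂ x) {X Y : Op F n (Fin N)} (hX : X ∈ loc F n As.toFinset)
    (hY : Y ∈ loc F n Bs.toFinset) :
    ∃ Z ∈ loc F n St.toFinset,
      braid q u₀ l₀ (m₁ ++ As) * X * braid q u₁ (m₁ ++ As) (m₂ ++ Bs) * Y *
        braid q u₂ (m₂ ++ Bs) l₃ = braid q u₀ l₀ (O ++ St) * Z * braid q u₂ (O ++ St) l₃ := by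
  have r₁ : (O ++ (B' ++ As)).Perm (O ++ St) := List.Perm.append_left O p₂
  have r₂ : (O ++ (A' ++ Bs)).Perm (O ++ St) := List.Perm.append_left O p₄
  have r₃ : (m₁ ++ As).Perm (O ++ (B' ++ As)) := by
    rw [← List.append_assoc]; exact List.Perm.append_right As p₁
  have r₄ : (m₂ ++ Bs).Perm (O ++ (A' ++ Bs)) := by
    rw [← List.append_assoc]; exact List.Perm.append_right Bs p₃
  have nd : (O ++ St).Nodup := p₀.nodup_iff.1 hl
  have tr : ∀ {w : Fin N → F} (_ : ∀ l, Regular q w l) {l l' l'' : List (Fin N)}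
      (_ : l.Perm (O ++ St)) (_ : l'.Perm (O ++ St)) (_ : l''.Perm (O ++ St)),
      (braid q w l l' * braid q w l' l'' : Op F n (Fin N)) = braid q w l l'' := by
    intro w hw l l' l'' h h' h''
    exact braid_trans hq (h.nodup_iff.2 nd) (h.trans h'.symm) (h'.trans h''.symm) (hw _)
  have disj : ∀ {s t : List (Fin N)}, (s ++ t).Perm (O ++ St) → Disjoint s.toFinset t.toFinset := by
    intro s t h
    have := List.nodup_append.1 (h.nodup_iff.2 nd)
    simp only [Finset.disjoint_left, List.mem_toFinset]
    exact fun x hx hx' => this.2.2 x hx x hx' rfl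
  have b₁ : (braid q u₀ (O ++ (B' ++ As)) (m₁ ++ As) : Op F n (Fin N)) =
      braid q u₁ (O ++ (B' ++ As)) (m₁ ++ As) := by
    rw [← List.append_assoc, braid_append_right _ _ p₁.symm, braid_append_right _ _ p₁.symm]
    exact braid_congr _ _ _ e₀ fun y hy => e₀ y (p₁.mem_iff.1 hy)
  have b₁' : (braid q u₁ (O ++ (B' ++ As)) (m₁ ++ As) : Op F n (Fin N)) ∈
      loc F n (O ++ B').toFinset := by
    rw [← List.append_assoc, braid_append_right _ _ p₁.symm]
    exact braid_mem_loc _ _ _ _ (by simp) fun y hy => by simpa using p₁.mem_iff.1 hy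
  have b₂ : (braid q u₁ (m₂ ++ Bs) (O ++ (A' ++ Bs)) : Op F n (Fin N)) =
      braid q u₂ (m₂ ++ Bs) (O ++ (A' ++ Bs)) := by
    rw [← List.append_assoc, braid_append_right _ _ p₃, braid_append_right _ _ p₃]
    exact braid_congr _ _ _ (fun y hy => e₁ y (p₃.mem_iff.1 hy)) e₁
  have b₂' : (braid q u₁ (m₂ ++ Bs) (O ++ (A' ++ Bs)) : Op F n (Fin N)) ∈
      loc F n (O ++ A').toFinset := by
    rw [← List.append_assoc, braid_append_right _ _ p₃]
    exact braid_mem_loc _ _ _ _ (fun y hy => by simpa using p₃.mem_iff.1 hy) (by simp)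
  have c₁ := loc_commute (disj (by rwa [List.append_assoc])) b₁' hX
  have c₂ := loc_commute (disj (by rwa [List.append_assoc])) b₂' hY
  -- The same diagram with the strands of `O` deleted.
  refine ⟨braid q u₀ St (B' ++ As) * X * braid q u₁ (B' ++ As) (A' ++ Bs) * Y *
    braid q u₂ (A' ++ Bs) St, ?_, ?_⟩
  · have m1 : ∀ y ∈ B' ++ As, y ∈ St.toFinset := fun y hy => by simpa using p₂.mem_iff.1 hy
    have m2 : ∀ y ∈ A' ++ Bs, y ∈ St.toFinset := fun y hy => by simpa using p₄.mem_iff.1 hy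
    have m3 : ∀ y ∈ St, y ∈ St.toFinset := fun y hy => by simpa using hy
    refine mul_mem (mul_mem (mul_mem (mul_mem (braid_mem_loc _ _ _ _ m3 m1) ?_)
      (braid_mem_loc _ _ _ _ m1 m2)) ?_) (braid_mem_loc _ _ _ _ m2 m3)
    · exact loc_mono (fun y hy => m1 y (by simp at hy; simp [hy])) hX
    · exact loc_mono (fun y hy => m2 y (by simp at hy; simp [hy])) hY
  · rw [← braid_append_left u₀ O p₂.symm, ← braid_append_left u₁ O (p₂.trans p₄.symm),
      ← braid_append_left u₂ O p₄]
    have t₀ := tr h₀ p₀ r₁ (r₃.trans r₁)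
    have t₂ := tr h₂ (r₄.trans r₂) r₂ p₅.symm
    calc _ = braid q u₀ l₀ (O ++ (B' ++ As)) * (braid q u₁ (O ++ (B' ++ As)) (m₁ ++ As) * X) *
          braid q u₁ (m₁ ++ As) (m₂ ++ Bs) * (Y * braid q u₁ (m₂ ++ Bs) (O ++ (A' ++ Bs))) *
          braid q u₂ (O ++ (A' ++ Bs)) l₃ := by
          rw [← t₀, ← t₂, b₁, b₂]
          simp only [mul_assoc]
      _ = braid q u₀ l₀ (O ++ (B' ++ As)) * X * (braid q u₁ (O ++ (B' ++ As)) (m₁ ++ As) *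
          braid q u₁ (m₁ ++ As) (m₂ ++ Bs) * braid q u₁ (m₂ ++ Bs) (O ++ (A' ++ Bs))) * Y *
          braid q u₂ (O ++ (A' ++ Bs)) l₃ := by
          rw [c₁.eq, ← c₂.eq]
          simp only [mul_assoc]
      _ = _ := by
          rw [tr h₁ r₁ (r₃.trans r₁) (r₄.trans r₂), tr h₁ r₁ (r₄.trans r₂) r₂,
            ← tr h₀ p₀ (List.Perm.refl _) r₁, ← tr h₂ r₂ (List.Perm.refl _) p₅.symm]
          simp only [mul_assoc]

end WheelForm
end RShuffle

namespace RShuffle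

/-! ### Products of operators of wheel form -/

section WheelProduct

variable {F : Type*} [Field F] {n k l N : ℕ}

/-- A partial matching extends to an involution. -/
theorem exists_perm_of_matching {α : Type*} (r : α → α → Prop)
    (h₁ : ∀ x y y', r x y → r x y' → y = y') (h₂ : ∀ x x' y, r x y → r x' y → x = x')
    (h₃ : ∀ x y w, r x y → ¬ r y w) :
    ∃ π : Equiv.Perm α, (∀ x y, r x y → π x = y) ∧ (∀ x y, r x y → π y = x) ∧
      ∀ x, (∀ y, ¬ r x y) → (∀ y, ¬ r y x) → π x = x := by
  classical
  let φ : α → α := fun x => if h : ∃ y, r x y then h.choose else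
    if h : ∃ y, r y x then h.choose else x
  have a₁ : ∀ x y, r x y → φ x = y := by
    intro x y h
    have : ∃ y, r x y := ⟨y, h⟩
    simp only [φ, dif_pos this]
    exact h₁ _ _ _ this.choose_spec h
  have a₂ : ∀ x y, r x y → φ y = x := by
    intro x y h
    have h' : ∃ x, r x y := ⟨x, h⟩
    have h'' : ¬ ∃ w, r y w := fun ⟨w, hw⟩ => h₃ _ _ _ h hw
    simp only [φ, dif_neg h'', dif_pos h']
    exact h₂ _ _ _ h'.choose_spec h
  have a₃ : ∀ x, (∀ y, ¬ r x y) → (∀ y, ¬ r y x) → φ x = x := by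
    intro x h h'
    have h1 : ¬ ∃ y, r x y := fun ⟨y, hy⟩ => h y hy
    have h2 : ¬ ∃ y, r y x := fun ⟨y, hy⟩ => h' y hy
    simp only [φ, dif_neg h1, dif_neg h2]
  have hinv : Function.Involutive φ := by
    intro x
    by_cases h : ∃ y, r x y
    · obtain ⟨y, hy⟩ := h
      rw [a₁ x y hy, a₂ x y hy]
    by_cases h' : ∃ y, r y x
    · obtain ⟨y, hy⟩ := h'
      rw [a₂ y x hy, a₁ y x hy]
    · have := a₃ x (fun y hy => h ⟨y, hy⟩) fun y hy => h' ⟨y, hy⟩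
      rw [this, this]
  exact ⟨hinv.toPerm, a₁, a₂, a₃⟩

/-- The labels of the strands of `a` that start a block, for the blocks formed by the strands of
`a` inside the blocks starting at `S`. -/
def pullStarts (S : Finset (Fin N)) (a : Fin k ↪ Fin N) : Finset (Fin k) :=
  Finset.univ.filter fun i => ¬ (a i ∉ S ∧ ∃ i', (a i : ℕ) = a i' + 1)

theorem not_mem_pullStarts {S : Finset (Fin N)} {a : Fin k ↪ Fin N} {i : Fin k} :
    i ∉ pullStarts S a ↔ a i ∉ S ∧ ∃ i', (a i : ℕ) = a i' + 1 := by
  simp [pullStarts]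

/-- An index strictly in between would have its value strictly between two consecutive integers. -/
theorem val_succ_of_strictMono {a : Fin k ↪ Fin N} (ha : StrictMono a) {i i' : Fin k}
    (h : (a i : ℕ) = a i' + 1) : (i : ℕ) = i' + 1 := by
  have h1 : i' < i := by
    rw [← ha.lt_iff_lt, Fin.lt_def]
    omega
  by_contra hne
  have h2 : (i' : ℕ) + 1 < i := by
    rw [Fin.lt_def] at h1
    omega
  let i'' : Fin k := ⟨i' + 1, by omega⟩
  have h3 : a i' < a i'' := ha (by rw [Fin.lt_def]; simp [i''])
  have h4 : a i'' < a i := ha (by rw [Fin.lt_def]; exact h2)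
  rw [Fin.lt_def] at h3 h4
  omega

theorem hasZero_pullStarts (S : Finset (Fin N)) {a : Fin k ↪ Fin N} (ha : StrictMono a) :
    HasZero (pullStarts S a) := by
  intro p hp
  by_contra h
  obtain ⟨_, i, hi⟩ := not_mem_pullStarts.1 h
  have := val_succ_of_strictMono ha hi
  omega

theorem SuccPerm.apply_pullStarts {S : Finset (Fin N)} {a : Fin k ↪ Fin N} (ha : StrictMono a)
    {σ : Equiv.Perm (Fin k)} (hσ : SuccPerm (pullStarts S a) σ) {i i' : Fin k}
    (h : (a i' : ℕ) = a i + 1) (hi : a i' ∉ S) : σ i = i' :=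
  hσ i i' (val_succ_of_strictMono ha h) (not_mem_pullStarts.2 ⟨hi, i, h⟩)

/-- The permutation of the labels that combines the permutations for the strands of `a` and those
of `b`. -/
theorem exists_combined_perm {S : Finset (Fin N)} (hS : HasZero S) {a : Fin k ↪ Fin N}
    {b : Fin l ↪ Fin N} (hab : Complementary a b) (ha : StrictMono a) (hb : StrictMono b)
    (hba : ∀ i j, (a i : ℕ) = b j + 1 → a i ∈ S) {σA : Equiv.Perm (Fin k)}
    {σB : Equiv.Perm (Fin l)} (hσA : SuccPerm (pullStarts S a) σA)
    (hσB : SuccPerm (pullStarts S b) σB) {ρ : Equiv.Perm (Fin N)} (hρa : ∀ i, ρ (a i) = a (σA i))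
    (hρb : ∀ j, ρ (b j) = b (σB j)) {c : F} {u : Fin N → F}
    (hu : ∀ p p' : Fin N, (p' : ℕ) = p + 1 → p' ∉ S → u p' = c * u p) :
    ∃ π : Equiv.Perm (Fin N), SuccPerm S (π * ρ) ∧ (∀ j, j ∈ pullStarts S b → π (b j) ∈ S) ∧
      ∀ w : Fin N → F, (∀ j, w (b j) = u (b j)) → (∀ i, w (a (σA i)) = c * u (a i)) →
        ∀ x, w (π x) = w x := by
  -- At each boundary where `a i` is followed by `b j` within a block, `a (σA i)` is matched with `b
  -- j`; exchanging them makes `π * ρ` send `a i` to its successor `b j`.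
  let r : Fin N → Fin N → Prop := fun x y =>
    ∃ i j, x = a (σA i) ∧ y = b j ∧ (b j : ℕ) = a i + 1 ∧ b j ∉ S
  obtain ⟨π, h1, h2, h3⟩ := exists_perm_of_matching r (by
      rintro x y y' ⟨i, j, rfl, rfl, h, _⟩ ⟨i', j', hx, rfl, h', _⟩
      have : i = i' := σA.injective (a.injective hx)
      subst this
      exact Fin.ext (h.trans h'.symm)) (by
      rintro x x' y ⟨i, j, rfl, rfl, h, _⟩ ⟨i', j', rfl, hy, h', _⟩
      have : j = j' := b.injective hy
      subst this
      have : a i = a i' := Fin.ext (by omega)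
      rw [a.injective this]) (by
      rintro x y w ⟨i, j, rfl, rfl, -, -⟩ ⟨i', j', h, -⟩
      exact hab.disj _ _ h.symm)
  have cov : ∀ x, (∃ i, a i = x) ∨ ∃ j, b j = x := fun x =>
    (hab.cover x).imp mem_ord.1 mem_ord.1
  refine ⟨π, ?_, ?_, ?_⟩
  · intro p p' hp hp'
    rw [Equiv.Perm.mul_apply]
    rcases cov p with ⟨i, rfl⟩ | ⟨j, rfl⟩ <;> rcases cov p' with ⟨i', rfl⟩ | ⟨j', rfl⟩
    · have e := hσA.apply_pullStarts ha hp hp'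
      rw [hρa, e]
      refine h3 _ ?_ ?_
      · rintro y ⟨i₁, j, hx, rfl, h, -⟩
        have : i = i₁ := σA.injective (e.trans (a.injective hx))
        subst this
        exact hab.disj i' j (Fin.ext (hp.trans h.symm))
      · rintro y ⟨i₁, j, -, hx, -, -⟩
        exact hab.disj _ _ hx
    · rw [hρa]
      exact h1 _ _ ⟨i, j', rfl, rfl, hp, hp'⟩
    · exact absurd (hba i' j hp) hp'
    · have e := hσB.apply_pullStarts hb hp hp'
      rw [hρb, e]
      refine h3 _ ?_ ?_
      · rintro y ⟨i₁, j₁, hx, -⟩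
        exact hab.disj _ _ hx.symm
      · rintro y ⟨i₁, j₁, -, hx, h, -⟩
        rw [← hx] at h
        exact hab.disj i₁ j (Fin.ext (by omega))
  · intro j hj
    by_cases h : ∃ i, r (a (σA i)) (b j)
    · obtain ⟨i, hr⟩ := h
      rw [h2 _ _ hr]
      obtain ⟨i₁, j₁, hi, hj₁, h, hS₁⟩ := hr
      have : i = i₁ := σA.injective (a.injective hi)
      subst this
      have : j = j₁ := b.injective hj₁
      subst this
      -- Otherwise the predecessor of `a (σA i)` would be a label `a i'` with `σA i' = σA i`, hence
      -- `a i` itself, whose successor is `b j`.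
      by_contra hn
      obtain ⟨p, hp⟩ := hS.exists_pred hn
      rcases cov p with ⟨i', rfl⟩ | ⟨j', rfl⟩
      · have e := hσA.apply_pullStarts ha hp hn
        have : i' = i := σA.injective e
        subst this
        exact hab.disj _ _ (Fin.ext (hp.trans h.symm))
      · exact hn (hba _ _ hp)
    · have e : π (b j) = b j := by
        refine h3 _ ?_ ?_
        · rintro y ⟨i₁, j₁, hx, -⟩
          exact hab.disj _ _ hx.symm
        · rintro y ⟨i₁, j₁, rfl, hx, h', hS'⟩
          exact h ⟨i₁, i₁, j₁, rfl, hx, h', hS'⟩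
      rw [e]
      by_contra hn
      obtain ⟨p, hp⟩ := hS.exists_pred hn
      rcases cov p with ⟨i', rfl⟩ | ⟨j', rfl⟩
      · exact h ⟨i', i', j, rfl, rfl, hp, hn⟩
      · exact not_mem_pullStarts.2 ⟨hn, j', hp⟩ hj
  · intro w hwb hwa x
    -- Matched strands have equal parameters: `u (b j) = c * u (a i)`, which is the parameter of `a
    -- (σA i)` after the first operator.
    have key : ∀ x y, r x y → w y = w x := by
      rintro x y ⟨i, j, rfl, rfl, h, hS'⟩
      rw [hwb, hwa, hu _ _ h hS']
    by_cases hx : ∃ y, r x y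
    · obtain ⟨y, hy⟩ := hx
      rw [h1 _ _ hy, key _ _ hy]
    by_cases hx' : ∃ y, r y x
    · obtain ⟨y, hy⟩ := hx'
      rw [h2 _ _ hy, key _ _ hy]
    · rw [h3 x (fun y hy => hx ⟨y, hy⟩) fun y hy => hx' ⟨y, hy⟩]

/-- The evaluation of a term of the shuffle product of two tensors subject to the wheel conditions
has wheel form. -/
theorem WheelForm.product {q c : F} (hq : q ≠ 0) (hc : c ≠ 0) (hkl : k + l = N)
    {S : Finset (Fin N)} (hS : HasZero S) {a : Fin k ↪ Fin N} {b : Fin l ↪ Fin N}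
    (hab : Complementary a b) (ha : StrictMono a) (hb : StrictMono b)
    (hba : ∀ i j, (a i : ℕ) = b j + 1 → a i ∈ S) {u : Fin N → F}
    (hu : ∀ p p' : Fin N, (p' : ℕ) = p + 1 → p' ∉ S → u p' = c * u p)
    (hreg : ∀ w : Fin N → F, (∀ x, ∃ y, w x = u y ∨ w x = c * u y) → ∀ l, Regular q w l)
    {TX : Op F n (Fin k)} {TY : Op F n (Fin l)} (hX : WheelForm q c (pullStarts S a) (u ∘ a) TX)
    (hY : WheelForm q c (pullStarts S b) (u ∘ b) TY) :
    WheelForm q c S u (braid q u (List.finRange N) (ord b ++ ord a) * act a TX *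
      braid q (fun x => if x ∈ ord a then c * u x else u x) (ord b ++ ord a) (ord a ++ ord b) *
      act b TY * braid q u (ord a ++ ord b) (List.finRange N)) := by
  obtain ⟨σA, hσA, ZX, hZX, rfl⟩ := hX
  obtain ⟨σB, hσB, ZY, hZY, rfl⟩ := hY
  -- `ρA` and `ρB` extend `σA` and `σB` to all labels, each fixing the other family.
  obtain ⟨ρA, hA1, hA2⟩ := hab.exists_perm hkl (hab.perm_trans σA 1)
  obtain ⟨ρB, hB1, hB2⟩ := hab.exists_perm hkl (hab.perm_trans 1 σB)
  replace hA1 : ∀ i, ρA (a i) = a (σA i) := DFunLike.congr_fun hA1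
  replace hA2 : ∀ j, ρA (b j) = b j := DFunLike.congr_fun hA2
  replace hB1 : ∀ i, ρB (a i) = a i := DFunLike.congr_fun hB1
  replace hB2 : ∀ j, ρB (b j) = b (σB j) := DFunLike.congr_fun hB2
  set ρ := ρA * ρB with hρ
  have hρa : ∀ i, ρ (a i) = a (σA i) := fun i => by rw [hρ, Equiv.Perm.mul_apply, hB1, hA1]
  have hρb : ∀ j, ρ (b j) = b (σB j) := fun j => by rw [hρ, Equiv.Perm.mul_apply, hB2, hA2]
  have hρa' : ∀ i, ρ⁻¹ (a (σA i)) = a i := fun i => by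
    rw [Equiv.Perm.inv_def, Equiv.symm_apply_eq, hρa]
  have hρb' : ∀ j, ρ⁻¹ (b (σB j)) = b j := fun j => by
    rw [Equiv.Perm.inv_def, Equiv.symm_apply_eq, hρb]
  have cov : ∀ x, (∃ i, a i = x) ∨ ∃ j, b j = x := fun x =>
    (hab.cover x).imp mem_ord.1 mem_ord.1
  have haa : ∀ i, a i ∈ ord a := fun i => mem_ord.2 ⟨i, rfl⟩
  have hbb : ∀ j, b j ∈ ord b := fun j => mem_ord.2 ⟨j, rfl⟩
  have hba' : ∀ j, b j ∉ ord a := fun j => hab.not_mem (hbb j)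
  have hab' : ∀ i, a i ∉ ord b := fun i => hab.symm.not_mem (haa i)
  obtain ⟨π, hσ, hπS, hπ⟩ := exists_combined_perm hS hab ha hb hba hσA hσB hρa hρb hu
  set σ := π * ρ with hσ_def

  set w : Fin N → F := fun x => if x ∈ ord a then c * u x else u x
  -- The parameters after the first operator, after both operators, and after both with the strands
  -- renamed by `π`.
  set u₁ : Fin N → F := fun x => if x ∈ ord a then c * u (ρ⁻¹ x) else u x with hu₁
  set u₂ : Fin N → F := fun x => c * u (ρ⁻¹ x) with hu₂
  set u₃ : Fin N → F := fun x => c * u (σ⁻¹ x) with hu₃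
  have u₁a : ∀ i, u₁ (a (σA i)) = c * u (a i) := fun i => by
    simp only [hu₁, if_pos (haa _), hρa']
  have u₁b : ∀ j, u₁ (b j) = u (b j) := fun j => if_neg (hba' j)
  have u₁π := hπ u₁ u₁b u₁a
  have ru := hreg u fun x => ⟨x, Or.inl rfl⟩
  have r₁ : ∀ l, Regular q u₁ l := hreg u₁ fun x => by
    by_cases hx : x ∈ ord a
    · exact ⟨ρ⁻¹ x, Or.inr (if_pos hx)⟩
    · exact ⟨x, Or.inl (if_neg hx)⟩
  have r₂ : ∀ l, Regular q u₂ l := hreg u₂ fun x => ⟨_, Or.inr rfl⟩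
  have r₃ : ∀ l, Regular q u₃ l := hreg u₃ fun x => ⟨_, Or.inr rfl⟩
  set SA := pullStarts S a
  set SB := pullStarts S b
  set aO := (laterList SA).map a with haO
  set aS := (startList SA).map a with haS
  set bO := (laterList SB).map b with hbO
  set bS := (startList SB).map b with hbS
  set aσ := ord (σA.toEmbedding.trans a) with haσ
  set bσ := ord (σB.toEmbedding.trans b) with hbσ
  have pA : (ord a).Perm (aO ++ aS) := by
    rw [haO, haS, ← List.map_append]
    exact (later_start_perm SA).map a
  have pB : (ord b).Perm (bO ++ bS) := by
    rw [hbO, hbS, ← List.map_append]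
    exact (later_start_perm SB).map b
  have pAσ : aσ.Perm (ord a) := ord_perm σA a
  have pBσ : bσ.Perm (ord b) := ord_perm σB b
  have pN := hab.perm
  have ndN := List.nodup_finRange N
  have tr : ∀ {w : Fin N → F} (_ : ∀ l, Regular q w l) {l l' l'' : List (Fin N)}
      (_ : (List.finRange N).Perm l) (_ : (List.finRange N).Perm l')
      (_ : (List.finRange N).Perm l''),
      (braid q w l l' * braid q w l' l'' : Op F n (Fin N)) = braid q w l l'' := by
    intro w hw l l' l'' h h' h''
    exact braid_trans hq (h.nodup_iff.1 ndN) (h.symm.trans h') (h'.symm.trans h'') (hw _)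
  have eX : act a (braid q (u ∘ a) (List.finRange k) (laterList SA ++ startList SA) * ZX *
      braid q (fun x => c * (u ∘ a) (σA⁻¹ x)) (laterList SA ++ startList SA) (ord σA.toEmbedding) *
      permF σA : Op F n (Fin k)) = braid q u (ord a) (aO ++ aS) * act a ZX *
      braid q u₁ (aO ++ aS) aσ * permF ρA := by
    have e1 : (fun x => c * (u ∘ a) (σA⁻¹ x)) = u₁ ∘ a := by
      funext x
      have := u₁a (σA⁻¹ x)
      rw [Equiv.Perm.inv_def, Equiv.apply_symm_apply] at this
      exact this.symm
    rw [act_mul, act_mul, act_mul, act_braid, e1, act_braid, List.map_append, map_ord,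
      act_permF hA1 fun x hx => ?_]
    · rfl
    · rcases cov x with ⟨i, rfl⟩ | ⟨j, rfl⟩
      exacts [absurd ⟨i, rfl⟩ hx, hA2 j]
  have eY : act b (braid q (u ∘ b) (List.finRange l) (laterList SB ++ startList SB) * ZY *
      braid q (fun x => c * (u ∘ b) (σB⁻¹ x)) (laterList SB ++ startList SB) (ord σB.toEmbedding) *
      permF σB : Op F n (Fin l)) = braid q u (ord b) (bO ++ bS) * act b ZY *
      braid q u₂ (bO ++ bS) bσ * permF ρB := by
    have e1 : (fun x => c * (u ∘ b) (σB⁻¹ x)) = u₂ ∘ b := by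
      funext x
      have := hρb' (σB⁻¹ x)
      rw [Equiv.Perm.inv_def σB, Equiv.apply_symm_apply] at this
      simp only [hu₂, Function.comp_apply, this]
      rfl
    rw [act_mul, act_mul, act_mul, act_braid, e1, act_braid, List.map_append, map_ord,
      act_permF hB2 fun x hx => ?_]
    · rfl
    · rcases cov x with ⟨i, rfl⟩ | ⟨j, rfl⟩
      exacts [hB1 i, absurd ⟨j, rfl⟩ hx]
  have mapA : (ord a).map ρA = aσ := by
    rw [haσ, ord, ord, List.map_map]
    exact List.map_congr_left fun i _ => hA1 i
  have mapA' : (ord b).map ρA = ord b := by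
    rw [ord, List.map_map]
    exact List.map_congr_left fun i _ => hA2 i
  have mapρA : (ord a).map ρ = aσ := by
    rw [haσ, ord, ord, List.map_map]
    exact List.map_congr_left fun i _ => hρa i
  have mapρB : (ord b).map ρ = bσ := by
    rw [hbσ, ord, ord, List.map_map]
    exact List.map_congr_left fun i _ => hρb i
  have s1 : (permF ρA * braid q w (ord b ++ ord a) (ord a ++ ord b) : Op F n (Fin N)) =
      braid q u₁ (ord b ++ aσ) (aσ ++ ord b) * permF ρA := by
    have e : w = u₁ ∘ ρA := by
      funext x
      rcases cov x with ⟨i, rfl⟩ | ⟨j, rfl⟩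
      · rw [Function.comp_apply, hA1, u₁a]
        exact if_pos (haa i)
      · rw [Function.comp_apply, hA2, u₁b]
        exact if_neg (hba' j)
    rw [e, permF_mul_braid, List.map_append, List.map_append, mapA, mapA']
  have s2 : (permF ρA * act b (braid q (u ∘ b) (List.finRange l) (laterList SB ++ startList SB) *
      ZY * braid q (fun x => c * (u ∘ b) (σB⁻¹ x)) (laterList SB ++ startList SB)
      (ord σB.toEmbedding) * permF σB) : Op F n (Fin N)) = act b (braid q (u ∘ b) (List.finRange l)
      (laterList SB ++ startList SB) * ZY * braid q (fun x => c * (u ∘ b) (σB⁻¹ x))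
      (laterList SB ++ startList SB) (ord σB.toEmbedding) * permF σB) * permF ρA := by
    refine (loc_commute (S := (ord a).toFinset) (T := (ord b).toFinset) ?_
      (permF_mem_loc fun x hx => ?_) (act_mem_loc b (fun j => by simp [hbb]) _)).eq
    · simp only [Finset.disjoint_left, List.mem_toFinset]
      exact fun x hx hx' => hab.not_mem hx' hx
    · rcases cov x with ⟨i, rfl⟩ | ⟨j, rfl⟩
      exacts [absurd (by simp [haa]) hx, hA2 j]
  have s3 : (permF ρA * (permF ρB * braid q u (ord a ++ ord b) (List.finRange N)) :
      Op F n (Fin N)) = braid q u₂ (aσ ++ bσ) (ord ρ.toEmbedding) * permF ρ := by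
    rw [← mul_assoc, permF_mul, ← hρ, ← braid_homog q hc u]
    have e : (fun y => c * u y) = u₂ ∘ ρ := by
      funext x
      simp [hu₂]
    rw [e, permF_mul_braid, List.map_append, mapρA, mapρB]
    rfl
  have o1 : (List.finRange N).Perm (ord b ++ ord a) := pN.trans List.perm_append_comm
  have o2 : (List.finRange N).Perm (ord b ++ (aO ++ aS)) := o1.trans (List.Perm.append_left _ pA)
  have o3 : (List.finRange N).Perm (ord b ++ aσ) := o1.trans (List.Perm.append_left _ pAσ.symm)
  have o4 : (List.finRange N).Perm (aσ ++ ord b) := o3.trans List.perm_append_comm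
  have o5 : (List.finRange N).Perm (aσ ++ (bO ++ bS)) := o4.trans (List.Perm.append_left _ pB)
  have o6 : (List.finRange N).Perm (aσ ++ bσ) := o4.trans (List.Perm.append_left _ pBσ.symm)
  have l1 := braid_append_left (n := n) (q := q) u (ord b) pA
  have l2 := braid_append_left (n := n) (q := q) u₁ (ord b) (pA.symm.trans pAσ.symm)
  have l3 : (braid q u₁ (aσ ++ ord b) (aσ ++ (bO ++ bS)) : Op F n (Fin N)) =
      braid q u (ord b) (bO ++ bS) := by
    rw [braid_append_left _ _ pB]
    have : ∀ y ∈ ord b, u₁ y = u y := fun y hy => by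
      obtain ⟨j, rfl⟩ := mem_ord.1 hy
      exact u₁b j
    exact braid_congr _ _ _ this fun y hy => this y (pB.mem_iff.2 hy)
  have l4 := braid_append_left (n := n) (q := q) u₂ aσ (pB.symm.trans pBσ.symm)
  have s4 : (braid q u₂ (aσ ++ (bO ++ bS)) (ord ρ.toEmbedding) * permF ρ : Op F n (Fin N)) =
      permF π⁻¹ * (braid q u₃ ((aσ ++ bO).map π ++ bS.map π) (ord σ.toEmbedding) * permF σ) := by
    have e : u₂ = u₃ ∘ π := by
      funext x
      simp [hu₂, hu₃, hσ_def]
    have e' := permF_mul_braid (n := n) q π u₃ (aσ ++ (bO ++ bS)) (ord ρ.toEmbedding)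
    rw [← e, ord_mul, ← hσ_def, ← List.append_assoc, List.map_append] at e'
    have e'' : (permF π * permF ρ : Op F n (Fin N)) = permF σ := permF_mul _ _
    rw [← permF_inv_mul_cancel π (braid q u₂ (aσ ++ (bO ++ bS)) (ord ρ.toEmbedding) * permF ρ),
      ← mul_assoc (permF π), ← List.append_assoc, e', mul_assoc, e'']
  have hbSS : ∀ x ∈ bS.map π, x ∈ S := by
    intro x hx
    obtain ⟨y, hy, rfl⟩ := List.mem_map.1 hx
    obtain ⟨j, hj, rfl⟩ := List.mem_map.1 hy
    exact hπS j (mem_startList.1 hj)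
  have haSS : ∀ x ∈ aS, x ∈ S := by
    intro x hx
    obtain ⟨i, hi, rfl⟩ := List.mem_map.1 hx
    by_contra hn
    obtain ⟨p, hp⟩ := hS.exists_pred hn
    rcases cov p with ⟨i', rfl⟩ | ⟨j', rfl⟩
    · exact not_mem_pullStarts.2 ⟨hn, i', hp⟩ (mem_startList.1 hi)
    · exact hn (hba _ _ hp)
  obtain ⟨ZY', hZY', eZ⟩ : ∃ Z' ∈ loc F n (bS.map π).toFinset,
      permF π * act b ZY = Z' * permF π := by
    refine permF_conj_loc π (S := bS.toFinset) (fun x hx => ?_)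
      (act_loc b (S := SB) (fun j hj => ?_) hZY)
    · simpa using List.mem_map_of_mem (f := π) (List.mem_toFinset.1 hx)
    · simpa [hbS] using mem_startList.2 hj
  have s5 : act b ZY * permF π⁻¹ = permF π⁻¹ * ZY' := by
    rw [← permF_inv_mul_cancel π (act b ZY * permF π⁻¹), ← mul_assoc (permF π), eZ, mul_assoc ZY',
      permF_mul_inv, mul_one]
  have o5' : (List.finRange N).Perm ((aσ ++ bO).map π ++ bS.map π) := by
    rw [← List.map_append, List.append_assoc]
    refine (finRange_perm_ord π).trans (?_ : ((List.finRange N).map π).Perm _)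
    exact o5.map π
  -- `π` preserves `u₁`, so its operator is itself a braid and joins the middle braid.
  have s6 : (braid q u₁ (ord b ++ (aO ++ aS)) (aσ ++ (bO ++ bS)) * permF π⁻¹ : Op F n (Fin N)) =
      braid q u₁ (ord b ++ (aO ++ aS)) ((aσ ++ bO).map π ++ bS.map π) := by
    have e := braid_map_perm (n := n) hq (o5.nodup_iff.1 ndN)
      (fun x => o5.mem_iff.1 (List.mem_finRange x)) (r₁ _) π u₁π
    rw [← e, ← List.append_assoc aσ, List.map_append]
    refine tr r₁ o2 ?_ o5'
    rwa [List.append_assoc]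
  -- With all permutations collected at the right, the product becomes three braids separated by an
  -- operator on `aS` and one on `bS.map π`.
  have total : braid q u (List.finRange N) (ord b ++ ord a) * act a (braid q (u ∘ a)
      (List.finRange k) (laterList SA ++ startList SA) * ZX * braid q (fun x => c * (u ∘ a) (σA⁻¹ x))
      (laterList SA ++ startList SA) (ord σA.toEmbedding) * permF σA) *
      braid q w (ord b ++ ord a) (ord a ++ ord b) * act b (braid q (u ∘ b) (List.finRange l)
      (laterList SB ++ startList SB) * ZY * braid q (fun x => c * (u ∘ b) (σB⁻¹ x))
      (laterList SB ++ startList SB) (ord σB.toEmbedding) * permF σB) *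
      braid q u (ord a ++ ord b) (List.finRange N) =
      braid q u (List.finRange N) (ord b ++ (aO ++ aS)) * act a ZX *
      braid q u₁ (ord b ++ (aO ++ aS)) ((aσ ++ bO).map π ++ bS.map π) * ZY' *
      braid q u₃ ((aσ ++ bO).map π ++ bS.map π) (ord σ.toEmbedding) * permF σ := by
    calc _ = braid q u (List.finRange N) (ord b ++ ord a) * braid q u (ord a) (aO ++ aS) *
          act a ZX * (braid q u₁ (aO ++ aS) aσ * braid q u₁ (ord b ++ aσ) (aσ ++ ord b)) *
          (permF ρA * act b (braid q (u ∘ b) (List.finRange l)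
      (laterList SB ++ startList SB) * ZY * braid q (fun x => c * (u ∘ b) (σB⁻¹ x))
      (laterList SB ++ startList SB) (ord σB.toEmbedding) * permF σB)) *
          braid q u (ord a ++ ord b) (List.finRange N) := by
          rw [eX]
          simp only [mul_assoc]
          rw [← mul_assoc (permF ρA), s1]
          simp only [mul_assoc]
      _ = braid q u (List.finRange N) (ord b ++ ord a) * braid q u (ord a) (aO ++ aS) *
          act a ZX * (braid q u₁ (aO ++ aS) aσ * braid q u₁ (ord b ++ aσ) (aσ ++ ord b) *
          braid q u (ord b) (bO ++ bS)) * act b ZY * (braid q u₂ (bO ++ bS) bσ *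
          braid q u₂ (aσ ++ bσ) (ord ρ.toEmbedding)) * permF ρ := by
          rw [s2, eY]
          simp only [mul_assoc]
          have : (permF ρB * (permF ρA * braid q u (ord a ++ ord b) (List.finRange N)) :
              Op F n (Fin N)) = permF ρA * (permF ρB * braid q u (ord a ++ ord b)
                (List.finRange N)) := by
            rw [← mul_assoc, ← mul_assoc, permF_mul, permF_mul]
            congr 2
            ext x
            rcases cov x with ⟨i, rfl⟩ | ⟨j, rfl⟩
            · simp [hA1, hB1]
            · simp [hA2, hB2]
          rw [this, s3]
      _ = braid q u (List.finRange N) (ord b ++ (aO ++ aS)) * act a ZX *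
          braid q u₁ (ord b ++ (aO ++ aS)) (aσ ++ (bO ++ bS)) * act b ZY *
          (braid q u₂ (aσ ++ (bO ++ bS)) (ord ρ.toEmbedding) * permF ρ) := by
          rw [← l1, ← l2, ← l3, ← l4, tr ru (List.Perm.refl _) o1 o2, tr r₁ o2 o3 o4,
            tr r₁ o2 o4 o5, tr r₂ o5 o6 (finRange_perm_ord ρ)]
          simp only [mul_assoc]
      _ = _ := by
          rw [s4]
          simp only [mul_assoc]
          rw [← mul_assoc (act b ZY), s5, ← s6]
          simp only [mul_assoc]
  have ndS := startList_nodup S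
  have nd2 : (ord b ++ aO ++ aS).Nodup := by
    rw [List.append_assoc]
    exact o2.nodup_iff.1 ndN
  have nd5 := o5'.nodup_iff.1 ndN
  have m2 : ∀ x, x ∈ ord b ++ aO ↔ x ∉ aS := fun x => by
    have h := o2.mem_iff.1 (List.mem_finRange x)
    rw [← List.append_assoc, List.mem_append] at h
    exact ⟨fun h1 h2 => (List.nodup_append.1 nd2).2.2 x h1 x h2 rfl, h.resolve_right⟩
  have m5 : ∀ x, x ∈ (aσ ++ bO).map π ↔ x ∉ bS.map π := fun x => by
    have h := o5'.mem_iff.1 (List.mem_finRange x)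
    rw [List.mem_append] at h
    exact ⟨fun h1 h2 => (List.nodup_append.1 nd5).2.2 x h1 x h2 rfl, h.resolve_right⟩
  have perm_aux : ∀ {m s : List (Fin N)} (_ : (m ++ s).Nodup) (_ : ∀ x, x ∈ m ↔ x ∉ s)
      (_ : ∀ x ∈ s, x ∈ S), m.Perm (laterList S ++ (startList S).filter (· ∉ s)) ∧
      ((startList S).filter (· ∉ s) ++ s).Perm (startList S) := by
    intro m s hnd hm hs
    have hnd' := List.nodup_append.1 hnd
    constructor
    · refine (List.perm_ext_iff_of_nodup hnd'.1 (List.nodup_append.2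
        ⟨laterList_nodup S, ndS.filter _, ?_⟩)).2 fun x => ?_
      · rintro x hx y hy rfl
        exact mem_laterList.1 hx (mem_startList.1 (List.mem_filter.1 hy).1)
      · simp only [hm, List.mem_append, mem_laterList, List.mem_filter, mem_startList,
          decide_eq_true_eq]
        have := hs x
        tauto
    · refine (List.perm_ext_iff_of_nodup (List.nodup_append.2
        ⟨ndS.filter _, hnd'.2.1, ?_⟩) ndS).2 fun x => ?_
      · rintro x hx y hy rfl
        simpa [hy] using (List.mem_filter.1 hx).2
      · simp only [List.mem_append, List.mem_filter, mem_startList, decide_eq_true_eq]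
        have := hs x
        tauto
  obtain ⟨pa1, pa2⟩ := perm_aux nd2 m2 haSS
  obtain ⟨pb1, pb2⟩ := perm_aux nd5 m5 hbSS
  -- Strands of `b` are not yet shifted. A non-first strand of `a` receives `c` times the parameter
  -- of its predecessor, which is its own old parameter.
  have v₁ : ∀ x ∈ laterList S ++ (startList S).filter (· ∉ aS), u x = u₁ x := by
    intro x hx
    rcases List.mem_append.1 (pa1.mem_iff.2 hx) with hx | hx
    · obtain ⟨j, rfl⟩ := mem_ord.1 hx
      exact (u₁b j).symm
    · obtain ⟨i, hi, rfl⟩ := List.mem_map.1 hx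
      obtain ⟨hi1, i', hi2⟩ := not_mem_pullStarts.1 (mem_laterList.1 hi)
      rw [hu _ _ hi2 hi1, ← hσA.apply_pullStarts ha hi2 hi1, u₁a]
  have v₂ : ∀ x ∈ laterList S ++ (startList S).filter (· ∉ bS.map π), u₁ x = u₃ x := by
    intro x hx
    obtain ⟨y, hy, rfl⟩ := List.mem_map.1 (pb1.mem_iff.2 hx)
    have e3 : u₃ (π y) = c * u (ρ⁻¹ y) := by simp [hu₃, hσ_def]
    rw [u₁π, e3]
    rcases List.mem_append.1 hy with hy | hy
    · exact if_pos (pAσ.mem_iff.1 hy)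
    · obtain ⟨j, hj, rfl⟩ := List.mem_map.1 hy
      obtain ⟨hj1, j', hj2⟩ := not_mem_pullStarts.1 (mem_laterList.1 hj)
      rw [u₁b, hu _ _ hj2 hj1, ← hσB.apply_pullStarts hb hj2 hj1, hρb']
  have hZX' : act a ZX ∈ loc F n aS.toFinset :=
    act_loc a (S := SA) (fun i hi => by simpa [haS] using mem_startList.2 hi) hZX
  obtain ⟨Z, hZ, e⟩ := exists_loc_of_braids (n := n) hq ru r₁ r₃ ndN (later_start_perm S) pa1 pa2
    pb1 pb2 ((later_start_perm S).symm.trans (finRange_perm_ord σ)) v₁ v₂ hZX' hZY'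
  refine ⟨σ, hσ, Z, by rwa [startList_toFinset] at hZ, ?_⟩
  rw [total, ← List.append_assoc, e]

end WheelProduct
end RShuffle

namespace RShuffle

/-! ### Iterated residues as values -/

section Residues

variable {K : Type*} [Field K] {F : Type*} [Field F] [Algebra K F] {n k l N : ℕ} {q qb : K}

/-- The reduced denominator divides every other denominator, so it does not vanish at the point
either, and the value does not depend on the fraction chosen. -/
theorem Sp.residue_eq {i j : Fin k} {c : K} {g r : RatF K k}
    (h : Sp (collide i j c) (g * (RShuffle.const k c * RShuffle.z i - RShuffle.z j)) r) :
    residue i j c g = r := by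
  obtain ⟨p, d, hd, h1, h2⟩ := h
  have e : algebraMap (MvPolynomial (Fin k) K) (RatF K k)
      (MvPolynomial.C c * MvPolynomial.X i - MvPolynomial.X j) =
        RShuffle.const k c * RShuffle.z i - RShuffle.z j := by
    rw [map_sub, map_mul, algebraMap_C]; rfl
  rw [← e] at h1
  simp only [residue, ← aeval_collide]
  generalize g * algebraMap (MvPolynomial (Fin k) K) (RatF K k)
    (MvPolynomial.C c * MvPolynomial.X i - MvPolynomial.X j) = h at *
  set a := IsFractionRing.num (MvPolynomial (Fin k) K) h
  set b : MvPolynomial (Fin k) K := (IsFractionRing.den (MvPolynomial (Fin k) K) h).1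
  have hb0 : algebraMap (MvPolynomial (Fin k) K) (RatF K k) b ≠ 0 :=
    algebraMap_ne_zero (nonZeroDivisors.ne_zero (IsFractionRing.den _ h).2)
  have hab : algebraMap _ (RatF K k) a / algebraMap _ (RatF K k) b = h :=
    IsFractionRing.mk'_num_den' (MvPolynomial (Fin k) K) h
  have e1 : a * d = p * b := by
    apply IsFractionRing.injective (MvPolynomial (Fin k) K) (RatF K k)
    rw [map_mul, map_mul, ← h1, ← hab]
    field_simp
  have hdvd : b ∣ d := by
    have hr : IsRelPrime a b := IsFractionRing.num_den_reduced (MvPolynomial (Fin k) K) h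
    exact hr.symm.dvd_of_dvd_mul_left ⟨p, by rw [e1, mul_comm]⟩
  have hb1 : MvPolynomial.aeval (collide i j c) b ≠ 0 := by
    obtain ⟨d', rfl⟩ := hdvd
    rw [map_mul] at hd
    exact left_ne_zero_of_mul hd
  have e2 := congrArg (MvPolynomial.aeval (collide i j c)) e1
  rw [map_mul, map_mul, ← h2] at e2
  rw [div_eq_iff hb1]
  apply mul_right_cancel₀ hd
  linear_combination e2

theorem aeval_algebraMap_comp (w : Fin k → MvPolynomial (Fin N) K) (p : MvPolynomial (Fin k) K) :
    MvPolynomial.aeval (fun i => algebraMap _ (RatF K N) (w i)) p =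
      algebraMap _ (RatF K N) (MvPolynomial.aeval w p) :=
  (MvPolynomial.comp_aeval_apply w
    (IsScalarTower.toAlgHom K (MvPolynomial (Fin N) K) (RatF K N)) p).symm

theorem aeval_aeval (w : Fin k → MvPolynomial (Fin N) K) (u : Fin N → F)
    (p : MvPolynomial (Fin k) K) : MvPolynomial.aeval u (MvPolynomial.aeval w p) =
      MvPolynomial.aeval (fun i => MvPolynomial.aeval u (w i)) p :=
  MvPolynomial.comp_aeval_apply w (MvPolynomial.aeval u) p

/-- A function that is regular at a specialization of a point is regular at the point. -/
theorem Sp.generalize {w : Fin k → MvPolynomial (Fin N) K} {u : Fin N → F} {G : RatF K k} {h : F}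
    (H : Sp (fun i => MvPolynomial.aeval u (w i)) G h) :
    ∃ v, Sp (fun i => algebraMap _ (RatF K N) (w i)) G v := by
  obtain ⟨p, d, h1, h2, -⟩ := H
  have hd : MvPolynomial.aeval (fun i => algebraMap _ (RatF K N) (w i)) d ≠ 0 := by
    rw [aeval_algebraMap_comp]
    refine algebraMap_ne_zero fun h0 => h1 ?_
    rw [← aeval_aeval, h0, map_zero]
  exact ⟨_, p, d, hd, h2, div_mul_cancel₀ _ hd⟩

/-- Values may be computed in two steps. -/
theorem Sp.comp {w : Fin k → MvPolynomial (Fin N) K} {u : Fin N → F} {G : RatF K k}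
    {v : RatF K N} {h : F} (H : Sp (fun i => MvPolynomial.aeval u (w i)) G h)
    (H' : Sp (fun i => algebraMap _ (RatF K N) (w i)) G v) : Sp u v h := by
  obtain ⟨p, d, h1, h2, h3⟩ := H
  have hd : MvPolynomial.aeval (fun i => algebraMap _ (RatF K N) (w i)) d ≠ 0 := by
    rw [aeval_algebraMap_comp]
    refine algebraMap_ne_zero fun h0 => h1 ?_
    rw [← aeval_aeval, h0, map_zero]
  have e : v = MvPolynomial.aeval (fun i => algebraMap _ (RatF K N) (w i)) p /
      MvPolynomial.aeval (fun i => algebraMap _ (RatF K N) (w i)) d :=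
    H'.unique ⟨p, d, hd, h2, div_mul_cancel₀ _ hd⟩
  refine ⟨MvPolynomial.aeval w p, MvPolynomial.aeval w d, by rwa [aeval_aeval], ?_, ?_⟩
  · rw [← aeval_algebraMap_comp, ← aeval_algebraMap_comp, e, div_mul_cancel₀ _ hd]
  · rw [aeval_aeval, aeval_aeval, h3]

/-- The point at which the variables in `L` are set to `c^e` times the variables at `st`. -/
def partialPoint (st : Fin k → Fin k) (c : Fin k → K) (L : List (Fin k)) (p : Fin k) :
    MvPolynomial (Fin k) K :=
  if p ∈ L then MvPolynomial.C (c p) * MvPolynomial.X (st p) else MvPolynomial.X p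

/-- Induction on the variables still to be eliminated. Here `g` is the value of `G` at the partly
specialized point, and each residue moves one linear form into `G`. Regularity of the full product
at the final point, `hv`, supplies the regularity needed at every intermediate point. -/
theorem foldl_residue {st pr : Fin k → Fin k} {c : Fin k → K} {d : K} {Q : Fin k → Prop}
    (hst : ∀ p, ¬ Q (st p)) (hQ : ∀ p, ¬ Q p → st p = p ∧ c p = 1)
    (hpr : ∀ p, Q p → st (pr p) = st p ∧ c p = d * c (pr p)) (hprne : ∀ p, Q p → pr p ≠ p)
    {L : List (Fin k)} {D : List (Fin k)} (hL : ∀ p ∈ L, Q p) (hD : ∀ p ∈ D, Q p)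
    (hnd : (D ++ L).Nodup)
    (hord : ∀ L₁ p L₂, L = L₁ ++ p :: L₂ → ¬ Q (pr p) ∨ pr p ∈ D ++ L₁) {G g v : RatF K k}
    (hg : Sp (fun i => algebraMap _ (RatF K k) (partialPoint st c D i)) G g)
    (hv : Sp (fun i => algebraMap _ (RatF K k) (partialPoint st c (D ++ L) i))
      (G * (L.map fun p => const k d * z (pr p) - z p).prod) v) :
    L.foldl (fun g p => residue (st p) p (c p) g) g = v := by
  induction L generalizing D G g with
  | nil =>
    rw [List.append_nil, List.map_nil, List.prod_nil, mul_one] at hv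
    exact hg.unique hv
  | cons p L ih =>
    rw [List.foldl_cons]
    have hp : Q p := hL p (by simp)
    have hpD : p ∉ D := fun h => (List.nodup_append.1 hnd).2.2 p h p (by simp) rfl
    have hstne : ∀ x, st x ≠ p := fun x h => hst x (h ▸ hp)
    have hpt : ∀ (L' : List (Fin k)) (x : Fin k), ¬ Q x ∨ x ∈ L' →
        algebraMap _ (RatF K k) (partialPoint st c L' x) = const k (c x) * z (st x) := by
      intro L' x hx
      by_cases h : x ∈ L'
      · rw [partialPoint, if_pos h, map_mul, algebraMap_C]; rfl
      · obtain ⟨e1, e2⟩ := hQ x (hx.resolve_right h)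
        rw [partialPoint, if_neg h, e1, e2]
        simp [const, z]
    have hpt' : ∀ (L' : List (Fin k)) (x : Fin k), x ∉ L' →
        algebraMap _ (RatF K k) (partialPoint st c L' x) = z x := by
      intro L' x hx
      rw [partialPoint, if_neg hx]; rfl
    have hpr' : ∀ (L' : List (Fin k)) (x : Fin k), ∃ (y : Fin k) (e : K), (x = y ∨ ∃ x', y = st x') ∧
        algebraMap _ (RatF K k) (partialPoint st c L' x) = const k e * z y := by
      intro L' x
      by_cases h : x ∈ L'
      · exact ⟨st x, c x, Or.inr ⟨x, rfl⟩, hpt L' x (Or.inr h)⟩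
      · exact ⟨x, 1, Or.inl rfl, by rw [hpt' L' x h]; simp [const]⟩
    have hcol : ∀ i, MvPolynomial.aeval (collide (st p) p (c p)) (partialPoint st c D i) =
        algebraMap _ (RatF K k) (partialPoint st c (D ++ [p]) i) := by
      intro i
      by_cases h : i ∈ D
      · rw [hpt _ _ (Or.inr (by simp [h])), partialPoint, if_pos h, map_mul, MvPolynomial.aeval_C,
          MvPolynomial.aeval_X, collide, Function.update_of_ne (hstne i)]
        rfl
      · rw [partialPoint, if_neg h, MvPolynomial.aeval_X]
        by_cases hi : i = p
        · subst hi
          rw [hpt _ _ (Or.inr (by simp)), collide, Function.update_self]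
        · rw [hpt' _ _ (by simp [h, hi]), collide, Function.update_of_ne hi]
    have hfin : ∀ i, MvPolynomial.aeval
        (fun i => algebraMap _ (RatF K k) (partialPoint st c (D ++ p :: L) i))
        (partialPoint st c (D ++ [p]) i) =
        algebraMap _ (RatF K k) (partialPoint st c (D ++ p :: L) i) := by
      intro i
      by_cases h : i ∈ D ++ [p]
      · rw [hpt _ i (Or.inr (by simp at h ⊢; tauto)), partialPoint, if_pos h, map_mul,
          MvPolynomial.aeval_C, MvPolynomial.aeval_X, hpt _ _ (Or.inl (hst i)), (hQ _ (hst i)).1,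
          (hQ _ (hst i)).2]
        simp [const]
      · rw [partialPoint, if_neg h, MvPolynomial.aeval_X]
    -- Regularity passes from the final point to the more generic intermediate one. There the
    -- remaining linear forms do not vanish, since each contains a variable not yet specialized, and
    -- can be divided out.
    have hreg : ∃ r, Sp (fun i => algebraMap _ (RatF K k) (partialPoint st c (D ++ [p]) i))
        (G * (const k d * z (pr p) - z p)) r := by
      have h1 := hv
      rw [← funext hfin] at h1
      obtain ⟨r, hr⟩ := h1.generalize
      rw [List.map_cons, List.prod_cons, ← mul_assoc] at hr
      have hLp : ∀ L' : List (Fin k), (∀ x ∈ L', x ∈ L) → ∃ s, s ≠ 0 ∧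
          Sp (fun i => algebraMap _ (RatF K k) (partialPoint st c (D ++ [p]) i))
            (L'.map fun p => const k d * z (pr p) - z p).prod s := by
        intro L' hL'
        induction L' with
        | nil => exact ⟨1, one_ne_zero, by simpa using Sp.one _⟩
        | cons x L' ih' =>
          obtain ⟨s, hs, hs'⟩ := ih' fun y hy => hL' y (by simp [hy])
          have hx : x ∈ L := hL' x (by simp)
          have hxQ : Q x := hL x (by simp [hx])
          have hxD : x ∉ D ++ [p] := by
            intro h
            have hnd2 : ((D ++ [p]) ++ L).Nodup := by simpa using hnd
            exact (List.nodup_append.1 hnd2).2.2 x h x hx rfl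
          have h2 := ((Sp.const (fun i => algebraMap _ (RatF K k) (partialPoint st c (D ++ [p]) i))
            d).mul (Sp.z _ (pr x))).sub (Sp.z _ x)
          refine ⟨_, mul_ne_zero ?_ hs, by simpa using h2.mul hs'⟩
          rw [hpt' _ x hxD]
          obtain ⟨y, e, hy, hy'⟩ := hpr' (D ++ [p]) (pr x)
          rw [hy']
          have hyx : x ≠ y := by
            rintro rfl
            rcases hy with h | ⟨x', h⟩
            · exact hprne x hxQ h
            · exact hst x' (h ▸ hxQ)
          have := linear_ne_zero (K := K) hyx one_ne_zero (d * e)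
          intro h0
          apply this
          simp only [const, map_one, map_mul] at h0 ⊢
          linear_combination -h0
      obtain ⟨s, hs, hs'⟩ := hLp L fun x hx => hx
      have h3 := hr.mul (hs'.inv hs)
      refine ⟨_, by
        rwa [mul_assoc, mul_inv_cancel₀, mul_one] at h3
        intro h0
        rw [h0] at hs'
        exact hs (hs'.unique (Sp.zero _))⟩
    obtain ⟨r, hr⟩ := hreg
    -- The predecessor of `p` is a first label or already specialized, so the form `d z_{pr p} -
    -- z_p` takes the value `c p z_{st p} - z_p` used by `residue`.
    have hstep : residue (st p) p (c p) g = r := by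
      refine Sp.residue_eq ?_
      have h1 : Sp (fun i => algebraMap _ (RatF K k) (partialPoint st c D i))
          (G * (const k d * z (pr p) - z p)) (g * (const k (c p) * z (st p) - z p)) := by
        refine hg.mul ?_
        have h2 := ((Sp.const (fun i => algebraMap _ (RatF K k) (partialPoint st c D i))
            d).mul (Sp.z _ (pr p))).sub (Sp.z _ p)
        rw [hpt' D p hpD, hpt D (pr p) (by simpa using hord [] p L rfl), (hpr p hp).1] at h2
        rw [(hpr p hp).2]
        simpa [const, mul_assoc] using h2
      refine Sp.comp ?_ h1
      rwa [funext hcol]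
    rw [hstep]
    refine ih (D := D ++ [p]) (G := G * (const k d * z (pr p) - z p))
      (fun x hx => hL x (by simp [hx])) ?_ (by simpa using hnd) ?_ hr ?_
    · intro x hx
      rcases List.mem_append.1 hx with hx | hx
      · exact hD x hx
      · rw [List.mem_singleton.1 hx]
        exact hp
    · rintro L₁ x L₂ rfl
      have := hord (p :: L₁) x L₂ rfl
      simpa using this
    · simpa [mul_assoc] using hv

end Residues
end RShuffle

namespace RShuffle

/-! ### Blocks of a composition -/

section Blocks

variable {k : ℕ} (lam : Composition k)

/-- The first labels of the blocks of a composition. -/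
def starts : Finset (Fin k) := Finset.univ.filter fun p => (lam.invEmbedding p : ℕ) = 0

variable {lam}

theorem mem_starts {p : Fin k} : p ∈ starts lam ↔ (lam.invEmbedding p : ℕ) = 0 := by
  rw [starts, Finset.mem_filter, and_iff_right (Finset.mem_univ p)]

theorem start_val (s : Fin lam.length) : (start lam s : ℕ) = lam.sizeUpTo s := by
  change (lam.embedding s _ : ℕ) = _
  rw [lam.coe_embedding]; simp

theorem index_start (s : Fin lam.length) : lam.index (start lam s) = s := lam.index_embedding s _

theorem invEmbedding_start (s : Fin lam.length) : (lam.invEmbedding (start lam s) : ℕ) = 0 :=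
  lam.invEmbedding_comp s _

theorem start_mem_starts (s : Fin lam.length) : start lam s ∈ starts lam :=
  mem_starts.2 (invEmbedding_start s)

theorem start_index {p : Fin k} (h : p ∈ starts lam) : start lam (lam.index p) = p := by
  conv_rhs => rw [← lam.embedding_comp_inv p]
  exact congrArg (lam.embedding (lam.index p)) (Fin.ext (mem_starts.1 h : _ = 0).symm)

theorem mem_starts_iff {p : Fin k} : p ∈ starts lam ↔ ∃ s, start lam s = p :=
  ⟨fun h => ⟨_, start_index h⟩, by rintro ⟨s, rfl⟩; exact start_mem_starts s⟩

theorem exists_embedding (p : Fin k) : ∃ s e, lam.embedding s e = p :=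
  ⟨_, _, lam.embedding_comp_inv p⟩

theorem embedding_mem_starts {s : Fin lam.length} {e : Fin (lam.blocksFun s)} :
    lam.embedding s e ∈ starts lam ↔ (e : ℕ) = 0 := by
  rw [mem_starts, lam.invEmbedding_comp]

theorem embedding_lt {s t : Fin lam.length} (h : s < t) (e : Fin (lam.blocksFun s))
    (e' : Fin (lam.blocksFun t)) : lam.embedding s e < lam.embedding t e' := by
  rw [Fin.lt_def, lam.coe_embedding, lam.coe_embedding]
  have h1 := lam.sizeUpTo_succ' s
  have h2 := lam.monotone_sizeUpTo (show (s : ℕ) + 1 ≤ t from h)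
  have := e.2
  omega

theorem embedding_lt_iff {s t : Fin lam.length} {e : Fin (lam.blocksFun s)}
    {e' : Fin (lam.blocksFun t)} :
    lam.embedding s e < lam.embedding t e' ↔ s < t ∨ (s = t ∧ (e : ℕ) < e') := by
  rcases lt_trichotomy s t with h | rfl | h
  · simp [h, embedding_lt h]
  · simp [(lam.embedding s).lt_iff_lt]
  · have := embedding_lt h e' e
    simp [h.ne', this.not_gt, h.not_gt]

theorem start_lt_iff {s t : Fin lam.length} : start lam s < start lam t ↔ s < t := by
  change lam.embedding s _ < lam.embedding t _ ↔ _
  rw [embedding_lt_iff]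
  simp

/-- Consecutive labels in a block. -/
theorem exists_embedding_succ {p p' : Fin k} (h : (p' : ℕ) = p + 1) (h' : p' ∉ starts lam) :
    ∃ s e e', lam.embedding s e = p ∧ lam.embedding s e' = p' ∧ (e' : ℕ) = e + 1 := by
  obtain ⟨s, e', rfl⟩ := exists_embedding (lam := lam) p'
  rw [embedding_mem_starts] at h'
  refine ⟨s, ⟨e' - 1, by omega⟩, e', Fin.ext ?_, rfl, by simp; omega⟩
  rw [lam.coe_embedding] at h ⊢
  simp
  omega

theorem embedding_succ {s : Fin lam.length} {e e' : Fin (lam.blocksFun s)} (h : (e' : ℕ) = e + 1) :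
    (lam.embedding s e' : ℕ) = lam.embedding s e + 1 := by
  rw [lam.coe_embedding, lam.coe_embedding, h, add_assoc]

theorem hasZero_starts : HasZero (starts lam) := by
  intro p hp
  obtain ⟨s, e, rfl⟩ := exists_embedding (lam := lam) p
  rw [lam.coe_embedding] at hp
  rw [embedding_mem_starts]
  omega

/-- The block boundaries are the elements of `S` together with 0 and the end `k`. This permits wheel
conditions to be used for the blocks induced on a subfamily of strands. -/
theorem HasZero.exists_starts {S : Finset (Fin k)} (h : HasZero S) :
    ∃ lam : Composition k, starts lam = S := by
  let c : CompositionAsSet k :=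
    { boundaries := insert 0 (insert (Fin.last k) (S.map Fin.castSuccEmb))
      zero_mem := by simp
      getLast_mem := by simp }
  refine ⟨c.toComposition, ?_⟩
  ext p
  have h1 : p ∈ S ↔ p.castSucc ∈ c.boundaries := by
    simp only [c, Finset.mem_insert, Finset.mem_map, Fin.castSuccEmb_apply]
    constructor
    · exact fun hp => Or.inr (Or.inr ⟨p, hp, rfl⟩)
    · rintro (h0 | h0 | ⟨p', hp', h0⟩)
      · exact h p (by simpa using congrArg Fin.val h0)
      · exact absurd h0 (Fin.castSucc_lt_last p).ne
      · rwa [← Fin.castSucc_injective _ h0]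
  rw [h1, ← c.toComposition_boundaries, mem_starts_iff]
  simp only [Composition.boundaries, Finset.mem_map, Finset.mem_univ, true_and]
  constructor
  · rintro ⟨s, rfl⟩
    exact ⟨s.castSucc, Fin.ext (by simp [Composition.boundary, start_val])⟩
  · rintro ⟨i, hi⟩
    have hi' : c.toComposition.sizeUpTo i = p := by
      simpa [Composition.boundary] using congrArg Fin.val hi
    have hlt : (i : ℕ) < c.toComposition.length := by
      by_contra hge
      rw [c.toComposition.sizeUpTo_ofLength_le i (by omega)] at hi'
      exact p.2.ne hi'.symm
    exact ⟨⟨i, hlt⟩, Fin.ext (by rw [start_val]; exact hi')⟩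

theorem val_finRotate {m : ℕ} (e : Fin m) :
    (finRotate m e : ℕ) = if (e : ℕ) + 1 < m then (e : ℕ) + 1 else 0 := by
  cases m with
  | zero => exact e.elim0
  | succ m =>
    split_ifs with h
    · have : e = ⟨e, by omega⟩ := rfl
      rw [this, finRotate_of_lt (by omega)]
    · have : e = Fin.last m := Fin.ext (by simp; omega)
      rw [this, finRotate_last]; rfl

theorem blockCycles_embedding (s : Fin lam.length) (e : Fin (lam.blocksFun s)) :
    blockCycles lam (lam.embedding s e) = lam.embedding s (finRotate _ e) := by
  have : lam.blocksFinEquiv.symm (lam.embedding s e) = ⟨s, e⟩ := by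
    rw [Equiv.symm_apply_eq]; rfl
  rw [blockCycles, Equiv.permCongr_apply, this]
  rfl

theorem succPerm_blockCycles : SuccPerm (starts lam) (blockCycles lam) := by
  intro p p' h h'
  obtain ⟨s, e, e', rfl, rfl, h1⟩ := exists_embedding_succ h h'
  rw [blockCycles_embedding]
  congr 1
  refine Fin.ext ?_
  rw [val_finRotate, if_pos (by omega), h1]

theorem exists_blockCycles_eq_start (s : Fin lam.length) : ∃ e : Fin (lam.blocksFun s), (e : ℕ) + 1 = lam.blocksFun s ∧
    blockCycles lam (lam.embedding s e) = start lam s := by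
  have h := lam.one_le_blocksFun s
  refine ⟨⟨lam.blocksFun s - 1, by omega⟩, Nat.sub_add_cancel h, ?_⟩
  rw [blockCycles_embedding]
  change _ = lam.embedding s _
  congr 1
  refine Fin.ext ?_
  rw [val_finRotate, if_neg (by simp)]

theorem mem_laterIdx {s : Fin lam.length} {e : Fin (lam.blocksFun s)} :
    e ∈ laterIdx lam s ↔ 1 ≤ (e : ℕ) := by
  simp [laterIdx]

theorem startList_starts : startList (starts lam) = (List.finRange lam.length).map (start lam) :=
  ord_eq_filter (fun _ _ h => start_lt_iff.2 h) _ fun x => by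
    rw [decide_eq_true_iff, mem_starts_iff, mem_ord]

/-- Both lists are strictly increasing; hence the iterated residue eliminates the variables in
increasing order of their labels. -/
theorem laterList_starts : laterList (starts lam) =
    (List.finRange lam.length).flatMap fun s => (laterIdx lam s).map (lam.embedding s) := by
  have hp : (laterList (starts lam)).Pairwise (· < ·) := (List.pairwise_lt_finRange k).filter _
  have hp' : ((List.finRange lam.length).flatMap fun s =>
      (laterIdx lam s).map (lam.embedding s)).Pairwise (· < ·) := by
    rw [List.pairwise_flatMap]
    refine ⟨fun s _ => ?_, (List.pairwise_lt_finRange _).imp fun {s t} hst => ?_⟩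
    · rw [List.pairwise_map]
      exact ((List.pairwise_lt_finRange _).filter _).imp fun h => (lam.embedding s).lt_iff_lt.2 h
    · intro x hx y hy
      obtain ⟨e, -, rfl⟩ := List.mem_map.1 hx
      obtain ⟨e', -, rfl⟩ := List.mem_map.1 hy
      exact embedding_lt hst e e'
  refine List.Perm.eq_of_pairwise (fun x y _ _ h h' => absurd (h.trans h') (lt_irrefl x)) hp hp' ?_
  refine (List.perm_ext_iff_of_nodup (hp.imp fun h => h.ne) (hp'.imp fun h => h.ne)).2 fun x => ?_
  obtain ⟨s, e, rfl⟩ := exists_embedding (lam := lam) x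
  rw [mem_laterList, embedding_mem_starts]
  simp only [List.mem_flatMap, List.mem_finRange, true_and, List.mem_map, mem_laterIdx]
  constructor
  · exact fun h => ⟨s, e, by omega, rfl⟩
  · rintro ⟨t, e', h1, h2⟩ h3
    have h4 := embedding_mem_starts (lam := lam) (s := t) (e := e')
    rw [h2, embedding_mem_starts] at h4
    exact absurd (h4.1 h3) (by omega)

/-- The preimages are block ends for first labels and predecessors for the others, so within each of
the two classes the cycles keep the increasing order. -/
theorem ord_blockCycles_interleaving :
    Interleaving (fun x y => (blockCycles lam)⁻¹ x < (blockCycles lam)⁻¹ y)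
      (laterList (starts lam)) (startList (starts lam)) (ord (blockCycles lam).toEmbedding) := by
  have hp : (ord (blockCycles lam).toEmbedding).Pairwise
      fun x y => (blockCycles lam)⁻¹ x < (blockCycles lam)⁻¹ y := by
    rw [ord, List.pairwise_map]
    exact (List.pairwise_lt_finRange k).imp fun h => by simpa using h
  have key : ∀ (f : Fin k → Bool), (∀ x y, f x = true → f y = true →
      (blockCycles lam)⁻¹ x < (blockCycles lam)⁻¹ y → x < y) →
      (ord (blockCycles lam).toEmbedding).filter f = (List.finRange k).filter f := by
    intro f hf
    refine List.Perm.eq_of_pairwise (le := (· < ·))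
      (fun x y _ _ h h' => absurd (h.trans h') (lt_irrefl x)) ?_
      ((List.pairwise_lt_finRange k).filter _) (List.Perm.filter _ (finRange_perm_ord _).symm)
    rw [List.pairwise_filter]
    exact hp.imp fun h hx hy => hf _ _ hx hy h
  have h := Interleaving.of_filter _ (fun x y h => h.not_gt) (fun x => decide (x ∈ starts lam)) hp
  have e1 := key (fun x => decide (x ∈ starts lam)) ?_
  have e2 := key (fun x => !decide (x ∈ starts lam)) ?_
  · rw [e1, e2] at h
    simpa [laterList, startList] using h
  · intro x y hx hy h
    obtain ⟨s, e, rfl⟩ := exists_embedding (lam := lam) x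
    obtain ⟨t, e', rfl⟩ := exists_embedding (lam := lam) y
    simp only [Bool.not_eq_true', decide_eq_false_iff_not, embedding_mem_starts] at hx hy
    have hs : ∀ (s : Fin lam.length) (e : Fin (lam.blocksFun s)) (h0 : (e : ℕ) ≠ 0),
        (blockCycles lam)⁻¹ (lam.embedding s e) = lam.embedding s ⟨e - 1, by omega⟩ := by
      intro s e h0
      rw [Equiv.Perm.inv_def, Equiv.symm_apply_eq, blockCycles_embedding]
      congr 1
      refine Fin.ext ?_
      rw [val_finRotate, if_pos (by simp; omega)]
      simp; omega
    rw [hs s e hx, hs t e' hy, embedding_lt_iff] at h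
    rw [embedding_lt_iff]
    refine h.imp_right fun h => ⟨h.1, ?_⟩
    have := h.2
    simp at this
    omega
  · intro x y hx hy h
    obtain ⟨s, rfl⟩ := mem_starts_iff.1 (of_decide_eq_true hx)
    obtain ⟨t, rfl⟩ := mem_starts_iff.1 (of_decide_eq_true hy)
    obtain ⟨e, h1, h2⟩ := exists_blockCycles_eq_start s
    obtain ⟨e', h1', h2'⟩ := exists_blockCycles_eq_start t
    rw [← h2, ← h2', Equiv.Perm.inv_def, Equiv.symm_apply_apply, Equiv.symm_apply_apply,
      embedding_lt_iff] at h
    rw [start_lt_iff]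
    rcases h with h | ⟨rfl, h⟩
    · exact h
    · omega

end Blocks
end RShuffle

namespace RShuffle

/-! ### Wheel conditions and values at the generic point -/

section Generic

variable {K : Type*} [Field K] {n k l m N : ℕ} {q qb : K}

theorem scaled_z_injective (hq : GenericParams q qb) {e e' : ℕ} {s s' : Fin m}
    (h : const m (qb ^ e) * z s = const m (qb ^ e') * z s') : s = s' ∧ e = e' := by
  have hs : s = s' := by
    by_contra hs
    exact linear_ne_zero hs (pow_ne_zero e hq.qb_ne) (qb ^ e') (sub_eq_zero.2 h)
  subst hs
  refine ⟨rfl, ?_⟩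
  have h1 := (algebraMap K (RatF K m)).injective (mul_right_cancel₀ (z_ne_zero s) h)
  by_contra hne
  rcases Nat.lt_or_gt_of_ne hne with hlt | hlt
  · refine hq.qb_pow (e' - e) (by omega) (mul_left_cancel₀ (pow_ne_zero e hq.qb_ne) ?_)
    rw [← pow_add, mul_one, h1]; congr 1; omega
  · refine hq.qb_pow (e - e') (by omega) (mul_left_cancel₀ (pow_ne_zero e' hq.qb_ne) ?_)
    rw [← pow_add, mul_one, ← h1]; congr 1; omega

/-- Parameters in different variables are independent. For the same variable a singularity would
mean q² q̄^{e'} = q̄^e, excluded by `qb_pow_ne` or `mul_qb_pow_ne` according to the sign of e - e'.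
-/
theorem regular_monomial (hq : GenericParams q qb) {w : Fin N → RatF K m}
    (h : ∀ x, ∃ (e : ℕ) (s : Fin m), w x = const m (qb ^ e) * z s) (l : List (Fin N)) :
    Regular (const m q) w l := by
  intro x _ y _ _ h0
  obtain ⟨e, s, hx⟩ := h x
  obtain ⟨e', s', hy⟩ := h y
  have hq0 : const m q ≠ 0 := const_ne_zero hq.q_ne
  have h1 : const m (q ^ 2 * qb ^ e') * z s' - const m (qb ^ e) * z s = 0 := by
    have : const m (q ^ 2 * qb ^ e') * z s' - const m (qb ^ e) * z s =
        const m q * (const m q * w y - (const m q)⁻¹ * w x) := by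
      rw [mul_sub, mul_inv_cancel_left₀ hq0, hx, hy]
      simp only [const, map_mul, map_pow]
      ring
    rw [this, h0, mul_zero]
  have hs : s' = s := by
    by_contra hs
    exact linear_ne_zero hs (mul_ne_zero (pow_ne_zero 2 hq.q_ne) (pow_ne_zero e' hq.qb_ne)) _ h1
  subst hs
  have h2 := (algebraMap K (RatF K m)).injective (mul_right_cancel₀ (z_ne_zero s') (sub_eq_zero.1 h1))
  rcases le_total e e' with hle | hle
  · refine hq.mul_qb_pow_ne (e' - e) (mul_right_cancel₀ (pow_ne_zero e hq.qb_ne) ?_)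
    rw [mul_assoc, ← pow_add, Nat.sub_add_cancel hle, h2, one_mul]
  · refine hq.qb_pow_ne (e - e') (mul_right_cancel₀ (pow_ne_zero e' hq.qb_ne) ?_)
    rw [← pow_add, Nat.sub_add_cancel hle, h2]

/-- The point `z_{c_s + e} = y_s q̄^{2e}`. -/
def genericPoint (qb : K) (lam : Composition k) (p : Fin k) : RatF K lam.length :=
  const _ (qb ^ (2 * (lam.invEmbedding p : ℕ))) * z (lam.index p)

variable {lam : Composition k}

theorem genericPoint_embedding (s : Fin lam.length) (e : Fin (lam.blocksFun s)) :
    genericPoint qb lam (lam.embedding s e) = const _ (qb ^ (2 * (e : ℕ))) * z s := by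
  rw [genericPoint, lam.invEmbedding_comp, lam.index_embedding]

theorem genericPoint_start (s : Fin lam.length) : genericPoint qb lam (start lam s) = z s := by
  rw [genericPoint, invEmbedding_start, index_start]
  simp [const]

theorem genericPoint_succ {p p' : Fin k} (h : (p' : ℕ) = p + 1) (h' : p' ∉ starts lam) :
    genericPoint qb lam p' = const _ qb ^ 2 * genericPoint qb lam p := by
  obtain ⟨s, e, e', rfl, rfl, h1⟩ := exists_embedding_succ h h'
  rw [genericPoint_embedding, genericPoint_embedding, h1]
  simp only [const, map_pow]
  ring

theorem genericPoint_ne_zero (hqb : qb ≠ 0) (p : Fin k) : genericPoint qb lam p ≠ 0 :=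
  mul_ne_zero (const_ne_zero (pow_ne_zero _ hqb)) (z_ne_zero _)

theorem genericPoint_mul (e : ℕ) (p : Fin k) : const _ (qb ^ e) * genericPoint qb lam p =
    const _ (qb ^ (e + 2 * (lam.invEmbedding p : ℕ))) * z (lam.index p) := by
  rw [genericPoint]
  simp only [const, map_pow]
  ring

/-- Identifies the factors of the pole denominator that vanish at the generic point: those of
consecutive labels in a block. -/
theorem genericPoint_eq (hq : GenericParams q qb) {x y : Fin k}
    (h : genericPoint qb lam x = const _ qb ^ 2 * genericPoint qb lam y) :
    (x : ℕ) = y + 1 ∧ x ∉ starts lam := by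
  rw [const, ← map_pow, ← const, genericPoint_mul, genericPoint] at h
  obtain ⟨s, e, rfl⟩ := exists_embedding (lam := lam) x
  obtain ⟨t, e', rfl⟩ := exists_embedding (lam := lam) y
  obtain ⟨h1, h2⟩ := scaled_z_injective hq h
  rw [lam.index_embedding, lam.index_embedding] at h1
  subst h1
  rw [lam.invEmbedding_comp, lam.invEmbedding_comp] at h2
  rw [embedding_mem_starts]
  exact ⟨embedding_succ (by omega), by omega⟩

theorem genericPoint_injective (hq : GenericParams q qb) :
    Function.Injective (genericPoint qb lam) := by
  intro x y h
  obtain ⟨s, e, rfl⟩ := exists_embedding (lam := lam) x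
  obtain ⟨t, e', rfl⟩ := exists_embedding (lam := lam) y
  rw [genericPoint_embedding, genericPoint_embedding] at h
  obtain ⟨rfl, h2⟩ := scaled_z_injective hq h
  congr 1
  exact Fin.ext (by omega)

/-- The product of the linear forms that vanish at the poles of the iterated residue. -/
def wheelDen (qb : K) (S : Finset (Fin N)) : RatF K N :=
  ∏ p : Fin N, ∏ p' : Fin N,
    if (p' : ℕ) = p + 1 ∧ p' ∉ S then const N qb ^ 2 * z p - z p' else 1

theorem list_prod_map_filter {α M : Type*} [Monoid M] (l : List α) (P : α → Prop) [DecidablePred P]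
    (f : α → M) : ((l.filter P).map f).prod = (l.map fun x => if P x then f x else 1).prod := by
  induction l with
  | nil => rfl
  | cons x l ih =>
    by_cases h : P x
    · simp [h, ih]
    · simp [h, ih]

theorem list_prod_map_flatMap {α β M : Type*} [Monoid M] (l : List α) (g : α → List β)
    (f : β → M) : ((l.flatMap g).map f).prod = (l.map fun x => ((g x).map f).prod).prod := by
  induction l with
  | nil => rfl
  | cons x l ih => simp [ih]

/-- The preceding label. -/
def pred' (p : Fin N) : Fin N := ⟨p - 1, by omega⟩

theorem wheelDen_eq {S : Finset (Fin N)} (hS : HasZero S) : wheelDen qb S =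
    ((laterList S).map fun p => const N (qb ^ 2) * z (pred' p) - z p).prod := by
  rw [laterList, list_prod_map_filter, wheelDen, Finset.prod_comm, ← Fin.prod_univ_def]
  refine Finset.prod_congr rfl fun p' _ => ?_
  by_cases h : p' ∈ S
  · simp [h]
  · obtain ⟨p, hp⟩ := hS.exists_pred h
    have hp' : pred' p' = p := Fin.ext (by simp [pred', hp])
    rw [Finset.prod_eq_single p, if_pos ⟨hp, h⟩, if_pos h, hp', const, const, map_pow]
    · intro x _ hx
      exact if_neg fun h' => hx (Fin.ext (by omega))
    · exact fun h' => absurd (Finset.mem_univ p) h'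

/-- An instance of `foldl_residue`: every non-first variable is eliminated, with the linear form
joining it to its predecessor. The embedding `start lam` renames y_s as z_{c_s}. -/
theorem iteratedResidue_eq {g : RatF K k} {v : RatF K lam.length}
    (h : Sp (genericPoint qb lam) (wheelDen qb (starts lam) * g) v) :
    iteratedResidue qb lam g = varMap (start lam) v := by
  have hφ : ∀ p, varMap (start lam) (genericPoint qb lam p) =
      const k (qb ^ (2 * (lam.invEmbedding p : ℕ))) * z (start lam (lam.index p)) := fun p => by
    rw [genericPoint, map_mul, varMap_z, varMap_const]
  have e1 : iteratedResidue qb lam g = (laterList (starts lam)).foldl (fun g p =>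
      residue (start lam (lam.index p)) p (qb ^ (2 * (lam.invEmbedding p : ℕ))) g) g := by
    rw [laterList_starts, List.foldl_flatMap, iteratedResidue]
    simp only [List.foldl_map, lam.index_embedding, lam.invEmbedding_comp]
  rw [e1]
  have hpred : ∀ p, p ∉ starts lam → ∃ s e e', lam.embedding s e = pred' p ∧
      lam.embedding s e' = p ∧ (e' : ℕ) = e + 1 := by
    intro p hp
    obtain ⟨p₀, hp₀⟩ := hasZero_starts.exists_pred hp
    obtain ⟨s, e, e', h1, h2, h3⟩ := exists_embedding_succ hp₀ hp
    exact ⟨s, e, e', h1.trans (Fin.ext (by simp [pred', hp₀])), h2, h3⟩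
  refine foldl_residue (pr := pred') (d := qb ^ 2) (Q := fun p => p ∉ starts lam) (D := []) (G := g)
    (fun p => not_not.2 (start_mem_starts _)) (fun p hp => ?_) (fun p hp => ?_) (fun p hp => ?_)
    (fun p hp => mem_laterList.1 hp) (by simp) (laterList_nodup _) ?_ ?_ ?_
  · rw [not_not] at hp
    exact ⟨start_index hp, by rw [mem_starts.1 hp]; simp⟩
  · obtain ⟨s, e, e', h1, h2, h3⟩ := hpred p hp
    rw [← h1, ← h2]
    refine ⟨congrArg _ (by rw [lam.index_embedding, lam.index_embedding]), ?_⟩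
    rw [lam.invEmbedding_comp, lam.invEmbedding_comp, h3, ← pow_add]
    congr 1
    ring
  · obtain ⟨p₀, hp₀⟩ := hasZero_starts.exists_pred hp
    intro h0
    have := congrArg Fin.val h0
    simp [pred'] at this
    omega
  · intro L₁ p L₂ hL
    by_cases hp : pred' p ∈ starts lam
    · exact Or.inl (not_not.2 hp)
    · right
      have hpw : (laterList (starts lam)).Pairwise (· < ·) :=
        (List.pairwise_lt_finRange k).filter _
      have hm := mem_laterList.2 hp
      have hpl : p ∉ starts lam := mem_laterList.1 (hL ▸ by simp)
      obtain ⟨p₀, hp₀⟩ := hasZero_starts.exists_pred hpl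
      have hlt : pred' p < p := by rw [Fin.lt_def]; simp [pred']; omega
      rw [hL, List.pairwise_append] at hpw
      rw [hL, List.mem_append] at hm
      rcases hm with hm | hm
      · simpa using hm
      · rcases List.mem_cons.1 hm with hm | hm
        · exact absurd hm hlt.ne
        · exact absurd ((List.pairwise_cons.1 hpw.2.1).1 _ hm) hlt.not_gt
  · have := Sp.self g
    convert this using 1
    funext p
    rw [partialPoint, if_neg List.not_mem_nil]
    rfl
  · have h1 := h.map (varMap (start lam))
    rw [wheelDen_eq hasZero_starts, mul_comm] at h1
    convert h1 using 1
    funext p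
    rw [hφ, List.nil_append, partialPoint]
    split_ifs with hp
    · rw [map_mul, algebraMap_C]; rfl
    · rw [mem_laterList, not_not] at hp
      rw [start_index hp, mem_starts.1 hp]
      simp [const, RShuffle.z]

theorem exists_grid_smul {A B M α β : Type*} [Field A] [Field B] [Ring M] [Algebra B M] (φ : A →+* B)
    (l : List α) (r : List β) (P : α → β → Prop) [∀ a b, Decidable (P a b)] (f g : α → β → M)
    (h : ∀ a ∈ l, ∀ b ∈ r, ∃ c, c ≠ 0 ∧ f a b = φ c • g a b) :
    ∃ c, c ≠ 0 ∧ (l.map fun a => (r.map fun b => if P a b then f a b else 1).prod).prod =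
      φ c • (l.map fun a => (r.map fun b => if P a b then g a b else 1).prod).prod := by
  classical
  have h' : ∀ a b, ∃ c, c ≠ 0 ∧ (a ∈ l → b ∈ r → f a b = φ c • g a b) := by
    intro a b
    by_cases hab : a ∈ l ∧ b ∈ r
    · obtain ⟨c, hc, e⟩ := h a hab.1 b hab.2
      exact ⟨c, hc, fun _ _ => e⟩
    · exact ⟨1, one_ne_zero, fun ha hb => absurd ⟨ha, hb⟩ hab⟩
  choose c hc e using h'
  refine ⟨(l.map fun a => (r.map fun b => if P a b then c a b else 1).prod).prod, ?_, ?_⟩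
  · refine List.prod_ne_zero fun h0 => ?_
    obtain ⟨a, -, ha⟩ := List.mem_map.1 h0
    refine List.prod_ne_zero (fun h0 => ?_) ha
    obtain ⟨b, -, hb⟩ := List.mem_map.1 h0
    split_ifs at hb
    exacts [hc a b hb, one_ne_zero hb]
  · rw [list_grid_smul l r P f g (fun a b => φ (c a b)) fun a ha b hb => e a b ha hb]
    congr 1
    rw [map_list_prod, List.map_map]
    congr 1
    refine List.map_congr_left fun a _ => ?_
    rw [Function.comp_apply, map_list_prod, List.map_map]
    congr 1
    refine List.map_congr_left fun b _ => ?_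
    rw [Function.comp_apply]
    split_ifs
    · rfl
    · exact (map_one φ).symm

/-- The scalar comes from the smaller field of functions of the y_s, so that the unknown tensor of
the wheel condition can absorb it. -/
theorem exists_R_eq_smul_Rh (φ : Fin m ↪ Fin N) {a b : Fin N} (hab : a ≠ b) {x y : RatF K m}
    (hy : y ≠ 0) (hxy : y - x ≠ 0) (hd : const m q * y - (const m q)⁻¹ * x ≠ 0) :
    ∃ c : RatF K m, c ≠ 0 ∧ (R q a b (varMap φ x / varMap φ y) : Tens K n N) =
      varMap φ c • Rh (const N q) a b (varMap φ x) (varMap φ y) := by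
  have hinj : ∀ g : RatF K m, g ≠ 0 → varMap φ g ≠ 0 := fun g => (map_ne_zero (varMap φ : RatF K m →ₐ[K] RatF K N)).2
  refine ⟨gfac q x y, div_ne_zero hd hxy, ?_⟩
  rw [varMap_gfac, R_eq_smul_Rh q hab (hinj y hy) (by rw [← map_sub]; exact hinj _ hxy)]
  rw [← varMap_const φ q, ← map_inv₀, ← map_mul, ← map_mul, ← map_sub]
  exact hinj _ hd

/-- The pairs (c_s, c_t + e) with s ≤ t are exactly those with c_s < c_t + e, the crossings that
bring the first labels to the right of all others. -/
theorem exists_wheelLeft_eq (hq : GenericParams q qb) (lam : Composition k) :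
    ∃ c : RatF K lam.length, c ≠ 0 ∧ (wheelLeft q qb lam : Tens K n k) = varMap (start lam) c •
      braid (const k q) (fun p => varMap (start lam) (genericPoint qb lam p)) (List.finRange k)
        (laterList (starts lam) ++ startList (starts lam)) := by
  have hI : Interleaving (· < ·) (laterList (starts lam)) (startList (starts lam))
      (List.finRange k) := by
    have := Interleaving.of_filter (· < ·) (fun x y h => h.not_gt)
      (fun x => decide (x ∈ starts lam)) (List.pairwise_lt_finRange k)
    simpa [laterList, startList] using this
  have e1 : (wheelLeft q qb lam : Tens K n k) = ((startList (starts lam)).reverse.map fun a =>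
      ((laterList (starts lam)).map fun b => if a < b then
        R q a b (varMap (start lam) (genericPoint qb lam a) /
          varMap (start lam) (genericPoint qb lam b)) else 1).prod).prod := by
    rw [startList_starts, laterList_starts, ← List.map_reverse, List.map_map, wheelLeft]
    congr 1
    refine List.map_congr_left fun s _ => ?_
    rw [list_prod_map_filter, Function.comp_apply, list_prod_map_flatMap]
    congr 1
    refine List.map_congr_left fun t _ => ?_
    rw [List.map_map]
    have hst : ∀ e ∈ laterIdx lam t, start lam s < lam.embedding t e ↔ s ≤ t := by
      intro e he
      rw [mem_laterIdx] at he
      change lam.embedding s _ < _ ↔ _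
      rw [embedding_lt_iff, le_iff_lt_or_eq]
      simp; omega
    split_ifs with h
    · congr 1
      refine List.map_congr_left fun e he => ?_
      rw [Function.comp_apply, if_pos ((hst e he).2 h), genericPoint_start, genericPoint_embedding,
        map_mul, varMap_z, varMap_z, varMap_const, mul_comm (const k _)]
      simp only [const, map_pow]
    · rw [List.prod_eq_one]
      intro x hx
      obtain ⟨e, he, rfl⟩ := List.mem_map.1 hx
      exact if_neg fun h' => h ((hst e he).1 h')
  obtain ⟨c, hc, e⟩ := exists_grid_smul (varMap (start lam) : RatF K lam.length →ₐ[K] RatF K k).toRingHom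
    (startList (starts lam)).reverse (laterList (starts lam)) (fun a b => a < b)
    (fun a b => (R q a b (varMap (start lam) (genericPoint qb lam a) /
      varMap (start lam) (genericPoint qb lam b)) : Tens K n k))
    (fun a b => Rh (const k q) a b (varMap (start lam) (genericPoint qb lam a))
      (varMap (start lam) (genericPoint qb lam b))) (fun a ha b hb => by
      have hab : a ≠ b := by
        rintro rfl
        exact mem_laterList.1 hb (mem_startList.1 (List.mem_reverse.1 ha))
      exact exists_R_eq_smul_Rh (start lam) hab (genericPoint_ne_zero hq.qb_ne b)
        (sub_ne_zero.2 fun h => hab (genericPoint_injective hq h).symm)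
        (regular_monomial hq (w := genericPoint qb lam) (fun x => ⟨_, _, rfl⟩) [a, b] _ (by simp)
          _ (by simp) hab))
  refine ⟨c, hc, ?_⟩
  rw [e1, e, braid_interleaving_append _ _ hI (List.nodup_finRange k)]
  rfl

end Generic
end RShuffle

namespace RShuffle

/-! ### The wheel conditions at the generic point -/

section WheelConditions

variable {K : Type*} [Field K] {F : Type*} [Field F] [Algebra K F] {n k l m N : ℕ} {q qb : K} {lam : Composition k}

theorem blockCycles_inv_start (s : Fin lam.length) : ∃ e : Fin (lam.blocksFun s),
    (e : ℕ) + 1 = lam.blocksFun s ∧ (blockCycles lam)⁻¹ (start lam s) = lam.embedding s e := by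
  obtain ⟨e, h, h'⟩ := exists_blockCycles_eq_start s
  exact ⟨e, h, by rw [Equiv.Perm.inv_def, Equiv.symm_apply_eq, h']⟩

theorem blockCycles_inv_embedding {s : Fin lam.length} {e : Fin (lam.blocksFun s)}
    (he : 1 ≤ (e : ℕ)) : ∃ e' : Fin (lam.blocksFun s),
    (e : ℕ) = e' + 1 ∧ (blockCycles lam)⁻¹ (lam.embedding s e) = lam.embedding s e' := by
  refine ⟨⟨e - 1, by omega⟩, by simp; omega, ?_⟩
  rw [Equiv.Perm.inv_def, Equiv.symm_apply_eq, blockCycles_embedding]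
  congr 1
  refine Fin.ext ?_
  rw [val_finRotate, if_pos (by simp; omega)]
  simp; omega

/-- The parameters of the strands after moving the last label of each block to the front. -/
def rotatedPoint (qb : K) (lam : Composition k) (p : Fin k) : RatF K lam.length :=
  const _ qb ^ 2 * genericPoint qb lam ((blockCycles lam)⁻¹ p)

theorem rotatedPoint_eq (p : Fin k) : ∃ (e : ℕ) (s : Fin lam.length),
    rotatedPoint qb lam p = const _ (qb ^ e) * z s :=
  ⟨_, _, by rw [rotatedPoint, const, ← map_pow, ← const, genericPoint_mul]⟩

theorem rotatedPoint_injective (hq : GenericParams q qb) :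
    Function.Injective (rotatedPoint qb lam) := fun _ _ h =>
  (blockCycles lam)⁻¹.injective (genericPoint_injective hq
    (mul_left_cancel₀ (pow_ne_zero 2 (const_ne_zero hq.qb_ne)) h))

/-- After the block cycles c_s carries q̄² times the parameter of the last label of its block,
namely y_s q̄^{2λ_s}, while c_t + e still carries y_t q̄^{2e}. In the order given by the preimages,
c_s precedes c_t + e exactly when s < t. -/
theorem exists_wheelRight_eq (hq : GenericParams q qb) (lam : Composition k) :
    ∃ c : RatF K lam.length, c ≠ 0 ∧ (wheelRight q qb lam : Tens K n k) = varMap (start lam) c •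
      braid (const k q) (fun p => varMap (start lam) (rotatedPoint qb lam p))
        (laterList (starts lam) ++ startList (starts lam)) (ord (blockCycles lam).toEmbedding) := by
  have e1 : (wheelRight q qb lam : Tens K n k) = ((startList (starts lam)).map fun a =>
      ((laterList (starts lam)).reverse.map fun b =>
        if (blockCycles lam)⁻¹ a < (blockCycles lam)⁻¹ b then
        R q b a (varMap (start lam) (rotatedPoint qb lam b) /
          varMap (start lam) (rotatedPoint qb lam a)) else 1).prod).prod := by
    rw [startList_starts, laterList_starts, List.map_map, wheelRight]
    congr 1
    refine List.map_congr_left fun s _ => ?_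
    rw [list_prod_map_filter, Function.comp_apply, List.reverse_flatMap, list_prod_map_flatMap]
    congr 1
    refine List.map_congr_left fun t _ => ?_
    rw [Function.comp_apply, ← List.map_reverse, List.map_map]
    obtain ⟨e₀, h₀, h₀'⟩ := blockCycles_inv_start s
    have hst : ∀ e ∈ (laterIdx lam t).reverse,
        (blockCycles lam)⁻¹ (start lam s) < (blockCycles lam)⁻¹ (lam.embedding t e) ↔ s < t := by
      intro e he
      rw [List.mem_reverse, mem_laterIdx] at he
      obtain ⟨e', h1, h1'⟩ := blockCycles_inv_embedding he
      rw [h₀', h1', embedding_lt_iff]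
      refine ⟨fun h => h.resolve_right ?_, Or.inl⟩
      rintro ⟨rfl, h⟩
      omega
    have h₁ : const k qb ^ (2 * lam.blocksFun s) = const k qb ^ (2 * ((e₀ : ℕ) + 1)) := by
      rw [h₀]
    split_ifs with h
    · congr 1
      refine List.map_congr_left fun e he => ?_
      rw [Function.comp_apply, if_pos ((hst e he).2 h)]
      rw [List.mem_reverse, mem_laterIdx] at he
      obtain ⟨e', h1, h1'⟩ := blockCycles_inv_embedding he
      rw [rotatedPoint, rotatedPoint, h₀', h1', genericPoint_embedding, genericPoint_embedding,
        h1, h₁]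
      simp only [map_mul, map_pow, varMap_z, varMap_const]
      congr 2 <;> simp only [const, map_pow] <;> ring
    · rw [List.prod_eq_one]
      intro x hx
      obtain ⟨e, he, rfl⟩ := List.mem_map.1 hx
      exact if_neg fun h' => h ((hst e he).1 h')
  obtain ⟨c, hc, e⟩ := exists_grid_smul
    (varMap (start lam) : RatF K lam.length →ₐ[K] RatF K k).toRingHom
    (startList (starts lam)) (laterList (starts lam)).reverse
    (fun a b => (blockCycles lam)⁻¹ a < (blockCycles lam)⁻¹ b)
    (fun a b => (R q b a (varMap (start lam) (rotatedPoint qb lam b) /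
      varMap (start lam) (rotatedPoint qb lam a)) : Tens K n k))
    (fun a b => Rh (const k q) b a (varMap (start lam) (rotatedPoint qb lam b))
      (varMap (start lam) (rotatedPoint qb lam a))) (fun a ha b hb => by
      have hab : a ≠ b := by
        rintro rfl
        exact mem_laterList.1 (List.mem_reverse.1 hb) (mem_startList.1 ha)
      exact exists_R_eq_smul_Rh (start lam) hab.symm
        (mul_ne_zero (pow_ne_zero 2 (const_ne_zero hq.qb_ne)) (genericPoint_ne_zero hq.qb_ne _))
        (sub_ne_zero.2 fun h => hab (rotatedPoint_injective hq h))
        (regular_monomial hq (w := rotatedPoint qb lam) rotatedPoint_eq [b, a] _ (by simp)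
          _ (by simp) hab.symm))
  refine ⟨c, hc, ?_⟩
  rw [e1, e, braid_append_interleaving _ _ ord_blockCycles_interleaving (ord_nodup _)]
  rfl

theorem f_div_ne_zero {x y : RatF K N} (hq : q ≠ 0) (hy : y ≠ 0) (hxy : x ≠ y)
    (h : const N q * y - (const N q)⁻¹ * x ≠ 0) (h' : const N q * x - (const N q)⁻¹ * y ≠ 0) :
    f q (x / y) ≠ 0 := by
  have hq' : const N q ≠ 0 := const_ne_zero hq
  refine div_ne_zero (mul_ne_zero (fun h0 => h' ?_) fun h0 => h ?_)
    (pow_ne_zero 2 (sub_ne_zero.2 fun h0 => hxy ?_))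
  · field_simp at h0 ⊢
    linear_combination -h0
  · field_simp at h0 ⊢
    linear_combination h0
  · exact ((div_eq_one_iff_eq hy).1 h0.symm)

theorem varMap_f (a : Fin k ↪ Fin N) (x : RatF K k) : varMap a (f q x) = f q (varMap a x) := by
  simp only [f, map_div₀, map_mul, map_sub, map_one, map_pow, map_inv₀, varMap_const]

theorem exists_wheelScalar_eq (hq : GenericParams q qb) (lam : Composition k) :
    ∃ c : RatF K lam.length, c ≠ 0 ∧ ((const k q)⁻¹ - const k q) ^ (k - lam.length) *
      wheelScalar q qb lam = varMap (start lam) c := by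
  have hq' : const lam.length q ≠ 0 := const_ne_zero hq.q_ne
  have hr := regular_monomial hq (w := genericPoint qb lam) fun x => ⟨_, _, rfl⟩
  refine ⟨((const _ q)⁻¹ - const _ q) ^ (k - lam.length) *
    ∏ p ∈ (Finset.univ : Finset (Fin k × Fin k)).filter (fun p => p.1 < p.2 ∧
      1 ≤ (lam.invEmbedding p.1 : ℕ) ∧ 1 ≤ (lam.invEmbedding p.2 : ℕ)),
      f q (genericPoint qb lam p.1 / genericPoint qb lam p.2),
    mul_ne_zero (pow_ne_zero _ fun h0 => ?_) (Finset.prod_ne_zero_iff.2 fun p hp => ?_), ?_⟩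
  · have h1 : const lam.length (q ^ 2) = 1 := by
      simp only [const, map_pow] at hq' h0 ⊢
      field_simp at h0
      linear_combination -h0
    have h2 := (algebraMap K (RatF K lam.length)).injective (h1.trans (map_one _).symm)
    exact hq.qb_pow_ne 0 (by rw [pow_zero, h2])
  · have h := (Finset.mem_filter.1 hp).2.1.ne
    exact f_div_ne_zero hq.q_ne (genericPoint_ne_zero hq.qb_ne _)
      (fun h0 => h (genericPoint_injective hq h0)) (hr [p.1, p.2] _ (by simp) _ (by simp) h)
      (hr [p.1, p.2] _ (by simp) _ (by simp) h.symm)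
  · rw [map_mul, map_pow, map_sub, map_inv₀, varMap_const, map_prod, wheelScalar]
    congr 1
    refine Finset.prod_congr rfl fun p _ => ?_
    rw [varMap_f, map_div₀, genericPoint, genericPoint, map_mul, map_mul, varMap_const,
      varMap_const, varMap_z, varMap_z, mul_comm (const k _), mul_comm (const k _)]
    simp only [const, map_pow]

/-- All factors come from the field of the y_s through the embedding `φ`, so equality can be tested
there, and the nonzero scalars are absorbed into `Y`. Conversely a wheel form may be rewritten with
the permutation `blockCycles`. -/
theorem wheelCondition_iff (hq : GenericParams q qb) {X : Tens K n k}
    {T : Op (RatF K lam.length) n (Fin k)}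
    (hT : SpM (genericPoint qb lam) (wheelDen qb (starts lam) • X) T) :
    (∃ Y : Tens K n lam.length, X.map (iteratedResidue qb lam) =
      (((const k q)⁻¹ - const k q) ^ (k - lam.length) * wheelScalar q qb lam) •
        (wheelLeft q qb lam * place (start lam) Y * wheelRight q qb lam *
          permOp (blockCycles lam))) ↔
    WheelForm (const _ q) (const _ qb ^ 2) (starts lam) (genericPoint qb lam) T := by
  set φ : RatF K lam.length →ₐ[K] RatF K k := varMap (start lam) with hφ
  have hres : X.map (iteratedResidue qb lam) = T.map φ := by
    ext I J
    exact iteratedResidue_eq (hT I J)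
  have hinj : ∀ {M M' : Op (RatF K lam.length) n (Fin k)}, M.map φ = M'.map φ → M = M' := by
    intro M M' h
    ext I J
    exact φ.toRingHom.injective (congrFun (congrFun h I) J)
  obtain ⟨c₁, hc₁, e₁⟩ := exists_wheelLeft_eq (n := n) hq lam
  obtain ⟨c₂, hc₂, e₂⟩ := exists_wheelRight_eq (n := n) hq lam
  obtain ⟨c₃, hc₃, e₃⟩ := exists_wheelScalar_eq hq lam
  have key : ∀ Y : Tens K n lam.length,
      (((const k q)⁻¹ - const k q) ^ (k - lam.length) * wheelScalar q qb lam) •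
        (wheelLeft q qb lam * place (start lam) Y * wheelRight q qb lam *
          permOp (blockCycles lam)) =
      (braid (const _ q) (genericPoint qb lam) (List.finRange k)
        (laterList (starts lam) ++ startList (starts lam)) *
        act (start lam) ((c₃ * c₁ * c₂) • Y) *
        braid (const _ q) (rotatedPoint qb lam)
          (laterList (starts lam) ++ startList (starts lam)) (ord (blockCycles lam).toEmbedding) *
        permF (blockCycles lam) : Op (RatF K lam.length) n (Fin k)).map φ := by
    intro Y
    have m1 := map_braid (n := n) φ.toRingHom (const _ q) (genericPoint qb lam) (List.finRange k)
      (laterList (starts lam) ++ startList (starts lam))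
    have m2 := map_braid (n := n) φ.toRingHom (const _ q) (rotatedPoint qb lam)
      (laterList (starts lam) ++ startList (starts lam)) (ord (blockCycles lam).toEmbedding)
    have m3 := map_act φ.toRingHom (start lam) Y
    have m4 := map_permF (n := n) φ.toRingHom (blockCycles lam)
    have hc : φ.toRingHom (const _ q) = const k q := varMap_const _ _
    rw [hc] at m1 m2
    have m5 : ∀ M M' : Op (RatF K lam.length) n (Fin k),
        (M * M').map φ = M.map φ * M'.map φ := fun M M' => Matrix.map_mul (f := φ.toRingHom)
    have m6 : ∀ (c : RatF K lam.length) (M : Op (RatF K lam.length) n (Fin k)),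
        (c • M).map φ = φ c • M.map φ := fun c M => by
      ext I J
      simp
    rw [e₁, e₂, e₃, place_eq, act_smul, m5, m5, m5, m6]
    change _ = Matrix.map _ φ.toRingHom * (_ • Matrix.map _ φ.toRingHom) *
      Matrix.map _ φ.toRingHom * Matrix.map _ φ.toRingHom
    rw [m1, m2, m3, m4]
    simp only [smul_mul_assoc, mul_smul_comm, smul_smul, map_mul]
    rw [show φ c₃ * φ c₁ * φ c₂ = φ c₃ * (φ c₂ * φ c₁) by ring]
    rfl
  simp only [hres, key]
  constructor
  · rintro ⟨Y, hY⟩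
    exact ⟨blockCycles lam, succPerm_blockCycles, _,
      act_mem_loc (start lam) (fun s => start_mem_starts s) _, hinj hY⟩
  · intro h
    obtain ⟨Z, hZ, rfl⟩ := h.exists_of_succPerm (const_ne_zero hq.q_ne) hasZero_starts
      succPerm_blockCycles (regular_monomial hq rotatedPoint_eq)
    obtain ⟨Y, rfl⟩ := exists_act_of_mem_loc (start lam) (fun m hm => mem_starts_iff.1 hm) hZ
    refine ⟨(c₃ * c₁ * c₂)⁻¹ • Y, ?_⟩
    rw [smul_smul, mul_inv_cancel₀ (mul_ne_zero (mul_ne_zero hc₃ hc₁) hc₂), one_smul]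
    rfl

/-- Each factor of `poleDen` that can vanish at `w` belongs to consecutive labels of a block and is,
up to sign, cancelled by a factor of `wheelDen`. -/
theorem exists_sp_wheelDen_div {S : Finset (Fin k)} {w : Fin k → F}
    (hw : ∀ x y, w x = algebraMap K F qb ^ 2 * w y → (x : ℕ) = y + 1 ∧ x ∉ S) :
    ∃ v, Sp w (wheelDen qb S * (poleDen qb k)⁻¹) v := by
  rw [wheelDen, poleDen, prod_filter_ne fun i j => (z i - z j * const k qb ^ 2),
    Finset.prod_comm (f := fun i j : Fin k => if i ≠ j then z i - z j * const k qb ^ 2 else 1),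
    ← Finset.prod_inv_distrib, ← Finset.prod_mul_distrib]
  refine Sp.exists_prod _ fun p _ => ?_
  rw [← Finset.prod_inv_distrib, ← Finset.prod_mul_distrib]
  refine Sp.exists_prod _ fun p' _ => ?_
  by_cases hp : p' = p
  · rw [if_neg (fun h => by rw [hp] at h; omega), if_neg (not_not.2 hp), inv_one, mul_one]
    exact ⟨_, Sp.one _⟩
  · rw [if_pos hp]
    have h0 : (z p' - z p * const k qb ^ 2 : RatF K k) ≠ 0 := by
      rw [const, ← map_pow]
      exact z_sub_mul_ne_zero hp (qb ^ 2)
    split_ifs with h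
    · refine ⟨-1, ?_⟩
      have : (const k qb ^ 2 * z p - z p') * (z p' - z p * const k qb ^ 2)⁻¹ = -1 := by
        rw [← div_eq_mul_inv, div_eq_iff h0]; ring
      rw [this]
      exact (Sp.one _).neg
    · rw [one_mul]
      refine ⟨_, ((Sp.z _ p').sub ((Sp.z _ p).mul ((Sp.const _ qb).pow 2))).inv fun h1 => h ?_⟩
      exact hw _ _ ((sub_eq_zero.1 h1).trans (mul_comm _ _))

theorem exists_spM_wheelDen {X : Tens K n k} (hX : HasAllowedPoles qb X) {S : Finset (Fin k)}
    {w : Fin k → F} (hw0 : ∀ x, w x ≠ 0)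
    (hw : ∀ x y, w x = algebraMap K F qb ^ 2 * w y → (x : ℕ) = y + 1 ∧ x ∉ S) :
    ∃ T, SpM w (wheelDen qb S • X) T := by
  rw [hasAllowedPoles_iff] at hX
  obtain ⟨v, hv⟩ := exists_sp_wheelDen_div hw
  choose T hT using fun I J => Sp.exists_of_mem_laurent (u := w) hw0 (hX I J)
  refine ⟨Matrix.of fun I J => v * T I J, fun I J => ?_⟩
  have := hv.mul (hT I J)
  rwa [Matrix.smul_apply, smul_eq_mul, mul_assoc, inv_mul_cancel_left₀ (poleDen_ne_zero qb k)]
    at this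

theorem exists_spM_genericPoint (hq : GenericParams q qb) {X : Tens K n k}
    (hX : HasAllowedPoles qb X) (lam : Composition k) :
    ∃ T, SpM (genericPoint qb lam) (wheelDen qb (starts lam) • X) T :=
  exists_spM_wheelDen hX (genericPoint_ne_zero hq.qb_ne) fun _ _ h => genericPoint_eq hq h

/-- The wheel conditions in terms of the values at generic points. -/
theorem wheelConditions_iff (hq : GenericParams q qb) {X : Tens K n k}
    (hX : HasAllowedPoles qb X) : WheelConditions q qb X ↔ ∀ (lam : Composition k)
      (T : Op (RatF K lam.length) n (Fin k)),
      SpM (genericPoint qb lam) (wheelDen qb (starts lam) • X) T →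
      WheelForm (const _ q) (const _ qb ^ 2) (starts lam) (genericPoint qb lam) T := by
  constructor
  · exact fun h lam T hT => (wheelCondition_iff hq hT).1 (h lam)
  · intro h lam
    obtain ⟨T, hT⟩ := exists_spM_genericPoint hq hX lam
    exact (wheelCondition_iff hq hT).2 (h lam T hT)

end WheelConditions
end RShuffle

namespace RShuffle

/-! ### Wheel forms at specializations of the generic point -/

section Specialization

variable {K : Type*} [Field K] {F : Type*} [Field F] [Algebra K F] {n k l m N : ℕ} {q qb : K}
variable {lam : Composition k}

theorem map_mem_loc {E E' : Type*} [Field E] [Field E'] (φ : E →+* E') {S : Finset (Fin N)}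
    {M : Op E n (Fin N)} (h : M ∈ loc E n S) : M.map φ ∈ loc E' n S := by
  obtain ⟨X, rfl⟩ := mem_loc.1 h
  exact mem_loc.2 ⟨_, (map_act φ _ X).symm⟩

theorem WheelForm.map {E E' : Type*} [Field E] [Field E'] (φ : E →+* E') {q c : E}
    {S : Finset (Fin N)} {u : Fin N → E} {T : Op E n (Fin N)} (h : WheelForm q c S u T) :
    WheelForm (φ q) (φ c) S (fun p => φ (u p)) (T.map φ) := by
  obtain ⟨σ, hσ, Z, hZ, rfl⟩ := h
  refine ⟨σ, hσ, Z.map φ, map_mem_loc φ hZ, ?_⟩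
  have m5 : ∀ M M' : Op E n (Fin N), (M * M').map φ = M.map φ * M'.map φ :=
    fun M M' => Matrix.map_mul
  rw [m5, m5, m5, map_braid, map_braid, map_permF]
  simp only [map_mul]

/-- Both summands are written with the same permutation, after which their operators on `S` add. -/
theorem WheelForm.add {q c : F} (hq : q ≠ 0) {S : Finset (Fin N)} (hS : HasZero S)
    {u : Fin N → F} (hreg : ∀ w : Fin N → F, (∀ x, ∃ y, w x = c * u y) → ∀ l, Regular q w l)
    {T T' : Op F n (Fin N)} (h : WheelForm q c S u T) (h' : WheelForm q c S u T') :
    WheelForm q c S u (T + T') := by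
  obtain ⟨σ, hσ, Z, hZ, rfl⟩ := h
  obtain ⟨Z', hZ', rfl⟩ := h'.exists_of_succPerm hq hS hσ (hreg _ fun x => ⟨_, rfl⟩)
  refine ⟨σ, hσ, Z + Z', add_mem hZ hZ', ?_⟩
  simp only [mul_add, add_mul]

theorem wheelForm_zero {q c : F} {S : Finset (Fin N)} (hS : HasZero S) (u : Fin N → F) :
    WheelForm q c S u (0 : Op F n (Fin N)) := by
  obtain ⟨lam, rfl⟩ := hS.exists_starts
  exact ⟨_, succPerm_blockCycles, 0, zero_mem _, by simp⟩

theorem WheelForm.sum {q c : F} (hq : q ≠ 0) {S : Finset (Fin N)} (hS : HasZero S)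
    {u : Fin N → F} (hreg : ∀ w : Fin N → F, (∀ x, ∃ y, w x = c * u y) → ∀ l, Regular q w l)
    {α : Type*} (s : Finset α) {T : α → Op F n (Fin N)} (h : ∀ i ∈ s, WheelForm q c S u (T i)) :
    WheelForm q c S u (∑ i ∈ s, T i) :=
  Finset.sum_induction T (WheelForm q c S u) (fun _ _ => WheelForm.add hq hS hreg)
    (wheelForm_zero hS u) h

theorem regular_genericPoint (hq : GenericParams q qb) (w : Fin N → RatF K lam.length)
    (hw : ∀ x, ∃ y, w x = genericPoint qb lam y ∨ w x = const _ qb ^ 2 * genericPoint qb lam y)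
    (l : List (Fin N)) : Regular (const _ q) w l := by
  refine regular_monomial hq (fun x => ?_) l
  obtain ⟨y, h | h⟩ := hw x
  · exact ⟨_, _, h⟩
  · exact ⟨_, _, by rw [h, const, ← map_pow, ← const, genericPoint_mul]⟩

theorem algebraicIndependent_scale {ι : Type*} {x : ι → F} (hx : AlgebraicIndependent K x)
    {c : ι → K} (hc : ∀ i, c i ≠ 0) :
    AlgebraicIndependent K fun i => algebraMap K F (c i) * x i := by
  let τ : (ι → K) → MvPolynomial ι K →ₐ[K] MvPolynomial ι K := fun c =>
    MvPolynomial.aeval fun i => MvPolynomial.C (c i) * MvPolynomial.X i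
  have h1 : ∀ p, τ (fun i => (c i)⁻¹) (τ c p) = p := by
    intro p
    have : (τ fun i => (c i)⁻¹).comp (τ c) = AlgHom.id K _ := by
      ext i
      simp only [τ, AlgHom.comp_apply, MvPolynomial.aeval_X, map_mul, AlgHom.id_apply]
      rw [MvPolynomial.algHom_C, MvPolynomial.algebraMap_eq, ← mul_assoc, ← map_mul,
        mul_inv_cancel₀ (hc i), map_one, one_mul]
    exact DFunLike.congr_fun this p
  have h2 : MvPolynomial.aeval (fun i => algebraMap K F (c i) * x i) =
      (MvPolynomial.aeval x).comp (τ c) := by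
    ext i
    simp [τ]
  rw [AlgebraicIndependent, h2]
  intro p p' h
  have h3 : τ c p = τ c p' := hx h
  rw [← h1 p, h3, h1]

theorem algebraicIndependent_z : AlgebraicIndependent K (z : Fin k → RatF K k) := by
  have : MvPolynomial.aeval (z : Fin k → RatF K k) =
      IsScalarTower.toAlgHom K (MvPolynomial (Fin k) K) (RatF K k) := by
    ext i
    simp [z]
  rw [AlgebraicIndependent, this]
  exact IsFractionRing.injective _ _

/-- By independence y_s ↦ w(c_s) extends to rational functions; the recursion along the blocks
determines the other coordinates. -/
theorem exists_algHom_genericPoint {w : Fin k → F}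
    (hw : ∀ p p' : Fin k, (p' : ℕ) = p + 1 → p' ∉ starts lam → w p' = algebraMap K F qb ^ 2 * w p)
    (hi : AlgebraicIndependent K fun p : starts lam => w p) :
    ∃ ψ : RatF K lam.length →ₐ[K] F, ∀ p, ψ (genericPoint qb lam p) = w p := by
  have hi' : AlgebraicIndependent K fun s => w (start lam s) :=
    hi.comp (fun s => ⟨start lam s, start_mem_starts s⟩) fun s t h =>
      (start lam).injective (congrArg Subtype.val h)
  let ψ : RatF K lam.length →ₐ[K] F := IsFractionRing.liftAlgHom
    (A := MvPolynomial (Fin lam.length) K) (g := MvPolynomial.aeval fun s => w (start lam s)) hi'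
  have hψ : ∀ s, ψ (z s) = w (start lam s) := by
    intro s
    have := IsFractionRing.lift_algebraMap (K := RatF K lam.length) (g := (MvPolynomial.aeval
      (R := K) fun s => w (start lam s)).toRingHom) hi' (MvPolynomial.X s)
    exact this.trans (MvPolynomial.aeval_X _ _)
  refine ⟨ψ, fun p => ?_⟩
  obtain ⟨s, e, rfl⟩ := exists_embedding (lam := lam) p
  obtain ⟨e, he⟩ := e
  induction e with
  | zero =>
    change ψ (genericPoint qb lam (start lam s)) = w (start lam s)
    rw [genericPoint_start, hψ]
  | succ e ih =>
    have h1 : (lam.embedding s ⟨e + 1, he⟩ : ℕ) = lam.embedding s ⟨e, by omega⟩ + 1 :=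
      embedding_succ rfl
    have h2 : lam.embedding s ⟨e + 1, he⟩ ∉ starts lam := by
      rw [embedding_mem_starts]; simp
    rw [hw _ _ h1 h2, genericPoint_succ h1 h2, map_mul, map_pow, ih]
    congr 2
    exact ψ.commutes qb

/-- The values at all specializations of the generic points that keep the first labels of the
blocks independent. -/
theorem WheelConditions.exists_wheelForm (hq : GenericParams q qb) {X : Tens K n k}
    (hX : HasAllowedPoles qb X) (hX' : WheelConditions q qb X) {S : Finset (Fin k)}
    (hS : HasZero S) {w : Fin k → F}
    (hw : ∀ p p' : Fin k, (p' : ℕ) = p + 1 → p' ∉ S → w p' = algebraMap K F qb ^ 2 * w p)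
    (hi : AlgebraicIndependent K fun p : S => w p) :
    ∃ T, SpM w (wheelDen qb S • X) T ∧
      WheelForm (algebraMap K F q) (algebraMap K F qb ^ 2) S w T := by
  obtain ⟨lam, rfl⟩ := hS.exists_starts
  obtain ⟨ψ, hψ⟩ := exists_algHom_genericPoint hw hi
  obtain ⟨T, hT⟩ := exists_spM_genericPoint hq hX lam
  have hψ' : (fun p => ψ (genericPoint qb lam p)) = w := funext hψ
  refine ⟨T.map ψ, fun I J => ?_, ?_⟩
  · have := (hT I J).map ψ
    rw [hψ'] at this
    exact this
  · have := ((wheelConditions_iff hq hX).1 hX' lam T hT).map ψ.toRingHom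
    have e1 : ψ.toRingHom (const _ q) = algebraMap K F q := ψ.commutes q
    have e2 : ψ.toRingHom (const _ qb) = algebraMap K F qb := ψ.commutes qb
    rw [map_pow, e1, e2] at this
    rw [← hψ']
    exact this

/-- Residues defined through lowest terms are not visibly additive, so the argument goes through
values at the generic point. -/
theorem WheelConditions.add (hq : GenericParams q qb) {X Y : Tens K n k}
    (hX : HasAllowedPoles qb X) (hX' : WheelConditions q qb X) (hY : HasAllowedPoles qb Y)
    (hY' : WheelConditions q qb Y) (hXY : HasAllowedPoles qb (X + Y)) :
    WheelConditions q qb (X + Y) := by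
  rw [wheelConditions_iff hq hXY]
  intro lam T hT
  obtain ⟨TX, hTX⟩ := exists_spM_genericPoint hq hX lam
  obtain ⟨TY, hTY⟩ := exists_spM_genericPoint hq hY lam
  rw [smul_add] at hT
  rw [hT.unique (hTX.add hTY)]
  exact WheelForm.add (const_ne_zero hq.q_ne) hasZero_starts
    (fun w hw => regular_genericPoint hq w fun x => (hw x).imp fun _ => Or.inr)
    ((wheelConditions_iff hq hX).1 hX' lam TX hTX) ((wheelConditions_iff hq hY).1 hY' lam TY hTY)

theorem WheelConditions.smul (hq : GenericParams q qb) {X : Tens K n k} (c : K)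
    (hX : HasAllowedPoles qb X) (hX' : WheelConditions q qb X)
    (hcX : HasAllowedPoles qb (c • X)) : WheelConditions q qb (c • X) := by
  rw [wheelConditions_iff hq hcX]
  intro lam T hT
  obtain ⟨TX, hTX⟩ := exists_spM_genericPoint hq hX lam
  have e : wheelDen qb (starts lam) • (c • X) = const k c • wheelDen qb (starts lam) • X := by
    rw [smul_comm, algebra_compatible_smul (RatF K k) c]; rfl
  rw [e] at hT
  rw [hT.unique (SpM.smul (Sp.const _ c) hTX)]
  exact ((wheelConditions_iff hq hX).1 hX' lam TX hTX).smul _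

theorem wheelConditions_zero (hq : GenericParams q qb)
    (h0 : HasAllowedPoles qb (0 : Tens K n k)) : WheelConditions q qb (0 : Tens K n k) := by
  rw [wheelConditions_iff hq h0]
  intro lam T hT
  rw [smul_zero] at hT
  rw [hT.unique (SpM.zero _)]
  exact wheelForm_zero hasZero_starts _

theorem hasAllowedPoles_one : HasAllowedPoles qb (1 : Tens K n k) :=
  hasAllowedPoles_iff.2 (LaurentM.one.smul (prod_mem fun _ _ => sub_mem (z_mem_laurent _)
    (mul_mem (z_mem_laurent _) (pow_mem (const_mem_laurent qb) 2))))

theorem wheelConditions_one (hq : GenericParams q qb) :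
    WheelConditions q qb (1 : Tens K n 0) := by
  rw [wheelConditions_iff hq hasAllowedPoles_one]
  intro lam T _
  refine ⟨1, fun p => p.elim0, T, ?_, ?_⟩
  · rw [← act_refl T]
    exact act_mem_loc _ (fun i => i.elim0) T
  · have h1 : ∀ l : List (Fin 0), l = [] := fun l => List.eq_nil_iff_forall_not_mem.2 fun x => x.elim0
    rw [h1 (List.finRange 0), h1 (laterList _ ++ _), h1 (ord _), permF_one]
    simp [braid]

end Specialization
end RShuffle

namespace RShuffle

/-! ### The wheel conditions for shuffle products -/

section WheelShuffle

variable {K : Type*} [Field K] {n k l m N : ℕ} {q qb : K} {lam : Composition N}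
  {a : Fin k ↪ Fin N} {b : Fin l ↪ Fin N}

theorem pullStarts_iff {S : Finset (Fin N)} (ha : StrictMono a) {i i' : Fin k} :
    ((i' : ℕ) = i + 1 ∧ i' ∉ pullStarts S a) ↔ ((a i' : ℕ) = a i + 1 ∧ a i' ∉ S) := by
  constructor
  · rintro ⟨h, h'⟩
    obtain ⟨h1, i'', h2⟩ := not_mem_pullStarts.1 h'
    have h3 := val_succ_of_strictMono ha h2
    have : i'' = i := Fin.ext (by omega)
    rw [← this]
    exact ⟨h2, h1⟩
  · rintro ⟨h, h'⟩
    exact ⟨val_succ_of_strictMono ha h, not_mem_pullStarts.2 ⟨h', i, h⟩⟩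

/-- The linear forms attached to consecutive labels in a block, the first one in `a` and the
second one in `b`. -/
def crossDen (qb : K) (S : Finset (Fin N)) (a : Fin k ↪ Fin N) (b : Fin l ↪ Fin N) : RatF K N :=
  ∏ i, ∏ j, if (b j : ℕ) = a i + 1 ∧ b j ∉ S then const N qb ^ 2 * z (a i) - z (b j) else 1

theorem varMap_wheelDen (S : Finset (Fin N)) (ha : StrictMono a) :
    varMap a (wheelDen qb (pullStarts S a)) = ∏ i, ∏ i',
      if (a i' : ℕ) = a i + 1 ∧ a i' ∉ S then const N qb ^ 2 * z (a i) - z (a i') else 1 := by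
  rw [wheelDen, map_prod]
  refine Finset.prod_congr rfl fun i _ => ?_
  rw [map_prod]
  refine Finset.prod_congr rfl fun i' _ => ?_
  simp only [pullStarts_iff ha]
  split_ifs
  · rw [map_sub, map_mul, map_pow, varMap_const, varMap_z, varMap_z]
  · exact map_one _

/-- Consecutive labels of a block lie both in `a`, both in `b`, or cross from one family to the
other in either direction. -/
theorem wheelDen_split (h : Complementary a b) (ha : StrictMono a) (hb : StrictMono b)
    (S : Finset (Fin N)) : wheelDen qb S = varMap a (wheelDen qb (pullStarts S a)) *
      varMap b (wheelDen qb (pullStarts S b)) * (crossDen qb S b a * crossDen qb S a b) := by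
  rw [varMap_wheelDen S ha, varMap_wheelDen S hb, wheelDen, h.prod_univ]
  simp only [h.prod_univ, Finset.prod_mul_distrib, crossDen]
  ring

/-- The scalar has vanishing denominators q̄² z_a - z_b exactly where a label of `a` is followed by
one of `b` in a block, and `crossDen` supplies these factors. The opposite direction meets no pole.
-/
theorem exists_sp_crossDen_mul (hq : GenericParams q qb) (h : Complementary a b) :
    ∃ v, Sp (genericPoint qb lam) (crossDen qb (starts lam) a b * shuffleScalar q qb a b) v := by
  rw [crossDen, shuffleScalar, ← Finset.prod_mul_distrib]
  refine Sp.exists_prod _ fun i _ => ?_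
  rw [← Finset.prod_mul_distrib]
  refine Sp.exists_prod _ fun j _ => ?_
  set u := genericPoint qb lam
  have hz := fun x => Sp.z (K := K) u x
  have hc := fun c : K => Sp.const (k := N) u c
  have h1 : ∃ v, Sp u (gfac q (z (a i)) (z (b j))) v := by
    have h2 := (((hc q).mul (hz (b j))).sub
      (((hc q).inv ((map_ne_zero _).2 hq.q_ne)).mul (hz (a i)))).mul
      (((hz (b j)).sub (hz (a i))).inv (sub_ne_zero.2 fun h0 =>
        h.disj i j (genericPoint_injective hq h0).symm))
    rw [gfac, div_eq_mul_inv]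
    exact ⟨_, h2⟩
  obtain ⟨v, hv⟩ := h1
  have hnum := ((hc q).mul (((hc qb).pow 2).mul (hz (a i)))).sub
      (((hc q).inv ((map_ne_zero _).2 hq.q_ne)).mul (hz (b j)))
  have hden := (((hc qb).pow 2).mul (hz (a i))).sub (hz (b j))
  have hg : gfac q (z (b j)) (const N qb ^ 2 * z (a i)) =
      (const N q * (const N qb ^ 2 * z (a i)) - (const N q)⁻¹ * z (b j)) /
        (const N qb ^ 2 * z (a i) - z (b j)) := rfl
  split_ifs with hs
  · have h0 : (const N qb ^ 2 * z (a i) - z (b j) : RatF K N) ≠ 0 := by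
      have := linear_ne_zero (K := K) (h.disj i j) (pow_ne_zero 2 hq.qb_ne) 1
      simpa [const] using this
    rw [mul_left_comm, hg, mul_div_cancel₀ _ h0]
    exact ⟨_, hv.mul hnum⟩
  · rw [one_mul, hg, div_eq_mul_inv]
    exact ⟨_, hv.mul (hnum.mul (hden.inv fun h0 => hs
      (genericPoint_eq hq (sub_eq_zero.1 h0).symm)))⟩

theorem sp_crossDen_eq_zero {i : Fin k} {j : Fin l} (h : (b j : ℕ) = a i + 1)
    (h' : b j ∉ starts lam) : Sp (genericPoint qb lam) (crossDen qb (starts lam) a b) 0 := by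
  set u := genericPoint qb lam
  rw [crossDen, ← Finset.mul_prod_erase _ _ (Finset.mem_univ i),
    ← Finset.mul_prod_erase _ _ (Finset.mem_univ j), if_pos ⟨h, h'⟩]
  have hz := fun x => Sp.z (K := K) u x
  have hc := fun c : K => Sp.const (k := N) u c
  have h1 : ∀ i j, ∃ v, Sp u (if (b j : ℕ) = a i + 1 ∧ b j ∉ starts lam then
      const N qb ^ 2 * z (a i) - z (b j) else 1) v := by
    intro i j
    split_ifs
    exacts [⟨_, (((hc qb).pow 2).mul (hz (a i))).sub (hz (b j))⟩, ⟨_, Sp.one u⟩]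
  obtain ⟨v, hv⟩ := Sp.exists_prod (u := u) (Finset.univ.erase j) fun j _ => h1 i j
  obtain ⟨v', hv'⟩ := Sp.exists_prod (u := u) (Finset.univ.erase i) fun i _ =>
    Sp.exists_prod (u := u) Finset.univ fun j _ => h1 i j
  have h2 := ((((hc qb).pow 2).mul (hz (a i))).sub (hz (b j))).mul hv |>.mul hv'
  have h3 : algebraMap K _ qb ^ 2 * u (a i) - u (b j) = 0 :=
    sub_eq_zero.2 (genericPoint_succ h h').symm
  rwa [h3, zero_mul, zero_mul] at h2

theorem exists_sp_crossDen (S : Finset (Fin N)) (u : Fin N → RatF K m) :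
    ∃ v, Sp u (crossDen qb S a b) v := by
  have hz := fun x => Sp.z (K := K) u x
  have hc := fun c : K => Sp.const (k := N) u c
  refine Sp.exists_prod _ fun i _ => Sp.exists_prod _ fun j _ => ?_
  split_ifs
  exacts [⟨_, (((hc qb).pow 2).mul (hz (a i))).sub (hz (b j))⟩, ⟨_, Sp.one u⟩]

theorem algebraicIndependent_pullStarts (hqb : qb ≠ 0)
    (h : ∀ i ∈ pullStarts (starts lam) a, ∀ i' ∈ pullStarts (starts lam) a,
      lam.index (a i) = lam.index (a i') → i = i') :
    AlgebraicIndependent K fun p : pullStarts (starts lam) a => genericPoint qb lam (a p) := by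
  have h1 := (algebraicIndependent_z (K := K) (k := lam.length)).comp
    (fun p : pullStarts (starts lam) a => lam.index (a p))
    fun p p' hp => Subtype.ext (h p p.2 p' p'.2 hp)
  have h2 := algebraicIndependent_scale h1
    (c := fun p => qb ^ (2 * (lam.invEmbedding (a p) : ℕ))) fun _ => pow_ne_zero _ hqb
  exact h2

/-- If no label of `b` is directly followed by one of `a`, every run of labels of `a` begins at the
start of a block. -/
theorem index_injOn_left (h : Complementary a b)
    (hba : ∀ i j, (a i : ℕ) = b j + 1 → a i ∈ starts lam) {i i' : Fin k}
    (hi : i ∈ pullStarts (starts lam) a) (hi' : i' ∈ pullStarts (starts lam) a)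
    (hii : lam.index (a i) = lam.index (a i')) : i = i' := by
  have key : ∀ i ∈ pullStarts (starts lam) a, a i ∈ starts lam := by
    intro i hi
    by_contra hn
    obtain ⟨p, hp⟩ := hasZero_starts.exists_pred hn
    rcases h.cover p with hc | hc
    · obtain ⟨i', rfl⟩ := mem_ord.1 hc
      exact not_mem_pullStarts.2 ⟨hn, i', hp⟩ hi
    · obtain ⟨j, rfl⟩ := mem_ord.1 hc
      exact hn (hba i j hp)
  apply a.injective
  rw [← start_index (key i hi), hii, start_index (key i' hi')]

/-- If no label of `b` is directly followed by one of `a`, the labels of `b` in a block form a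
single run at its end. -/
theorem index_injOn_right (h : Complementary a b)
    (hba : ∀ i j, (a i : ℕ) = b j + 1 → a i ∈ starts lam) {j j' : Fin l}
    (hj : j ∈ pullStarts (starts lam) b) (hj' : j' ∈ pullStarts (starts lam) b)
    (hjj : lam.index (b j) = lam.index (b j')) : j = j' := by
  have key : ∀ {j j'}, j' ∈ pullStarts (starts lam) b → lam.index (b j) = lam.index (b j') →
      ¬ b j < b j' := by
    intro j j' hj' hjj hlt
    obtain ⟨s, e, he⟩ := exists_embedding (lam := lam) (b j)
    obtain ⟨t, e', he'⟩ := exists_embedding (lam := lam) (b j')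
    rw [← he, ← he', lam.index_embedding, lam.index_embedding] at hjj
    subst hjj
    rw [← he, ← he', (lam.embedding s).lt_iff_lt, Fin.lt_def] at hlt
    have hA : ∀ e₀ : Fin (lam.blocksFun s), (∀ j, lam.embedding s e₀ ≠ b j) →
        lam.embedding s e₀ ∈ ord a := by
      intro e₀ hn
      refine (h.cover _).resolve_right fun hc => ?_
      obtain ⟨j, hj⟩ := mem_ord.1 hc
      exact hn j hj.symm
    -- Going back from the start `b j'` of a run: the label before it is in `a`, and inside the
    -- block a label of `a` is preceded only by labels of `a`. This would reach `b j`.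
    have claim : ∀ (d : ℕ) (e₀ : Fin (lam.blocksFun s)), (e₀ : ℕ) + d + 1 = e' →
        lam.embedding s e₀ ∈ ord a := by
      intro d
      induction d with
      | zero =>
        intro e₀ h0
        refine hA e₀ fun j₀ hj₀ => not_mem_pullStarts.2 ⟨?_, j₀, ?_⟩ hj'
        · rw [← he', embedding_mem_starts]; omega
        · rw [← hj₀, ← he']
          exact embedding_succ (by omega)
      | succ d ih =>
        intro e₀ h0
        have h1 : (e₀ : ℕ) + 1 < lam.blocksFun s := by omega
        obtain ⟨i, hi⟩ := mem_ord.1 (ih ⟨e₀ + 1, h1⟩ (by simp; omega))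
        refine hA e₀ fun j₀ hj₀ => ?_
        have h2 := hba i j₀ (by
          rw [hi, ← hj₀]
          exact embedding_succ rfl)
        rw [hi, embedding_mem_starts] at h2
        simp at h2
    obtain ⟨i, hi⟩ := mem_ord.1 (claim (e' - e - 1) e (by omega))
    exact h.disj i j (hi.trans he)
  rcases lt_trichotomy (b j) (b j') with hlt | heq | hlt
  · exact absurd hlt (key hj' hjj)
  · exact b.injective heq
  · exact absurd hlt (key hj hjj.symm)

/-- Splits `wheelDen` among `X`, `Y` and the scalar, so that each part of the term has a value at
the generic point. The order of the two families within the blocks decides between a wheel form and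
zero. -/
theorem exists_wheelForm_shuffleTerm (hq : GenericParams q qb) (hkl : k + l = N)
    (h : Complementary a b) (ha : StrictMono a) (hb : StrictMono b) (lam : Composition N)
    {X : Tens K n k} {Y : Tens K n l} (hX : HasAllowedPoles qb X) (hX' : WheelConditions q qb X)
    (hY : HasAllowedPoles qb Y) (hY' : WheelConditions q qb Y) :
    ∃ T, SpM (genericPoint qb lam) (wheelDen qb (starts lam) • shuffleTerm q qb a b X Y) T ∧
      WheelForm (const _ q) (const _ qb ^ 2) (starts lam) (genericPoint qb lam) T := by
  set u := genericPoint qb lam with hu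
  set S := starts lam with hS
  obtain ⟨s, hs⟩ := exists_sp_crossDen_mul (lam := lam) hq h
  have hp1 : (List.finRange N).Perm (ord b ++ ord a) :=
    h.perm.trans List.perm_append_comm
  have hm : ∀ (L L' : List (Fin N)), L.Perm L' → ∀ y ∈ L', y ∈ L := fun _ _ hp _ hy =>
    hp.mem_iff.2 hy
  have hreg := fun w hw l => regular_genericPoint (N := N) (lam := lam) hq w hw l
  have hsh : ∀ p, Sp u (shifted qb a p) (if p ∈ ord a then const _ qb ^ 2 * u p else u p) := by
    intro p
    rw [shifted]
    split_ifs
    exacts [((Sp.const u qb).pow 2).mul (Sp.z u p), Sp.z u p]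
  have b1 : SpM u (braid (const N q) z (List.finRange N) (ord b ++ ord a) : Tens K n N)
      (braid (const _ q) u (List.finRange N) (ord b ++ ord a)) :=
    SpM.braid q (fun p => Sp.z u p) (hm _ _ hp1) (hreg _ (fun x => ⟨x, Or.inl rfl⟩) _)
      h.symm.nodup
  have b2 : SpM u (braid (const N q) (shifted qb a) (ord b ++ ord a) (ord a ++ ord b) : Tens K n N)
      (braid (const _ q) (fun x => if x ∈ ord a then const _ qb ^ 2 * u x else u x)
        (ord b ++ ord a) (ord a ++ ord b)) :=
    SpM.braid q hsh (hm _ _ List.perm_append_comm) (hreg _ (fun x => by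
      split_ifs
      exacts [⟨x, Or.inr rfl⟩, ⟨x, Or.inl rfl⟩]) _) h.nodup
  have b3 : SpM u (braid (const N q) z (ord a ++ ord b) (List.finRange N) : Tens K n N)
      (braid (const _ q) u (ord a ++ ord b) (List.finRange N)) :=
    SpM.braid q (fun p => Sp.z u p) (hm _ _ h.perm.symm) (hreg _ (fun x => ⟨x, Or.inl rfl⟩) _)
      (List.nodup_finRange N)
  have e : wheelDen qb S • shuffleTerm q qb a b X Y =
      (crossDen qb S b a * (crossDen qb S a b * shuffleScalar q qb a b)) •
      (braid (const N q) z (List.finRange N) (ord b ++ ord a) *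
        place a (wheelDen qb (pullStarts S a) • X) *
        braid (const N q) (shifted qb a) (ord b ++ ord a) (ord a ++ ord b) *
        place b (wheelDen qb (pullStarts S b) • Y) *
        braid (const N q) z (ord a ++ ord b) (List.finRange N)) := by
    rw [wheelDen_split h ha hb S, shuffleTerm, place_smul', place_smul']
    simp only [mul_smul_comm, smul_mul_assoc, smul_smul]
    congr 1
    ring
  rw [e]
  have val : ∀ {TA TB v}, SpM (u ∘ a) (wheelDen qb (pullStarts S a) • X) TA →
      SpM (u ∘ b) (wheelDen qb (pullStarts S b) • Y) TB → Sp u (crossDen qb S b a) v →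
      SpM u _ _ := fun hA hB hv => SpM.smul (hv.mul hs)
        ((((b1.mul (SpM.place a hA)).mul b2).mul (SpM.place b hB)).mul b3)
  -- In this case each block contains at most one run of each family, so the parameters at the
  -- starts of the runs are independent and the wheel conditions of `X` and `Y` apply to the induced
  -- blocks.
  by_cases hba : ∀ i j, (a i : ℕ) = b j + 1 → a i ∈ S
  · have hrec : ∀ {r : ℕ} (c : Fin r ↪ Fin N), StrictMono c → ∀ p p' : Fin r, (p' : ℕ) = p + 1 →
        p' ∉ pullStarts S c → (u ∘ c) p' = algebraMap K _ qb ^ 2 * (u ∘ c) p := by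
      intro r c hc p p' h1 h2
      have h3 := (pullStarts_iff hc).1 ⟨h1, h2⟩
      exact genericPoint_succ h3.1 h3.2
    obtain ⟨TA, hTA, hTA'⟩ := hX'.exists_wheelForm hq hX (hasZero_pullStarts S ha) (hrec a ha)
      (algebraicIndependent_pullStarts hq.qb_ne fun i hi i' hi' => index_injOn_left h hba hi hi')
    obtain ⟨TB, hTB, hTB'⟩ := hY'.exists_wheelForm hq hY (hasZero_pullStarts S hb) (hrec b hb)
      (algebraicIndependent_pullStarts hq.qb_ne fun i hi i' hi' => index_injOn_right h hba hi hi')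
    obtain ⟨v, hv⟩ := exists_sp_crossDen (a := b) (b := a) (qb := qb) S u
    refine ⟨_, val hTA hTB hv, ?_⟩
    exact (WheelForm.product (const_ne_zero hq.q_ne) (pow_ne_zero 2 (const_ne_zero hq.qb_ne)) hkl
      hasZero_starts h ha hb hba (fun p p' h1 h2 => genericPoint_succ h1 h2) hreg hTA' hTB').smul _
  -- A label of `b` followed by one of `a` inside a block makes `crossDen qb S b a` vanish, and the
  -- other factors are still regular.
  · push Not at hba
    obtain ⟨i, j, h1, h2⟩ := hba
    have hval : ∀ {r : ℕ} (c : Fin r ↪ Fin N), StrictMono c → ∀ x y : Fin r,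
        (u ∘ c) x = algebraMap K _ qb ^ 2 * (u ∘ c) y → (x : ℕ) = y + 1 ∧ x ∉ pullStarts S c := by
      intro r c hc x y hxy
      exact (pullStarts_iff hc).2 (genericPoint_eq hq hxy)
    obtain ⟨TA, hTA⟩ := exists_spM_wheelDen hX
      (fun x => genericPoint_ne_zero (lam := lam) hq.qb_ne (a x)) (hval a ha)
    obtain ⟨TB, hTB⟩ := exists_spM_wheelDen hY
      (fun x => genericPoint_ne_zero (lam := lam) hq.qb_ne (b x)) (hval b hb)
    refine ⟨_, val hTA hTB (sp_crossDen_eq_zero h1 h2), ?_⟩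
    rw [zero_mul, zero_smul]
    exact wheelForm_zero hasZero_starts _

theorem wheelConditions_shuffleProd [CharZero K] (hq : GenericParams q qb) {X : Tens K n k}
    {Y : Tens K n l} (hX : HasAllowedPoles qb X) (hX' : WheelConditions q qb X)
    (hX'' : IsSymm q X) (hY : HasAllowedPoles qb Y) (hY' : WheelConditions q qb Y)
    (hY'' : IsSymm q Y) : WheelConditions q qb (shuffleProd q qb X Y) := by
  rw [wheelConditions_iff hq (hasAllowedPoles_shuffleProd hq hX hY hX'' hY'')]
  intro lam T hT
  rw [shuffleProd_eq hq.q_ne hq.qb_ne, Finset.smul_sum] at hT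
  have h1 : ∀ p ∈ shuffles k l, ∃ T, SpM (genericPoint qb lam)
      (wheelDen qb (starts lam) • shuffleTerm q qb p.1 p.2 X Y) T ∧
      WheelForm (const _ q) (const _ qb ^ 2) (starts lam) (genericPoint qb lam) T := by
    intro p hp
    have h := complementary_of_mem_shuffles hp
    simp only [shuffles, Finset.mem_filter, Finset.mem_univ, true_and] at hp
    exact exists_wheelForm_shuffleTerm hq rfl h hp.1 hp.2.1 lam hX hX' hY hY'
  choose! T' hT' hT'' using h1
  rw [hT.unique (SpM.sum _ hT')]
  exact WheelForm.sum (const_ne_zero hq.q_ne) hasZero_starts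
    (fun w hw => regular_genericPoint hq w fun x => (hw x).imp fun _ => Or.inr) _ hT''

end WheelShuffle
end RShuffle

namespace RShuffle

/-! ### The shuffle algebra -/

section ShuffleAlgebra

variable {K : Type*} [Field K] {n k l : ℕ} {q qb : K}

/-- The tensors in `k` variables that satisfy the conditions defining the shuffle algebra. -/
def component (hq : GenericParams q qb) (n k : ℕ) : Submodule K (Tens K n k) where
  carrier := {X | HasAllowedPoles qb X ∧ IsSymm q X ∧ WheelConditions q qb X}
  zero_mem' := by
    have h0 : HasAllowedPoles qb (0 : Tens K n k) :=
      hasAllowedPoles_iff.2 fun I J => by rw [smul_zero]; exact zero_mem _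
    refine ⟨h0, (isSymm_iff hq.q_ne _).2 fun σ => ?_, wheelConditions_zero hq h0⟩
    rw [adj, place_zero, mul_zero, zero_mul]
  add_mem' := by
    rintro X Y ⟨h1, h2, h3⟩ ⟨h1', h2', h3'⟩
    have h : HasAllowedPoles qb (X + Y) := by
      rw [hasAllowedPoles_iff] at *
      rw [smul_add]
      exact fun I J => add_mem (h1 I J) (h1' I J)
    rw [isSymm_iff hq.q_ne] at h2 h2'
    exact ⟨h, (isSymm_iff hq.q_ne _).2 fun σ => by rw [adj_add, h2, h2'], h3.add hq h1 h1' h3' h⟩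
  smul_mem' := by
    rintro c X ⟨h1, h2, h3⟩
    have h : HasAllowedPoles qb (c • X) := by
      rw [hasAllowedPoles_iff] at *
      intro I J
      rw [smul_comm]
      exact (laurent K k).smul_mem (h1 I J) c
    rw [isSymm_iff hq.q_ne] at h2
    exact ⟨h, (isSymm_iff hq.q_ne _).2 fun σ => by rw [adj_smul, h2], h3.smul hq c h1 h⟩

/-- The shuffle algebra as a subspace. -/
def shuffleSubmodule (hq : GenericParams q qb) (n : ℕ) : Submodule K (Ambient K n) :=
  ⨅ k, (component hq n k).comap (DirectSum.component K ℕ (fun m => Tens K n m) k)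

variable {hq : GenericParams q qb}

theorem mem_shuffleSubmodule {X : Ambient K n} :
    X ∈ shuffleSubmodule hq n ↔ ∀ k, X k ∈ component hq n k := by
  simp only [shuffleSubmodule, Submodule.mem_iInf, Submodule.mem_comap]
  rfl

theorem lof_mem_shuffleSubmodule {X : Tens K n k} (hX : X ∈ component hq n k) :
    DirectSum.lof K ℕ (fun m => Tens K n m) k X ∈ shuffleSubmodule hq n := by
  rw [mem_shuffleSubmodule]
  intro j
  rw [DirectSum.lof_eq_of]
  by_cases h : k = j
  · subst h
    rwa [DirectSum.of_eq_same]
  · rw [DirectSum.of_eq_of_ne _ _ _ (Ne.symm h)]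
    exact zero_mem _

/-- A linear condition on the shuffle algebra holds if it holds on homogeneous elements. -/
theorem shuffleSubmodule_induction {P : Ambient K n → Prop} (h0 : P 0)
    (hadd : ∀ X Y, P X → P Y → P (X + Y))
    (hlof : ∀ k, ∀ X ∈ component hq n k, P (DirectSum.lof K ℕ (fun m => Tens K n m) k X))
    {X : Ambient K n} (hX : X ∈ shuffleSubmodule hq n) : P X := by
  classical
  rw [← DirectSum.sum_support_of X]
  exact Finset.sum_induction _ P hadd h0 fun k _ => hlof k _ (mem_shuffleSubmodule.1 hX k)

theorem one_mem_component : (1 : Tens K n 0) ∈ component hq n 0 :=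
  ⟨hasAllowedPoles_one, isSymm_one hq.q_ne, wheelConditions_one hq⟩

theorem unit_mem : unit K n ∈ shuffleSubmodule hq n := lof_mem_shuffleSubmodule one_mem_component

variable [CharZero K]

theorem shuffleProd_mem {X : Tens K n k} {Y : Tens K n l} (hX : X ∈ component hq n k)
    (hY : Y ∈ component hq n l) : shuffleProd q qb X Y ∈ component hq n (k + l) :=
  ⟨hasAllowedPoles_shuffleProd hq hX.1 hY.1 hX.2.1 hY.2.1,
    isSymm_shuffleProd hq.q_ne hq.qb_ne hX.2.1 hY.2.1,
    wheelConditions_shuffleProd hq hX.1 hX.2.2 hX.2.1 hY.1 hY.2.2 hY.2.1⟩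

theorem shuffle_mem {X Y : Ambient K n} (hX : X ∈ shuffleSubmodule hq n)
    (hY : Y ∈ shuffleSubmodule hq n) : shuffle q qb n X Y ∈ shuffleSubmodule hq n := by
  refine shuffleSubmodule_induction (P := fun X => shuffle q qb n X Y ∈ shuffleSubmodule hq n)
    (by simp) (fun X X' h h' => ?_) (fun k X hX => ?_) hX
  · rw [map_add, LinearMap.add_apply]
    exact add_mem h h'
  refine shuffleSubmodule_induction (P := fun Y => shuffle q qb n _ Y ∈ shuffleSubmodule hq n)
    (by simp) (fun Y Y' h h' => ?_) (fun l Y hY => ?_) hY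
  · rw [map_add]
    exact add_mem h h'
  rw [shuffle_lof]
  exact lof_mem_shuffleSubmodule (shuffleProd_mem hX hY)

theorem unit_shuffle {X : Ambient K n} (hX : X ∈ shuffleSubmodule hq n) :
    shuffle q qb n (unit K n) X = X := by
  refine shuffleSubmodule_induction (P := fun X => shuffle q qb n (unit K n) X = X)
    (map_zero _) (fun X X' h h' => by rw [map_add, h, h']) (fun k X hX => ?_) hX
  rw [unit, shuffle_lof]
  exact one_shuffleProd hq.q_ne hq.qb_ne hX.2.1

theorem shuffle_unit {X : Ambient K n} (hX : X ∈ shuffleSubmodule hq n) :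
    shuffle q qb n X (unit K n) = X := by
  refine shuffleSubmodule_induction (P := fun X => shuffle q qb n X (unit K n) = X)
    (by simp) (fun X X' h h' => by rw [map_add, LinearMap.add_apply, h, h'])
    (fun k X hX => ?_) hX
  rw [unit, shuffle_lof]
  exact shuffleProd_one hq.q_ne hq.qb_ne hX.2.1

theorem shuffle_assoc {X Y Z : Ambient K n} (hX : X ∈ shuffleSubmodule hq n)
    (hY : Y ∈ shuffleSubmodule hq n) (hZ : Z ∈ shuffleSubmodule hq n) :
    shuffle q qb n (shuffle q qb n X Y) Z = shuffle q qb n X (shuffle q qb n Y Z) := by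
  refine shuffleSubmodule_induction (P := fun X => shuffle q qb n (shuffle q qb n X Y) Z =
    shuffle q qb n X (shuffle q qb n Y Z)) (by simp)
    (fun X X' h h' => by simp only [map_add, LinearMap.add_apply, h, h']) (fun k X hX => ?_) hX
  refine shuffleSubmodule_induction (P := fun Y => shuffle q qb n (shuffle q qb n _ Y) Z =
    shuffle q qb n _ (shuffle q qb n Y Z)) (by simp)
    (fun Y Y' h h' => by simp only [map_add, LinearMap.add_apply, h, h']) (fun l Y hY => ?_) hY
  refine shuffleSubmodule_induction (P := fun Z => shuffle q qb n (shuffle q qb n _ _) Z =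
    shuffle q qb n _ (shuffle q qb n _ Z)) (by simp)
    (fun Z Z' h h' => by simp only [map_add, h, h']) (fun m Z hZ => ?_) hZ
  simp only [shuffle_lof]
  exact shuffleProd_assoc hq.q_ne hq.qb_ne hX.2.1 hY.2.1 hZ.2.1

/-- Each inequality of monomials is detected by evaluating the two indeterminates at (0, 0) or (0,
1). The condition `1 ≤ n` ensures that q̄ is not 1. -/
theorem genericParams_groundField (hn : 1 ≤ n) : GenericParams qParam (qbarParam n) := by
  have hinj := IsFractionRing.injective (MvPolynomial (Fin 2) ℚ) GroundField
  have hX : ∀ i, algebraMap (MvPolynomial (Fin 2) ℚ) GroundField (MvPolynomial.X i) ≠ 0 :=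
    fun i h => MvPolynomial.X_ne_zero i (hinj (h.trans (map_zero _).symm))
  refine ⟨hX 0, pow_ne_zero n (hX 1), fun m hm h => ?_, fun m h => ?_, fun m h => ?_⟩
  · rw [qbarParam, ← pow_mul, ← map_pow] at h
    have := congrArg (MvPolynomial.eval 0) (hinj (h.trans (map_one _).symm))
    have hnm : n * m ≠ 0 := Nat.mul_ne_zero (by omega) hm
    simp [hnm] at this
  · rw [qbarParam, qParam, ← pow_mul, ← map_pow, ← map_pow] at h
    have := congrArg (MvPolynomial.eval ![0, 1]) (hinj h)
    simp at this
  · rw [qbarParam, qParam, ← pow_mul, ← map_pow, ← map_pow, ← map_mul] at h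
    have := congrArg (MvPolynomial.eval ![0, 1]) (hinj (h.trans (map_one _).symm))
    simp at this

end ShuffleAlgebra
end RShuffle

end

/-! ### The shuffle algebra over the field of two indeterminates. -/

theorem mainTheorem9 (n : ℕ) (hn : 1 ≤ n) :
    ∃ S : Submodule RShuffle.GroundField (RShuffle.Ambient RShuffle.GroundField n),
      (∀ X : RShuffle.Ambient RShuffle.GroundField n,
        X ∈ S ↔ RShuffle.InShuffleAlgebra RShuffle.qParam (RShuffle.qbarParam n) X) ∧
      (∀ X ∈ S, ∀ Y ∈ S,
        RShuffle.shuffle RShuffle.qParam (RShuffle.qbarParam n) n X Y ∈ S) ∧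
      RShuffle.unit RShuffle.GroundField n ∈ S ∧
      (∀ X ∈ S,
        RShuffle.shuffle RShuffle.qParam (RShuffle.qbarParam n) n
          (RShuffle.unit RShuffle.GroundField n) X = X ∧
        RShuffle.shuffle RShuffle.qParam (RShuffle.qbarParam n) n
          X (RShuffle.unit RShuffle.GroundField n) = X) ∧
      (∀ X ∈ S, ∀ Y ∈ S, ∀ Z ∈ S,
        RShuffle.shuffle RShuffle.qParam (RShuffle.qbarParam n) n
          (RShuffle.shuffle RShuffle.qParam (RShuffle.qbarParam n) n X Y) Z =
        RShuffle.shuffle RShuffle.qParam (RShuffle.qbarParam n) n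
          X (RShuffle.shuffle RShuffle.qParam (RShuffle.qbarParam n) n Y Z)) := by
  have hq := RShuffle.genericParams_groundField hn
  exact ⟨RShuffle.shuffleSubmodule hq n, fun X => RShuffle.mem_shuffleSubmodule,
    fun X hX Y hY => RShuffle.shuffle_mem hX hY, RShuffle.unit_mem,
    fun X hX => ⟨RShuffle.unit_shuffle hX, RShuffle.shuffle_unit hX⟩,
    fun X hX Y hY Z hZ => RShuffle.shuffle_assoc hX hY hZ⟩
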